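/- **Setting.** Let $\mathcal G\rightrightarrows M$ be a Lie groupoid (Hausdorff, second countable, without boundary) over a compact manifold $M$, with source $s$, target $t$, unit map $u$, product $ab$ defined when $s(a)=t(b)$, and $s$-fibers $\mathcal G_x=s^{-1}(x)$. Let $A=\ker(ds)|_{u(M)}$ be its Lie algebroid, $\nu=dt|_A$ its anchor, and for $X\in\Gamma^\infty(A)$ let $X^r$ be the right invariant vector field on $\mathcal G$ determined by $X$. Assume that $\mathcal G$ is a boundary groupoid: 1. the singular foliation of $M$ defined by $\nu$ has finitely many leaves $M_0,\dots,M_r$, with $\dim M=\dim M_0>\dim M_1>\dots>\dim M_r$; 2. each $\bar M_k=M_k\cup M_{k+1}\cup\dots\cup M_r$ is a closed immersed submanifold of $M$; 3. $\mathcal G_k:=s^{-1}(M_k)=t^{-1}(M_k)\cong G_k\times(M_k\times M_k)$ as a Lie groupoid, for connected Lie groups $G_k$ with $G_0$ trivial; 4. for each $k$ there is a subbundle $\bar A_k\subset A|_{\bar M_k}$ with $\bar A_k|_{M_k}=\ker(\nu|_{M_k})$. Fix a smooth metric $g_A$ on $A$. By right invariance it gives a Riemannian metric on every $\mathcal G_x$;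 let $d(a,b)$, for $s(a)=s(b)$, be the Riemannian distance and $\mu_x$ the Riemannian volume measure on $\mathcal G_x$. Assume that $\mathcal G$ has polynomial growth: there are $N\in\mathbb N$ and $C>0$ such that $\mu_{s(a)}(B(a,\rho))\le C\rho^N$ for all $a\in\mathcal G$ and $\rho\ge 1$, where $B(a,\rho)$ is the ball in $\mathcal G_{s(a)}$. Let $\nabla$ be the Levi-Civita $A$-connection of $g_A$. For a function $F$ of the pairs $(a,b)$ with $s(a)=s(b)$, and fields $Z_i=X_i^r\oplus Y_i^r$ with $X_i,Y_i\in\Gamma^\infty(A)$, put $\tilde\nabla^0F=F$ and $$\tilde\nabla^lF(Z_1,\dots,Z_l)=L_{Z_1}\big(\tilde\nabla^{l-1}F(Z_2,\dots,Z_l)\big)-\sum_{k=2}^l\tilde\nabla^{l-1}F(Z_2,\dots,\tilde\nabla_{Z_1}Z_k,\dots,Z_l),$$ where $\tilde\nabla_{Z_1}Z_k=(\nabla_{X_1}X_k)^r\oplus(\nabla_{Y_1}Y_k)^r$. For $\varepsilon\ge0$ let $\Psi^{-\infty}_{\varepsilon;\mathbf 0}(\mathcal G)$ be the set of continuous $\psi:\mathcal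 G\to\mathbb C$ whose restriction to each $\mathcal G_k$ is smooth and for which there is $\varepsilon'>\varepsilon$ such that for every $l\in\{0,1,2,\dots\}$ there is $C_l>0$ with $$\big|\tilde\nabla^l\big(\psi(ab^{-1})\big)(X_1^r\oplus Y_1^r,\dots,X_l^r\oplus Y_l^r)(a,b)\big|\le C_l\,e^{-\varepsilon' d(a,b)}\prod_{i=1}^l\big(|X_i(t(a))|+|Y_i(t(b))|\big)$$ for all $X_i,Y_i\in\Gamma^\infty(A)$ and all $a,b$ with $s(a)=s(b)$. **Statement.** Let $\varepsilon_1,\varepsilon_2\ge0$, $\psi_1\in\Psi^{-\infty}_{\varepsilon_1;\mathbf 0}(\mathcal G)$ and $\psi_2\in\Psi^{-\infty}_{\varepsilon_2;\mathbf 0}(\mathcal G)$. Then the convolution $$(\psi_1\circ\psi_2)(a)=\int_{\mathcal G_{s(a)}}\psi_1(ab^{-1})\,\psi_2(b)\,d\mu_{s(a)}(b)$$ is well defined, i.e. the integrand is integrable for every $a\in\mathcal G$, and $\psi_1\circ\psi_2\in\Psi^{-\infty}_{\min\{\varepsilon_1,\varepsilon_2\};\mathbf 0}(\mathcal G)$.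 -/

import Mathlib

open Set MeasureTheory
open scoped Manifold ContDiff

/-- A Lie groupoid `G ⇉ M` (manifolds without boundary, modelled on `EG` and `EM`).
`mul a b` is the product `a b`; it is only meaningful when `src a = tgt b`, and all laws,
as well as smoothness, are only required on composable pairs. -/
structure LieGroupoid (EG EM G M : Type*)
    [NormedAddCommGroup EG] [NormedSpace ℝ EG] [NormedAddCommGroup EM] [NormedSpace ℝ EM]
    [TopologicalSpace G] [ChartedSpace EG G] [TopologicalSpace M] [ChartedSpace EM M] where
  unit : M → G
  src : G → M
  tgt : G → M
  mul : G → G → G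
  inv : G → G
  contMDiff_unit : ContMDiff 𝓘(ℝ, EM) 𝓘(ℝ, EG) ∞ unit
  contMDiff_src : ContMDiff 𝓘(ℝ, EG) 𝓘(ℝ, EM) ∞ src
  contMDiff_tgt : ContMDiff 𝓘(ℝ, EG) 𝓘(ℝ, EM) ∞ tgt
  submersion_src : ∀ a, Function.Surjective (mfderiv 𝓘(ℝ, EG) 𝓘(ℝ, EM) src a)
  submersion_tgt : ∀ a, Function.Surjective (mfderiv 𝓘(ℝ, EG) 𝓘(ℝ, EM) tgt a)
  contMDiffOn_mul : ContMDiffOn (𝓘(ℝ, EG).prod 𝓘(ℝ, EG)) 𝓘(ℝ, EG) ∞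
    (fun p : G × G => mul p.1 p.2) {p | src p.1 = tgt p.2}
  contMDiff_inv : ContMDiff 𝓘(ℝ, EG) 𝓘(ℝ, EG) ∞ inv
  src_unit : ∀ x, src (unit x) = x
  tgt_unit : ∀ x, tgt (unit x) = x
  src_mul : ∀ a b, src a = tgt b → src (mul a b) = src b
  tgt_mul : ∀ a b, src a = tgt b → tgt (mul a b) = tgt a
  mul_assoc : ∀ a b c, src a = tgt b → src b = tgt c → mul (mul a b) c = mul a (mul b c)
  mul_unit : ∀ a, mul a (unit (src a)) = a
  unit_mul : ∀ a, mul (unit (tgt a)) a = a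
  src_inv : ∀ a, src (inv a) = tgt a
  tgt_inv : ∀ a, tgt (inv a) = src a
  mul_inv : ∀ a, mul a (inv a) = unit (tgt a)
  inv_mul : ∀ a, mul (inv a) a = unit (src a)

namespace LieGroupoid

section

variable {EG EM G M : Type*}
  [NormedAddCommGroup EG] [NormedSpace ℝ EG] [NormedAddCommGroup EM] [NormedSpace ℝ EM]
  [TopologicalSpace G] [ChartedSpace EG G] [TopologicalSpace M] [ChartedSpace EM M]

/-- The `s`-fiber `G_x = s⁻¹(x)`. -/
def fiber (Γ : LieGroupoid EG EM G M) (x : M) : Set G := {a | Γ.src a = x}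

/-- The fiber `A_x = ker (ds)` at the unit `u(x)` of the Lie algebroid `A`. -/
noncomputable def algebroid (Γ : LieGroupoid EG EM G M) (x : M) :
    Submodule ℝ (TangentSpace 𝓘(ℝ, EG) (Γ.unit x)) :=
  (mfderiv 𝓘(ℝ, EG) 𝓘(ℝ, EM) Γ.src (Γ.unit x)).ker

/-- The anchor `ν = dt` at the point `x`, as a map on the whole tangent space of `G` at `u(x)`;
the anchor proper is its restriction to `A_x`. -/
noncomputable def anchor (Γ : LieGroupoid EG EM G M) (x : M) :
    TangentSpace 𝓘(ℝ, EG) (Γ.unit x) →ₗ[ℝ] TangentSpace 𝓘(ℝ, EM) (Γ.tgt (Γ.unit x)) :=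
  (mfderiv 𝓘(ℝ, EG) 𝓘(ℝ, EM) Γ.tgt (Γ.unit x)).toLinearMap

/-- Right translation `dR_a : A_{t(a)} → T_a G_{s(a)}`, where `R_a : G_{t(a)} → G_{s(a)}`,
`c ↦ c a`. The value is the true differential of `R_a` on vectors tangent to the fiber, i.e. on
`A_{t(a)}`, and is meaningless on other vectors. -/
noncomputable def rightTranslate (Γ : LieGroupoid EG EM G M) (a : G)
    (v : TangentSpace 𝓘(ℝ, EG) (Γ.unit (Γ.tgt a))) : TangentSpace 𝓘(ℝ, EG) a :=
  mfderivWithin 𝓘(ℝ, EG) 𝓘(ℝ, EG) (fun c => Γ.mul c a) (Γ.fiber (Γ.tgt a))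
    (Γ.unit (Γ.tgt a)) v

/-- Right translation `dR_{a⁻¹} : T_a G_{s(a)} → A_{t(a)}` back to the unit. Meaningful on
vectors tangent to the `s`-fiber. -/
noncomputable def toAlgebroid (Γ : LieGroupoid EG EM G M) (a : G)
    (v : TangentSpace 𝓘(ℝ, EG) a) : TangentSpace 𝓘(ℝ, EG) (Γ.unit (Γ.tgt a)) :=
  mfderivWithin 𝓘(ℝ, EG) 𝓘(ℝ, EG) (fun c => Γ.mul c (Γ.inv a)) (Γ.fiber (Γ.src a)) a v

/-- Not necessarily smooth sections of `u^* TG`; a section of `A` takes its values in `A_x`. -/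
abbrev PreSection (Γ : LieGroupoid EG EM G M) : Type _ :=
  (x : M) → TangentSpace 𝓘(ℝ, EG) (Γ.unit x)

/-- `X ∈ Γ^∞(A)`: a smooth section of the Lie algebroid. -/
structure IsSection [IsManifold 𝓘(ℝ, EG) ∞ G] (Γ : LieGroupoid EG EM G M)
    (X : Γ.PreSection) : Prop where
  mem : ∀ x, X x ∈ Γ.algebroid x
  smooth : ContMDiff 𝓘(ℝ, EM) 𝓘(ℝ, EG).tangent ∞
    (fun x => (⟨Γ.unit x, X x⟩ : TangentBundle 𝓘(ℝ, EG) G))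

/-- The right invariant vector field `X^r` on `G` determined by a section `X` of `A`. -/
noncomputable def rightInvariant (Γ : LieGroupoid EG EM G M) (X : Γ.PreSection) :
    (a : G) → TangentSpace 𝓘(ℝ, EG) a :=
  fun a => Γ.rightTranslate a (X (Γ.tgt a))

/-- The Lie bracket of sections of `A`: `[X, Y]^r = [X^r, Y^r]`. -/
noncomputable def bracket (Γ : LieGroupoid EG EM G M) (X Y : Γ.PreSection) : Γ.PreSection :=
  fun x => VectorField.mlieBracket 𝓘(ℝ, EG) (Γ.rightInvariant X) (Γ.rightInvariant Y) (Γ.unit x)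

/-- The vector field `ν(X)` on `M`. -/
noncomputable def anchorField (Γ : LieGroupoid EG EM G M) (X : Γ.PreSection) :
    (x : M) → TangentSpace 𝓘(ℝ, EM) x :=
  fun x => Γ.anchor x (X x)

/-- The derivative `ν(X) f` of a function `f` on `M`. -/
noncomputable def anchorDeriv (Γ : LieGroupoid EG EM G M) (X : Γ.PreSection) (f : M → ℝ)
    (x : M) : ℝ :=
  mfderiv 𝓘(ℝ, EM) 𝓘(ℝ, ℝ) f x (Γ.anchorField X x)

/-- The leaf through `x` of the singular foliation of `M` defined by the anchor: the points that
can be reached from `x` along finitely many integral curves of vector fields `ν(X)`,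
`X ∈ Γ^∞(A)`. -/
def leaf [IsManifold 𝓘(ℝ, EG) ∞ G] (Γ : LieGroupoid EG EM G M) (x : M) : Set M :=
  {y | Relation.ReflTransGen (fun p q => ∃ X, Γ.IsSection X ∧ ∃ γ : ℝ → M,
    IsMIntegralCurve (I := 𝓘(ℝ, EM)) γ (Γ.anchorField X) ∧ γ 0 = p ∧ γ 1 = q) x y}

/-- The restriction `G_S = s⁻¹(S) = t⁻¹(S)` of `G` to the invariant submanifold `S` is isomorphic,
as a Lie groupoid over `S`, to `H × (S × S)` with `H` the given Lie group: `a ↦ (θ a, t a, s a)` is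
a groupoid isomorphism, smooth with smooth inverse `σ`. -/
def TrivializedBy [IsManifold 𝓘(ℝ, EG) ∞ G] (Γ : LieGroupoid EG EM G M) (S : Set M)
    (EH : Type*) [NormedAddCommGroup EH] [NormedSpace ℝ EH]
    (H : Type*) [Group H] [TopologicalSpace H] [ChartedSpace EH H] : Prop :=
  ∃ (θ : G → H) (σ : H × (M × M) → G),
    ContMDiffOn 𝓘(ℝ, EG) 𝓘(ℝ, EH) ∞ θ (Γ.src ⁻¹' S) ∧
    ContMDiffOn (𝓘(ℝ, EH).prod (𝓘(ℝ, EM).prod 𝓘(ℝ, EM))) 𝓘(ℝ, EG) ∞ σ (univ ×ˢ (S ×ˢ S)) ∧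
    (∀ a b, Γ.src a ∈ S → Γ.src b ∈ S → Γ.src a = Γ.tgt b → θ (Γ.mul a b) = θ a * θ b) ∧
    (∀ h, ∀ y ∈ S, ∀ x ∈ S, θ (σ (h, y, x)) = h ∧ Γ.tgt (σ (h, y, x)) = y ∧
      Γ.src (σ (h, y, x)) = x) ∧
    (∀ a, Γ.src a ∈ S → σ (θ a, Γ.tgt a, Γ.src a) = a)

/-- `G` is a boundary groupoid with invariant submanifolds `S 0, …, S r` of dimensions
`d 0, …, d r`. Since `S k` is a leaf and is open in the closed set `⋃ j ≥ k, S j`, it is an embedded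
submanifold of `M`, so that smoothness on `S k`, and on the part of `G` over `S k`, is smoothness on
a subset in the sense of `ContMDiffOn`. -/
structure IsBoundaryGroupoidWith [IsManifold 𝓘(ℝ, EG) ∞ G] (Γ : LieGroupoid EG EM G M)
    {r : ℕ} (S : Fin (r + 1) → Set M) (d : Fin (r + 1) → ℕ) : Prop where
  /-- The `S k` are exactly the leaves. -/
  isLeaf : ∀ k, ∃ x, S k = Γ.leaf x
  cover : ∀ x, ∃ k, x ∈ S k
  /-- The leaf `S k` has dimension `d k`; its tangent spaces are the images of the anchor. -/
  dim_eq : ∀ k, ∀ x ∈ S k, Module.finrank ℝ ((Γ.algebroid x).map (Γ.anchor x)) = d k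
  dim_zero : d 0 = Module.finrank ℝ EM
  dim_lt : StrictAnti d
  closed : ∀ k, IsClosed (⋃ j ≥ k, S j)
  /-- `⋃ j ≥ k, S j` is an immersed submanifold of `M`, the image of an immersion `ι` of a manifold
  `N`, and carries a vector subbundle `B` of `A` that equals `ker ν` over `S k`. -/
  immersed : ∀ k, ∃ (N : Type) (_ : TopologicalSpace N) (_ : T2Space N)
    (_ : SecondCountableTopology N) (_ : ChartedSpace (EuclideanSpace ℝ (Fin (d k))) N)
    (_ : IsManifold 𝓘(ℝ, EuclideanSpace ℝ (Fin (d k))) ∞ N) (ι : N → M),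
    ContMDiff 𝓘(ℝ, EuclideanSpace ℝ (Fin (d k))) 𝓘(ℝ, EM) ∞ ι ∧
    (∀ p, Function.Injective (mfderiv 𝓘(ℝ, EuclideanSpace ℝ (Fin (d k))) 𝓘(ℝ, EM) ι p)) ∧
    range ι = (⋃ j ≥ k, S j) ∧
    ∃ (m : ℕ) (B : (x : M) → Submodule ℝ (TangentSpace 𝓘(ℝ, EG) (Γ.unit x))),
      (∀ x ∈ (⋃ j ≥ k, S j), B x ≤ Γ.algebroid x) ∧
      (∀ x ∈ S k, B x = Γ.algebroid x ⊓ LinearMap.ker (Γ.anchor x)) ∧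
      ∀ p : N, ∃ W : Set N, IsOpen W ∧ p ∈ W ∧
        ∃ e : Fin m → (q : N) → TangentSpace 𝓘(ℝ, EG) (Γ.unit (ι q)),
          (∀ i, ContMDiffOn 𝓘(ℝ, EuclideanSpace ℝ (Fin (d k))) 𝓘(ℝ, EG).tangent ∞
            (fun q => (⟨Γ.unit (ι q), e i q⟩ : TangentBundle 𝓘(ℝ, EG) G)) W) ∧
          ∀ q ∈ W, LinearIndependent ℝ (fun i => e i q) ∧
            Submodule.span ℝ (range fun i => e i q) = B (ι q)
  invariant : ∀ k, Γ.src ⁻¹' S k = Γ.tgt ⁻¹' S k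
  /-- Over `S k` the groupoid is `H × (S k × S k)` for a connected Lie group `H`, trivial if
  `k = 0`. -/
  trivial : ∀ k, ∃ (n : ℕ) (H : Type) (_ : Group H) (_ : TopologicalSpace H) (_ : T2Space H)
    (_ : SecondCountableTopology H) (_ : ConnectedSpace H)
    (_ : ChartedSpace (EuclideanSpace ℝ (Fin n)) H)
    (_ : LieGroup 𝓘(ℝ, EuclideanSpace ℝ (Fin n)) ∞ H),
    (k = 0 → Subsingleton H) ∧ Γ.TrivializedBy (S k) (EuclideanSpace ℝ (Fin n)) H

/-- `G` is a boundary groupoid. -/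
def IsBoundaryGroupoid [IsManifold 𝓘(ℝ, EG) ∞ G] (Γ : LieGroupoid EG EM G M) : Prop :=
  ∃ (r : ℕ) (S : Fin (r + 1) → Set M) (d : Fin (r + 1) → ℕ), Γ.IsBoundaryGroupoidWith S d

/-- A smooth metric `g_A` on the Lie algebroid. `form x` is written as a bilinear form on the
tangent space of `G` at `u(x)`; only its restriction to `A_x` is constrained and used. -/
structure Metric [IsManifold 𝓘(ℝ, EG) ∞ G] (Γ : LieGroupoid EG EM G M) where
  form : (x : M) → LinearMap.BilinForm ℝ (TangentSpace 𝓘(ℝ, EG) (Γ.unit x))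
  symm : ∀ x, ∀ v ∈ Γ.algebroid x, ∀ w ∈ Γ.algebroid x, form x v w = form x w v
  pos : ∀ x, ∀ v ∈ Γ.algebroid x, v ≠ 0 → 0 < form x v v
  smooth : ∀ X Y, Γ.IsSection X → Γ.IsSection Y →
    ContMDiff 𝓘(ℝ, EM) 𝓘(ℝ, ℝ) ∞ (fun x => form x (X x) (Y x))

namespace Metric

variable [IsManifold 𝓘(ℝ, EG) ∞ G] {Γ : LieGroupoid EG EM G M}

/-- The norm `|v|` of `v ∈ A_x`. -/
noncomputable def norm (g : Γ.Metric) (x : M) (v : TangentSpace 𝓘(ℝ, EG) (Γ.unit x)) : ℝ :=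
  Real.sqrt (g.form x v v)

/-- The right invariant Riemannian metric on the `s`-fiber through `a`, at `a`
(for `v`, `w` tangent to the fiber). -/
noncomputable def fiberInner (g : Γ.Metric) (a : G) (v w : TangentSpace 𝓘(ℝ, EG) a) : ℝ :=
  g.form (Γ.tgt a) (Γ.toAlgebroid a v) (Γ.toAlgebroid a w)

/-- The length of a path `γ : [0, 1] → G` that runs in one `s`-fiber. -/
noncomputable def pathLength (g : Γ.Metric) (γ : ℝ → G) : ENNReal :=
  ∫⁻ τ in Icc (0 : ℝ) 1, ENNReal.ofReal (Real.sqrt (g.fiberInner (γ τ)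
    (mfderivWithin 𝓘(ℝ, ℝ) 𝓘(ℝ, EG) γ (Icc 0 1) τ 1)
    (mfderivWithin 𝓘(ℝ, ℝ) 𝓘(ℝ, EG) γ (Icc 0 1) τ 1)))

/-- The Riemannian distance `d(a, b)` on the `s`-fiber that contains `a` and `b`
(the fibers of the groupoids considered are connected). -/
noncomputable def dist (g : Γ.Metric) (a b : G) : ℝ :=
  (⨅ (γ : ℝ → G) (_ : ContMDiffOn 𝓘(ℝ, ℝ) 𝓘(ℝ, EG) 1 γ (Icc 0 1))
    (_ : ∀ τ ∈ Icc (0 : ℝ) 1, Γ.src (γ τ) = Γ.src a) (_ : γ 0 = a) (_ : γ 1 = b),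
    g.pathLength γ).toReal

/-- A smooth regular parametrization `φ`, on an open set `V` of `ℝⁿ`, of an open piece of the
`s`-fiber over `x`, where `n = dim G - dim M` is the dimension of the fiber. -/
structure _root_.LieGroupoid.LocalParam (Γ : LieGroupoid EG EM G M) (x : M) where
  dom : Set (EuclideanSpace ℝ (Fin (Module.finrank ℝ EG - Module.finrank ℝ EM)))
  toFun : EuclideanSpace ℝ (Fin (Module.finrank ℝ EG - Module.finrank ℝ EM)) → G
  isOpen_dom : IsOpen dom
  smooth : ContMDiffOn 𝓘(ℝ, EuclideanSpace ℝ (Fin (Module.finrank ℝ EG - Module.finrank ℝ EM)))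
    𝓘(ℝ, EG) ∞ toFun dom
  injOn : InjOn toFun dom
  immersion : ∀ y ∈ dom, Function.Injective
    (mfderiv 𝓘(ℝ, EuclideanSpace ℝ (Fin (Module.finrank ℝ EG - Module.finrank ℝ EM)))
      𝓘(ℝ, EG) toFun y)
  mapsTo : ∀ y ∈ dom, Γ.src (toFun y) = x

/-- The Riemannian volume density `√ det (g(∂ᵢφ, ∂ⱼφ))` in the parametrization `φ`. -/
noncomputable def density (g : Γ.Metric) {x : M} (φ : Γ.LocalParam x)
    (y : EuclideanSpace ℝ (Fin (Module.finrank ℝ EG - Module.finrank ℝ EM))) : ℝ :=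
  Real.sqrt (Matrix.det (Matrix.of
    fun i j : Fin (Module.finrank ℝ EG - Module.finrank ℝ EM) => g.fiberInner (φ.toFun y)
      (mfderiv 𝓘(ℝ, EuclideanSpace ℝ (Fin (Module.finrank ℝ EG - Module.finrank ℝ EM)))
        𝓘(ℝ, EG) φ.toFun y (EuclideanSpace.single i (1 : ℝ)))
      (mfderiv 𝓘(ℝ, EuclideanSpace ℝ (Fin (Module.finrank ℝ EG - Module.finrank ℝ EM)))
        𝓘(ℝ, EG) φ.toFun y (EuclideanSpace.single j (1 : ℝ)))))

/-- The Riemannian volume measure `μ_x` of the `s`-fiber over `x`, as a measure on `G` concentrated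
on that fiber: the measure obtained by gluing (supremum in the lattice of measures) the measures
`√ det g dy` of all parametrized pieces. -/
noncomputable def fiberVolume [MeasurableSpace G] [BorelSpace G] (g : Γ.Metric) (x : M) :
    Measure G :=
  ⨆ φ : Γ.LocalParam x, Measure.map φ.toFun
    ((volume.restrict φ.dom).withDensity fun y => ENNReal.ofReal (g.density φ y))

/-- Polynomial volume growth of the `s`-fibers, uniformly over all balls. -/
def PolynomialGrowth [MeasurableSpace G] [BorelSpace G] (g : Γ.Metric) : Prop :=
  ∃ (N : ℕ) (C : ℝ), 0 < C ∧ ∀ (a : G) (r : ℝ), 1 ≤ r →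
    g.fiberVolume (Γ.src a) {b | Γ.src b = Γ.src a ∧ g.dist a b < r} ≤ ENNReal.ofReal (C * r ^ N)

/-- The convolution product of kernels. -/
noncomputable def conv [MeasurableSpace G] [BorelSpace G] (g : Γ.Metric) (f₁ f₂ : G → ℂ)
    (a : G) : ℂ :=
  ∫ b, f₁ (Γ.mul a (Γ.inv b)) * f₂ b ∂(g.fiberVolume (Γ.src a))

/-- The right hand side of the Koszul formula for `2 g(∇_X Y, Z)`. -/
noncomputable def koszul (g : Γ.Metric) (X Y Z : Γ.PreSection) (x : M) : ℝ :=
  Γ.anchorDeriv X (fun z => g.form z (Y z) (Z z)) x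
    + Γ.anchorDeriv Y (fun z => g.form z (Z z) (X z)) x
    - Γ.anchorDeriv Z (fun z => g.form z (X z) (Y z)) x
    + g.form x (Γ.bracket X Y x) (Z x)
    - g.form x (Γ.bracket Y Z x) (X x)
    + g.form x (Γ.bracket Z X x) (Y x)

open Classical in
/-- The Levi-Civita `A`-connection `∇_X Y` of the metric: the section of `A` determined, for
`X, Y ∈ Γ^∞(A)`, by the Koszul formula. -/
noncomputable def nabla (g : Γ.Metric) (X Y : Γ.PreSection) : Γ.PreSection := fun x =>
  if h : ∃ v ∈ Γ.algebroid x, ∀ Z, Γ.IsSection Z → 2 * g.form x v (Z x) = g.koszul X Y Z x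
  then h.choose else 0

/-- The derivative of a function `F` on `{(a, b) | s(a) = s(b)}` along `X^r ⊕ Y^r`, computed within
the product `G_x × G_x` of `s`-fibers, `x = s(a)`, to which this field is tangent. -/
noncomputable def _root_.LieGroupoid.lieDeriv (Γ : LieGroupoid EG EM G M)
    (Z : Γ.PreSection × Γ.PreSection) (F : G × G → ℂ) (p : G × G) : ℂ :=
  mfderivWithin (𝓘(ℝ, EG).prod 𝓘(ℝ, EG)) 𝓘(ℝ, ℂ) F
    (Γ.fiber (Γ.src p.1) ×ˢ Γ.fiber (Γ.src p.1)) p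
    ((Γ.rightInvariant Z.1 p.1, Γ.rightInvariant Z.2 p.2) : EG × EG)

/-- The iterated covariant derivative `∇̃^l F (X₁^r ⊕ Y₁^r, …, X_l^r ⊕ Y_l^r)` for the product
connection `∇̃`; the pair `(X_i, Y_i)` is `Z i`. -/
noncomputable def covDeriv (g : Γ.Metric) (F : G × G → ℂ) :
    (l : ℕ) → (Fin l → Γ.PreSection × Γ.PreSection) → G × G → ℂ
  | 0, _ => F
  | l + 1, Z => fun p =>
      Γ.lieDeriv (Z 0) (covDeriv g F l (Fin.tail Z)) p
        - ∑ k : Fin l, covDeriv g F l (Function.update (Fin.tail Z) k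
            (g.nabla (Z 0).1 (Fin.tail Z k).1, g.nabla (Z 0).2 (Fin.tail Z k).2)) p

/-- The exponentially decaying calculus of order `ε`: continuous kernels, smooth over every leaf,
such that for some `ε' > ε` all covariant derivatives of `(a, b) ↦ ψ (a b⁻¹)` are bounded by
constants times `exp (-ε' d(a, b))`. -/
def expCalculus (g : Γ.Metric) (ε : ℝ) : Set (G → ℂ) :=
  {ψ | Continuous ψ ∧
    (∀ x, ContMDiffOn 𝓘(ℝ, EG) 𝓘(ℝ, ℂ) ∞ ψ (Γ.src ⁻¹' Γ.leaf x)) ∧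
    ∃ ε' > ε, ∀ l : ℕ, ∃ C > 0, ∀ X Y : Fin l → Γ.PreSection,
      (∀ i, Γ.IsSection (X i)) → (∀ i, Γ.IsSection (Y i)) →
      ∀ a b, Γ.src a = Γ.src b →
        ‖g.covDeriv (fun p => ψ (Γ.mul p.1 (Γ.inv p.2))) l (fun i => (X i, Y i)) (a, b)‖
          ≤ C * Real.exp (-ε' * g.dist a b)
            * ∏ i, (g.norm (Γ.tgt a) (X i (Γ.tgt a)) + g.norm (Γ.tgt b) (Y i (Γ.tgt b)))}

end Metric

end

end LieGroupoid

/-! Write `k_i(a, b) = ψ_i (a b⁻¹)` for `a`, `b` in one `s`-fiber. The fiber volumes are invariant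
under right translation, so the substitution `d ↦ d b⁻¹` gives `(ψ₁ ∘ ψ₂)(a b⁻¹) = ∫ k₁(a, d) k₂(d,
b) dμ(d)` (`conv_mul_inv`). The theorem thus becomes a statement on the composition `star` of
kernels on the products `G_x × G_x`.

Decay. Let both kernels and their derivatives decay at rate `m > min ε₁ ε₂`, and let `min ε₁ ε₂ < ε'
< m`. By the triangle inequality `exp (-m d(a, d)) exp (-m d(d, b))` is at most `exp (-ε' d(a, b))
exp (-(m - ε') d(a, d))`. Polynomial growth makes the last factor integrable in `d`, uniformly in
`a` (`exists_lintegral_exp_le`, `norm_star_le`). The triangle inequality for the real valued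
distance needs connected fibers, which the trivializations over the leaves supply
(`isPreconnected_fiber`).

Derivatives. A field `X^r ⊕ Y^r` acts on the composition through `X` on the first kernel and through
`Y` on the second (`lieDeriv_star`). The connection is a product, so the corrections separate as
well, and the covariant derivative of order `l` is a sum over subsets of the `l` indices: those in
the subset differentiate `k₁` along `X_i`, the others differentiate `k₂` along `Y_i`
(`covDeriv_star`). Each summand is bounded by the product of some `|X_i|` and the complementary
`|Y_i|`, hence by the product of all `|X_i| + |Y_i|` (`CovBounded.star`). Differentiation under the
integral requires decay of all Lie derivatives. This follows from the bounds on covariant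
derivatives, since the recursion defining `covDeriv` can be solved for the Lie derivative
(`CovSpan.lieDeriv`).

Regularity. The convolution is a uniform limit of integrals cut off to a compact neighbourhood of
the units, and these are continuous (`exists_compact_ball`, `continuous_conv`). Over a leaf, every
`a` is `p q⁻¹` with `p`, `q` in one fixed fiber and smooth in `a`, so smoothness of the kernel on
`G_x × G_x` gives smoothness of the convolution (`contMDiffOn_of_fiberSmooth`).

All derivatives are taken within fibers, which are not open in `G`. Charts in which the source is a
linear projection turn them into ordinary derivatives on a Euclidean space. -/

open Filter Topology

set_option linter.unusedSectionVars false

/-! ### Charts adapted to the source map. -/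

namespace LieGroupoid

section AdaptedChart

/-- The model space of the `s`-fibers. -/
abbrev FiberModel (EG EM : Type*) [NormedAddCommGroup EG] [NormedSpace ℝ EG]
    [NormedAddCommGroup EM] [NormedSpace ℝ EM] : Type :=
  EuclideanSpace ℝ (Fin (Module.finrank ℝ EG - Module.finrank ℝ EM))

variable {EG EM G M : Type*}
  [NormedAddCommGroup EG] [NormedSpace ℝ EG]
  [NormedAddCommGroup EM] [NormedSpace ℝ EM]

/-- A projection of `EG` onto the kernel of `f`, followed by an identification of the kernel with
`FiberModel EG EM`, supplies the missing coordinates; rank-nullity gives the dimension. -/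
theorem exists_equiv_prod_of_surjective [FiniteDimensional ℝ EG] [FiniteDimensional ℝ EM]
    (f : EG →L[ℝ] EM) (hf : Function.Surjective f) :
    ∃ (π : EG →L[ℝ] FiberModel EG EM) (e : EG ≃L[ℝ] EM × FiberModel EG EM),
      (e : EG →L[ℝ] EM × FiberModel EG EM) = f.prod π := by
  have hr : Module.finrank ℝ f.toLinearMap.range + Module.finrank ℝ f.toLinearMap.ker
      = Module.finrank ℝ EG := f.toLinearMap.finrank_range_add_finrank_ker
  have hrange : f.toLinearMap.range = ⊤ := LinearMap.range_eq_top.2 hf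
  rw [hrange, finrank_top] at hr
  have hk : Module.finrank ℝ f.toLinearMap.ker = Module.finrank ℝ (FiberModel EG EM) := by
    simp only [finrank_euclideanSpace, Fintype.card_fin]
    omega
  let i : f.toLinearMap.ker ≃ₗ[ℝ] FiberModel EG EM := LinearEquiv.ofFinrankEq _ _ hk
  obtain ⟨p, hp⟩ := f.toLinearMap.ker.subtype.exists_leftInverse_of_injective
    (Submodule.ker_subtype _)
  let π : EG →L[ℝ] FiberModel EG EM := LinearMap.toContinuousLinearMap (i.toLinearMap ∘ₗ p)
  have hinj : Function.Injective (f.prod π) := by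
    rw [injective_iff_map_eq_zero]
    intro v hv
    have h1 : f v = 0 := congrArg Prod.fst hv
    have h2 : i (p v) = 0 := congrArg Prod.snd hv
    have h3 : p v = 0 := by simpa using h2
    have h4 : p v = ⟨v, h1⟩ := by
      have := LinearMap.congr_fun hp (⟨v, h1⟩ : f.toLinearMap.ker)
      simpa using this
    rw [h3] at h4
    exact (congrArg Subtype.val h4).symm
  have hfr : Module.finrank ℝ EG = Module.finrank ℝ (EM × FiberModel EG EM) := by
    rw [Module.finrank_prod, ← hk]; omega
  refine ⟨π, (LinearEquiv.ofInjectiveOfFinrankEq (f.prod π).toLinearMap hinj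
    hfr).toContinuousLinearEquiv, ?_⟩
  ext v <;> rfl

variable [TopologicalSpace G] [ChartedSpace EG G] [TopologicalSpace M] [ChartedSpace EM M]

/-- A chart of `G` in which the source map is the first projection. -/
structure AdaptedChart (Γ : LieGroupoid EG EM G M) where
  base : M
  e : OpenPartialHomeomorph G (EM × FiberModel EG EM)
  smooth : ContMDiffOn 𝓘(ℝ, EG) 𝓘(ℝ, EM × FiberModel EG EM) ∞ e e.source
  smooth_symm : ContMDiffOn 𝓘(ℝ, EM × FiberModel EG EM) 𝓘(ℝ, EG) ∞ e.symm e.target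
  src_mem : ∀ a ∈ e.source, Γ.src a ∈ (chartAt EM base).source
  fst_eq : ∀ a ∈ e.source, (e a).1 = chartAt EM base (Γ.src a)

/-- Inverse function theorem for `z ↦ (f z, π z)`, where `f` is the source map in charts and the
linear map `π` completes its differential at the given point to an isomorphism. -/
theorem exists_adaptedChart [FiniteDimensional ℝ EG] [FiniteDimensional ℝ EM]
    [IsManifold 𝓘(ℝ, EG) ∞ G] [IsManifold 𝓘(ℝ, EM) ∞ M]
    (Γ : LieGroupoid EG EM G M) (a₀ : G) :
    ∃ c : Γ.AdaptedChart, c.base = Γ.src a₀ ∧ a₀ ∈ c.e.source := by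
  set ψ := chartAt EG a₀ with hψ
  set χ := chartAt EM (Γ.src a₀) with hχ
  have hsm := Γ.contMDiff_src
  let f : EG → EM := fun z => χ (Γ.src (ψ.symm z))
  let O : Set EG := ψ.target ∩ ψ.symm ⁻¹' (Γ.src ⁻¹' χ.source)
  have hO : IsOpen O := ψ.symm.isOpen_inter_preimage (χ.open_source.preimage hsm.continuous)
  have hz₀ : ψ a₀ ∈ O := by
    refine ⟨mem_chart_target EG a₀, ?_⟩
    simp only [mem_preimage, hψ, (chartAt EG a₀).left_inv (mem_chart_source EG a₀)]
    exact mem_chart_source EM _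
  have hψs : ContMDiffOn 𝓘(ℝ, EG) 𝓘(ℝ, EG) ∞ ψ ψ.source := contMDiffOn_chart
  have hψi : ContMDiffOn 𝓘(ℝ, EG) 𝓘(ℝ, EG) ∞ ψ.symm ψ.target := contMDiffOn_chart_symm
  have hχs : ContMDiffOn 𝓘(ℝ, EM) 𝓘(ℝ, EM) ∞ χ χ.source := contMDiffOn_chart
  have hf : ContDiffOn ℝ ∞ f O := by
    rw [← contMDiffOn_iff_contDiffOn]
    exact (hχs.comp hsm.contMDiffOn (fun _ h => h)).comp (hψi.mono inter_subset_left)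
      (fun z hz => hz.2)
  have hsurj : Function.Surjective (fderiv ℝ f (ψ a₀)) := by
    have := Γ.submersion_src a₀
    rw [MDifferentiableAt.mfderiv (hsm.mdifferentiable (by simp) a₀)] at this
    simp only [writtenInExtChartAt, mfld_simps, fderivWithin_univ,
      Function.comp_def] at this
    exact this
  obtain ⟨π, L, hL⟩ := exists_equiv_prod_of_surjective _ hsurj
  let q : EG → EM × FiberModel EG EM := fun z => (f z, π z)
  have hq : ContDiffOn ℝ ∞ q O := hf.prodMk π.contDiff.contDiffOn
  have hfd : ∀ z ∈ O, HasFDerivAt q ((fderiv ℝ f z).prod π) z := fun z hz =>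
    ((hf.contDiffAt (hO.mem_nhds hz)).differentiableAt (by simp)).hasFDerivAt.prodMk π.hasFDerivAt
  have hqz : ContDiffAt ℝ ∞ q (ψ a₀) := hq.contDiffAt (hO.mem_nhds hz₀)
  have hqd : HasFDerivAt q (L : EG →L[ℝ] EM × FiberModel EG EM) (ψ a₀) := hL ▸ hfd _ hz₀
  let h := hqz.toOpenPartialHomeomorph q hqd (by simp)
  -- Shrinking to the open set where the differential is invertible makes the inverse smooth on the
  -- whole target and not merely at the image of `a₀`.
  let O' : Set EG := O ∩ fderiv ℝ q ⁻¹' (range ((↑) : (EG ≃L[ℝ] EM × FiberModel EG EM) → _))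
  have hO' : IsOpen O' := (hq.continuousOn_fderiv_of_isOpen hO (by simp)).isOpen_inter_preimage hO
    (ContinuousLinearEquiv.isOpen)
  have hz₀' : ψ a₀ ∈ O' := ⟨hz₀, L, hqd.fderiv.symm⟩
  let e := ψ.trans (h.restrOpen O' hO')
  have hesrc : ∀ a ∈ e.source, a ∈ ψ.source ∧ ψ a ∈ h.source ∧ ψ a ∈ O' := by
    intro a ha
    simp only [e, OpenPartialHomeomorph.trans_source, OpenPartialHomeomorph.restrOpen_source] at ha
    exact ⟨ha.1, ha.2.1, ha.2.2⟩
  have hea : ∀ a, e a = q (ψ a) := fun a => rfl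
  have hsrc' : ∀ a ∈ e.source, Γ.src a ∈ χ.source := by
    intro a ha
    obtain ⟨h1, -, h2⟩ := hesrc a ha
    have := h2.1.2
    simpa only [mem_preimage, ψ.left_inv h1] using this
  refine ⟨⟨Γ.src a₀, e, ?_, ?_, hsrc', ?_⟩, rfl, ?_⟩
  · have := (contMDiffOn_iff_contDiffOn.2 hq).comp (hψs.mono fun a ha => (hesrc a ha).1)
      (fun a ha => (hesrc a ha).2.2.1)
    exact this
  · have hinv : ContDiffOn ℝ ∞ (h.restrOpen O' hO').symm (h.restrOpen O' hO').target := by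
      intro y hy
      have hy' := (h.restrOpen O' hO').map_target hy
      simp only [OpenPartialHomeomorph.restrOpen_source] at hy'
      obtain ⟨L', hL'⟩ := hy'.2.2
      refine (OpenPartialHomeomorph.contDiffAt_symm _ (f₀' := L') hy ?_ ?_).contDiffWithinAt
      · rw [hL']
        exact ((hq.contDiffAt (hO.mem_nhds hy'.2.1)).differentiableAt (by simp)).hasFDerivAt
      · exact hq.contDiffAt (hO.mem_nhds hy'.2.1)
    have htgt : ∀ y ∈ e.target, y ∈ (h.restrOpen O' hO').target ∧
        (h.restrOpen O' hO').symm y ∈ ψ.target := by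
      intro y hy
      rw [OpenPartialHomeomorph.trans_target] at hy
      exact hy
    exact hψi.comp ((contMDiffOn_iff_contDiffOn.2 hinv).mono fun y hy => (htgt y hy).1)
      (fun y hy => (htgt y hy).2)
  · intro a ha
    show f (ψ a) = _
    simp only [f, ψ.left_inv (hesrc a ha).1]
    rfl
  · simp only [e, OpenPartialHomeomorph.trans_source, OpenPartialHomeomorph.restrOpen_source]
    exact ⟨mem_chart_source EG a₀, hqz.mem_toOpenPartialHomeomorph_source hqd (by simp), hz₀'⟩

end AdaptedChart

end LieGroupoid

/-! ### Parametrizations of the fibers by adapted charts. -/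

namespace LieGroupoid

section AdaptedChart

variable {EG EM G M : Type*}
  [NormedAddCommGroup EG] [NormedSpace ℝ EG]
  [NormedAddCommGroup EM] [NormedSpace ℝ EM]
  [TopologicalSpace G] [ChartedSpace EG G] [TopologicalSpace M] [ChartedSpace EM M]

/-- The differential of the source map. -/
noncomputable def dsrc (Γ : LieGroupoid EG EM G M) (a : G) : EG →L[ℝ] EM :=
  mfderiv 𝓘(ℝ, EG) 𝓘(ℝ, EM) Γ.src a

/-- The tangent space of the `s`-fiber through `a`. -/
noncomputable def vertical (Γ : LieGroupoid EG EM G M) (a : G) :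
    Submodule ℝ EG :=
  LinearMap.ker (Γ.dsrc a).toLinearMap

theorem mem_vertical {Γ : LieGroupoid EG EM G M} {a : G} {v : EG} :
    v ∈ Γ.vertical a ↔ Γ.dsrc a v = 0 := Iff.rfl

theorem isClosed_fiber [T2Space M] (Γ : LieGroupoid EG EM G M) (x : M) : IsClosed (Γ.fiber x) :=
  isClosed_eq Γ.contMDiff_src.continuous continuous_const

namespace AdaptedChart

variable {Γ : LieGroupoid EG EM G M} (c : Γ.AdaptedChart)

/-- The fiber component of an adapted chart. -/
noncomputable def kappa (a : G) : FiberModel EG EM := (c.e a).2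

/-- The parametrization of the `s`-fiber over `x` given by an adapted chart. -/
noncomputable def pt (x : M) (k : FiberModel EG EM) : G := c.e.symm (chartAt EM c.base x, k)

/-- The domain of the parametrization `c.pt x`. -/
def dom (x : M) : Set (FiberModel EG EM) := {k | (chartAt EM c.base x, k) ∈ c.e.target}

/-- The fiber component of a tangent vector. -/
noncomputable def coord (a : G) : EG →L[ℝ] FiberModel EG EM :=
  (ContinuousLinearMap.snd ℝ EM (FiberModel EG EM)).comp
    (mfderiv 𝓘(ℝ, EG) 𝓘(ℝ, EM × FiberModel EG EM) c.e a : EG →L[ℝ] EM × FiberModel EG EM)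

/-- The differential of `c.pt x`. -/
noncomputable def dpt (x : M) (k : FiberModel EG EM) : FiberModel EG EM →L[ℝ] EG :=
  mfderiv 𝓘(ℝ, FiberModel EG EM) 𝓘(ℝ, EG) (c.pt x) k

theorem isOpen_dom (x : M) : IsOpen (c.dom x) :=
  c.e.open_target.preimage (by fun_prop)

variable {c}

theorem pt_mem {x : M} {k : FiberModel EG EM} (hk : k ∈ c.dom x) : c.pt x k ∈ c.e.source :=
  c.e.map_target hk

theorem e_pt {x : M} {k : FiberModel EG EM} (hk : k ∈ c.dom x) :
    c.e (c.pt x k) = (chartAt EM c.base x, k) := c.e.right_inv hk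

theorem kappa_pt {x : M} {k : FiberModel EG EM} (hk : k ∈ c.dom x) :
    c.kappa (c.pt x k) = k := by rw [kappa, e_pt hk]

theorem src_pt {x : M} (hx : x ∈ (chartAt EM c.base).source) {k : FiberModel EG EM}
    (hk : k ∈ c.dom x) : Γ.src (c.pt x k) = x := by
  apply (chartAt EM c.base).injOn (c.src_mem _ (pt_mem hk)) hx
  rw [← c.fst_eq _ (pt_mem hk), e_pt hk]

theorem kappa_mem {a : G} (ha : a ∈ c.e.source) : c.kappa a ∈ c.dom (Γ.src a) := by
  show (chartAt EM c.base (Γ.src a), c.kappa a) ∈ c.e.target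
  rw [← c.fst_eq a ha]
  exact c.e.map_source ha

theorem pt_kappa {a : G} (ha : a ∈ c.e.source) : c.pt (Γ.src a) (c.kappa a) = a := by
  rw [pt, ← c.fst_eq a ha]
  exact c.e.left_inv ha

theorem exists_pt {a : G} (ha : a ∈ c.e.source) :
    ∃ x ∈ (chartAt EM c.base).source, ∃ k ∈ c.dom x, a = c.pt x k :=
  ⟨_, c.src_mem a ha, _, kappa_mem ha, (pt_kappa ha).symm⟩

theorem contMDiffOn_pt (x : M) :
    ContMDiffOn 𝓘(ℝ, FiberModel EG EM) 𝓘(ℝ, EG) ∞ (c.pt x) (c.dom x) := by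
  refine c.smooth_symm.comp (t := c.e.target) ?_ (fun k hk => hk)
  rw [contMDiffOn_iff_contDiffOn]
  exact contDiffOn_const.prodMk contDiffOn_id

theorem contMDiffAt_pt {x : M} {k : FiberModel EG EM} (hk : k ∈ c.dom x) :
    ContMDiffAt 𝓘(ℝ, FiberModel EG EM) 𝓘(ℝ, EG) ∞ (c.pt x) k :=
  (contMDiffOn_pt x).contMDiffAt ((c.isOpen_dom x).mem_nhds hk)

theorem contMDiffAt_e {a : G} (ha : a ∈ c.e.source) :
    ContMDiffAt 𝓘(ℝ, EG) 𝓘(ℝ, EM × FiberModel EG EM) ∞ c.e a :=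
  c.smooth.contMDiffAt (c.e.open_source.mem_nhds ha)

theorem contMDiffAt_e_symm {z : EM × FiberModel EG EM} (hz : z ∈ c.e.target) :
    ContMDiffAt 𝓘(ℝ, EM × FiberModel EG EM) 𝓘(ℝ, EG) ∞ c.e.symm z :=
  c.smooth_symm.contMDiffAt (c.e.open_target.mem_nhds hz)

theorem contMDiffAt_kappa {a : G} (ha : a ∈ c.e.source) :
    ContMDiffAt 𝓘(ℝ, EG) 𝓘(ℝ, FiberModel EG EM) ∞ c.kappa a :=
  (contDiff_snd.contMDiff.contMDiffAt (x := c.e a)).comp a (contMDiffAt_e ha)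

theorem mfderiv_kappa {a : G} (ha : a ∈ c.e.source) (v : EG) :
    mfderiv 𝓘(ℝ, EG) 𝓘(ℝ, FiberModel EG EM) c.kappa a v = c.coord a v := by
  have h1 : HasMFDerivAt 𝓘(ℝ, EM × FiberModel EG EM) 𝓘(ℝ, FiberModel EG EM)
      (Prod.snd : EM × FiberModel EG EM → _) (c.e a) (ContinuousLinearMap.snd ℝ EM (FiberModel EG EM)) :=
    hasFDerivAt_snd.hasMFDerivAt
  have h2 := h1.comp a ((contMDiffAt_e ha).mdifferentiableAt (by simp)).hasMFDerivAt
  have h3 : HasMFDerivAt 𝓘(ℝ, EG) 𝓘(ℝ, FiberModel EG EM) c.kappa a _ := h2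
  rw [h3.mfderiv]
  rfl

theorem mfderiv_symm_e {a : G} (ha : a ∈ c.e.source) (v : EG) :
    (mfderiv 𝓘(ℝ, EM × FiberModel EG EM) 𝓘(ℝ, EG) c.e.symm (c.e a)
      (mfderiv 𝓘(ℝ, EG) 𝓘(ℝ, EM × FiberModel EG EM) c.e a v) : EG) = v := by
  have h1 := ((contMDiffAt_e_symm (c.e.map_source ha)).mdifferentiableAt (by simp)).hasMFDerivAt
  have h2 := ((contMDiffAt_e ha).mdifferentiableAt (by simp)).hasMFDerivAt
  have h3 := h1.comp a h2
  have h4 : c.e.symm ∘ c.e =ᶠ[𝓝 a] id :=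
    Filter.eventuallyEq_of_mem (c.e.open_source.mem_nhds ha) fun b hb => c.e.left_inv hb
  have h5 := (hasMFDerivAt_id (I := 𝓘(ℝ, EG)) a).congr_of_eventuallyEq h4
  have := hasMFDerivAt_unique h3 h5
  exact congrArg (fun L : EG →L[ℝ] EG => L v) this

theorem mfderiv_e_symm {z : EM × FiberModel EG EM} (hz : z ∈ c.e.target)
    (w : EM × FiberModel EG EM) :
    (mfderiv 𝓘(ℝ, EG) 𝓘(ℝ, EM × FiberModel EG EM) c.e (c.e.symm z)
      (mfderiv 𝓘(ℝ, EM × FiberModel EG EM) 𝓘(ℝ, EG) c.e.symm z w) :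
      EM × FiberModel EG EM) = w := by
  have h1 := ((contMDiffAt_e_symm hz).mdifferentiableAt (by simp)).hasMFDerivAt
  have h2 := ((contMDiffAt_e (c.e.map_target hz)).mdifferentiableAt (by simp)).hasMFDerivAt
  have h3 := h2.comp z h1
  have h4 : c.e ∘ c.e.symm =ᶠ[𝓝 z] id :=
    Filter.eventuallyEq_of_mem (c.e.open_target.mem_nhds hz) fun b hb => c.e.right_inv hb
  have h5 := (hasMFDerivAt_id (I := 𝓘(ℝ, EM × FiberModel EG EM)) z).congr_of_eventuallyEq h4
  have := hasMFDerivAt_unique h3 h5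
  exact congrArg (fun L : (EM × FiberModel EG EM) →L[ℝ] (EM × FiberModel EG EM) => L w) this

theorem hasMFDerivAt_pt {x : M} {k : FiberModel EG EM} (hk : k ∈ c.dom x) :
    HasMFDerivAt 𝓘(ℝ, FiberModel EG EM) 𝓘(ℝ, EG) (c.pt x) k (c.dpt x k) :=
  ((contMDiffAt_pt hk).mdifferentiableAt (by simp)).hasMFDerivAt

theorem dpt_apply {x : M} {k : FiberModel EG EM} (hk : k ∈ c.dom x) (w : FiberModel EG EM) :
    c.dpt x k w =
      mfderiv 𝓘(ℝ, EM × FiberModel EG EM) 𝓘(ℝ, EG) c.e.symm (chartAt EM c.base x, k)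
        ((0, w) : EM × FiberModel EG EM) := by
  have h0 : HasFDerivAt (fun k : FiberModel EG EM => ((chartAt EM c.base x : EM), k))
      ((0 : FiberModel EG EM →L[ℝ] EM).prod (ContinuousLinearMap.id ℝ _)) k :=
    (hasFDerivAt_const _ _).prodMk (hasFDerivAt_id _)
  have h2 := ((contMDiffAt_e_symm (c := c) hk).mdifferentiableAt (by simp)).hasMFDerivAt.comp k
    h0.hasMFDerivAt
  have h3 : HasMFDerivAt 𝓘(ℝ, FiberModel EG EM) 𝓘(ℝ, EG) (c.pt x) k _ := h2
  rw [dpt, h3.mfderiv]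
  rfl

theorem coord_dpt {x : M} {k : FiberModel EG EM} (hk : k ∈ c.dom x)
    (w : FiberModel EG EM) :
    c.coord (c.pt x k) (c.dpt x k w) = w := by
  have h := mfderiv_e_symm (c := c) hk (0, w)
  rw [← dpt_apply hk] at h
  exact congrArg Prod.snd h

theorem dpt_mem_vertical {x : M} (hx : x ∈ (chartAt EM c.base).source)
    {k : FiberModel EG EM} (hk : k ∈ c.dom x) (w : FiberModel EG EM) :
    c.dpt x k w ∈ Γ.vertical (c.pt x k) := by
  rw [mem_vertical]
  have h1 := (Γ.contMDiff_src.mdifferentiable (by simp) (c.pt x k)).hasMFDerivAt.comp k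
    (hasMFDerivAt_pt hk)
  have h2 : Γ.src ∘ c.pt x =ᶠ[𝓝 k] fun _ => x :=
    Filter.eventuallyEq_of_mem ((c.isOpen_dom x).mem_nhds hk) fun l hl => src_pt hx hl
  have h3 := (hasMFDerivAt_const (I := 𝓘(ℝ, FiberModel EG EM)) (I' := 𝓘(ℝ, EM)) x k).congr_of_eventuallyEq h2
  have := hasMFDerivAt_unique h1 h3
  exact congrArg (fun L : FiberModel EG EM →L[ℝ] EM => L w) this

theorem fst_mfderiv_e [IsManifold 𝓘(ℝ, EM) ∞ M] {a : G} (ha : a ∈ c.e.source)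
    {v : EG} (hv : v ∈ Γ.vertical a) :
    (mfderiv 𝓘(ℝ, EG) 𝓘(ℝ, EM × FiberModel EG EM) c.e a v : EM × FiberModel EG EM).1 = 0 := by
  have h1 : HasMFDerivAt 𝓘(ℝ, EM × FiberModel EG EM) 𝓘(ℝ, EM)
      (Prod.fst : EM × FiberModel EG EM → _) (c.e a)
      (ContinuousLinearMap.fst ℝ EM (FiberModel EG EM)) :=
    hasFDerivAt_fst.hasMFDerivAt
  have h2 := h1.comp a ((contMDiffAt_e ha).mdifferentiableAt (by simp)).hasMFDerivAt
  have h3 : ContMDiffAt 𝓘(ℝ, EM) 𝓘(ℝ, EM) ∞ (chartAt EM c.base) (Γ.src a) :=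
    contMDiffOn_chart.contMDiffAt ((chartAt EM c.base).open_source.mem_nhds (c.src_mem a ha))
  let L : EM →L[ℝ] EM := mfderiv 𝓘(ℝ, EM) 𝓘(ℝ, EM) (chartAt EM c.base) (Γ.src a)
  have h4 : HasMFDerivAt 𝓘(ℝ, EG) 𝓘(ℝ, EM) (chartAt EM c.base ∘ Γ.src) a (L.comp (Γ.dsrc a)) :=
    (h3.mdifferentiableAt (by simp)).hasMFDerivAt.comp a
      (Γ.contMDiff_src.mdifferentiable (by simp) a).hasMFDerivAt
  have h5 : (Prod.fst : EM × FiberModel EG EM → _) ∘ c.e =ᶠ[𝓝 a] chartAt EM c.base ∘ Γ.src :=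
    Filter.eventuallyEq_of_mem (c.e.open_source.mem_nhds ha) fun b hb => c.fst_eq b hb
  have := hasMFDerivAt_unique h2 (h4.congr_of_eventuallyEq h5)
  refine (congrArg (fun L : EG →L[ℝ] EM => L v) this).trans ?_
  show L (Γ.dsrc a v) = 0
  rw [mem_vertical.1 hv, map_zero]

/-- In an adapted chart the source is the first component, so a vertical vector has no first
component and is determined by its fiber component. -/
theorem dpt_coord [IsManifold 𝓘(ℝ, EM) ∞ M] {x : M} {k : FiberModel EG EM} (hk : k ∈ c.dom x)
    {v : EG} (hv : v ∈ Γ.vertical (c.pt x k)) :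
    c.dpt x k (c.coord (c.pt x k) v) = v := by
  have h2 : ((0, c.coord (c.pt x k) v) : EM × FiberModel EG EM) =
      mfderiv 𝓘(ℝ, EG) 𝓘(ℝ, EM × FiberModel EG EM) c.e (c.pt x k) v :=
    Prod.ext (fst_mfderiv_e (pt_mem hk) hv).symm rfl
  refine (dpt_apply hk _).trans ?_
  rw [h2, ← e_pt hk]
  exact mfderiv_symm_e (pt_mem hk) v

section Fiber

variable {EN HN N : Type*} [NormedAddCommGroup EN] [NormedSpace ℝ EN] [TopologicalSpace HN]
  {J : ModelWithCorners ℝ EN HN} [TopologicalSpace N] [ChartedSpace HN N]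

theorem hasMFDerivAt_comp_pt {f : G → N} {x : M} (hx : x ∈ (chartAt EM c.base).source)
    {k : FiberModel EG EM} (hk : k ∈ c.dom x)
    {f' : TangentSpace 𝓘(ℝ, EG) (c.pt x k) →L[ℝ] TangentSpace J (f (c.pt x k))}
    (hf : HasMFDerivWithinAt 𝓘(ℝ, EG) J f (Γ.fiber x) (c.pt x k) f') :
    HasMFDerivAt 𝓘(ℝ, FiberModel EG EM) J (f ∘ c.pt x) k
      ((f' : EG →L[ℝ] EN).comp (c.dpt x k)) := by
  have h := hasMFDerivAt_pt hk
  exact (hf.comp k (h.hasMFDerivWithinAt (s := c.dom x)) fun l hl => src_pt hx hl).hasMFDerivAt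
    ((c.isOpen_dom x).mem_nhds hk)

/-- The fiber components `kappa` are smooth on open subsets of `G` and, on the fiber, inverse to the
parametrizations `pt`. Composition with `pt` gives one direction and composition with `kappa` the
other. -/
theorem contMDiffWithinAt_fiber_prod_iff {c' : Γ.AdaptedChart} {f : G × G → N} {x : M}
    (hx : x ∈ (chartAt EM c.base).source) {k : FiberModel EG EM} (hk : k ∈ c.dom x)
    (hx' : x ∈ (chartAt EM c'.base).source) {k' : FiberModel EG EM} (hk' : k' ∈ c'.dom x)
    {n : ℕ∞} :
    ContMDiffWithinAt (𝓘(ℝ, EG).prod 𝓘(ℝ, EG)) J n f (Γ.fiber x ×ˢ Γ.fiber x)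
        (c.pt x k, c'.pt x k') ↔
      ContMDiffAt 𝓘(ℝ, FiberModel EG EM × FiberModel EG EM) J n
        (fun p => f (c.pt x p.1, c'.pt x p.2)) (k, k') := by
  have hn : (n : ℕ∞ω) ≤ ∞ := by exact_mod_cast le_top
  constructor
  · intro h
    have h0 : ContMDiffAt 𝓘(ℝ, FiberModel EG EM × FiberModel EG EM) 𝓘(ℝ, FiberModel EG EM) n
      (Prod.fst : FiberModel EG EM × FiberModel EG EM → _) (k, k') :=
      contDiff_fst.contMDiff.contMDiffAt
    have h0' : ContMDiffAt 𝓘(ℝ, FiberModel EG EM × FiberModel EG EM) 𝓘(ℝ, FiberModel EG EM) n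
      (Prod.snd : FiberModel EG EM × FiberModel EG EM → _) (k, k') :=
      contDiff_snd.contMDiff.contMDiffAt
    have h1 := ContMDiffAt.comp (k, k') ((contMDiffAt_pt hk).of_le hn) h0
    have h1' := ContMDiffAt.comp (k, k') ((contMDiffAt_pt hk').of_le hn) h0'
    have hopen : IsOpen (c.dom x ×ˢ c'.dom x) := (c.isOpen_dom x).prod (c'.isOpen_dom x)
    have h2 := h.comp (k, k') ((h1.prodMk h1').contMDiffWithinAt (s := c.dom x ×ˢ c'.dom x))
      (fun l (hl : l ∈ c.dom x ×ˢ c'.dom x) =>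
        (⟨src_pt hx hl.1, src_pt hx' hl.2⟩ : (c.pt x l.1, c'.pt x l.2) ∈ Γ.fiber x ×ˢ Γ.fiber x))
    exact h2.contMDiffAt (hopen.mem_nhds ⟨hk, hk'⟩)
  · intro h
    have h1 : ContMDiffAt (𝓘(ℝ, EG).prod 𝓘(ℝ, EG)) 𝓘(ℝ, FiberModel EG EM) n
        (fun p : G × G => c.kappa p.1) (c.pt x k, c'.pt x k') :=
      ContMDiffAt.comp (g := c.kappa) (f := Prod.fst) (c.pt x k, c'.pt x k')
        ((contMDiffAt_kappa (pt_mem hk)).of_le hn) contMDiffAt_fst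
    have h1' : ContMDiffAt (𝓘(ℝ, EG).prod 𝓘(ℝ, EG)) 𝓘(ℝ, FiberModel EG EM) n
        (fun p : G × G => c'.kappa p.2) (c.pt x k, c'.pt x k') :=
      ContMDiffAt.comp (g := c'.kappa) (f := Prod.snd) (c.pt x k, c'.pt x k')
        ((contMDiffAt_kappa (pt_mem hk')).of_le hn) contMDiffAt_snd
    have h2 := h1.prodMk_space h1'
    have h3 : ContMDiffAt 𝓘(ℝ, FiberModel EG EM × FiberModel EG EM) J n
        (fun p => f (c.pt x p.1, c'.pt x p.2))
        (c.kappa (c.pt x k, c'.pt x k').1, c'.kappa (c.pt x k, c'.pt x k').2) := by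
      simpa only [kappa_pt hk, kappa_pt hk'] using h
    refine ((ContMDiffAt.comp (c.pt x k, c'.pt x k') h3 h2).contMDiffWithinAt
      (s := Γ.fiber x ×ˢ Γ.fiber x)).congr_of_eventuallyEq ?_ ?_
    · have hopen : IsOpen (c.e.source ×ˢ c'.e.source) := c.e.open_source.prod c'.e.open_source
      filter_upwards [self_mem_nhdsWithin,
        nhdsWithin_le_nhds (hopen.mem_nhds ⟨pt_mem hk, pt_mem hk'⟩)] with b hb hbs
      have e1 : Γ.src b.1 = x := hb.1
      have e2 : Γ.src b.2 = x := hb.2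
      have e3 := pt_kappa hbs.1
      have e4 := pt_kappa hbs.2
      rw [e1] at e3
      rw [e2] at e4
      simp only [Function.comp_apply, e3, e4, Prod.mk.eta]
    · simp only [Function.comp_apply, kappa_pt hk, kappa_pt hk']

end Fiber

end AdaptedChart

end AdaptedChart

end LieGroupoid

/-! ### Algebra in the groupoid. -/

namespace LieGroupoid

section Algebra

variable {EG EM G M : Type*}
  [NormedAddCommGroup EG] [NormedSpace ℝ EG]
  [NormedAddCommGroup EM] [NormedSpace ℝ EM]
  [TopologicalSpace G] [ChartedSpace EG G] [TopologicalSpace M] [ChartedSpace EM M]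
  (Γ : LieGroupoid EG EM G M)

theorem mul_right_cancel {a b c : G} (h₁ : Γ.src a = Γ.tgt c) (h₂ : Γ.src b = Γ.tgt c)
    (h : Γ.mul a c = Γ.mul b c) : a = b := by
  have h' := congrArg (fun d => Γ.mul d (Γ.inv c)) h
  have hc : Γ.src c = Γ.tgt (Γ.inv c) := (Γ.tgt_inv c).symm
  simp only [Γ.mul_assoc _ _ _ h₁ hc, Γ.mul_assoc _ _ _ h₂ hc, Γ.mul_inv] at h'
  rwa [← h₁, Γ.mul_unit, h₁, ← h₂, Γ.mul_unit] at h'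

theorem mul_mul_inv {a b : G} (h : Γ.src a = Γ.tgt b) : Γ.mul (Γ.mul a b) (Γ.inv b) = a := by
  rw [Γ.mul_assoc _ _ _ h (Γ.tgt_inv b).symm, Γ.mul_inv, ← h, Γ.mul_unit]

theorem mul_inv_mul {a b : G} (h : Γ.src a = Γ.src b) : Γ.mul (Γ.mul a (Γ.inv b)) b = a := by
  rw [Γ.mul_assoc _ _ _ (h.trans (Γ.tgt_inv b).symm) (Γ.src_inv b), Γ.inv_mul, ← h, Γ.mul_unit]

theorem inv_inv (a : G) : Γ.inv (Γ.inv a) = a := by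
  apply Γ.mul_right_cancel (c := Γ.inv a)
  · rw [Γ.src_inv]
  · rw [Γ.tgt_inv]
  · rw [Γ.inv_mul, Γ.mul_inv, Γ.src_inv]

theorem inv_eq_of_mul_eq_unit {a b : G} (h : Γ.src a = Γ.tgt b)
    (hab : Γ.mul a b = Γ.unit (Γ.src b)) : Γ.inv b = a := by
  apply Γ.mul_right_cancel (c := b) (Γ.src_inv b) h
  rw [Γ.inv_mul, hab]

theorem inv_mul_rev {a b : G} (h : Γ.src a = Γ.tgt b) :
    Γ.inv (Γ.mul a b) = Γ.mul (Γ.inv b) (Γ.inv a) := by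
  have h1 : Γ.src (Γ.inv b) = Γ.tgt (Γ.inv a) := by rw [Γ.src_inv, Γ.tgt_inv, h]
  apply Γ.inv_eq_of_mul_eq_unit
  · rw [Γ.src_mul _ _ h1, Γ.tgt_mul _ _ h, Γ.src_inv]
  · rw [← Γ.mul_assoc _ _ _ (by rw [Γ.src_mul _ _ h1, Γ.src_inv]) h,
      Γ.mul_assoc _ _ _ h1 (Γ.src_inv a), Γ.inv_mul, h, ← Γ.src_inv b, Γ.mul_unit, Γ.inv_mul,
      Γ.src_mul _ _ h]

theorem inv_unit (x : M) : Γ.inv (Γ.unit x) = Γ.unit x := by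
  apply Γ.inv_eq_of_mul_eq_unit
  · rw [Γ.src_unit, Γ.tgt_unit]
  · have := Γ.mul_unit (Γ.unit x)
    rwa [Γ.src_unit] at this ⊢

theorem src_mul_inv {a b : G} (h : Γ.src a = Γ.src b) :
    Γ.src (Γ.mul a (Γ.inv b)) = Γ.tgt b := by
  rw [Γ.src_mul _ _ (h.trans (Γ.tgt_inv b).symm), Γ.src_inv]

/-- Kernels `ψ (a b⁻¹)` are invariant under a common right translation; the change of variables in
`conv_mul_inv` rests on this. -/
theorem mul_mul_inv_mul {a b d : G} (h : Γ.src a = Γ.tgt d) (h' : Γ.src b = Γ.tgt d) :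
    Γ.mul (Γ.mul a d) (Γ.inv (Γ.mul b d)) = Γ.mul a (Γ.inv b) := by
  have h1 : Γ.src (Γ.inv d) = Γ.tgt (Γ.inv b) := by rw [Γ.src_inv, Γ.tgt_inv, h']
  rw [Γ.inv_mul_rev h', ← Γ.mul_assoc _ _ _ (by rw [Γ.src_mul _ _ h, Γ.tgt_inv]) h1,
    Γ.mul_mul_inv h]

end Algebra

/-! ### Differentials of right translations. -/

section Translation

variable {EG EM G M : Type*}
  [NormedAddCommGroup EG] [NormedSpace ℝ EG] [FiniteDimensional ℝ EG]
  [NormedAddCommGroup EM] [NormedSpace ℝ EM] [FiniteDimensional ℝ EM]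
  [TopologicalSpace G] [ChartedSpace EG G] [IsManifold 𝓘(ℝ, EG) ∞ G]
  [TopologicalSpace M] [ChartedSpace EM M] [IsManifold 𝓘(ℝ, EM) ∞ M]
  (Γ : LieGroupoid EG EM G M)

variable {EN HN N : Type*} [NormedAddCommGroup EN] [NormedSpace ℝ EN] [TopologicalSpace HN]
  {J : ModelWithCorners ℝ EN HN} [TopologicalSpace N] [ChartedSpace HN N]

variable {Γ}

theorem exists_adaptedChart_pt (a : G) : ∃ (c : Γ.AdaptedChart) (k : FiberModel EG EM),
    c.base = Γ.src a ∧ Γ.src a ∈ (chartAt EM c.base).source ∧ k ∈ c.dom (Γ.src a) ∧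
      c.pt (Γ.src a) k = a := by
  obtain ⟨c, hb, hc⟩ := Γ.exists_adaptedChart a
  exact ⟨c, c.kappa a, hb, c.src_mem a hc, AdaptedChart.kappa_mem hc, AdaptedChart.pt_kappa hc⟩

/-- A fiber is not a set of unique differentiability in `G`, so a derivative within it is determined
on vertical vectors only. There it can be read off from the composition with a parametrization of
the fiber. -/
theorem hasMFDerivWithinAt_vertical_unique {f : G → N} {a : G}
    {f₁ f₂ : TangentSpace 𝓘(ℝ, EG) a →L[ℝ] TangentSpace J (f a)}
    (h₁ : HasMFDerivWithinAt 𝓘(ℝ, EG) J f (Γ.fiber (Γ.src a)) a f₁)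
    (h₂ : HasMFDerivWithinAt 𝓘(ℝ, EG) J f (Γ.fiber (Γ.src a)) a f₂)
    {v : EG} (hv : v ∈ Γ.vertical a) : f₁ v = f₂ v := by
  obtain ⟨c, k, -, hx, hk, ha⟩ := exists_adaptedChart_pt (Γ := Γ) a
  generalize hxx : Γ.src a = x at *
  subst ha
  have e := hasMFDerivAt_unique (AdaptedChart.hasMFDerivAt_comp_pt hx hk h₁)
    (AdaptedChart.hasMFDerivAt_comp_pt hx hk h₂)
  have e1 := AdaptedChart.dpt_coord hk hv
  have e2 := congrArg (fun L : FiberModel EG EM →L[ℝ] EN => L (c.coord (c.pt x k) v)) e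
  exact (congrArg (f₁ : EG →L[ℝ] EN) e1.symm).trans
    (e2.trans (congrArg (f₂ : EG →L[ℝ] EN) e1))

variable (Γ)

theorem contMDiffOn_mul_right (b : G) :
    ContMDiffOn 𝓘(ℝ, EG) 𝓘(ℝ, EG) ∞ (fun a => Γ.mul a b) (Γ.fiber (Γ.tgt b)) :=
  Γ.contMDiffOn_mul.comp (f := fun a => (a, b))
    (contMDiff_id.prodMk contMDiff_const).contMDiffOn (fun _ ha => ha)

/-- The differential of right translation by `b`, at a point `a` of the `s`-fiber over `t(b)`. -/
noncomputable def transl (b a : G) : EG →L[ℝ] EG :=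
  mfderivWithin 𝓘(ℝ, EG) 𝓘(ℝ, EG) (fun d => Γ.mul d b) (Γ.fiber (Γ.src a)) a

variable {Γ}

theorem hasMFDerivWithinAt_mul_right {a b : G} (h : Γ.src a = Γ.tgt b) :
    HasMFDerivWithinAt 𝓘(ℝ, EG) 𝓘(ℝ, EG) (fun d => Γ.mul d b) (Γ.fiber (Γ.src a)) a
      (Γ.transl b a) := by
  have h' := (Γ.contMDiffOn_mul_right b a h).mdifferentiableWithinAt (by simp)
  rw [← h] at h'
  exact h'.hasMFDerivWithinAt

theorem transl_mem_vertical {a b : G} (h : Γ.src a = Γ.tgt b) {v : EG} (hv : v ∈ Γ.vertical a) :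
    Γ.transl b a v ∈ Γ.vertical (Γ.mul a b) := by
  have h1 := (Γ.contMDiff_src.mdifferentiable (by simp)
    (Γ.mul a b)).hasMFDerivAt.comp_hasMFDerivWithinAt a (hasMFDerivWithinAt_mul_right h)
  have h2 : HasMFDerivWithinAt 𝓘(ℝ, EG) 𝓘(ℝ, EM) (Γ.src ∘ fun d => Γ.mul d b)
      (Γ.fiber (Γ.src a)) a (0 : EG →L[ℝ] EM) := by
    refine (hasMFDerivWithinAt_const (Γ.src b) _ a).congr_of_eventuallyEq ?_ (Γ.src_mul a b h)
    filter_upwards [self_mem_nhdsWithin] with d hd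
    exact Γ.src_mul d b ((show Γ.src d = Γ.src a from hd).trans h)
  exact hasMFDerivWithinAt_vertical_unique h1 h2 hv

/-- Chain rule for `(e b) d = e (b d)`. The identity holds on the fiber only, so the differentials
can be compared on vertical vectors only. -/
theorem transl_transl {a b d : G} (hab : Γ.src a = Γ.tgt b) (hbd : Γ.src b = Γ.tgt d) {v : EG}
    (hv : v ∈ Γ.vertical a) :
    Γ.transl d (Γ.mul a b) (Γ.transl b a v) = Γ.transl (Γ.mul b d) a v := by
  have hs : Γ.src (Γ.mul a b) = Γ.tgt d := (Γ.src_mul a b hab).trans hbd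
  have h1 := HasMFDerivWithinAt.comp (g := fun e => Γ.mul e d) (f := fun e => Γ.mul e b)
    (u := Γ.fiber (Γ.src (Γ.mul a b))) a (hasMFDerivWithinAt_mul_right hs)
    (hasMFDerivWithinAt_mul_right hab) (fun e he => show Γ.mul e b ∈ Γ.fiber (Γ.src (Γ.mul a b)) from
      (Γ.src_mul e b ((show Γ.src e = Γ.src a from he).trans hab)).trans
        (Γ.src_mul a b hab).symm)
  have hs' : Γ.src a = Γ.tgt (Γ.mul b d) := hab.trans (Γ.tgt_mul b d hbd).symm
  have h2 : HasMFDerivWithinAt 𝓘(ℝ, EG) 𝓘(ℝ, EG) ((fun e => Γ.mul e d) ∘ fun e => Γ.mul e b)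
      (Γ.fiber (Γ.src a)) a (Γ.transl (Γ.mul b d) a) := by
    refine (hasMFDerivWithinAt_mul_right hs').congr_of_eventuallyEq ?_
      (Γ.mul_assoc a b d hab hbd)
    filter_upwards [self_mem_nhdsWithin] with e he
    exact Γ.mul_assoc e b d ((show Γ.src e = Γ.src a from he).trans hab) hbd
  exact hasMFDerivWithinAt_vertical_unique h1 h2 hv

theorem transl_unit {a : G} {v : EG} (hv : v ∈ Γ.vertical a) :
    Γ.transl (Γ.unit (Γ.src a)) a v = v := by
  have h := hasMFDerivWithinAt_mul_right (Γ.tgt_unit (Γ.src a)).symm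
  have h2 : HasMFDerivWithinAt 𝓘(ℝ, EG) 𝓘(ℝ, EG) (fun d => Γ.mul d (Γ.unit (Γ.src a)))
      (Γ.fiber (Γ.src a)) a (ContinuousLinearMap.id ℝ EG) := by
    refine (hasMFDerivWithinAt_id _ a).congr_of_eventuallyEq ?_ (Γ.mul_unit a)
    filter_upwards [self_mem_nhdsWithin] with d hd
    rw [← show Γ.src d = Γ.src a from hd]
    exact Γ.mul_unit d
  exact hasMFDerivWithinAt_vertical_unique h h2 hv

/-- Right translation `A_{t(a)} → T_a G_{s(a)}`. -/
noncomputable def fromUnit (Γ : LieGroupoid EG EM G M) (a : G) : EG →L[ℝ] EG :=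
  Γ.transl a (Γ.unit (Γ.tgt a))

/-- Right translation `T_a G_{s(a)} → A_{t(a)}`. -/
noncomputable def toUnit (Γ : LieGroupoid EG EM G M) (a : G) : EG →L[ℝ] EG :=
  Γ.transl (Γ.inv a) a

theorem rightTranslate_eq (a : G) (v : EG) : Γ.rightTranslate a v = Γ.fromUnit a v := by
  unfold rightTranslate fromUnit transl
  rw [Γ.src_unit]
  rfl

theorem fromUnit_mem_vertical {a : G} {v : EG} (hv : v ∈ Γ.vertical (Γ.unit (Γ.tgt a))) :
    Γ.fromUnit a v ∈ Γ.vertical a := by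
  have h := transl_mem_vertical (Γ.src_unit (Γ.tgt a)) hv
  rwa [Γ.unit_mul] at h

theorem toUnit_mem_vertical {a : G} {v : EG} (hv : v ∈ Γ.vertical a) :
    Γ.toUnit a v ∈ Γ.vertical (Γ.unit (Γ.tgt a)) := by
  have h := transl_mem_vertical (Γ.tgt_inv a).symm hv
  rwa [Γ.mul_inv] at h

theorem fromUnit_toUnit {a : G} {v : EG} (hv : v ∈ Γ.vertical a) :
    Γ.fromUnit a (Γ.toUnit a v) = v := by
  have h := transl_transl (Γ.tgt_inv a).symm (Γ.src_inv a) hv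
  rw [Γ.mul_inv, Γ.inv_mul] at h
  rw [fromUnit, toUnit, h, transl_unit hv]

/-- Since `b (a b)⁻¹ = a⁻¹`, transport to the unit forgets a previous right translation. Invariance
of the metric, the distance and the volume comes from here. -/
theorem toUnit_transl {a b : G} (h : Γ.src a = Γ.tgt b) {v : EG} (hv : v ∈ Γ.vertical a) :
    Γ.toUnit (Γ.mul a b) (Γ.transl b a v) = Γ.toUnit a v := by
  rw [toUnit, toUnit, transl_transl h (by rw [Γ.tgt_inv, Γ.src_mul _ _ h]) hv,
    Γ.inv_mul_rev h, ← Γ.mul_assoc _ _ _ (Γ.tgt_inv b).symm (by rw [Γ.src_inv, Γ.tgt_inv, h]),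
    Γ.mul_inv, ← h, ← Γ.tgt_inv, Γ.unit_mul]

/-- A derivative within a fiber becomes an ordinary derivative on a Euclidean space, with the base
points as parameters. In this form its smooth dependence on the parameters can be shown. -/
theorem coord_transl {c₁ c₂ : Γ.AdaptedChart} {a b : G} (h : Γ.src a = Γ.tgt b)
    (ha : a ∈ c₁.e.source) (hab : Γ.mul a b ∈ c₂.e.source) {v : EG} (hv : v ∈ Γ.vertical a) :
    c₂.coord (Γ.mul a b) (Γ.transl b a v) =
      fderiv ℝ (fun k => c₂.kappa (Γ.mul (c₁.pt (Γ.src a) k) b)) (c₁.kappa a) (c₁.coord a v) := by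
  have hm := hasMFDerivWithinAt_mul_right h
  obtain ⟨x, hx, k, hk, rfl⟩ := AdaptedChart.exists_pt ha
  rw [AdaptedChart.kappa_pt hk]
  rw [AdaptedChart.src_pt hx hk] at hm ⊢
  have h1 := AdaptedChart.hasMFDerivAt_comp_pt hx hk hm
  have h2 := ((AdaptedChart.contMDiffAt_kappa hab).mdifferentiableAt (by simp)).hasMFDerivAt
  have h3 : HasMFDerivAt 𝓘(ℝ, FiberModel EG EM) 𝓘(ℝ, FiberModel EG EM)
    (fun k => c₂.kappa (Γ.mul (c₁.pt x k) b)) k _ := 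
    HasMFDerivAt.comp (g := c₂.kappa) (f := fun k => Γ.mul (c₁.pt x k) b) k h2 h1
  rw [← mfderiv_eq_fderiv, h3.mfderiv]
  refine (AdaptedChart.mfderiv_kappa hab _).symm.trans ?_
  have := AdaptedChart.dpt_coord hk hv
  exact congrArg (fun w : EG => (mfderiv 𝓘(ℝ, EG) 𝓘(ℝ, FiberModel EG EM) c₂.kappa
    (Γ.mul (c₁.pt x k) b) (Γ.transl b (c₁.pt x k) w) : FiberModel EG EM)) this.symm

end Translation

end LieGroupoid

/-! ### Smooth dependence of tangent vectors and translations on parameters. -/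

namespace LieGroupoid

section Tangent

variable {E₁ E₂ EN HN N : Type*} [NormedAddCommGroup E₁] [NormedSpace ℝ E₁]
  [NormedAddCommGroup E₂] [NormedSpace ℝ E₂]
  [NormedAddCommGroup EN] [NormedSpace ℝ EN] [TopologicalSpace HN]
  {J : ModelWithCorners ℝ EN HN} [TopologicalSpace N] [ChartedSpace HN N]

theorem contMDiffAt_fderiv_apply [IsManifold J ∞ N] {f : N → E₁ → E₂} {g : N → E₁} {x₀ : N}
    (hf : ContMDiffAt (J.prod 𝓘(ℝ, E₁)) 𝓘(ℝ, E₂) ∞ (Function.uncurry f) (x₀, g x₀))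
    (hg : ContMDiffAt J 𝓘(ℝ, E₁) ∞ g x₀) :
    ContMDiffAt J 𝓘(ℝ, E₁ →L[ℝ] E₂) ∞ (fun x => fderiv ℝ (f x) (g x)) x₀ := by
  have h := ContMDiffAt.mfderiv (m := ∞) f g hf hg le_rfl
  refine h.congr_of_eventuallyEq (Filter.Eventually.of_forall fun x => ?_)
  show fderiv ℝ (f x) (g x) = _
  rw [← mfderiv_eq_fderiv]
  exact (congrFun (inTangentCoordinates_model_space (fun x => g x) (fun x => f x (g x))
    (fun x => (mfderiv 𝓘(ℝ, E₁) 𝓘(ℝ, E₂) (f x) (g x) : E₁ →L[ℝ] E₂)) x₀) x).symm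

theorem contMDiffAt_mk_vectorSpace {z w : N → E₁} {p₀ : N}
    (hz : ContMDiffAt J 𝓘(ℝ, E₁) ∞ z p₀) (hw : ContMDiffAt J 𝓘(ℝ, E₁) ∞ w p₀) :
    ContMDiffAt J 𝓘(ℝ, E₁).tangent ∞
      (fun p => (⟨z p, w p⟩ : TangentBundle 𝓘(ℝ, E₁) E₁)) p₀ := by
  apply Bundle.contMDiffAt_totalSpace.2
  refine ⟨hz, ?_⟩
  convert! hw with y
  simp

variable {EG G : Type*} [NormedAddCommGroup EG] [NormedSpace ℝ EG] [TopologicalSpace G]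
  [ChartedSpace EG G] [IsManifold 𝓘(ℝ, EG) ∞ G]
  {EG' G' : Type*} [NormedAddCommGroup EG'] [NormedSpace ℝ EG'] [TopologicalSpace G']
  [ChartedSpace EG' G'] [IsManifold 𝓘(ℝ, EG') ∞ G']

theorem contMDiffAt_mfderiv_mk {f : G → G'} {U : Set G} (hU : IsOpen U)
    (hf : ContMDiffOn 𝓘(ℝ, EG) 𝓘(ℝ, EG') ∞ f U) {b : N → G}
    {v : (p : N) → TangentSpace 𝓘(ℝ, EG) (b p)} {p₀ : N}
    (hv : ContMDiffAt J 𝓘(ℝ, EG).tangent ∞ (fun p => (⟨b p, v p⟩ : TangentBundle 𝓘(ℝ, EG) G)) p₀)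
    (hb : b p₀ ∈ U) :
    ContMDiffAt J 𝓘(ℝ, EG').tangent ∞ (fun p => (⟨f (b p),
      mfderiv 𝓘(ℝ, EG) 𝓘(ℝ, EG') f (b p) (v p)⟩ : TangentBundle 𝓘(ℝ, EG') G')) p₀ := by
  have : IsManifold 𝓘(ℝ, EG) 1 G := IsManifold.of_le (n := ∞) (by simp)
  have : IsManifold 𝓘(ℝ, EG') 1 G' := IsManifold.of_le (n := ∞) (by simp)
  have h1 := hf.contMDiffOn_tangentMapWithin (m := ∞) le_rfl hU.uniqueMDiffOn
  have hcont : ContinuousAt b p₀ :=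
    (FiberBundle.continuous_proj EG (TangentSpace 𝓘(ℝ, EG) : G → Type _)).continuousAt.comp
      hv.continuousAt
  have hopen : IsOpen (Bundle.TotalSpace.proj ⁻¹' U : Set (TangentBundle 𝓘(ℝ, EG) G)) :=
    hU.preimage (FiberBundle.continuous_proj EG (TangentSpace 𝓘(ℝ, EG) : G → Type _))
  have h2 := (h1.contMDiffAt (x := (⟨b p₀, v p₀⟩ : TangentBundle 𝓘(ℝ, EG) G))
    (hopen.mem_nhds hb)).comp p₀ hv
  refine h2.congr_of_eventuallyEq ?_
  filter_upwards [hcont (hU.mem_nhds hb)] with p hp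
  simp only [Function.comp_apply, tangentMapWithin]
  rw [mfderivWithin_of_isOpen hU hp]

theorem contMDiffAt_mfderiv_apply {f : G → E₂} {U : Set G} (hU : IsOpen U)
    (hf : ContMDiffOn 𝓘(ℝ, EG) 𝓘(ℝ, E₂) ∞ f U) {b : N → G}
    {v : (p : N) → TangentSpace 𝓘(ℝ, EG) (b p)} {p₀ : N}
    (hv : ContMDiffAt J 𝓘(ℝ, EG).tangent ∞ (fun p => (⟨b p, v p⟩ : TangentBundle 𝓘(ℝ, EG) G)) p₀)
    (hb : b p₀ ∈ U) :
    ContMDiffAt J 𝓘(ℝ, E₂) ∞ (fun p => (mfderiv 𝓘(ℝ, EG) 𝓘(ℝ, E₂) f (b p) (v p) : E₂)) p₀ :=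
  ((contMDiff_snd_tangentBundle_modelSpace E₂ 𝓘(ℝ, E₂)).contMDiffAt).comp p₀
    (contMDiffAt_mfderiv_mk hU hf hv hb)

end Tangent

section Translation

variable {EG EM G M : Type*}
  [NormedAddCommGroup EG] [NormedSpace ℝ EG] [FiniteDimensional ℝ EG]
  [NormedAddCommGroup EM] [NormedSpace ℝ EM] [FiniteDimensional ℝ EM]
  [TopologicalSpace G] [ChartedSpace EG G] [IsManifold 𝓘(ℝ, EG) ∞ G]
  [TopologicalSpace M] [ChartedSpace EM M] [IsManifold 𝓘(ℝ, EM) ∞ M]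
  {Γ : LieGroupoid EG EM G M}

variable {EN HN N : Type*} [NormedAddCommGroup EN] [NormedSpace ℝ EN] [TopologicalSpace HN]
  {J : ModelWithCorners ℝ EN HN} [TopologicalSpace N] [ChartedSpace HN N]

theorem AdaptedChart.contMDiffAt_pt_uncurry {c : Γ.AdaptedChart} {x : N → M}
    {k : N → FiberModel EG EM} {p₀ : N} (hx : ContMDiffAt J 𝓘(ℝ, EM) ∞ x p₀)
    (hk : ContMDiffAt J 𝓘(ℝ, FiberModel EG EM) ∞ k p₀)
    (hx₀ : x p₀ ∈ (chartAt EM c.base).source) (hk₀ : k p₀ ∈ c.dom (x p₀)) :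
    ContMDiffAt J 𝓘(ℝ, EG) ∞ (fun p => c.pt (x p) (k p)) p₀ := by
  have h1 : ContMDiffAt 𝓘(ℝ, EM) 𝓘(ℝ, EM) ∞ (chartAt EM c.base) (x p₀) :=
    contMDiffOn_chart.contMDiffAt ((chartAt EM c.base).open_source.mem_nhds hx₀)
  have h2 := (ContMDiffAt.comp p₀ h1 hx).prodMk_space hk
  exact ContMDiffAt.comp p₀ (contMDiffAt_e_symm hk₀) h2

/-- The points at which a parametrization by an adapted chart is defined. -/
theorem AdaptedChart.eventually_mem_dom {c : Γ.AdaptedChart} {X : Type*} [TopologicalSpace X]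
    {x : X → M} {k : X → FiberModel EG EM} {p₀ : X} (hx : ContinuousAt x p₀)
    (hk : ContinuousAt k p₀) (hx₀ : x p₀ ∈ (chartAt EM c.base).source)
    (hk₀ : k p₀ ∈ c.dom (x p₀)) :
    ∀ᶠ p in 𝓝 p₀, x p ∈ (chartAt EM c.base).source ∧ k p ∈ c.dom (x p) := by
  have h1 : ContinuousAt (chartAt EM c.base) (x p₀) :=
    (chartAt EM c.base).continuousAt hx₀
  have h2 : ContinuousAt (fun p => (chartAt EM c.base (x p), k p)) p₀ :=
    (ContinuousAt.comp (f := x) h1 hx).prodMk hk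
  exact (hx.eventually_mem ((chartAt EM c.base).open_source.mem_nhds hx₀)).and
    (h2.eventually_mem (c.e.open_target.mem_nhds hk₀))

/-- Multiplication is smooth on composable pairs only. The factors `c₁.pt (s (A p)) k` and `B p` are
composable for all `(p, k)` near the given point, so their product is smooth on a full neighbourhood
and may be differentiated in `k`. -/
theorem contMDiffAt_translCoord [IsManifold J ∞ N] {A B : N → G} {p₀ : N}
    (hA : ContMDiffAt J 𝓘(ℝ, EG) ∞ A p₀) (hB : ContMDiffAt J 𝓘(ℝ, EG) ∞ B p₀)
    (hAB : ∀ p, Γ.src (A p) = Γ.tgt (B p)) {c₁ c₂ : Γ.AdaptedChart} (h₁ : A p₀ ∈ c₁.e.source)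
    (h₂ : Γ.mul (A p₀) (B p₀) ∈ c₂.e.source) :
    ContMDiffAt J 𝓘(ℝ, FiberModel EG EM →L[ℝ] FiberModel EG EM) ∞
      (fun p => fderiv ℝ (fun k => c₂.kappa (Γ.mul (c₁.pt (Γ.src (A p)) k) (B p)))
        (c₁.kappa (A p))) p₀ := by
  have hkA : ContMDiffAt J 𝓘(ℝ, FiberModel EG EM) ∞ (fun p => c₁.kappa (A p)) p₀ :=
    ContMDiffAt.comp (g := c₁.kappa) (f := A) p₀ (AdaptedChart.contMDiffAt_kappa h₁) hA
  refine contMDiffAt_fderiv_apply ?_ hkA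
  have hsA : ContMDiffAt (J.prod 𝓘(ℝ, FiberModel EG EM)) 𝓘(ℝ, EM) ∞
      (fun q : N × FiberModel EG EM => Γ.src (A q.1)) (p₀, c₁.kappa (A p₀)) :=
    ContMDiffAt.comp (g := fun p => Γ.src (A p)) (f := Prod.fst) (p₀, c₁.kappa (A p₀))
      (ContMDiffAt.comp p₀ Γ.contMDiff_src.contMDiffAt hA) contMDiffAt_fst
  have hsnd : ContMDiffAt (J.prod 𝓘(ℝ, FiberModel EG EM)) 𝓘(ℝ, FiberModel EG EM) ∞
      (fun q : N × FiberModel EG EM => q.2) (p₀, c₁.kappa (A p₀)) := contMDiffAt_snd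
  have hd : (p₀, c₁.kappa (A p₀)).2 ∈ c₁.dom (Γ.src (A p₀)) := AdaptedChart.kappa_mem h₁
  have hs : Γ.src (A p₀) ∈ (chartAt EM c₁.base).source := c₁.src_mem _ h₁
  have hpt := AdaptedChart.contMDiffAt_pt_uncurry (c := c₁) hsA hsnd hs hd
  have hBq : ContMDiffAt (J.prod 𝓘(ℝ, FiberModel EG EM)) 𝓘(ℝ, EG) ∞
      (fun q : N × FiberModel EG EM => B q.1) (p₀, c₁.kappa (A p₀)) :=
    ContMDiffAt.comp (g := B) (f := Prod.fst) (p₀, c₁.kappa (A p₀)) hB contMDiffAt_fst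
  have hev := AdaptedChart.eventually_mem_dom (c := c₁) hsA.continuousAt hsnd.continuousAt hs hd
  have hmul := ContMDiffWithinAt.comp (p₀, c₁.kappa (A p₀))
    (Γ.contMDiffOn_mul (c₁.pt (Γ.src (A p₀)) (c₁.kappa (A p₀)), B p₀)
      (by
        show Γ.src (c₁.pt (Γ.src (A p₀)) (c₁.kappa (A p₀))) = Γ.tgt (B p₀)
        rw [AdaptedChart.pt_kappa h₁]; exact hAB p₀))
    ((hpt.prodMk hBq).contMDiffWithinAt
      (s := {q : N × FiberModel EG EM | Γ.src (A q.1) ∈ (chartAt EM c₁.base).source ∧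
        q.2 ∈ c₁.dom (Γ.src (A q.1))}))
    (fun q hq => by
      show Γ.src (c₁.pt (Γ.src (A q.1)) q.2) = Γ.tgt (B q.1)
      rw [AdaptedChart.src_pt hq.1 hq.2, hAB])
  have hmul' := hmul.contMDiffAt hev
  have hk2 : ContMDiffAt 𝓘(ℝ, EG) 𝓘(ℝ, FiberModel EG EM) ∞ c₂.kappa
      (Γ.mul (c₁.pt (Γ.src (A p₀)) (c₁.kappa (A p₀))) (B p₀)) := by
    rw [AdaptedChart.pt_kappa h₁]
    exact AdaptedChart.contMDiffAt_kappa h₂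
  exact ContMDiffAt.comp (p₀, c₁.kappa (A p₀)) hk2 hmul'

end Translation

/-! ### Right invariant vector fields are smooth. -/

section Sections

variable {EG EM G M : Type*}
  [NormedAddCommGroup EG] [NormedSpace ℝ EG] [FiniteDimensional ℝ EG]
  [NormedAddCommGroup EM] [NormedSpace ℝ EM] [FiniteDimensional ℝ EM]
  [TopologicalSpace G] [ChartedSpace EG G] [IsManifold 𝓘(ℝ, EG) ∞ G]
  [TopologicalSpace M] [ChartedSpace EM M] [IsManifold 𝓘(ℝ, EM) ∞ M]
  {Γ : LieGroupoid EG EM G M}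

variable {EN HN N : Type*} [NormedAddCommGroup EN] [NormedSpace ℝ EN] [TopologicalSpace HN]
  {J : ModelWithCorners ℝ EN HN} [TopologicalSpace N] [ChartedSpace HN N]

theorem contMDiffAt_coord {c : Γ.AdaptedChart} {b : N → G}
    {v : (p : N) → TangentSpace 𝓘(ℝ, EG) (b p)} {p₀ : N}
    (hv : ContMDiffAt J 𝓘(ℝ, EG).tangent ∞ (fun p => (⟨b p, v p⟩ : TangentBundle 𝓘(ℝ, EG) G)) p₀)
    (hb : b p₀ ∈ c.e.source) :
    ContMDiffAt J 𝓘(ℝ, FiberModel EG EM) ∞ (fun p => c.coord (b p) (v p)) p₀ :=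
  ContMDiffAt.comp p₀
    (g := (Prod.snd : EM × FiberModel EG EM → _)) contDiff_snd.contMDiff.contMDiffAt
    (contMDiffAt_mfderiv_apply c.e.open_source c.smooth hv hb)

theorem contMDiffAt_of_coord {c : Γ.AdaptedChart} {b : N → G}
    {v : (p : N) → TangentSpace 𝓘(ℝ, EG) (b p)} {p₀ : N} {w : N → FiberModel EG EM}
    (hb : ContMDiffAt J 𝓘(ℝ, EG) ∞ b p₀) (hb₀ : b p₀ ∈ c.e.source)
    (hw : ContMDiffAt J 𝓘(ℝ, FiberModel EG EM) ∞ w p₀)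
    (hv : ∀ᶠ p in 𝓝 p₀, (v p : EG) = c.dpt (Γ.src (b p)) (c.kappa (b p)) (w p)) :
    ContMDiffAt J 𝓘(ℝ, EG).tangent ∞
      (fun p => (⟨b p, v p⟩ : TangentBundle 𝓘(ℝ, EG) G)) p₀ := by
  have hz : ContMDiffAt J 𝓘(ℝ, EM × FiberModel EG EM) ∞ (fun p => c.e (b p)) p₀ :=
    ContMDiffAt.comp p₀ (AdaptedChart.contMDiffAt_e hb₀) hb
  have h0w : ContMDiffAt J 𝓘(ℝ, EM × FiberModel EG EM) ∞
      (fun p => ((0, w p) : EM × FiberModel EG EM)) p₀ := contMDiffAt_const.prodMk_space hw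
  have h := contMDiffAt_mfderiv_mk c.e.open_target c.smooth_symm
    (contMDiffAt_mk_vectorSpace hz h0w) (c.e.map_source hb₀)
  refine h.congr_of_eventuallyEq ?_
  filter_upwards [hv, hb.continuousAt (c.e.open_source.mem_nhds hb₀)] with p hp hps
  have e1 : c.e.symm (c.e (b p)) = b p := c.e.left_inv hps
  have e2 : (v p : EG) = mfderiv 𝓘(ℝ, EM × FiberModel EG EM) 𝓘(ℝ, EG) c.e.symm (c.e (b p))
      ((0, w p) : EM × FiberModel EG EM) := by
    rw [hp]
    refine (AdaptedChart.dpt_apply (AdaptedChart.kappa_mem hps) _).trans ?_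
    have e3 : (chartAt EM c.base (Γ.src (b p)), c.kappa (b p)) = c.e (b p) :=
      Prod.ext (c.fst_eq _ hps).symm rfl
    rw [e3]
  have key : ∀ (a a' : G) (u u' : EG), a = a' → u = u' →
      (⟨a, u⟩ : TangentBundle 𝓘(ℝ, EG) G) = ⟨a', u'⟩ := by
    rintro a a' u u' rfl rfl; rfl
  exact key _ _ _ _ e1.symm e2

theorem dpt_coord_of_mem {c : Γ.AdaptedChart} {a : G} (ha : a ∈ c.e.source) {v : EG}
    (hv : v ∈ Γ.vertical a) : c.dpt (Γ.src a) (c.kappa a) (c.coord a v) = v := by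
  have h : v ∈ Γ.vertical (c.pt (Γ.src a) (c.kappa a)) := by
    rwa [AdaptedChart.pt_kappa ha]
  have := AdaptedChart.dpt_coord (AdaptedChart.kappa_mem ha) h
  rwa [AdaptedChart.pt_kappa ha] at this

theorem coord_dpt_of_mem {c : Γ.AdaptedChart} {a : G} (ha : a ∈ c.e.source)
    (w : FiberModel EG EM) : c.coord a (c.dpt (Γ.src a) (c.kappa a) w) = w := by
  have := AdaptedChart.coord_dpt (AdaptedChart.kappa_mem ha) w
  rwa [AdaptedChart.pt_kappa ha] at this

theorem dpt_mem_vertical_of_mem {c : Γ.AdaptedChart} {a : G} (ha : a ∈ c.e.source)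
    (w : FiberModel EG EM) : c.dpt (Γ.src a) (c.kappa a) w ∈ Γ.vertical a := by
  have := AdaptedChart.dpt_mem_vertical (c.src_mem a ha) (AdaptedChart.kappa_mem ha) w
  rwa [AdaptedChart.pt_kappa ha] at this

/-- The coordinate expression of right translation away from the units. -/
noncomputable def fromUnitCoord (c₁ c₂ : Γ.AdaptedChart) (a : G) :
    FiberModel EG EM →L[ℝ] FiberModel EG EM :=
  fderiv ℝ (fun k => c₂.kappa (Γ.mul (c₁.pt (Γ.src (Γ.unit (Γ.tgt a))) k) a))
    (c₁.kappa (Γ.unit (Γ.tgt a)))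

/-- The coordinate expression of right translation to the units. -/
noncomputable def toUnitCoord (c₁ c₂ : Γ.AdaptedChart) (a : G) :
    FiberModel EG EM →L[ℝ] FiberModel EG EM :=
  fderiv ℝ (fun k => c₁.kappa (Γ.mul (c₂.pt (Γ.src a) k) (Γ.inv a))) (c₂.kappa a)

theorem contMDiffAt_fromUnitCoord {c₁ c₂ : Γ.AdaptedChart} {a : G}
    (h₁ : Γ.unit (Γ.tgt a) ∈ c₁.e.source) (h₂ : a ∈ c₂.e.source) :
    ContMDiffAt 𝓘(ℝ, EG) 𝓘(ℝ, FiberModel EG EM →L[ℝ] FiberModel EG EM) ∞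
      (fromUnitCoord c₁ c₂) a :=
  contMDiffAt_translCoord (A := fun a => Γ.unit (Γ.tgt a)) (B := id)
    (Γ.contMDiff_unit.comp Γ.contMDiff_tgt).contMDiffAt contMDiffAt_id
    (fun p => Γ.src_unit _) h₁ (by simpa only [id, Γ.unit_mul] using h₂)

theorem contMDiffAt_toUnitCoord {c₁ c₂ : Γ.AdaptedChart} {a : G}
    (h₁ : Γ.unit (Γ.tgt a) ∈ c₁.e.source) (h₂ : a ∈ c₂.e.source) :
    ContMDiffAt 𝓘(ℝ, EG) 𝓘(ℝ, FiberModel EG EM →L[ℝ] FiberModel EG EM) ∞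
      (toUnitCoord c₁ c₂) a :=
  contMDiffAt_translCoord (A := id) (B := Γ.inv) contMDiffAt_id Γ.contMDiff_inv.contMDiffAt
    (fun p => (Γ.tgt_inv _).symm) h₂ (by simpa only [id, Γ.mul_inv] using h₁)

theorem coord_fromUnit {c₁ c₂ : Γ.AdaptedChart} {a : G}
    (h₁ : Γ.unit (Γ.tgt a) ∈ c₁.e.source) (h₂ : a ∈ c₂.e.source) {v : EG}
    (hv : v ∈ Γ.vertical (Γ.unit (Γ.tgt a))) :
    c₂.coord a (Γ.fromUnit a v) =
      fromUnitCoord c₁ c₂ a (c₁.coord (Γ.unit (Γ.tgt a)) v) := by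
  have := coord_transl (c₂ := c₂) (b := a) (Γ.src_unit (Γ.tgt a)) h₁ (by rwa [Γ.unit_mul]) hv
  rwa [Γ.unit_mul] at this

theorem coord_toUnit {c₁ c₂ : Γ.AdaptedChart} {a : G}
    (h₁ : Γ.unit (Γ.tgt a) ∈ c₁.e.source) (h₂ : a ∈ c₂.e.source) {v : EG}
    (hv : v ∈ Γ.vertical a) :
    c₁.coord (Γ.unit (Γ.tgt a)) (Γ.toUnit a v) = toUnitCoord c₁ c₂ a (c₂.coord a v) := by
  have := coord_transl (c₂ := c₁) (Γ.tgt_inv a).symm h₂ (by rwa [Γ.mul_inv]) hv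
  rwa [Γ.mul_inv] at this

theorem IsSection.mem_vertical {X : Γ.PreSection} (hX : Γ.IsSection X) (x : M) :
    (X x : EG) ∈ Γ.vertical (Γ.unit x) := hX.mem x

theorem IsSection.contMDiffAt_coord {X : Γ.PreSection} (hX : Γ.IsSection X) {c : Γ.AdaptedChart}
    {x : M} (hx : Γ.unit x ∈ c.e.source) :
    ContMDiffAt 𝓘(ℝ, EM) 𝓘(ℝ, FiberModel EG EM) ∞ (fun y => c.coord (Γ.unit y) (X y)) x :=
  LieGroupoid.contMDiffAt_coord hX.smooth.contMDiffAt hx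

theorem rightInvariant_mem_vertical {X : Γ.PreSection} (hX : Γ.IsSection X) (a : G) :
    (Γ.rightInvariant X a : EG) ∈ Γ.vertical a :=
  (congrArg (· ∈ Γ.vertical a) (rightTranslate_eq (Γ := Γ) a (X (Γ.tgt a)))).mpr
    (fromUnit_mem_vertical (hX.mem_vertical _))

theorem coord_rightInvariant {X : Γ.PreSection} (hX : Γ.IsSection X) {c₁ c₂ : Γ.AdaptedChart}
    {a : G} (h₁ : Γ.unit (Γ.tgt a) ∈ c₁.e.source) (h₂ : a ∈ c₂.e.source) :
    c₂.coord a (Γ.rightInvariant X a) =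
      fromUnitCoord c₁ c₂ a (c₁.coord (Γ.unit (Γ.tgt a)) (X (Γ.tgt a))) :=
  (congrArg (c₂.coord a) (rightTranslate_eq (Γ := Γ) a (X (Γ.tgt a)))).trans
    (coord_fromUnit h₁ h₂ (hX.mem_vertical _))

theorem contMDiffAt_coord_rightInvariant {X : Γ.PreSection} (hX : Γ.IsSection X)
    {c : Γ.AdaptedChart} {a : G} (ha : a ∈ c.e.source) :
    ContMDiffAt 𝓘(ℝ, EG) 𝓘(ℝ, FiberModel EG EM) ∞
      (fun b => c.coord b (Γ.rightInvariant X b)) a := by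
  obtain ⟨c₁, -, h₁⟩ := Γ.exists_adaptedChart (Γ.unit (Γ.tgt a))
  have hX' : ContMDiffAt 𝓘(ℝ, EG) 𝓘(ℝ, FiberModel EG EM) ∞
      (fun b => c₁.coord (Γ.unit (Γ.tgt b)) (X (Γ.tgt b))) a :=
    ContMDiffAt.comp a (hX.contMDiffAt_coord h₁) Γ.contMDiff_tgt.contMDiffAt
  refine ((contMDiffAt_fromUnitCoord h₁ ha).clm_apply hX').congr_of_eventuallyEq ?_
  filter_upwards [c.e.open_source.mem_nhds ha,
    (Γ.contMDiff_unit.comp Γ.contMDiff_tgt).continuous.continuousAt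
      (c₁.e.open_source.mem_nhds h₁)] with b hb hb₁
  exact coord_rightInvariant hX hb₁ hb

theorem contMDiff_rightInvariant {X : Γ.PreSection} (hX : Γ.IsSection X) :
    ContMDiff 𝓘(ℝ, EG) 𝓘(ℝ, EG).tangent ∞
      (fun a => (⟨a, Γ.rightInvariant X a⟩ : TangentBundle 𝓘(ℝ, EG) G)) := by
  intro a
  obtain ⟨c, -, hc⟩ := Γ.exists_adaptedChart a
  refine contMDiffAt_of_coord (c := c) contMDiffAt_id hc
    (contMDiffAt_coord_rightInvariant hX hc) ?_
  filter_upwards [c.e.open_source.mem_nhds hc] with b hb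
  exact (dpt_coord_of_mem hb (rightInvariant_mem_vertical hX b)).symm

end Sections

end LieGroupoid

/-! ### Global sections and local frames of the Lie algebroid. -/

namespace LieGroupoid

section Sections

variable {EG EM G M : Type*}
  [NormedAddCommGroup EG] [NormedSpace ℝ EG] [FiniteDimensional ℝ EG]
  [NormedAddCommGroup EM] [NormedSpace ℝ EM] [FiniteDimensional ℝ EM]
  [TopologicalSpace G] [ChartedSpace EG G] [IsManifold 𝓘(ℝ, EG) ∞ G]
  [TopologicalSpace M] [ChartedSpace EM M] [IsManifold 𝓘(ℝ, EM) ∞ M]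
  {Γ : LieGroupoid EG EM G M}

theorem isSection_of_coord {X : Γ.PreSection}
    (hmem : ∀ x, (X x : EG) ∈ Γ.vertical (Γ.unit x))
    (h : ∀ x, ∃ c : Γ.AdaptedChart, Γ.unit x ∈ c.e.source ∧
      ContMDiffAt 𝓘(ℝ, EM) 𝓘(ℝ, FiberModel EG EM) ∞ (fun y => c.coord (Γ.unit y) (X y)) x) :
    Γ.IsSection X := by
  refine ⟨hmem, fun x => ?_⟩
  obtain ⟨c, hc, hX⟩ := h x
  refine contMDiffAt_of_coord Γ.contMDiff_unit.contMDiffAt hc hX ?_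
  filter_upwards [Γ.contMDiff_unit.continuous.continuousAt (c.e.open_source.mem_nhds hc)] with y hy
  exact (dpt_coord_of_mem hy (hmem y)).symm

/-- Sums and multiples are treated in one form, which the finite sums and the Leibniz rules for
bracket and Koszul expression share. -/
theorem IsSection.smul_add {X Y : Γ.PreSection} (hX : Γ.IsSection X) (hY : Γ.IsSection Y)
    {f : M → ℝ} (hf : ContMDiff 𝓘(ℝ, EM) 𝓘(ℝ, ℝ) ∞ f) :
    Γ.IsSection (fun x => f x • X x + Y x) := by
  refine isSection_of_coord (fun x => (Γ.vertical (Γ.unit x)).add_mem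
    ((Γ.vertical (Γ.unit x)).smul_mem _ (hX.mem_vertical x)) (hY.mem_vertical x)) fun x => ?_
  obtain ⟨c, -, hc⟩ := Γ.exists_adaptedChart (Γ.unit x)
  refine ⟨c, hc, ?_⟩
  have h := (hf.contMDiffAt.smul (hX.contMDiffAt_coord hc)).add (hY.contMDiffAt_coord hc)
  refine h.congr_of_eventuallyEq (Filter.Eventually.of_forall fun y => ?_)
  exact ((c.coord (Γ.unit y)).map_add (f y • (X y : EG)) (Y y)).trans
    (congrArg (· + _) ((c.coord (Γ.unit y)).map_smul (f y) (X y : EG)))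

theorem isSection_zero : Γ.IsSection (fun _ => 0) := by
  refine isSection_of_coord (fun x => (Γ.vertical (Γ.unit x)).zero_mem) fun x => ?_
  obtain ⟨c, -, hc⟩ := Γ.exists_adaptedChart (Γ.unit x)
  refine ⟨c, hc, (contMDiffAt_const (c := (0 : FiberModel EG EM))).congr_of_eventuallyEq
    (Filter.Eventually.of_forall fun y => ?_)⟩
  exact (c.coord (Γ.unit y)).map_zero

theorem isSection_sum {ι : Type*} (s : Finset ι) {X : ι → Γ.PreSection}
    (hX : ∀ i, Γ.IsSection (X i)) {f : ι → M → ℝ}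
    (hf : ∀ i, ContMDiff 𝓘(ℝ, EM) 𝓘(ℝ, ℝ) ∞ (f i)) :
    Γ.IsSection (fun x => ∑ i ∈ s, f i x • X i x) := by
  classical
  induction s using Finset.induction_on with
  | empty => simpa using isSection_zero
  | insert a s ha ih =>
    simp only [Finset.sum_insert ha]
    exact (hX a).smul_add ih (hf a)

variable [T2Space M]

theorem exists_bump {x : M} {U : Set M} (hU : U ∈ 𝓝 x) :
    ∃ b : M → ℝ, ContMDiff 𝓘(ℝ, EM) 𝓘(ℝ, ℝ) ∞ b ∧ tsupport b ⊆ U ∧ b =ᶠ[𝓝 x] 1 := by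
  obtain ⟨f, -, hf⟩ := (SmoothBumpFunction.nhds_basis_tsupport (I := 𝓘(ℝ, EM)) x).mem_iff.1 hU
  exact ⟨f, f.contMDiff, hf, f.eventuallyEq_one⟩

theorem contMDiff_bump_smul {F : Type*} [NormedAddCommGroup F] [NormedSpace ℝ F] {b : M → ℝ}
    {U : Set M} (hb : ContMDiff 𝓘(ℝ, EM) 𝓘(ℝ, ℝ) ∞ b) (hbU : tsupport b ⊆ U) {f : M → F}
    (hf : ∀ x ∈ U, ContMDiffAt 𝓘(ℝ, EM) 𝓘(ℝ, F) ∞ f x) :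
    ContMDiff 𝓘(ℝ, EM) 𝓘(ℝ, F) ∞ (fun x => b x • f x) := by
  refine contMDiff_of_tsupport fun x hx => ?_
  exact hb.contMDiffAt.smul (hf x (hbU (tsupport_smul_subset_left b f hx)))

/-- Near the support of `b` the coordinates are those of a smooth multiple of a constant vector, and
off the support the field is zero, whatever `c.dpt` is there. -/
theorem isSection_dpt {c : Γ.AdaptedChart} {b : M → ℝ} (hb : ContMDiff 𝓘(ℝ, EM) 𝓘(ℝ, ℝ) ∞ b)
    (hbU : tsupport b ⊆ Γ.unit ⁻¹' c.e.source) (w : FiberModel EG EM) :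
    Γ.IsSection (fun x => (b x • c.dpt x (c.kappa (Γ.unit x)) w : EG)) := by
  have hmem : ∀ x, (b x • c.dpt x (c.kappa (Γ.unit x)) w : EG) ∈ Γ.vertical (Γ.unit x) := by
    intro x
    by_cases hx : Γ.unit x ∈ c.e.source
    · have h := dpt_mem_vertical_of_mem hx w
      rw [Γ.src_unit] at h
      exact (Γ.vertical _).smul_mem _ h
    · have : b x = 0 := by
        by_contra h0
        exact hx (hbU (subset_tsupport b h0))
      rw [this, zero_smul]
      exact (Γ.vertical _).zero_mem
  refine isSection_of_coord hmem fun x => ?_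
  by_cases hx : x ∈ tsupport b
  · refine ⟨c, hbU hx, (hb.contMDiffAt.smul (contMDiffAt_const (c := w))).congr_of_eventuallyEq ?_⟩
    filter_upwards [Γ.contMDiff_unit.continuous.continuousAt
      (c.e.open_source.mem_nhds (hbU hx))] with y hy
    have h := coord_dpt_of_mem hy w
    rw [Γ.src_unit] at h
    exact ((c.coord (Γ.unit y)).map_smul _ _).trans (congrArg (b y • ·) h)
  · obtain ⟨c', -, hc'⟩ := Γ.exists_adaptedChart (Γ.unit x)
    refine ⟨c', hc', (contMDiffAt_const (c := (0 : FiberModel EG EM))).congr_of_eventuallyEq ?_⟩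
    filter_upwards [(isClosed_tsupport b).isOpen_compl.mem_nhds hx] with y hy
    have : b y = 0 := by
      by_contra h0
      exact hy (subset_tsupport b h0)
    simp only [this, zero_smul]
    exact (c'.coord (Γ.unit y)).map_zero

/-- A local frame of the Lie algebroid made of global sections. -/
structure LocalFrame (Γ : LieGroupoid EG EM G M) where
  chart : Γ.AdaptedChart
  field : Fin (Module.finrank ℝ EG - Module.finrank ℝ EM) → Γ.PreSection
  dom : Set M
  isSection : ∀ i, Γ.IsSection (field i)
  isOpen_dom : IsOpen dom
  unit_mem : ∀ x ∈ dom, Γ.unit x ∈ chart.e.source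
  field_eq : ∀ x ∈ dom, ∀ i,
    (field i x : EG) = chart.dpt x (chart.kappa (Γ.unit x)) (EuclideanSpace.single i 1)

theorem exists_localFrame (x : M) : ∃ 𝓕 : Γ.LocalFrame, x ∈ 𝓕.dom := by
  obtain ⟨c, -, hc⟩ := Γ.exists_adaptedChart (Γ.unit x)
  have hU : Γ.unit ⁻¹' c.e.source ∈ 𝓝 x :=
    Γ.contMDiff_unit.continuous.continuousAt (c.e.open_source.mem_nhds hc)
  obtain ⟨b, hb, hbU, hb1⟩ := exists_bump (EM := EM) hU
  obtain ⟨W, hW, hWo, hxW⟩ := eventually_nhds_iff.1 hb1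
  refine ⟨⟨c, fun i x => (b x • c.dpt x (c.kappa (Γ.unit x)) (EuclideanSpace.single i 1) : EG), W,
    fun i => isSection_dpt hb hbU _, hWo, fun y hy => ?_, fun y hy i => ?_⟩, hxW⟩
  · apply hbU
    apply subset_tsupport b
    rw [Function.mem_support, hW y hy]
    exact one_ne_zero
  · simp only [hW y hy, Pi.one_apply, one_smul]
    rfl

namespace LocalFrame

variable (𝓕 : Γ.LocalFrame)

/-- The fields of a local frame, with values in the model space. -/
noncomputable def vec (i : Fin (Module.finrank ℝ EG - Module.finrank ℝ EM)) (x : M) : EG := 𝓕.field i x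

/-- The coefficients of a vector of `A_x` in a local frame. -/
noncomputable def coeff (x : M) : EG →L[ℝ] FiberModel EG EM := 𝓕.chart.coord (Γ.unit x)

variable {𝓕}

theorem sum_coeff {x : M} (hx : x ∈ 𝓕.dom) {v : EG} (hv : v ∈ Γ.vertical (Γ.unit x)) :
    v = ∑ i, 𝓕.coeff x v i • 𝓕.vec i x := by
  have h := dpt_coord_of_mem (𝓕.unit_mem x hx) hv
  rw [Γ.src_unit] at h
  conv_lhs => rw [← h]
  have h2 : 𝓕.chart.coord (Γ.unit x) v = ∑ i, 𝓕.coeff x v i • EuclideanSpace.single i (1 : ℝ) := by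
    ext j
    simp [coeff, Pi.single_apply]
  rw [h2, map_sum]
  refine Finset.sum_congr rfl fun i _ => ?_
  rw [map_smul]
  exact congrArg _ (𝓕.field_eq x hx i).symm

theorem coeff_field {x : M} (hx : x ∈ 𝓕.dom) (i) :
    𝓕.coeff x (𝓕.vec i x) = EuclideanSpace.single i 1 := by
  have h := coord_dpt_of_mem (𝓕.unit_mem x hx) (EuclideanSpace.single i (1 : ℝ))
  rw [Γ.src_unit] at h
  exact (congrArg (𝓕.coeff x) (𝓕.field_eq x hx i)).trans h

theorem coeff_sum_field {x : M} (hx : x ∈ 𝓕.dom) (w : FiberModel EG EM) :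
    𝓕.coeff x (∑ i, w i • 𝓕.vec i x) = w := by
  rw [map_sum]
  simp only [map_smul]
  simp only [coeff_field hx]
  ext j
  simp [Pi.single_apply]

theorem sum_field_mem {x : M} (w : FiberModel EG EM) :
    (∑ i, w i • 𝓕.vec i x) ∈ Γ.vertical (Γ.unit x) :=
  Submodule.sum_mem _ fun i _ => Submodule.smul_mem _ _ ((𝓕.isSection i).mem_vertical x)

theorem contMDiffAt_coeff {X : Γ.PreSection} (hX : Γ.IsSection X) {x : M} (hx : x ∈ 𝓕.dom) :
    ContMDiffAt 𝓘(ℝ, EM) 𝓘(ℝ, FiberModel EG EM) ∞ (fun y => 𝓕.coeff y (X y)) x :=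
  hX.contMDiffAt_coord (𝓕.unit_mem x hx)

/-- Coefficients in a frame are meaningful on its domain only. A bump function equal to one at `x`
turns the local expansion into an identity between global sections without changing the values at
`x`. -/
theorem exists_coeff_smooth {X : Γ.PreSection} (hX : Γ.IsSection X) {x : M} (hx : x ∈ 𝓕.dom) :
    ∃ (b : M → ℝ) (f : Fin (Module.finrank ℝ EG - Module.finrank ℝ EM) → M → ℝ),
      ContMDiff 𝓘(ℝ, EM) 𝓘(ℝ, ℝ) ∞ b ∧ b x = 1 ∧
      (∀ i, ContMDiff 𝓘(ℝ, EM) 𝓘(ℝ, ℝ) ∞ (f i)) ∧ (∀ i, f i x = 𝓕.coeff x (X x) i) ∧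
      ∀ y, b y • (X y : EG) = ∑ i, f i y • 𝓕.vec i y := by
  obtain ⟨b, hb, hbU, hb1⟩ := exists_bump (EM := EM) (𝓕.isOpen_dom.mem_nhds hx)
  refine ⟨b, fun i y => b y • 𝓕.coeff y (X y) i, hb, hb1.self_of_nhds, fun i => ?_, fun i => ?_,
    fun y => ?_⟩
  · refine contMDiff_bump_smul hb hbU fun y hy => ?_
    exact ContMDiffAt.comp y (g := fun w : FiberModel EG EM => w i)
      (EuclideanSpace.proj i : FiberModel EG EM →L[ℝ] ℝ).contDiff.contMDiff.contMDiffAt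
      (contMDiffAt_coeff hX hy)
  · have : b x = 1 := hb1.self_of_nhds
    simp [this]
  · by_cases hy : b y = 0
    · simp only [hy, zero_smul, Finset.sum_const_zero]
      rfl
    · simp only [smul_eq_mul, mul_smul, ← Finset.smul_sum]
      exact congrArg _ (sum_coeff (hbU (subset_tsupport b hy)) (hX.mem_vertical y))

theorem exists_section {x : M} {v : EG} (hv : v ∈ Γ.vertical (Γ.unit x)) :
    ∃ X : Γ.PreSection, Γ.IsSection X ∧ (X x : EG) = v := by
  obtain ⟨𝓕, hx⟩ := exists_localFrame (Γ := Γ) x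
  exact ⟨fun y => ∑ i, 𝓕.coeff x v i • 𝓕.field i y,
    isSection_sum Finset.univ 𝓕.isSection fun i => contMDiff_const, (sum_coeff hx hv).symm⟩

end LocalFrame

end Sections

end LieGroupoid

/-! ### Anchor derivatives and the bracket of sections. -/

namespace LieGroupoid

section Bracket

variable {EG EM G M : Type*}
  [NormedAddCommGroup EG] [NormedSpace ℝ EG] [FiniteDimensional ℝ EG]
  [NormedAddCommGroup EM] [NormedSpace ℝ EM] [FiniteDimensional ℝ EM]
  [TopologicalSpace G] [ChartedSpace EG G] [IsManifold 𝓘(ℝ, EG) ∞ G]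
  [TopologicalSpace M] [ChartedSpace EM M] [IsManifold 𝓘(ℝ, EM) ∞ M]
  {Γ : LieGroupoid EG EM G M}

theorem clm_smul_add {E F : Type*} [NormedAddCommGroup E] [NormedSpace ℝ E]
    [NormedAddCommGroup F] [NormedSpace ℝ F] (L : E →L[ℝ] F) (c : ℝ) (u v : E) :
    L (c • u + v) = c • L u + L v := by
  rw [map_add, map_smul]

theorem two_le_infty : (2 : ℕ∞ω) ≤ ∞ :=
  WithTop.coe_le_coe.2 (le_top : (2 : ℕ∞) ≤ ⊤)

theorem three_le_infty : (3 : ℕ∞ω) ≤ ∞ :=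
  WithTop.coe_le_coe.2 (le_top : (3 : ℕ∞) ≤ ⊤)

theorem clm_inverse_apply_eq {E F : Type*} [NormedAddCommGroup E] [NormedSpace ℝ E]
    [NormedAddCommGroup F] [NormedSpace ℝ F] {A : E →L[ℝ] F} {B : F →L[ℝ] E}
    (h₁ : ∀ u, A (B u) = u) (h₂ : ∀ u, B (A u) = u) (v : F) : A.inverse v = B v := by
  rw [ContinuousLinearMap.inverse_eq (ContinuousLinearMap.ext h₁) (ContinuousLinearMap.ext h₂)]

theorem mlieBracket_vectorSpace {E : Type*} [NormedAddCommGroup E] [NormedSpace ℝ E]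
    (V W : E → E) (z : E) :
    VectorField.mlieBracket 𝓘(ℝ, E) V W z = fderiv ℝ W z (V z) - fderiv ℝ V z (W z) := by
  have h := congrFun (VectorField.mlieBracketWithin_eq_lieBracketWithin (𝕜 := ℝ) (V := V) (W := W)
    (s := univ)) z
  refine Eq.trans ?_ (h.trans ?_)
  · exact (congrFun (VectorField.mlieBracketWithin_univ (I := 𝓘(ℝ, E)) (V := V) (W := W)) z).symm
  exact congrFun (VectorField.lieBracketWithin_univ (𝕜 := ℝ) (V := V) (W := W)) z

/-- The values of a section, as vectors of the model space. -/
def val (X : Γ.PreSection) (x : M) : EG := X x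

/-- The differential of the target map. -/
noncomputable def dtgt (Γ : LieGroupoid EG EM G M) (a : G) : EG →L[ℝ] EM :=
  mfderiv 𝓘(ℝ, EG) 𝓘(ℝ, EM) Γ.tgt a

/-- The differential of a function on the base. -/
noncomputable def dfun (f : M → ℝ) (x : M) : EM →L[ℝ] ℝ := mfderiv 𝓘(ℝ, EM) 𝓘(ℝ, ℝ) f x

theorem fromUnit_unit {x : M} {v : EG} (hv : v ∈ Γ.vertical (Γ.unit x)) :
    Γ.fromUnit (Γ.unit x) v = v := by
  have h := transl_unit hv
  rw [Γ.src_unit] at h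
  unfold fromUnit
  rwa [Γ.tgt_unit]

theorem rightInvariant_unit {X : Γ.PreSection} (hX : Γ.IsSection X) (x : M) :
    (Γ.rightInvariant X (Γ.unit x) : EG) = X x := by
  refine (rightTranslate_eq (Γ := Γ) (Γ.unit x) (X (Γ.tgt (Γ.unit x)))).trans ?_
  have : (X (Γ.tgt (Γ.unit x)) : EG) = X x :=
    congrArg (β := EG) (fun y : M => (show EG from X y)) (Γ.tgt_unit x)
  refine (congrArg (Γ.fromUnit (Γ.unit x)) this).trans ?_
  exact fromUnit_unit (hX.mem_vertical x)

/-- Chain rule for `f ∘ Γ.tgt` at the unit. In this form smoothness in `x` follows from smoothness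
of `X` as a map into the tangent bundle of `G`. -/
theorem anchorDeriv_eq {X : Γ.PreSection} {f : M → ℝ} {x : M}
    (hf : MDifferentiableAt 𝓘(ℝ, EM) 𝓘(ℝ, ℝ) f x) :
    Γ.anchorDeriv X f x =
      (mfderiv 𝓘(ℝ, EG) 𝓘(ℝ, ℝ) (f ∘ Γ.tgt) (Γ.unit x) : EG →L[ℝ] ℝ) (X x : EG) := by
  have hf' : MDifferentiableAt 𝓘(ℝ, EM) 𝓘(ℝ, ℝ) f (Γ.tgt (Γ.unit x)) := by rwa [Γ.tgt_unit]
  have h := mfderiv_comp (I := 𝓘(ℝ, EG)) (I' := 𝓘(ℝ, EM)) (I'' := 𝓘(ℝ, ℝ)) (Γ.unit x) hf'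
    (Γ.contMDiff_tgt.mdifferentiableAt (by simp))
  have h2 : (mfderiv 𝓘(ℝ, EM) 𝓘(ℝ, ℝ) f (Γ.tgt (Γ.unit x)) : EM →L[ℝ] ℝ)
      = (mfderiv 𝓘(ℝ, EM) 𝓘(ℝ, ℝ) f x : EM →L[ℝ] ℝ) :=
    congrArg (β := EM →L[ℝ] ℝ) (fun y => (mfderiv 𝓘(ℝ, EM) 𝓘(ℝ, ℝ) f y : EM →L[ℝ] ℝ))
      (Γ.tgt_unit x)
  have h3 := congrArg (β := ℝ) (fun L : EG →L[ℝ] ℝ => L (X x)) h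
  refine Eq.trans ?_ h3.symm
  exact congrArg (β := ℝ) (fun L : EM →L[ℝ] ℝ =>
    L ((mfderiv 𝓘(ℝ, EG) 𝓘(ℝ, EM) Γ.tgt (Γ.unit x) : EG →L[ℝ] EM) (X x))) h2.symm

theorem contMDiff_anchorDeriv {X : Γ.PreSection} (hX : Γ.IsSection X) {f : M → ℝ}
    (hf : ContMDiff 𝓘(ℝ, EM) 𝓘(ℝ, ℝ) ∞ f) :
    ContMDiff 𝓘(ℝ, EM) 𝓘(ℝ, ℝ) ∞ (Γ.anchorDeriv X f) := by
  intro x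
  have h := contMDiffAt_mfderiv_apply isOpen_univ (hf.comp Γ.contMDiff_tgt).contMDiffOn
    (hX.smooth x) (mem_univ _)
  exact h.congr_of_eventuallyEq (Filter.Eventually.of_forall fun y =>
    anchorDeriv_eq (hf.mdifferentiableAt (by simp)))

theorem anchorDeriv_smul_add (X : Γ.PreSection) {f h k : M → ℝ} {x : M}
    (hf : MDifferentiableAt 𝓘(ℝ, EM) 𝓘(ℝ, ℝ) f x)
    (hh : MDifferentiableAt 𝓘(ℝ, EM) 𝓘(ℝ, ℝ) h x)
    (hk : MDifferentiableAt 𝓘(ℝ, EM) 𝓘(ℝ, ℝ) k x) :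
    Γ.anchorDeriv X (fun y => f y * h y + k y) x
      = Γ.anchorDeriv X f x * h x + f x * Γ.anchorDeriv X h x + Γ.anchorDeriv X k x := by
  have H := ((hf.hasMFDerivAt.mul hh.hasMFDerivAt).add hk.hasMFDerivAt).mfderiv
  refine (congrArg (β := ℝ) (fun L : EM →L[ℝ] ℝ => L (Γ.anchorField X x : EM)) H).trans ?_
  show f x * Γ.anchorDeriv X h x + h x * Γ.anchorDeriv X f x + Γ.anchorDeriv X k x = _
  ring

theorem anchorDeriv_field_smul_add (X Y : Γ.PreSection) (c : M → ℝ) (f : M → ℝ) (x : M) :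
    Γ.anchorDeriv (fun y => c y • X y + Y y) f x
      = c x * Γ.anchorDeriv X f x + Γ.anchorDeriv Y f x := by
  have h1 := clm_smul_add (Γ.dtgt (Γ.unit x)) (c x) (X x) (Y x)
  exact (congrArg (dfun f x) h1).trans (clm_smul_add (dfun f x) _ _ _)

theorem rightInvariant_smul_add (X Y : Γ.PreSection) (f : M → ℝ) :
    Γ.rightInvariant (fun y => f y • X y + Y y)
      = (f ∘ Γ.tgt) • Γ.rightInvariant X + Γ.rightInvariant Y := by
  funext a
  have h : ∀ v : EG, Γ.rightTranslate a v = Γ.fromUnit a v := rightTranslate_eq a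
  refine (h (f (Γ.tgt a) • (X (Γ.tgt a) : EG) + (Y (Γ.tgt a) : EG))).trans ?_
  refine (clm_smul_add (Γ.fromUnit a) _ _ _).trans ?_
  exact (congrArg₂ (fun u v : EG => f (Γ.tgt a) • u + v) (h _) (h _)).symm

theorem mdifferentiableAt_rightInvariant {X : Γ.PreSection} (hX : Γ.IsSection X) (a : G) :
    MDifferentiableAt 𝓘(ℝ, EG) 𝓘(ℝ, EG).tangent
      (fun a => (⟨a, Γ.rightInvariant X a⟩ : TangentBundle 𝓘(ℝ, EG) G)) a :=
  (contMDiff_rightInvariant hX).mdifferentiableAt (by simp)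

/-- Leibniz rule for `[X^r, (f ∘ t) Y^r]`, evaluated at the unit, where the derivative of `f ∘ t`
along `X^r` is that of `f` along the anchor of `X`. -/
theorem bracket_smul_add {X Y Z : Γ.PreSection} (hX : Γ.IsSection X) (hY : Γ.IsSection Y)
    (hZ : Γ.IsSection Z) {f : M → ℝ} (hf : ContMDiff 𝓘(ℝ, EM) 𝓘(ℝ, ℝ) ∞ f) (x : M) :
    val (Γ.bracket X (fun y => f y • Y y + Z y)) x
      = Γ.anchorDeriv X f x • val Y x + f x • val (Γ.bracket X Y) x + val (Γ.bracket X Z) x := by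
  have : IsManifold 𝓘(ℝ, EG) (minSmoothness ℝ 2) G :=
    IsManifold.of_le (n := ∞) (by simpa using two_le_infty)
  have : IsManifold 𝓘(ℝ, EG) (minSmoothness ℝ 3) G :=
    IsManifold.of_le (n := ∞) (by simpa using three_le_infty)
  have hft : MDifferentiableAt 𝓘(ℝ, EG) 𝓘(ℝ, ℝ) (f ∘ Γ.tgt) (Γ.unit x) :=
    (hf.comp Γ.contMDiff_tgt).mdifferentiableAt (by simp)
  have hfY : MDifferentiableAt 𝓘(ℝ, EG) 𝓘(ℝ, EG).tangent
      (fun a => (⟨a, ((f ∘ Γ.tgt) • Γ.rightInvariant Y) a⟩ : TangentBundle 𝓘(ℝ, EG) G))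
      (Γ.unit x) := by
    have h := mdifferentiableAt_rightInvariant (hY.smul_add isSection_zero hf) (Γ.unit x)
    have h0 : Γ.rightInvariant (fun y => f y • Y y + (fun _ => 0 : Γ.PreSection) y)
        = (f ∘ Γ.tgt) • Γ.rightInvariant Y := by
      rw [rightInvariant_smul_add]
      have : Γ.rightInvariant (fun _ => 0 : Γ.PreSection) = 0 := by
        funext a
        exact (rightTranslate_eq (Γ := Γ) a (0 : EG)).trans (map_zero _)
      rw [this, add_zero]
    rw [h0] at h
    exact h
  have e1 := VectorField.mlieBracket_add_right (V := Γ.rightInvariant X) hfY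
    (mdifferentiableAt_rightInvariant hZ (Γ.unit x))
  have e2 := VectorField.mlieBracket_smul_right (V := Γ.rightInvariant X) hft
    (mdifferentiableAt_rightInvariant hY (Γ.unit x))
  have e0 : val (Γ.bracket X (fun y => f y • Y y + Z y)) x = VectorField.mlieBracket 𝓘(ℝ, EG)
      (Γ.rightInvariant X) ((f ∘ Γ.tgt) • Γ.rightInvariant Y + Γ.rightInvariant Z) (Γ.unit x) := by
    unfold val bracket
    rw [rightInvariant_smul_add]
  refine e0.trans (e1.trans ?_)
  refine (congrArg (β := EG) (fun v : EG => v + val (Γ.bracket X Z) x) e2).trans ?_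
  have e3 : (mvfderiv 𝓘(ℝ, EG) (f ∘ Γ.tgt) (Γ.unit x) : EG →L[ℝ] ℝ)
      (Γ.rightInvariant X (Γ.unit x) : EG) = Γ.anchorDeriv X f x := by
    rw [anchorDeriv_eq (hf.mdifferentiableAt (by simp)), rightInvariant_unit hX]
    rfl
  have e4 : f (Γ.tgt (Γ.unit x)) = f x := by rw [Γ.tgt_unit]
  have e5 := rightInvariant_unit hY x
  show (mvfderiv 𝓘(ℝ, EG) (f ∘ Γ.tgt) (Γ.unit x) : EG →L[ℝ] ℝ)
      (Γ.rightInvariant X (Γ.unit x) : EG) • (show EG from Γ.rightInvariant Y (Γ.unit x)) +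
    f (Γ.tgt (Γ.unit x)) • (show EG from Γ.bracket X Y x) + _ = _
  rw [e3, e4]
  exact congrArg (fun v : EG => Γ.anchorDeriv X f x • v + f x • val (Γ.bracket X Y) x + _) e5

theorem bracket_swap (X Y : Γ.PreSection) (x : M) :
    val (Γ.bracket X Y) x = -val (Γ.bracket Y X) x :=
  VectorField.mlieBracket_swap_apply

/-- Vertical fields are those without first component in an adapted chart, and the bracket formula
of a vector space preserves this. Naturality of the bracket under the chart transfers it back to
`G`. -/
theorem bracket_mem_vertical {X Y : Γ.PreSection} (hX : Γ.IsSection X) (hY : Γ.IsSection Y)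
    (x : M) : (Γ.bracket X Y x : EG) ∈ Γ.vertical (Γ.unit x) := by
  have : IsManifold 𝓘(ℝ, EG) (minSmoothness ℝ 3) G :=
    IsManifold.of_le (n := ∞) (by simpa using three_le_infty)
  have : IsManifold 𝓘(ℝ, EG) 1 G := IsManifold.of_le (n := ∞) (by simp)
  obtain ⟨c, -, hc⟩ := Γ.exists_adaptedChart (Γ.unit x)
  have hz := c.e.map_source hc
  have hpull : ∀ z ∈ c.e.target, ∀ v : EG,
      ((mfderiv 𝓘(ℝ, EM × FiberModel EG EM) 𝓘(ℝ, EG) c.e.symm z :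
        EM × FiberModel EG EM →L[ℝ] EG).inverse v)
      = (mfderiv 𝓘(ℝ, EG) 𝓘(ℝ, EM × FiberModel EG EM) c.e (c.e.symm z) :
        EG →L[ℝ] EM × FiberModel EG EM) v := by
    intro z hz v
    have h1 : ∀ u : EG, (mfderiv 𝓘(ℝ, EM × FiberModel EG EM) 𝓘(ℝ, EG) c.e.symm z :
        EM × FiberModel EG EM →L[ℝ] EG)
        ((mfderiv 𝓘(ℝ, EG) 𝓘(ℝ, EM × FiberModel EG EM) c.e (c.e.symm z) :
          EG →L[ℝ] EM × FiberModel EG EM) u) = u := by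
      intro u
      have := AdaptedChart.mfderiv_symm_e (c.e.map_target hz) u
      rwa [c.e.right_inv hz] at this
    exact clm_inverse_apply_eq (E := EM × FiberModel EG EM) (F := EG) (A := (mfderiv 𝓘(ℝ, EM × FiberModel EG EM) 𝓘(ℝ, EG) c.e.symm z :
        EM × FiberModel EG EM →L[ℝ] EG))
      (B := (mfderiv 𝓘(ℝ, EG) 𝓘(ℝ, EM × FiberModel EG EM) c.e (c.e.symm z) :
          EG →L[ℝ] EM × FiberModel EG EM)) h1 (AdaptedChart.mfderiv_e_symm hz) v
  have hfst : ∀ {V : Γ.PreSection}, Γ.IsSection V → ∀ z ∈ c.e.target,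
      (VectorField.mpullback 𝓘(ℝ, EM × FiberModel EG EM) 𝓘(ℝ, EG) c.e.symm
        (Γ.rightInvariant V) z : EM × FiberModel EG EM).1 = 0 := fun hV z hz =>
    (congrArg Prod.fst (hpull z hz _)).trans
      (AdaptedChart.fst_mfderiv_e (c.e.map_target hz) (rightInvariant_mem_vertical hV _))
  -- The first component is constant near the point, so its derivative vanishes; if `V` is not
  -- differentiable, `fderiv` has the default value zero.
  have hD : ∀ {V : EM × FiberModel EG EM → EM × FiberModel EG EM},
      (∀ z ∈ c.e.target, (V z).1 = 0) → ∀ u,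
      (fderiv ℝ V (c.e (Γ.unit x)) u).1 = 0 := by
    intro V hV u
    by_cases hd : DifferentiableAt ℝ V (c.e (Γ.unit x))
    · have h1 := (ContinuousLinearMap.fst ℝ EM (FiberModel EG EM)).hasFDerivAt.comp
        (c.e (Γ.unit x)) hd.hasFDerivAt
      have h2 : ((ContinuousLinearMap.fst ℝ EM (FiberModel EG EM)) ∘ V)
          =ᶠ[𝓝 (c.e (Γ.unit x))] fun _ => 0 := by
        filter_upwards [c.e.open_target.mem_nhds hz] with z hz using hV z hz
      have h3 := h1.unique ((hasFDerivAt_const (0 : EM) _).congr_of_eventuallyEq h2)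
      exact congrArg (fun L => L u) h3
    · rw [fderiv_zero_of_not_differentiableAt hd]
      rfl
  have e0 : c.e.symm (c.e (Γ.unit x)) = Γ.unit x := c.e.left_inv hc
  have key := VectorField.mpullback_mlieBracket (I := 𝓘(ℝ, EM × FiberModel EG EM))
    (I' := 𝓘(ℝ, EG)) (n := ∞) (f := c.e.symm) (x₀ := c.e (Γ.unit x))
    (mdifferentiableAt_rightInvariant hX _) (mdifferentiableAt_rightInvariant hY _)
    (AdaptedChart.contMDiffAt_e_symm hz) (by simpa using two_le_infty)
  have hb : (VectorField.mpullback 𝓘(ℝ, EM × FiberModel EG EM) 𝓘(ℝ, EG) c.e.symm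
      (VectorField.mlieBracket 𝓘(ℝ, EG) (Γ.rightInvariant X) (Γ.rightInvariant Y))
      (c.e (Γ.unit x)) : EM × FiberModel EG EM).1 = 0 := by
    refine (congrArg Prod.fst key).trans ?_
    refine (congrArg Prod.fst (mlieBracket_vectorSpace _ _ _)).trans ?_
    exact (congrArg₂ (fun u v : EM => u - v) (hD (hfst hY) _) (hD (hfst hX) _)).trans (sub_zero _)
  have hb2 := (congrArg Prod.fst (hpull _ hz (VectorField.mlieBracket 𝓘(ℝ, EG)
    (Γ.rightInvariant X) (Γ.rightInvariant Y) (c.e.symm (c.e (Γ.unit x)))))).symm.trans hb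
  rw [e0] at hb2
  have h3 := AdaptedChart.mfderiv_symm_e hc (Γ.bracket X Y x : EG)
  have h4 := AdaptedChart.dpt_apply (AdaptedChart.kappa_mem hc)
    (c.coord (Γ.unit x) (Γ.bracket X Y x : EG))
  have h5 : (chartAt EM c.base (Γ.src (Γ.unit x)), c.kappa (Γ.unit x)) = c.e (Γ.unit x) :=
    Prod.ext (c.fst_eq _ hc).symm rfl
  rw [h5] at h4
  have h6 : ((0, c.coord (Γ.unit x) (Γ.bracket X Y x : EG)) : EM × FiberModel EG EM)
      = (mfderiv 𝓘(ℝ, EG) 𝓘(ℝ, EM × FiberModel EG EM) c.e (Γ.unit x) :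
        EG →L[ℝ] EM × FiberModel EG EM) (Γ.bracket X Y x : EG) := Prod.ext hb2.symm rfl
  have h7 := dpt_mem_vertical_of_mem hc (c.coord (Γ.unit x) (Γ.bracket X Y x : EG))
  have h8 : (Γ.bracket X Y x : EG) = c.dpt (Γ.src (Γ.unit x)) (c.kappa (Γ.unit x))
      (c.coord (Γ.unit x) (Γ.bracket X Y x : EG)) := by
    refine h3.symm.trans (Eq.trans ?_ h4.symm)
    exact congrArg (mfderiv 𝓘(ℝ, EM × FiberModel EG EM) 𝓘(ℝ, EG) c.e.symm (c.e (Γ.unit x)) :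
      EM × FiberModel EG EM →L[ℝ] EG) h6.symm
  exact h8 ▸ h7

theorem isSection_bracket {X Y : Γ.PreSection} (hX : Γ.IsSection X) (hY : Γ.IsSection Y) :
    Γ.IsSection (Γ.bracket X Y) := by
  refine ⟨bracket_mem_vertical hX hY, ?_⟩
  have : IsManifold 𝓘(ℝ, EG) (minSmoothness ℝ 3) G :=
    IsManifold.of_le (n := ∞) (by simpa using three_le_infty)
  have : IsManifold 𝓘(ℝ, EG) 1 G := IsManifold.of_le (n := ∞) (by simp)
  have : IsManifold 𝓘(ℝ, EG) (((⊤ : ℕ∞) : ℕ∞ω) + 1) G := by simpa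
  have h := ContDiff.mlieBracket_vectorField (m := ⊤) (n := ⊤) (contMDiff_rightInvariant hX)
    (contMDiff_rightInvariant hY) (by simp)
  exact h.comp Γ.contMDiff_unit

end Bracket

end LieGroupoid

/-! ### The Levi-Civita connection of the algebroid. -/

namespace LieGroupoid

section Connection

variable {EG EM G M : Type*}
  [NormedAddCommGroup EG] [NormedSpace ℝ EG] [FiniteDimensional ℝ EG]
  [NormedAddCommGroup EM] [NormedSpace ℝ EM] [FiniteDimensional ℝ EM]
  [TopologicalSpace G] [ChartedSpace EG G] [IsManifold 𝓘(ℝ, EG) ∞ G]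
  [TopologicalSpace M] [ChartedSpace EM M] [IsManifold 𝓘(ℝ, EM) ∞ M]
  {Γ : LieGroupoid EG EM G M}

namespace Metric

variable (g : Γ.Metric)

/-- The metric of the algebroid, with values in the model space. -/
noncomputable def ip (x : M) : LinearMap.BilinForm ℝ EG := g.form x

variable {g}

theorem ip_pos {x : M} {v : EG} (hv : v ∈ Γ.vertical (Γ.unit x)) (h : v ≠ 0) :
    0 < g.ip x v v := g.pos x v hv h

theorem mdifferentiable_form {X Y : Γ.PreSection} (hX : Γ.IsSection X) (hY : Γ.IsSection Y)
    (x : M) : MDifferentiableAt 𝓘(ℝ, EM) 𝓘(ℝ, ℝ) (fun y => g.form y (X y) (Y y)) x :=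
  (g.smooth X Y hX hY).mdifferentiableAt (by simp)

/-- The derivatives of `f` along `X` and `Y` that come from the anchor terms cancel, by symmetry of
the metric, against those from the brackets with `f Z + W`. Linearity over functions in the last
argument is what lets the Koszul formula define a vector at each point. -/
theorem koszul_smul_add {X Y Z W : Γ.PreSection} (hX : Γ.IsSection X) (hY : Γ.IsSection Y)
    (hZ : Γ.IsSection Z) (hW : Γ.IsSection W) {f : M → ℝ}
    (hf : ContMDiff 𝓘(ℝ, EM) 𝓘(ℝ, ℝ) ∞ f) (x : M) :
    g.koszul X Y (fun y => f y • Z y + W y) x = f x * g.koszul X Y Z x + g.koszul X Y W x := by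
  have hfx := hf.mdifferentiableAt (x := x) (by simp)
  have add_r : ∀ (y : M) (u v w : EG) (c : ℝ),
      g.ip y u (c • v + w) = c * g.ip y u v + g.ip y u w := by
    intro y u v w c; rw [map_add, map_smul]; rfl
  have add_l : ∀ (y : M) (u v w : EG) (c : ℝ),
      g.ip y (c • v + w) u = c * g.ip y v u + g.ip y w u := by
    intro y u v w c; rw [map_add, map_smul]; rfl
  have e1 : (fun y => g.form y (Y y) (f y • Z y + W y))
      = fun y => f y * g.form y (Y y) (Z y) + g.form y (Y y) (W y) :=
    funext fun y => add_r y _ _ _ _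
  have e2 : (fun y => g.form y (f y • Z y + W y) (X y))
      = fun y => f y * g.form y (Z y) (X y) + g.form y (W y) (X y) :=
    funext fun y => add_l y _ _ _ _
  have add3 : ∀ (c d : ℝ) (u v w t : EG), g.ip x (c • u + d • v + w) t
      = c * g.ip x u t + d * g.ip x v t + g.ip x w t := by
    intro c d u v w t
    rw [map_add, LinearMap.add_apply, map_add, LinearMap.add_apply, map_smul, map_smul]
    rfl
  have e5 : g.form x (Γ.bracket Y (fun y => f y • Z y + W y) x) (X x)
      = Γ.anchorDeriv Y f x * g.form x (Z x) (X x) + f x * g.form x (Γ.bracket Y Z x) (X x)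
        + g.form x (Γ.bracket Y W x) (X x) :=
    (congrArg (fun v : EG => g.ip x v (X x)) (bracket_smul_add hY hZ hW hf x)).trans
      (add3 _ _ _ _ _ _)
  have e6 : g.form x (Γ.bracket (fun y => f y • Z y + W y) X x) (Y x)
      = -Γ.anchorDeriv X f x * g.form x (Z x) (Y x) + f x * g.form x (Γ.bracket Z X x) (Y x)
        + g.form x (Γ.bracket W X x) (Y x) := by
    have h0 : val (Γ.bracket (fun y => f y • Z y + W y) X) x =
        (-Γ.anchorDeriv X f x) • val Z x + f x • val (Γ.bracket Z X) x
        + val (Γ.bracket W X) x := by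
      rw [bracket_swap, bracket_swap Z X, bracket_swap W X, bracket_smul_add hX hZ hW hf x,
        neg_add, neg_add, neg_smul, smul_neg]
    exact (congrArg (fun v : EG => g.ip x v (Y x)) h0).trans (add3 _ _ _ _ _ _)
  have e7 : g.form x (Z x) (Y x) = g.form x (Y x) (Z x) :=
    g.symm x _ (hZ.mem x) _ (hY.mem x)
  have e8 : g.form x (Γ.bracket X Y x) (f x • Z x + W x)
      = f x * g.form x (Γ.bracket X Y x) (Z x) + g.form x (Γ.bracket X Y x) (W x) :=
    add_r x _ _ _ _
  unfold koszul
  rw [e1, e2, e5, e6, e7, e8, anchorDeriv_field_smul_add,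
    anchorDeriv_smul_add X hfx (mdifferentiable_form hY hZ x) (mdifferentiable_form hY hW x),
    anchorDeriv_smul_add Y hfx (mdifferentiable_form hZ hX x) (mdifferentiable_form hW hX x)]
  ring

theorem koszul_zero {X Y : Γ.PreSection} (hX : Γ.IsSection X) (hY : Γ.IsSection Y) (x : M) :
    g.koszul X Y (fun _ => 0) x = 0 := by
  have h := koszul_smul_add (g := g) hX hY isSection_zero isSection_zero
    (contMDiff_const (c := (1 : ℝ))) x
  have h0 : (fun y => (fun _ => (1 : ℝ)) y • (fun _ => 0 : Γ.PreSection) y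
      + (fun _ => 0 : Γ.PreSection) y) = (fun _ => 0 : Γ.PreSection) := by
    funext y
    exact (add_zero _).trans (smul_zero (1 : ℝ))
  rw [h0] at h
  linarith

theorem koszul_sum {X Y : Γ.PreSection} (hX : Γ.IsSection X) (hY : Γ.IsSection Y)
    {ι : Type*} (s : Finset ι) {Z : ι → Γ.PreSection} (hZ : ∀ i, Γ.IsSection (Z i))
    {f : ι → M → ℝ} (hf : ∀ i, ContMDiff 𝓘(ℝ, EM) 𝓘(ℝ, ℝ) ∞ (f i)) (x : M) :
    g.koszul X Y (fun y => ∑ i ∈ s, f i y • Z i y) x = ∑ i ∈ s, f i x * g.koszul X Y (Z i) x := by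
  classical
  induction s using Finset.induction_on with
  | empty => simpa using koszul_zero hX hY x
  | insert a s ha ih =>
    simp only [Finset.sum_insert ha]
    rw [koszul_smul_add hX hY (hZ a) (isSection_sum s hZ hf) (hf a), ih]

theorem contMDiff_koszul {X Y Z : Γ.PreSection} (hX : Γ.IsSection X) (hY : Γ.IsSection Y)
    (hZ : Γ.IsSection Z) : ContMDiff 𝓘(ℝ, EM) 𝓘(ℝ, ℝ) ∞ (g.koszul X Y Z) := by
  have h1 := contMDiff_anchorDeriv hX (g.smooth Y Z hY hZ)
  have h2 := contMDiff_anchorDeriv hY (g.smooth Z X hZ hX)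
  have h3 := contMDiff_anchorDeriv hZ (g.smooth X Y hX hY)
  have h4 := g.smooth _ Z (isSection_bracket hX hY) hZ
  have h5 := g.smooth _ X (isSection_bracket hY hZ) hX
  have h6 := g.smooth _ Y (isSection_bracket hZ hX) hY
  exact ((((h1.add h2).sub h3).add h4).sub h5).add h6

variable [T2Space M]

/-- Tensoriality at a point: `b Z` is a global combination of the frame fields and agrees with `Z`
at `x`, where `b = 1`. -/
theorem koszul_eq_sum_coeff {X Y Z : Γ.PreSection} (hX : Γ.IsSection X) (hY : Γ.IsSection Y)
    (hZ : Γ.IsSection Z) {𝓕 : Γ.LocalFrame} {x : M} (hx : x ∈ 𝓕.dom) :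
    g.koszul X Y Z x = ∑ i, 𝓕.coeff x (Z x) i * g.koszul X Y (𝓕.field i) x := by
  obtain ⟨b, f, hb, hbx, hf, hfx, hbf⟩ := LocalFrame.exists_coeff_smooth hZ hx
  have h1 := koszul_smul_add (g := g) hX hY hZ isSection_zero hb x
  have h2 := koszul_sum (g := g) hX hY Finset.univ 𝓕.isSection hf x
  have h3 : (fun y => b y • Z y + (fun _ => 0 : Γ.PreSection) y)
      = fun y => ∑ i, f i y • 𝓕.field i y := by
    funext y
    exact (add_zero _).trans (hbf y)
  rw [h3, h2, koszul_zero hX hY, hbx, one_mul, add_zero] at h1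
  simp only [hfx] at h1
  exact h1.symm

/-- The Gram matrix of a local frame, as an operator. -/
noncomputable def gram (g : Γ.Metric) (𝓕 : Γ.LocalFrame) (x : M) :
    FiberModel EG EM →L[ℝ] FiberModel EG EM :=
  ∑ i, ∑ j, g.form x (𝓕.field i x) (𝓕.field j x) •
    (EuclideanSpace.proj i : FiberModel EG EM →L[ℝ] ℝ).smulRight
      (EuclideanSpace.single j (1 : ℝ))

theorem gram_apply (𝓕 : Γ.LocalFrame) (x : M) (w : FiberModel EG EM) (j) :
    g.gram 𝓕 x w j = g.ip x (∑ i, w i • 𝓕.vec i x) (𝓕.vec j x) := by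
  have h1 : g.ip x (∑ i, w i • 𝓕.vec i x) (𝓕.vec j x)
      = ∑ i, w i * g.ip x (𝓕.vec i x) (𝓕.vec j x) := by
    rw [map_sum, LinearMap.sum_apply]
    exact Finset.sum_congr rfl fun i _ => by rw [map_smul]; rfl
  rw [h1]
  have h2 : ∀ i k, (g.form x (𝓕.field i x) (𝓕.field k x) •
      (EuclideanSpace.proj i : FiberModel EG EM →L[ℝ] ℝ).smulRight
        (EuclideanSpace.single k (1 : ℝ) : FiberModel EG EM)) w j
      = if k = j then w i * g.ip x (𝓕.vec i x) (𝓕.vec j x) else 0 := by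
    intro i k
    by_cases hk : k = j
    · subst hk
      simp [mul_comm]
      exact Or.inl rfl
    · simp [hk, Ne.symm hk]
  simp only [gram, sum_apply, WithLp.ofLp_sum, Finset.sum_apply, h2]
  simp

theorem gram_injective {𝓕 : Γ.LocalFrame} {x : M} (hx : x ∈ 𝓕.dom) :
    Function.Injective (g.gram 𝓕 x) := by
  rw [injective_iff_map_eq_zero]
  intro w hw
  have h : g.ip x (∑ i, w i • 𝓕.vec i x) (∑ i, w i • 𝓕.vec i x) = 0 := by
    conv_lhs => rw [map_sum]
    refine Finset.sum_eq_zero fun j _ => ?_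
    rw [map_smul, ← gram_apply, hw]
    simp
  have h2 : ∑ i, w i • 𝓕.vec i x = 0 := by
    by_contra h0
    exact (ip_pos (LocalFrame.sum_field_mem w) h0).ne' h
  rw [← LocalFrame.coeff_sum_field hx w, h2, map_zero]

/-- The Gram matrix as an invertible operator. -/
noncomputable def gramEquiv (g : Γ.Metric) {𝓕 : Γ.LocalFrame} {x : M} (hx : x ∈ 𝓕.dom) :
    FiberModel EG EM ≃L[ℝ] FiberModel EG EM :=
  (LinearEquiv.ofInjectiveEndo (g.gram 𝓕 x).toLinearMap (gram_injective hx)).toContinuousLinearEquiv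

theorem coe_gramEquiv {𝓕 : Γ.LocalFrame} {x : M} (hx : x ∈ 𝓕.dom) :
    (g.gramEquiv hx : FiberModel EG EM →L[ℝ] FiberModel EG EM) = g.gram 𝓕 x := by
  ext w : 1
  rfl

theorem contMDiff_gram (𝓕 : Γ.LocalFrame) :
    ContMDiff 𝓘(ℝ, EM) 𝓘(ℝ, FiberModel EG EM →L[ℝ] FiberModel EG EM) ∞ (g.gram 𝓕) := by
  unfold gram
  refine contMDiff_finsetSum fun i _ => contMDiff_finsetSum fun j _ => ?_
  exact (g.smooth _ _ (𝓕.isSection i) (𝓕.isSection j)).smul contMDiff_const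

theorem eq_of_forall_form {x : M} {v w : EG} (hv : v ∈ Γ.vertical (Γ.unit x))
    (hw : w ∈ Γ.vertical (Γ.unit x))
    (h : ∀ Z, Γ.IsSection Z → 2 * g.ip x v (Z x) = 2 * g.ip x w (Z x)) : v = w := by
  by_contra hne
  have hd := (Γ.vertical (Γ.unit x)).sub_mem hv hw
  obtain ⟨Z, hZ, hZx⟩ := LocalFrame.exists_section hd
  have h1 : g.ip x v (v - w) = g.ip x w (v - w) := by
    have := h Z hZ
    rw [hZx] at this
    linarith
  have h2 := ip_pos (g := g) hd (sub_ne_zero.2 hne)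
  have h3 : g.ip x (v - w) (v - w) = g.ip x v (v - w) - g.ip x w (v - w) :=
    congrArg (fun L : EG →ₗ[ℝ] ℝ => L (v - w)) (map_sub (g.ip x) v w)
  linarith

/-- Every vector of `A_x` extends to a section and the metric is positive, so pairing with sections
determines a vector of `A_x`. The vector chosen in the definition is therefore any one that
satisfies the Koszul formula. -/
theorem nabla_eq {X Y : Γ.PreSection} {x : M} {v : EG} (hv : v ∈ Γ.vertical (Γ.unit x))
    (h : ∀ Z, Γ.IsSection Z → 2 * g.ip x v (Z x) = g.koszul X Y Z x) :
    (g.nabla X Y x : EG) = v := by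
  have hex : ∃ v ∈ Γ.algebroid x, ∀ Z, Γ.IsSection Z →
    2 * g.form x v (Z x) = g.koszul X Y Z x := ⟨v, hv, h⟩
  have h1 : g.nabla X Y x = hex.choose := dif_pos hex
  obtain ⟨h2, h3⟩ := hex.choose_spec
  refine h1.trans (eq_of_forall_form (g := g) h2 hv fun Z hZ => ?_)
  rw [h Z hZ]
  exact h3 Z hZ

/-- The coefficients of the Levi-Civita connection in a local frame. -/
noncomputable def nablaCoeff (g : Γ.Metric) (X Y : Γ.PreSection) (𝓕 : Γ.LocalFrame) (x : M) :
    FiberModel EG EM :=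
  (g.gram 𝓕 x).inverse (∑ j, ((1 / 2 : ℝ) * g.koszul X Y (𝓕.field j) x) •
    EuclideanSpace.single j (1 : ℝ))

/-- Existence of the vector in the Koszul formula: by linearity in `Z` the formula has to be tested
on the frame only, where it is a linear system for the invertible Gram operator. -/
theorem nabla_eq_sum {X Y : Γ.PreSection} (hX : Γ.IsSection X) (hY : Γ.IsSection Y)
    {𝓕 : Γ.LocalFrame} {x : M} (hx : x ∈ 𝓕.dom) :
    (g.nabla X Y x : EG) = ∑ i, g.nablaCoeff X Y 𝓕 x i • 𝓕.vec i x := by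
  refine nabla_eq (LocalFrame.sum_field_mem _) fun Z hZ => ?_
  rw [koszul_eq_sum_coeff hX hY hZ hx]
  have h1 : (Z x : EG) = ∑ i, 𝓕.coeff x (Z x) i • 𝓕.vec i x :=
    LocalFrame.sum_coeff hx (hZ.mem_vertical x)
  refine (congrArg (fun u : EG => 2 * g.ip x (∑ i, g.nablaCoeff X Y 𝓕 x i • 𝓕.vec i x) u)
    h1).trans ?_
  have h3 : g.gram 𝓕 x (g.nablaCoeff X Y 𝓕 x) = ∑ j, ((1 / 2 : ℝ) * g.koszul X Y (𝓕.field j) x) •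
      EuclideanSpace.single j (1 : ℝ) := by
    rw [nablaCoeff, ← coe_gramEquiv hx, ContinuousLinearMap.inverse_equiv]
    exact (g.gramEquiv hx).apply_symm_apply _
  rw [map_sum, Finset.mul_sum]
  refine Finset.sum_congr rfl fun j _ => ?_
  rw [map_smul, ← gram_apply, h3]
  simp [Pi.single_apply]
  ring

/-- In a frame the coefficients are the inverse Gram operator applied to a smooth vector function,
and inversion is smooth at invertible operators. -/
theorem isSection_nabla {X Y : Γ.PreSection} (hX : Γ.IsSection X) (hY : Γ.IsSection Y) :
    Γ.IsSection (g.nabla X Y) := by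
  have hmem : ∀ x, (g.nabla X Y x : EG) ∈ Γ.vertical (Γ.unit x) := by
    intro x
    obtain ⟨𝓕, hx⟩ := exists_localFrame (Γ := Γ) x
    exact (congrArg (· ∈ Γ.vertical (Γ.unit x)) (nabla_eq_sum (g := g) hX hY hx)).mpr
      (LocalFrame.sum_field_mem _)
  refine isSection_of_coord hmem fun x => ?_
  obtain ⟨𝓕, hx⟩ := exists_localFrame (Γ := Γ) x
  refine ⟨𝓕.chart, 𝓕.unit_mem x hx, ?_⟩
  have h1 : ContMDiffAt 𝓘(ℝ, EM) 𝓘(ℝ, FiberModel EG EM) ∞ (g.nablaCoeff X Y 𝓕) x := by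
    have hinv : ContDiffAt ℝ ∞ ContinuousLinearMap.inverse (g.gram 𝓕 x) := by
      rw [← coe_gramEquiv hx]
      exact contDiffAt_map_inverse _
    refine (ContMDiffAt.comp x hinv.contMDiffAt (contMDiff_gram 𝓕).contMDiffAt).clm_apply ?_
    refine (contMDiff_finsetSum fun j _ => ?_).contMDiffAt
    exact (contMDiff_const.mul (contMDiff_koszul hX hY (𝓕.isSection j))).smul contMDiff_const
  refine h1.congr_of_eventuallyEq ?_
  filter_upwards [𝓕.isOpen_dom.mem_nhds hx] with y hy
  refine (congrArg (𝓕.coeff y) (nabla_eq_sum hX hY hy)).trans ?_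
  exact LocalFrame.coeff_sum_field hy _

theorem rightInvariant_zero : Γ.rightInvariant (fun _ => 0) = 0 :=
  funext fun a => (rightTranslate_eq (Γ := Γ) a (0 : EG)).trans (map_zero _)

theorem bracket_zero_left (Y : Γ.PreSection) (x : M) : val (Γ.bracket (fun _ => 0) Y) x = 0 := by
  unfold val bracket
  rw [rightInvariant_zero, VectorField.mlieBracket_zero_left]
  rfl

theorem bracket_zero_right (Y : Γ.PreSection) (x : M) : val (Γ.bracket Y (fun _ => 0)) x = 0 := by
  rw [bracket_swap, bracket_zero_left, neg_zero]

theorem anchorDeriv_zero_left (f : M → ℝ) (x : M) :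
    Γ.anchorDeriv (fun _ => 0) f x = 0 :=
  (congrArg (dfun f x) (map_zero (Γ.dtgt (Γ.unit x)))).trans (map_zero _)

theorem anchorDeriv_zero_right (X : Γ.PreSection) (x : M) :
    Γ.anchorDeriv X (fun _ => 0) x = 0 := by
  unfold anchorDeriv
  rw [mfderiv_const]
  rfl

theorem ip_zero_left (x : M) (v : EG) : g.ip x 0 v = 0 := by
  rw [map_zero, LinearMap.zero_apply]

theorem koszul_zero_left (Y Z : Γ.PreSection) (x : M) :
    g.koszul (fun _ => 0) Y Z x = 0 := by
  have e1 : (fun y => g.form y (Z y) ((fun _ => 0 : Γ.PreSection) y)) = fun _ => 0 :=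
    funext fun y => map_zero (g.ip y (Z y))
  have e2 : (fun y => g.form y ((fun _ => 0 : Γ.PreSection) y) (Y y)) = fun _ => 0 :=
    funext fun y => ip_zero_left (g := g) y _
  have e3 : g.form x (Γ.bracket (fun _ => 0) Y x) (Z x) = 0 :=
    (congrArg (fun v : EG => g.ip x v (Z x)) (bracket_zero_left Y x)).trans (ip_zero_left x _)
  have e4 : g.form x (Γ.bracket Z (fun _ => 0) x) (Y x) = 0 :=
    (congrArg (fun v : EG => g.ip x v (Y x)) (bracket_zero_right Z x)).trans (ip_zero_left x _)
  have e5 : g.form x (Γ.bracket Y Z x) 0 = 0 := map_zero (g.ip x _)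
  unfold koszul
  rw [e1, e2, e3, e4, e5, anchorDeriv_zero_left, anchorDeriv_zero_right, anchorDeriv_zero_right]
  ring

/-- Under the corrections in `covDeriv`, pairs of the form `(X, 0)` and `(0, Y)` keep this form; the
separation of the two kernels in `covDeriv_star` depends on it. -/
theorem nabla_zero_left (Y : Γ.PreSection) : g.nabla (fun _ => 0) Y = fun _ => 0 :=
  funext fun x => nabla_eq (Γ.vertical _).zero_mem fun _ _ =>
    (congrArg (2 * ·) (ip_zero_left x _)).trans ((mul_zero _).trans (koszul_zero_left _ _ x).symm)

end Metric

end Connection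

end LieGroupoid

/-! ### The distance on the fibers as a Riemannian distance on `G` that charges nonvertical vectors
with infinite length. -/

namespace LieGroupoid

section Distance

variable {EG EM G M : Type*}
  [NormedAddCommGroup EG] [NormedSpace ℝ EG] [FiniteDimensional ℝ EG]
  [NormedAddCommGroup EM] [NormedSpace ℝ EM] [FiniteDimensional ℝ EM]
  [TopologicalSpace G] [ChartedSpace EG G] [IsManifold 𝓘(ℝ, EG) ∞ G]
  [TopologicalSpace M] [ChartedSpace EM M] [IsManifold 𝓘(ℝ, EM) ∞ M]
  {Γ : LieGroupoid EG EM G M}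

namespace Metric

variable (g : Γ.Metric)

/-- The right invariant metric on the fibers, with values in the model space. -/
noncomputable def fip (a : G) (v w : EG) : ℝ := g.ip (Γ.tgt a) (Γ.toUnit a v) (Γ.toUnit a w)

/-- The norm of a vector tangent to a fiber. -/
noncomputable def fnorm (a : G) (v : EG) : ℝ := √(g.fip a v v)

open Classical in
/-- The norm of a tangent vector of `G`, infinite if the vector is not tangent to the fiber. -/
noncomputable def fenorm (a : G) (v : EG) : ENNReal :=
  if v ∈ Γ.vertical a then ENNReal.ofReal (g.fnorm a v) else ⊤

/-- The extended norm of the fibers as a family of instances. -/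
@[reducible] noncomputable def fiberENorm (a : G) : ENorm (TangentSpace 𝓘(ℝ, EG) a) :=
  ⟨g.fenorm a⟩

variable {g}

theorem fip_smul (a : G) (c : ℝ) (v : EG) : g.fip a (c • v) (c • v) = c ^ 2 * g.fip a v v := by
  simp only [fip, map_smul, LinearMap.smul_apply, smul_eq_mul]
  ring

theorem fnorm_smul (a : G) (c : ℝ) (v : EG) : g.fnorm a (c • v) = |c| * g.fnorm a v := by
  rw [fnorm, fip_smul, Real.sqrt_mul (sq_nonneg c), Real.sqrt_sq_eq_abs, fnorm]

theorem fnorm_nonneg (a : G) (v : EG) : 0 ≤ g.fnorm a v := Real.sqrt_nonneg _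

theorem fenorm_of_mem {a : G} {v : EG} (hv : v ∈ Γ.vertical a) :
    g.fenorm a v = ENNReal.ofReal (g.fnorm a v) := if_pos hv

theorem fenorm_of_notMem {a : G} {v : EG} (hv : v ∉ Γ.vertical a) : g.fenorm a v = ⊤ := if_neg hv

theorem fenorm_smul (a : G) (c : ℝ) (v : EG) : g.fenorm a (c • v) = ‖c‖ₑ * g.fenorm a v := by
  by_cases hc : c = 0
  · subst hc
    rw [zero_smul, fenorm_of_mem (Γ.vertical a).zero_mem, enorm_zero, zero_mul, fnorm, fip,
      map_zero, map_zero, Real.sqrt_zero, ENNReal.ofReal_zero]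
  · by_cases hv : v ∈ Γ.vertical a
    · rw [fenorm_of_mem hv, fenorm_of_mem ((Γ.vertical a).smul_mem c hv), fnorm_smul,
        ENNReal.ofReal_mul (abs_nonneg c), ← Real.norm_eq_abs, ofReal_norm]
    · have h : c • v ∉ Γ.vertical a := by rwa [Submodule.smul_mem_iff _ hc]
      rw [fenorm_of_notMem hv, fenorm_of_notMem h, ENNReal.mul_top (by simpa using hc)]

theorem fiberENormSMulClass (a : G) :
    @ENormSMulClass ℝ (TangentSpace 𝓘(ℝ, EG) a) _ (g.fiberENorm a) _ :=
  @ENormSMulClass.mk ℝ (TangentSpace 𝓘(ℝ, EG) a) _ (g.fiberENorm a) _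
    (fun c (v : EG) => fenorm_smul a c v)

variable (g)

/-- The length of a path between two parameters. -/
noncomputable def length (γ : ℝ → G) (s t : ℝ) : ENNReal :=
  @Manifold.pathELength _ _ _ _ _ 𝓘(ℝ, EG) G _ _ g.fiberENorm γ s t

/-- The extended Riemannian distance on the fibers; points on different fibers have distance `⊤`. -/
noncomputable def edist (a b : G) : ENNReal :=
  @Manifold.riemannianEDist _ _ _ _ _ 𝓘(ℝ, EG) G _ _ g.fiberENorm a b

variable {g}

theorem length_eq (γ : ℝ → G) (s t : ℝ) :
    g.length γ s t = ∫⁻ τ in Icc s t, g.fenorm (γ τ) (mfderiv 𝓘(ℝ, ℝ) 𝓘(ℝ, EG) γ τ (1 : ℝ)) :=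
  @Manifold.pathELength_eq_lintegral_mfderiv_Icc _ _ _ _ _ 𝓘(ℝ, EG) G _ _ g.fiberENorm s t γ

theorem length_eq_within (γ : ℝ → G) (s t : ℝ) :
    g.length γ s t = ∫⁻ τ in Icc s t,
      g.fenorm (γ τ) (mfderivWithin 𝓘(ℝ, ℝ) 𝓘(ℝ, EG) γ (Icc s t) τ (1 : ℝ)) :=
  @Manifold.pathELength_eq_lintegral_mfderivWithin_Icc _ _ _ _ _ 𝓘(ℝ, EG) G _ _ g.fiberENorm s t γ

theorem length_add (γ : ℝ → G) {r s t : ℝ} (h : r ≤ s) (h' : s ≤ t) :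
    g.length γ r s + g.length γ s t = g.length γ r t :=
  @Manifold.pathELength_add _ _ _ _ _ 𝓘(ℝ, EG) G _ _ g.fiberENorm _ _ _ _ h h'

theorem edist_le_length {γ : ℝ → G} {s t : ℝ} (hγ : ContMDiffOn 𝓘(ℝ, ℝ) 𝓘(ℝ, EG) 1 γ (Icc s t))
    (hst : s ≤ t) : g.edist (γ s) (γ t) ≤ g.length γ s t :=
  @Manifold.riemannianEDist_le_pathELength _ _ _ _ _ 𝓘(ℝ, EG) G _ _ g.fiberENorm
    fiberENormSMulClass _ _ _ _ _ hγ rfl rfl hst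

theorem exists_path_of_edist_lt {a b : G} {r : ENNReal} (h : g.edist a b < r) :
    ∃ γ : ℝ → G, γ 0 = a ∧ γ 1 = b ∧ ContMDiff 𝓘(ℝ, ℝ) 𝓘(ℝ, EG) 1 γ ∧ g.length γ 0 1 < r := by
  obtain ⟨γ, h0, h1, h2, h3, -⟩ :=
    @Manifold.exists_lt_locally_constant_of_riemannianEDist_lt _ _ _ _ _ 𝓘(ℝ, EG) G _ _
      g.fiberENorm fiberENormSMulClass a b r 0 1 h zero_lt_one
  exact ⟨γ, h0, h1, h2, h3⟩

theorem edist_self (a : G) : g.edist a a = 0 :=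
  @Manifold.riemannianEDist_self _ _ _ _ _ 𝓘(ℝ, EG) G _ _ g.fiberENorm fiberENormSMulClass a

theorem edist_comm (a b : G) : g.edist a b = g.edist b a :=
  @Manifold.riemannianEDist_comm _ _ _ _ _ 𝓘(ℝ, EG) G _ _ g.fiberENorm fiberENormSMulClass a b

theorem edist_triangle [IsManifold 𝓘(ℝ, EG) 1 G] (a b c : G) :
    g.edist a c ≤ g.edist a b + g.edist b c :=
  @Manifold.riemannianEDist_triangle _ _ _ _ _ 𝓘(ℝ, EG) G _ _ g.fiberENorm fiberENormSMulClass
    a b c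

/-- The velocity of a path. -/
noncomputable def velocity (γ : ℝ → G) (τ : ℝ) : EG := mfderiv 𝓘(ℝ, ℝ) 𝓘(ℝ, EG) γ τ (1 : ℝ)

/-- The differential of a function on the groupoid. -/
noncomputable def dfunG (f : G → ℝ) (a : G) : EG →L[ℝ] ℝ := mfderiv 𝓘(ℝ, EG) 𝓘(ℝ, ℝ) f a

/-- Fundamental theorem of calculus along the path. It is applied to bump functions of the source
and to a cutoff near the units. -/
theorem enorm_sub_le_length {f : G → ℝ} (hf : ContMDiff 𝓘(ℝ, EG) 𝓘(ℝ, ℝ) 1 f) {L : ENNReal}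
    (hL : ∀ a (v : EG), ‖dfunG f a v‖ₑ ≤ L * g.fenorm a v)
    {γ : ℝ → G} (hγ : ContMDiff 𝓘(ℝ, ℝ) 𝓘(ℝ, EG) 1 γ) {s t : ℝ} (hst : s ≤ t) (hL' : L ≠ ⊤) :
    ‖f (γ t) - f (γ s)‖ₑ ≤ L * g.length γ s t := by
  have hc : ContDiff ℝ 1 (f ∘ γ) := contMDiff_iff_contDiff.1 (hf.comp hγ)
  have h1 : ∫ τ in s..t, deriv (f ∘ γ) τ = f (γ t) - f (γ s) :=
    intervalIntegral.integral_deriv_eq_sub (fun τ _ => (hc.differentiable one_ne_zero).differentiableAt)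
      ((hc.continuous_deriv le_rfl).intervalIntegrable _ _)
  have h2 : ∀ τ, deriv (f ∘ γ) τ = dfunG f (γ τ) (velocity (EG := EG) γ τ) := by
    intro τ
    have h := mfderiv_comp τ (hf.mdifferentiableAt (x := γ τ) one_ne_zero)
      (hγ.mdifferentiableAt (x := τ) one_ne_zero)
    rw [← fderiv_apply_one_eq_deriv, ← mfderiv_eq_fderiv]
    exact congrArg (fun A : ℝ →L[ℝ] ℝ => A 1) h
  rw [← h1, intervalIntegral.integral_of_le hst, length_eq, ← lintegral_const_mul' _ _ hL',
    ← integral_Icc_eq_integral_Ioc]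
  refine (enorm_integral_le_lintegral_enorm _).trans (lintegral_mono fun τ => ?_)
  rw [h2]
  exact hL _ _

/-- Let `b` be a bump function on the base that separates the two sources. The differential of `b ∘
s` kills vertical vectors and all other vectors have norm `⊤`, so `b ∘ s` is Lipschitz with every
constant `ε > 0`. Its jump, which is one, would be at most `ε` times the finite length for all `ε`.
-/
theorem src_eq_of_length_ne_top [T2Space M] {γ : ℝ → G} (hγ : ContMDiff 𝓘(ℝ, ℝ) 𝓘(ℝ, EG) 1 γ) {s t : ℝ}
    (hst : s ≤ t) (h : g.length γ s t ≠ ⊤) : Γ.src (γ t) = Γ.src (γ s) := by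
  by_contra hne
  obtain ⟨b, hb, hbU, hb1⟩ := exists_bump (EM := EM) (x := Γ.src (γ t)) (U := {Γ.src (γ s)}ᶜ)
    (isOpen_compl_singleton.mem_nhds hne)
  have hb1 : b (Γ.src (γ t)) = 1 := hb1.self_of_nhds
  have hb0 : b (Γ.src (γ s)) = 0 := by
    by_contra h0
    exact hbU (subset_tsupport b h0) rfl
  have key : ∀ ε : NNReal, 0 < ε → (1 : ENNReal) ≤ ε * g.length γ s t := by
    intro ε hε
    have hbs := (hb.comp Γ.contMDiff_src).of_le (n := ∞) (m := 1) (by simp)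
    have := enorm_sub_le_length (g := g) (f := b ∘ Γ.src) hbs (L := ε) (fun a v => ?_) hγ hst
      ENNReal.coe_ne_top
    · simpa [hb1, hb0] using this
    · by_cases hv : v ∈ Γ.vertical a
      · have h := mfderiv_comp a (hb.mdifferentiableAt (x := Γ.src a) (by simp))
          (Γ.contMDiff_src.mdifferentiableAt (x := a) (by simp))
        have h1 : dfunG (b ∘ Γ.src) a v = 0 :=
          (congrArg (fun A : EG →L[ℝ] ℝ => A v) h).trans
            ((congrArg (dfun b (Γ.src a)) (mem_vertical.1 hv)).trans (map_zero _))
        rw [h1]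
        simp
      · rw [fenorm_of_notMem hv, ENNReal.mul_top (by simpa using hε.ne')]
        exact le_top
  obtain ⟨ε, hε, hlt⟩ := ENNReal.exists_nnreal_pos_mul_lt h one_ne_zero
  exact (key ε hε).not_gt hlt

theorem pathLength_eq_length {γ : ℝ → G} (hγ : ContMDiffOn 𝓘(ℝ, ℝ) 𝓘(ℝ, EG) 1 γ (Icc 0 1)) {x : M}
    (hx : ∀ τ ∈ Icc (0 : ℝ) 1, Γ.src (γ τ) = x) : g.pathLength γ = g.length γ 0 1 := by
  rw [length_eq_within]
  refine setLIntegral_congr_fun measurableSet_Icc fun τ hτ => ?_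
  have hd := (hγ.mdifferentiableOn one_ne_zero τ hτ).hasMFDerivWithinAt
  have h1 := (Γ.contMDiff_src.mdifferentiableAt (x := γ τ) (by simp)).hasMFDerivAt.comp_hasMFDerivWithinAt
    τ hd
  have h2 : HasMFDerivWithinAt 𝓘(ℝ, ℝ) 𝓘(ℝ, EM) (Γ.src ∘ γ) (Icc 0 1) τ
      (0 : ℝ →L[ℝ] EM) :=
    (hasMFDerivWithinAt_const x (Icc 0 1) τ).congr_of_eventuallyEq
      (Filter.eventually_of_mem self_mem_nhdsWithin hx) (hx τ hτ)
  have h3 := (uniqueDiffOn_Icc (zero_lt_one' ℝ) τ hτ).uniqueMDiffWithinAt.eq h1 h2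
  have hv : ((mfderivWithin 𝓘(ℝ, ℝ) 𝓘(ℝ, EG) γ (Icc 0 1) τ : ℝ →L[ℝ] EG) 1)
      ∈ Γ.vertical (γ τ) := congrArg (fun A : ℝ →L[ℝ] EM => A 1) h3
  exact (fenorm_of_mem (g := g) hv).symm

/-- A path of finite `length` cannot leave its fiber, and for a path in a fiber the two notions of
length agree. The general properties of Riemannian distances thus become available for `dist`. -/
theorem dist_eq_toReal_edist [T2Space M] (a b : G) :
    g.dist a b = (g.edist a b).toReal := by
  unfold dist
  congr 1
  apply le_antisymm
  · refine le_of_forall_gt fun r hr => ?_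
    obtain ⟨γ, h0, h1, hγ, hl⟩ := exists_path_of_edist_lt hr
    have hsrc : ∀ τ ∈ Icc (0 : ℝ) 1, Γ.src (γ τ) = Γ.src a := by
      intro τ hτ
      rw [← h0]
      refine src_eq_of_length_ne_top (g := g) hγ hτ.1 (ne_top_of_lt (b := r) ?_)
      refine lt_of_le_of_lt ?_ hl
      rw [← length_add γ hτ.1 hτ.2]
      exact le_self_add
    refine lt_of_le_of_lt (iInf_le_of_le γ (iInf_le_of_le hγ.contMDiffOn (iInf_le_of_le hsrc
      (iInf_le_of_le h0 (iInf_le_of_le h1 ?_))))) hl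
    exact (pathLength_eq_length hγ.contMDiffOn hsrc).le
  · refine le_iInf fun γ => le_iInf fun hγ => le_iInf fun hsrc => le_iInf fun h0 => le_iInf fun h1 => ?_
    rw [pathLength_eq_length hγ hsrc, ← h0, ← h1]
    exact edist_le_length hγ zero_le_one

theorem fip_transl {a b : G} (h : Γ.src a = Γ.tgt b) {v w : EG} (hv : v ∈ Γ.vertical a)
    (hw : w ∈ Γ.vertical a) :
    g.fip (Γ.mul a b) (Γ.transl b a v) (Γ.transl b a w) = g.fip a v w := by
  rw [fip, fip, toUnit_transl h hv, toUnit_transl h hw, Γ.tgt_mul a b h]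

theorem fenorm_transl {a b : G} (h : Γ.src a = Γ.tgt b) {v : EG} (hv : v ∈ Γ.vertical a) :
    g.fenorm (Γ.mul a b) (Γ.transl b a v) = g.fenorm a v := by
  rw [fenorm_of_mem hv, fenorm_of_mem (transl_mem_vertical h hv), fnorm, fnorm, fip_transl h hv hv]

/-- A nearly shortest path is translated; its velocity is vertical, and right translation preserves
the norm of vertical vectors. The reverse inequality is this one for the inverse of `c`. -/
theorem edist_mul_right_le [T2Space M] {a b c : G} (ha : Γ.src a = Γ.tgt c) :
    g.edist (Γ.mul a c) (Γ.mul b c) ≤ g.edist a b := by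
  refine le_of_forall_gt fun r hr => ?_
  obtain ⟨γ, h0, h1, hγ, hl⟩ := exists_path_of_edist_lt hr
  have hsrc : ∀ τ ∈ Icc (0 : ℝ) 1, Γ.src (γ τ) = Γ.tgt c := by
    intro τ hτ
    rw [← ha, ← h0]
    refine src_eq_of_length_ne_top (g := g) hγ hτ.1 (ne_top_of_lt (b := r) ?_)
    refine lt_of_le_of_lt ?_ hl
    rw [← length_add γ hτ.1 hτ.2]
    exact le_self_add
  have hγc : ContMDiffOn 𝓘(ℝ, ℝ) 𝓘(ℝ, EG) 1 (fun τ => Γ.mul (γ τ) c) (Icc 0 1) :=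
    ((Γ.contMDiffOn_mul_right c).of_le (m := 1) (by simp)).comp hγ.contMDiffOn hsrc
  have h2 := edist_le_length (g := g) hγc zero_le_one
  simp only [h0, h1] at h2
  refine lt_of_le_of_lt (h2.trans (le_of_eq ?_)) hl
  rw [length_eq_within, length_eq_within]
  refine setLIntegral_congr_fun measurableSet_Icc fun τ hτ => ?_
  have hd := (hγ.contMDiffOn.mdifferentiableOn one_ne_zero τ hτ).hasMFDerivWithinAt
  have h1 := (Γ.contMDiff_src.mdifferentiableAt (x := γ τ) (by simp)).hasMFDerivAt.comp_hasMFDerivWithinAt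
    τ hd
  have h2 : HasMFDerivWithinAt 𝓘(ℝ, ℝ) 𝓘(ℝ, EM) (Γ.src ∘ γ) (Icc 0 1) τ
      (0 : ℝ →L[ℝ] EM) :=
    (hasMFDerivWithinAt_const (Γ.tgt c) (Icc 0 1) τ).congr_of_eventuallyEq
      (Filter.eventually_of_mem self_mem_nhdsWithin hsrc) (hsrc τ hτ)
  have h3 := (uniqueDiffOn_Icc (zero_lt_one' ℝ) τ hτ).uniqueMDiffWithinAt.eq h1 h2
  have hv : ((mfderivWithin 𝓘(ℝ, ℝ) 𝓘(ℝ, EG) γ (Icc 0 1) τ : ℝ →L[ℝ] EG) 1)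
      ∈ Γ.vertical (γ τ) := congrArg (fun A : ℝ →L[ℝ] EM => A 1) h3
  have h4 := HasMFDerivWithinAt.comp (g := fun d => Γ.mul d c) (f := γ) τ
    (hasMFDerivWithinAt_mul_right (hsrc τ hτ)) hd (fun σ hσ => (hsrc σ hσ).trans (hsrc τ hτ).symm)
  have h5 := h4.mfderivWithin (uniqueDiffOn_Icc (zero_lt_one' ℝ) τ hτ).uniqueMDiffWithinAt
  have h6 := congrArg (fun A : ℝ →L[ℝ] EG => g.fenorm (Γ.mul (γ τ) c) (A 1)) h5
  exact h6.trans (fenorm_transl (hsrc τ hτ) hv)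

theorem edist_mul_right [T2Space M] {a b c : G} (ha : Γ.src a = Γ.tgt c) (hb : Γ.src b = Γ.tgt c) :
    g.edist (Γ.mul a c) (Γ.mul b c) = g.edist a b := by
  refine le_antisymm (edist_mul_right_le ha) ?_
  have h := edist_mul_right_le (g := g) (a := Γ.mul a c) (b := Γ.mul b c) (c := Γ.inv c)
    (by rw [Γ.src_mul _ _ ha, Γ.tgt_inv])
  rwa [Γ.mul_mul_inv ha, Γ.mul_mul_inv hb] at h

theorem src_eq_of_edist_ne_top [T2Space M] {a b : G} (h : g.edist a b ≠ ⊤) : Γ.src a = Γ.src b := by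
  obtain ⟨γ, h0, h1, hγ, hl⟩ := exists_path_of_edist_lt (lt_top_iff_ne_top.2 h)
  rw [← h0, ← h1]
  exact (src_eq_of_length_ne_top (g := g) hγ zero_le_one hl.ne).symm

end Metric

end Distance

end LieGroupoid

/-! ### The metric in adapted charts and local finiteness of the distance. -/

namespace LieGroupoid

theorem bilin_sum_sum {E ι : Type*} [NormedAddCommGroup E] [NormedSpace ℝ E] [Fintype ι]
    (B : LinearMap.BilinForm ℝ E) (c d : ι → ℝ) (u v : ι → E) :
    B (∑ i, c i • u i) (∑ j, d j • v j) = ∑ i, ∑ j, c i * (d j * B (u i) (v j)) := by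
  simp only [map_sum, map_smul, LinearMap.sum_apply, LinearMap.smul_apply, smul_eq_mul]
  simp only [Finset.mul_sum]
  rw [Finset.sum_comm]
  exact Finset.sum_congr rfl fun i _ => Finset.sum_congr rfl fun j _ => by ring

section DistanceLocal

variable {EG EM G M : Type*}
  [NormedAddCommGroup EG] [NormedSpace ℝ EG] [FiniteDimensional ℝ EG]
  [NormedAddCommGroup EM] [NormedSpace ℝ EM] [FiniteDimensional ℝ EM]
  [TopologicalSpace G] [ChartedSpace EG G] [IsManifold 𝓘(ℝ, EG) ∞ G]
  [TopologicalSpace M] [ChartedSpace EM M] [IsManifold 𝓘(ℝ, EM) ∞ M]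
  {Γ : LieGroupoid EG EM G M} [T2Space M]

namespace Metric

variable {g : Γ.Metric}

theorem fip_eq_sum {𝓕 : Γ.LocalFrame} {c : Γ.AdaptedChart} {a : G} (ha : a ∈ c.e.source)
    (hta : Γ.tgt a ∈ 𝓕.dom) {v w : EG} (hv : v ∈ Γ.vertical a) (hw : w ∈ Γ.vertical a) :
    g.fip a v w = ∑ p, ∑ q, toUnitCoord 𝓕.chart c a (c.coord a v) p *
      (toUnitCoord 𝓕.chart c a (c.coord a w) q *
        g.form (Γ.tgt a) (𝓕.field p (Γ.tgt a)) (𝓕.field q (Γ.tgt a))) := by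
  have h : ∀ v ∈ Γ.vertical a, Γ.toUnit a v
      = ∑ p, toUnitCoord 𝓕.chart c a (c.coord a v) p • 𝓕.vec p (Γ.tgt a) := by
    intro v hv
    rw [← coord_toUnit (𝓕.unit_mem _ hta) ha hv]
    exact LocalFrame.sum_coeff hta (toUnit_mem_vertical hv)
  rw [fip, h v hv, h w hw]
  exact bilin_sum_sum _ _ _ _ _

/-- The matrix of the metric in an adapted chart. -/
noncomputable def chartForm (g : Γ.Metric) (c : Γ.AdaptedChart) (a : G)
    (i j : Fin (Module.finrank ℝ EG - Module.finrank ℝ EM)) : ℝ :=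
  g.fip a (c.dpt (Γ.src a) (c.kappa a) (EuclideanSpace.single i 1))
    (c.dpt (Γ.src a) (c.kappa a) (EuclideanSpace.single j 1))

theorem continuousAt_tgt_mem {s : Set M} (hs : IsOpen s) {a : G} (ha : Γ.tgt a ∈ s) :
    ∀ᶠ b in 𝓝 a, Γ.tgt b ∈ s :=
  Γ.contMDiff_tgt.continuous.continuousAt.eventually_mem (hs.mem_nhds ha)

theorem contMDiffAt_chartForm {c : Γ.AdaptedChart} {a : G} (ha : a ∈ c.e.source) (i j) :
    ContMDiffAt 𝓘(ℝ, EG) 𝓘(ℝ, ℝ) ∞ (fun b => g.chartForm c b i j) a := by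
  obtain ⟨𝓕, h𝓕⟩ := exists_localFrame (Γ := Γ) (Γ.tgt a)
  have hT := contMDiffAt_toUnitCoord (𝓕.unit_mem _ h𝓕) ha
  have hTi : ∀ (i p), ContMDiffAt 𝓘(ℝ, EG) 𝓘(ℝ, ℝ) ∞
      (fun b => toUnitCoord 𝓕.chart c b (EuclideanSpace.single i 1) p) a := fun i p =>
    ContMDiffAt.comp a (g := fun w : FiberModel EG EM => w p)
      (EuclideanSpace.proj p : FiberModel EG EM →L[ℝ] ℝ).contDiff.contMDiff.contMDiffAt
      (hT.clm_apply contMDiffAt_const)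
  have hF : ∀ p q, ContMDiffAt 𝓘(ℝ, EG) 𝓘(ℝ, ℝ) ∞ (fun b => g.form (Γ.tgt b)
      (𝓕.field p (Γ.tgt b)) (𝓕.field q (Γ.tgt b))) a := fun p q =>
    ((g.smooth _ _ (𝓕.isSection p) (𝓕.isSection q)).comp Γ.contMDiff_tgt).contMDiffAt
  have h : ContMDiffAt 𝓘(ℝ, EG) 𝓘(ℝ, ℝ) ∞ (fun b => ∑ p, ∑ q,
      toUnitCoord 𝓕.chart c b (EuclideanSpace.single i 1) p *
      (toUnitCoord 𝓕.chart c b (EuclideanSpace.single j 1) q *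
        g.form (Γ.tgt b) (𝓕.field p (Γ.tgt b)) (𝓕.field q (Γ.tgt b)))) a :=
    ContMDiffAt.sum fun p _ => ContMDiffAt.sum fun q _ => (hTi i p).mul ((hTi j q).mul (hF p q))
  refine h.congr_of_eventuallyEq ?_
  filter_upwards [c.e.open_source.mem_nhds ha, continuousAt_tgt_mem 𝓕.isOpen_dom h𝓕] with b hb hb𝓕
  rw [chartForm, fip_eq_sum hb hb𝓕 (dpt_mem_vertical_of_mem hb _) (dpt_mem_vertical_of_mem hb _),
    coord_dpt_of_mem hb, coord_dpt_of_mem hb]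

theorem fip_dpt (c : Γ.AdaptedChart) (a : G) (w : FiberModel EG EM) :
    g.fip a (c.dpt (Γ.src a) (c.kappa a) w) (c.dpt (Γ.src a) (c.kappa a) w)
      = ∑ i, ∑ j, w i * (w j * g.chartForm c a i j) := by
  have hw : w = ∑ i, w i • EuclideanSpace.single i (1 : ℝ) := by
    ext j
    simp [Pi.single_apply]
  have h : Γ.toUnit a (c.dpt (Γ.src a) (c.kappa a) w) = ∑ i, w i •
      Γ.toUnit a (c.dpt (Γ.src a) (c.kappa a) (EuclideanSpace.single i 1)) := by
    conv_lhs => rw [hw]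
    simp only [map_sum, map_smul]
  rw [fip, h]
  exact bilin_sum_sum (g.ip (Γ.tgt a)) w w
    (fun i => Γ.toUnit a (c.dpt (Γ.src a) (c.kappa a) (EuclideanSpace.single i 1)))
    (fun i => Γ.toUnit a (c.dpt (Γ.src a) (c.kappa a) (EuclideanSpace.single i 1)))

/-- The matrix entries of the metric are continuous, so near `a` the quadratic form is at most
`‖w‖²` times the sum of their absolute values at `a` plus one. -/
theorem eventually_fnorm_dpt_le {c : Γ.AdaptedChart} {a : G} (ha : a ∈ c.e.source) :
    ∃ C : ℝ, 0 ≤ C ∧ ∀ᶠ b in 𝓝 a, ∀ w : FiberModel EG EM,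
      g.fnorm b (c.dpt (Γ.src b) (c.kappa b) w) ≤ C * ‖w‖ := by
  have hcont : ContinuousAt (fun b => ∑ i, ∑ j, |g.chartForm c b i j|) a := by
    refine tendsto_finsetSum _ fun i _ => tendsto_finsetSum _ fun j _ => ?_
    exact (contMDiffAt_chartForm ha i j).continuousAt.abs
  have hev := hcont.eventually_lt (continuousAt_const (y := ∑ i, ∑ j, |g.chartForm c a i j| + 1))
    (by linarith)
  have h0 : 0 ≤ ∑ i, ∑ j, |g.chartForm c a i j| :=
    Finset.sum_nonneg fun i _ => Finset.sum_nonneg fun j _ => abs_nonneg _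
  refine ⟨√(∑ i, ∑ j, |g.chartForm c a i j| + 1), Real.sqrt_nonneg _, hev.mono fun b hb w => ?_⟩
  rw [fnorm, fip_dpt]
  refine Real.sqrt_le_iff.2 ⟨by positivity, ?_⟩
  rw [mul_pow, Real.sq_sqrt (by linarith)]
  have hwi : ∀ i, |w i| ≤ ‖w‖ := fun i => PiLp.norm_apply_le w i
  calc ∑ i, ∑ j, w i * (w j * g.chartForm c b i j)
      ≤ ∑ i, ∑ j, ‖w‖ ^ 2 * |g.chartForm c b i j| := by
        refine Finset.sum_le_sum fun i _ => Finset.sum_le_sum fun j _ => ?_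
        refine (le_abs_self _).trans ?_
        rw [abs_mul, abs_mul, sq, _root_.mul_assoc]
        exact mul_le_mul (hwi i) (mul_le_mul_of_nonneg_right (hwi j) (abs_nonneg _))
          (by positivity) (norm_nonneg _)
    _ = (∑ i, ∑ j, |g.chartForm c b i j|) * ‖w‖ ^ 2 := by
        simp only [← Finset.mul_sum]
        ring
    _ ≤ _ := by gcongr

/-- The image of a straight segment in an adapted chart is a path in the fiber, and its speed is
controlled by `eventually_fnorm_dpt_le`. -/
theorem eventually_edist_pt_le (a : G) : ∃ (c : Γ.AdaptedChart) (C : ℝ), a ∈ c.e.source ∧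
    ∀ᶠ k in 𝓝 (c.kappa a), k ∈ c.dom (Γ.src a) ∧
      g.edist a (c.pt (Γ.src a) k) ≤ ENNReal.ofReal (C * ‖k - c.kappa a‖) := by
  obtain ⟨c, -, ha⟩ := Γ.exists_adaptedChart a
  obtain ⟨C, hC, hev⟩ := eventually_fnorm_dpt_le (g := g) ha
  refine ⟨c, C, ha, ?_⟩
  have hk₀ := AdaptedChart.kappa_mem ha
  have hx := c.src_mem a ha
  have hcont : ContinuousAt (c.pt (Γ.src a)) (c.kappa a) :=
    (AdaptedChart.contMDiffAt_pt hk₀).continuousAt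
  have h1 : ∀ᶠ k in 𝓝 (c.kappa a), k ∈ c.dom (Γ.src a) ∧ ∀ w : FiberModel EG EM,
      g.fnorm (c.pt (Γ.src a) k) (c.dpt (Γ.src a) k w) ≤ C * ‖w‖ := by
    have h2 := (hcont.tendsto.eventually (by rwa [AdaptedChart.pt_kappa ha]))
    filter_upwards [h2, (c.isOpen_dom _).mem_nhds hk₀] with k hk hkd
    refine ⟨hkd, fun w => ?_⟩
    have := hk w
    rwa [AdaptedChart.src_pt hx hkd, AdaptedChart.kappa_pt hkd] at this
  obtain ⟨r, hr, hball⟩ := Metric.eventually_nhds_iff_ball.1 h1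
  filter_upwards [Metric.ball_mem_nhds _ hr] with k hk
  refine ⟨(hball k hk).1, ?_⟩
  set γ₀ : ℝ → FiberModel EG EM := fun τ => c.kappa a + τ • (k - c.kappa a) with hγ₀
  have hmem : ∀ τ ∈ Icc (0 : ℝ) 1, γ₀ τ ∈ Metric.ball (c.kappa a) r := by
    intro τ hτ
    rw [mem_ball_iff_norm] at hk ⊢
    simp only [hγ₀, add_sub_cancel_left, norm_smul, Real.norm_eq_abs, abs_of_nonneg hτ.1]
    exact lt_of_le_of_lt (mul_le_of_le_one_left (norm_nonneg _) hτ.2) hk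
  have hd₀ : ContDiff ℝ ∞ γ₀ := by fun_prop
  have hγ : ContMDiffOn 𝓘(ℝ, ℝ) 𝓘(ℝ, EG) 1 (c.pt (Γ.src a) ∘ γ₀) (Icc 0 1) :=
    ((AdaptedChart.contMDiffOn_pt (Γ.src a)).comp hd₀.contMDiff.contMDiffOn
      (fun τ hτ => (hball _ (hmem τ hτ)).1)).of_le (by simp)
  have h3 := edist_le_length (g := g) hγ zero_le_one
  have e0 : (c.pt (Γ.src a) ∘ γ₀) 0 = a := by
    simp [hγ₀, AdaptedChart.pt_kappa ha]
  have e1 : (c.pt (Γ.src a) ∘ γ₀) 1 = c.pt (Γ.src a) k := by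
    simp [hγ₀]
  rw [e0, e1] at h3
  refine h3.trans ?_
  rw [length_eq]
  have hbound : ∀ τ ∈ Icc (0 : ℝ) 1, g.fenorm ((c.pt (Γ.src a) ∘ γ₀) τ)
      (velocity (c.pt (Γ.src a) ∘ γ₀) τ) ≤ ENNReal.ofReal (C * ‖k - c.kappa a‖) := by
    intro τ hτ
    have hτd := hball _ (hmem τ hτ)
    have hv : HasMFDerivAt 𝓘(ℝ, ℝ) 𝓘(ℝ, FiberModel EG EM) γ₀ τ
        ((ContinuousLinearMap.id ℝ ℝ).smulRight (k - c.kappa a)) :=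
      (((hasFDerivAt_id τ).smul_const (k - c.kappa a)).const_add (c.kappa a)).hasMFDerivAt
    have h5 := (HasMFDerivAt.comp τ (AdaptedChart.hasMFDerivAt_pt hτd.1) hv).mfderiv
    have h6 : velocity (c.pt (Γ.src a) ∘ γ₀) τ = c.dpt (Γ.src a) (γ₀ τ) (k - c.kappa a) := by
      refine (congrArg (fun A : ℝ →L[ℝ] EG => A 1) h5).trans ?_
      show c.dpt (Γ.src a) (γ₀ τ) ((1 : ℝ) • (k - c.kappa a)) = _
      rw [one_smul]
    rw [h6]
    show g.fenorm (c.pt (Γ.src a) (γ₀ τ)) _ ≤ _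
    rw [fenorm_of_mem (AdaptedChart.dpt_mem_vertical hx hτd.1 _)]
    exact ENNReal.ofReal_le_ofReal (hτd.2 _)
  refine (setLIntegral_mono' measurableSet_Icc hbound).trans ?_
  simp

theorem tendsto_edist_nhdsWithin (a : G) :
    Tendsto (g.edist a) (𝓝[Γ.fiber (Γ.src a)] a) (𝓝 0) := by
  obtain ⟨c, C, ha, hev⟩ := eventually_edist_pt_le (g := g) a
  have hk : Tendsto c.kappa (𝓝[Γ.fiber (Γ.src a)] a) (𝓝 (c.kappa a)) :=
    (AdaptedChart.contMDiffAt_kappa ha).continuousAt.continuousWithinAt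
  have h0 : Tendsto (fun b => ENNReal.ofReal (C * ‖c.kappa b - c.kappa a‖))
      (𝓝[Γ.fiber (Γ.src a)] a) (𝓝 0) := by
    have := ENNReal.tendsto_ofReal ((hk.sub_const (c.kappa a)).norm.const_mul C)
    simpa using this
  refine tendsto_of_tendsto_of_tendsto_of_le_of_le' tendsto_const_nhds h0
    (Eventually.of_forall fun b => bot_le) ?_
  filter_upwards [hk.eventually hev, self_mem_nhdsWithin,
    mem_nhdsWithin_of_mem_nhds (c.e.open_source.mem_nhds ha)] with b hb hbs hbc
  have h1 : c.pt (Γ.src a) (c.kappa b) = b := by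
    have h2 : Γ.src b = Γ.src a := hbs
    rw [← h2, AdaptedChart.pt_kappa hbc]
  rw [h1] at hb
  exact hb.2

/-- Finite distance is an equivalence relation whose classes are open in the fiber, so a connected
fiber is a single class. Finiteness matters because `dist` is a `toReal`, for which the triangle
inequality could fail at `⊤`. -/
theorem edist_ne_top [IsManifold 𝓘(ℝ, EG) 1 G] {a b : G} (hab : Γ.src a = Γ.src b)
    (hc : IsPreconnected (Γ.fiber (Γ.src a))) : g.edist a b ≠ ⊤ := by
  refine hc.induction₂ (fun a b => g.edist a b ≠ ⊤) (fun p hp => ?_) (fun p q r _ _ _ h1 h2 => ?_)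
    (fun p q _ _ h => by rwa [edist_comm]) rfl hab.symm
  · have h := tendsto_edist_nhdsWithin (g := g) p
    have hp' : Γ.src p = Γ.src a := hp
    rw [hp'] at h
    filter_upwards [h.eventually_lt_const ENNReal.zero_lt_top] with q hq using hq.ne
  · exact ne_top_of_le_ne_top (ENNReal.add_ne_top.2 ⟨h1, h2⟩) (edist_triangle p q r)

end Metric

end DistanceLocal

end LieGroupoid

/-! ### Connected fibers, generators of the algebroid, compactness of balls about the units. -/

namespace LieGroupoid

section DistanceGlobal

variable {EG EM G M : Type*}
  [NormedAddCommGroup EG] [NormedSpace ℝ EG] [FiniteDimensional ℝ EG]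
  [NormedAddCommGroup EM] [NormedSpace ℝ EM] [FiniteDimensional ℝ EM]
  [TopologicalSpace G] [ChartedSpace EG G] [IsManifold 𝓘(ℝ, EG) ∞ G]
  [TopologicalSpace M] [ChartedSpace EM M] [IsManifold 𝓘(ℝ, EM) ∞ M]
  {Γ : LieGroupoid EG EM G M} [T2Space M]

/-- The integral curves that define the leaf stay in it, so a chain of them is a path in the leaf.
-/
theorem isPreconnected_leaf (x : M) : IsPreconnected (Γ.leaf x) := by
  have hpc : IsPathConnected (Γ.leaf x) := by
    refine ⟨x, Relation.ReflTransGen.refl, fun {y} hy => ?_⟩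
    induction hy with
    | refl => exact JoinedIn.refl Relation.ReflTransGen.refl
    | tail hp hq ih =>
      rename_i p q
      refine ih.trans ?_
      obtain ⟨X, hX, γ, hγ, h0, h1⟩ := hq
      have hcont : Continuous γ := continuous_iff_continuousAt.2 fun t => (hγ t).continuousAt
      have hmem : ∀ t, γ t ∈ Γ.leaf x := by
        intro t
        -- The curve `τ ↦ γ (τ t)` is an integral curve for the section `t X` and reaches `γ t` at
        -- time one.
        refine Relation.ReflTransGen.tail hp ⟨fun y => t • X y, ?_, γ ∘ (· * t), ?_, by simp [h0],
          by simp⟩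
        · have h := hX.smul_add isSection_zero (contMDiff_const (c := t))
          refine cast (congrArg _ (funext fun y => ?_)) h
          exact add_zero (M := EG) _
        · have h := hγ.comp_mul t
          refine cast (congrArg _ (funext fun y => ?_)) h
          exact (map_smul (Γ.dtgt (Γ.unit y)) t (X y)).symm
      refine JoinedIn.ofLine (f := γ) hcont.continuousOn h0 h1 ?_
      rintro _ ⟨t, -, rfl⟩
      exact hmem t
  exact hpc.isConnected.isPreconnected

/-- For `x` in `S k` the trivialization exhibits the fiber as the image of `H × S k` under `σ (·, ·,
x)`, and both `H` and the leaf `S k` are connected. -/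
theorem isPreconnected_fiber (hΓ : Γ.IsBoundaryGroupoid) (x : M) :
    IsPreconnected (Γ.fiber x) := by
  obtain ⟨r, S, d, h⟩ := hΓ
  obtain ⟨k, hk⟩ := h.cover x
  obtain ⟨n, H, _, _, _, _, _, _, _, -, θ, σ, hθ, hσ, -, h4, h5⟩ := h.trivial k
  obtain ⟨y, hy⟩ := h.isLeaf k
  have hS : IsPreconnected (S k) := hy ▸ isPreconnected_leaf y
  have himg : Γ.fiber x = (fun p : H × M => σ (p.1, p.2, x)) '' (univ ×ˢ S k) := by
    ext a
    constructor
    · intro ha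
      have ha' : Γ.src a = x := ha
      have haS : Γ.src a ∈ S k := by rwa [ha']
      have hta : Γ.tgt a ∈ S k := by
        have : a ∈ Γ.src ⁻¹' S k := haS
        rw [h.invariant k] at this
        exact this
      exact ⟨(θ a, Γ.tgt a), ⟨mem_univ _, hta⟩, by
        show σ (θ a, Γ.tgt a, x) = a
        rw [← ha']; exact h5 a haS⟩
    · rintro ⟨⟨p, q⟩, ⟨-, hq⟩, rfl⟩
      exact (h4 p q hq x hk).2.2
  rw [himg]
  refine (isPreconnected_univ.prod hS).image _ ?_
  exact hσ.continuousOn.comp (by fun_prop) fun p hp => ⟨mem_univ _, hp.2, hk⟩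

namespace Metric

variable {g : Γ.Metric}

theorem dist_comm (a b : G) : g.dist a b = g.dist b a := by
  rw [dist_eq_toReal_edist, dist_eq_toReal_edist, edist_comm]

theorem dist_self (a : G) : g.dist a a = 0 := by
  rw [dist_eq_toReal_edist, edist_self, ENNReal.toReal_zero]

theorem dist_nonneg (a b : G) : 0 ≤ g.dist a b := ENNReal.toReal_nonneg

theorem dist_triangle (hc : ∀ x, IsPreconnected (Γ.fiber x)) {a b c : G}
    (hab : Γ.src a = Γ.src b) (hbc : Γ.src b = Γ.src c) :
    g.dist a c ≤ g.dist a b + g.dist b c := by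
  have : IsManifold 𝓘(ℝ, EG) 1 G := IsManifold.of_le (n := ∞) (by simp)
  rw [dist_eq_toReal_edist, dist_eq_toReal_edist, dist_eq_toReal_edist,
    ← ENNReal.toReal_add (edist_ne_top hab (hc _)) (edist_ne_top hbc (hc _))]
  exact ENNReal.toReal_mono (ENNReal.add_ne_top.2
    ⟨edist_ne_top hab (hc _), edist_ne_top hbc (hc _)⟩) (edist_triangle a b c)

theorem continuousOn_dist (hc : ∀ x, IsPreconnected (Γ.fiber x)) (a : G) :
    ContinuousOn (g.dist a) (Γ.fiber (Γ.src a)) := by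
  intro b hb
  have hb' : Γ.src b = Γ.src a := hb
  have h := tendsto_edist_nhdsWithin (g := g) b
  have h2 : Tendsto (g.dist b) (𝓝[Γ.fiber (Γ.src b)] b) (𝓝 0) := by
    have := (ENNReal.tendsto_toReal ENNReal.zero_ne_top).comp h
    refine this.congr fun c => (dist_eq_toReal_edist b c).symm
  rw [hb'] at h2
  refine tendsto_iff_dist_tendsto_zero.2 (squeeze_zero' (Eventually.of_forall fun _ => _root_.dist_nonneg)
    ?_ h2)
  filter_upwards [self_mem_nhdsWithin] with c hcs
  have hc' : Γ.src c = Γ.src a := hcs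
  rw [Real.dist_eq, abs_le]
  have h3 := dist_triangle (g := g) hc (a := a) (b := b) (c := c) hb'.symm (hb'.trans hc'.symm)
  have h4 := dist_triangle (g := g) hc (a := a) (b := c) (c := b) hc'.symm (hc'.trans hb'.symm)
  rw [dist_comm c b] at h4
  constructor <;> linarith

/-- The norm of an algebroid vector. -/
noncomputable def vnorm (g : Γ.Metric) (x : M) (v : EG) : ℝ := √(g.ip x v v)

/-- By compactness of the unit sphere the Gram form at `x` has a positive lower bound `δ` there.
Gram operators within `δ / 2` of the one at `x` keep the lower bound `δ / 2`. -/
theorem eventually_norm_coeff_le {𝓕 : Γ.LocalFrame} {x : M} (hx : x ∈ 𝓕.dom) :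
    ∃ C : ℝ, 0 ≤ C ∧ ∀ᶠ y in 𝓝 x, ∀ v ∈ Γ.vertical (Γ.unit y),
      ‖𝓕.coeff y v‖ ≤ C * g.vnorm y v := by
  have hq : ∀ (y : M) (w : FiberModel EG EM), g.ip y (∑ i, w i • 𝓕.vec i y)
      (∑ i, w i • 𝓕.vec i y) = inner ℝ (g.gram 𝓕 y w) w := by
    intro y w
    rw [PiLp.inner_apply]
    conv_lhs => rw [map_sum]
    refine Finset.sum_congr rfl fun j _ => ?_
    rw [map_smul, ← gram_apply]
    rfl
  obtain ⟨δ, hδ, hmin⟩ := (isCompact_sphere (0 : FiberModel EG EM) 1).exists_forall_le'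
    (f := fun w => inner ℝ (g.gram 𝓕 x w) w) (by fun_prop) (a := 0) (fun w hw => by
      rw [← hq]
      refine ip_pos (LocalFrame.sum_field_mem w) fun h0 => ?_
      have := LocalFrame.coeff_sum_field hx w
      rw [h0, map_zero] at this
      rw [mem_sphere_zero_iff_norm, ← this] at hw
      simp at hw)
  have hev : ∀ᶠ y in 𝓝 x, ‖g.gram 𝓕 y - g.gram 𝓕 x‖ < δ / 2 := by
    have h : Tendsto (fun y => ‖g.gram 𝓕 y - g.gram 𝓕 x‖) (𝓝 x) (𝓝 0) := by
      have h := ((contMDiff_gram (g := g) 𝓕).continuous.sub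
        (continuous_const (y := g.gram 𝓕 x))).norm.tendsto x
      simpa using h
    exact h.eventually_lt_const (by positivity)
  have hlow : ∀ᶠ y in 𝓝 x, ∀ w : FiberModel EG EM,
      δ / 2 * ‖w‖ ^ 2 ≤ inner ℝ (g.gram 𝓕 y w) w := by
    filter_upwards [hev] with y hy w
    by_cases hw : w = 0
    · simp [hw]
    have hw' : 0 < ‖w‖ := norm_pos_iff.2 hw
    have h1 := hmin (‖w‖⁻¹ • w) (by
      rw [mem_sphere_zero_iff_norm, norm_smul, norm_inv, norm_norm, inv_mul_cancel₀ hw'.ne'])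
    rw [map_smul, inner_smul_left, inner_smul_right] at h1
    have h2 : δ * ‖w‖ ^ 2 ≤ inner ℝ (g.gram 𝓕 x w) w := by
      have h3 := mul_le_mul_of_nonneg_right h1 (sq_nonneg ‖w‖)
      refine h3.trans (le_of_eq ?_)
      simp
      field_simp
    have h4 : |inner ℝ ((g.gram 𝓕 y - g.gram 𝓕 x) w) w| ≤ δ / 2 * ‖w‖ ^ 2 := by
      refine (abs_real_inner_le_norm _ _).trans ?_
      rw [sq, ← _root_.mul_assoc]
      gcongr
      exact (ContinuousLinearMap.le_opNorm _ _).trans (by gcongr)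
    have h5 : inner ℝ (g.gram 𝓕 y w) w = inner ℝ (g.gram 𝓕 x w) w
        + inner ℝ ((g.gram 𝓕 y - g.gram 𝓕 x) w) w := by
      rw [sub_apply, inner_sub_left]
      ring
    rw [h5]
    have := (abs_le.1 h4).1
    linarith
  refine ⟨√(2 / δ), Real.sqrt_nonneg _, ?_⟩
  filter_upwards [hlow, 𝓕.isOpen_dom.mem_nhds hx] with y hy hyd v hv
  have h1 := hy (𝓕.coeff y v)
  rw [← hq, ← LocalFrame.sum_coeff hyd hv] at h1
  rw [vnorm, ← Real.sqrt_mul (by positivity)]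
  refine Real.le_sqrt_of_sq_le ?_
  rw [div_mul_eq_mul_div, le_div_iff₀ hδ]
  linarith

/-- Finitely many sections generate the algebroid of a groupoid with compact base, boundedly. -/
theorem exists_generators [CompactSpace M] (g : Γ.Metric) :
    ∃ (n : ℕ) (E : Fin n → Γ.PreSection) (C : ℝ), 0 ≤ C ∧ (∀ i, Γ.IsSection (E i)) ∧
      ∀ x, ∀ v ∈ Γ.vertical (Γ.unit x), ∃ c : Fin n → ℝ, v = ∑ i, c i • val (E i) x ∧
        ∀ i, |c i| ≤ C * g.vnorm x v := by
  choose 𝓕 h𝓕 using exists_localFrame (Γ := Γ)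
  choose C hC hev using fun x => eventually_norm_coeff_le (g := g) (h𝓕 x)
  obtain ⟨t, ht⟩ := CompactSpace.elim_nhds_subcover (fun x => {y | y ∈ (𝓕 x).dom ∧
    ∀ v ∈ Γ.vertical (Γ.unit y), ‖(𝓕 x).coeff y v‖ ≤ C x * g.vnorm y v})
    (fun x => inter_mem ((𝓕 x).isOpen_dom.mem_nhds (h𝓕 x)) (hev x))
  let ι := t × Fin (Module.finrank ℝ EG - Module.finrank ℝ EM)
  have e := Fintype.equivFin ι
  refine ⟨Fintype.card ι, fun i => (𝓕 (e.symm i).1).field (e.symm i).2, ∑ x ∈ t, C x,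
    Finset.sum_nonneg fun x _ => hC x, fun i => (𝓕 _).isSection _, fun x v hv => ?_⟩
  have hx := mem_univ x
  rw [← top_eq_univ, ← ht] at hx
  rw [mem_iUnion₂] at hx
  obtain ⟨y, hyt, hxd, hxv⟩ := hx
  classical
  -- Only one frame whose neighbourhood contains `x` is used; the coefficients of the others are
  -- zero. No continuity in `x` is asked for.
  refine ⟨fun i => if (e.symm i).1 = ⟨y, hyt⟩ then (𝓕 y).coeff x v (e.symm i).2 else 0, ?_, ?_⟩
  · rw [← e.sum_comp, Fintype.sum_prod_type]
    simp only [Equiv.symm_apply_apply]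
    rw [Finset.sum_eq_single ⟨y, hyt⟩]
    · simp only [if_true]
      exact LocalFrame.sum_coeff hxd hv
    · intro z _ hz
      simp [hz]
    · simp
  · intro i
    have h0 : 0 ≤ g.vnorm x v := Real.sqrt_nonneg _
    show |if (e.symm i).1 = ⟨y, hyt⟩ then (𝓕 y).coeff x v (e.symm i).2 else 0| ≤ _
    split_ifs
    · refine ((PiLp.norm_apply_le _ _).trans (hxv v hv)).trans ?_
      gcongr
      exact Finset.single_le_sum (fun x _ => hC x) hyt
    · simpa using mul_nonneg (Finset.sum_nonneg fun x _ => hC x) h0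

theorem length_self (γ : ℝ → G) (s : ℝ) : g.length γ s s = 0 := by
  rw [length_eq, Icc_self, setLIntegral_measure_zero _ _ (by simp)]

/-- Absolute continuity of the integral: a finite total length makes the length over a short
interval small. -/
theorem continuousOn_length {γ : ℝ → G} (hγ : g.length γ 0 1 ≠ ⊤) :
    ContinuousOn (g.length γ 0) (Icc 0 1) := by
  intro s₀ hs₀
  set f : ℝ → ENNReal := fun τ => g.fenorm (γ τ) (mfderiv 𝓘(ℝ, ℝ) 𝓘(ℝ, EG) γ τ (1 : ℝ)) with hf
  have hsmall : Tendsto (fun s => ∫⁻ τ in uIcc s s₀, f τ ∂volume.restrict (Icc 0 1)) (𝓝 s₀)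
      (𝓝 0) := by
    refine tendsto_setLIntegral_zero ?_ ?_
    · rwa [length_eq] at hγ
    · have h1 : Tendsto (fun s : ℝ => ENNReal.ofReal |s₀ - s|) (𝓝 s₀) (𝓝 0) := by
        have : Continuous fun s : ℝ => ENNReal.ofReal |s₀ - s| :=
          ENNReal.continuous_ofReal.comp (by fun_prop)
        simpa using this.tendsto s₀
      refine tendsto_of_tendsto_of_tendsto_of_le_of_le tendsto_const_nhds h1 (fun _ => bot_le)
        fun s => ?_
      exact (Measure.restrict_apply_le _ _).trans (by rw [Real.volume_interval])
  have hle : ∀ s ∈ Icc (0 : ℝ) 1, ∀ t ∈ Icc (0 : ℝ) 1, s ≤ t → ∀ u, Icc s t ⊆ u →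
      g.length γ 0 t ≤ g.length γ 0 s + ∫⁻ τ in u, f τ ∂volume.restrict (Icc 0 1) := by
    intro s hs t ht hst u hu
    rw [← length_add γ hs.1 hst]
    gcongr
    rw [length_eq]
    have : volume.restrict (Icc s t) = (volume.restrict (Icc 0 1)).restrict (Icc s t) := by
      rw [Measure.restrict_restrict measurableSet_Icc,
        inter_eq_left.2 (Icc_subset_Icc hs.1 ht.2)]
    rw [this]
    exact lintegral_mono_set hu
  have hmono : ∀ s ∈ Icc (0 : ℝ) 1, ∀ t ∈ Icc (0 : ℝ) 1, s ≤ t →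
      g.length γ 0 s ≤ g.length γ 0 t := by
    intro s hs t ht hst
    rw [← length_add γ hs.1 hst]
    exact le_self_add
  have hfin : g.length γ 0 s₀ ≠ ⊤ := by
    refine ne_top_of_le_ne_top hγ ?_
    exact hmono s₀ hs₀ 1 (by simp) hs₀.2
  refine (ENNReal.tendsto_nhds hfin).2 fun ε hε => ?_
  filter_upwards [mem_nhdsWithin_of_mem_nhds (hsmall.eventually_lt_const hε),
    self_mem_nhdsWithin] with s hs hsI
  rcases le_total s s₀ with h | h
  · refine ⟨tsub_le_iff_right.2 ((hle s hsI s₀ hs₀ h _ Icc_subset_uIcc).trans ?_),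
      (hmono s hsI s₀ hs₀ h).trans le_self_add⟩
    gcongr
  · refine ⟨tsub_le_self.trans (hmono s₀ hs₀ s hsI h),
      (hle s₀ hs₀ s hsI h _ Icc_subset_uIcc').trans ?_⟩
    gcongr

/-- Intermediate value theorem for arc length: unless the whole path is shorter than `A`, it is cut
where the length takes a value between the total length minus `B` and `A`. -/
theorem exists_split_length {γ : ℝ → G} {A B : ENNReal} (hA : A ≠ 0) (hB : B ≠ 0)
    (hγ : g.length γ 0 1 < A + B) :
    ∃ s ∈ Icc (0 : ℝ) 1, g.length γ 0 s < A ∧ g.length γ s 1 < B := by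
  have hγ' : g.length γ 0 1 ≠ ⊤ := ne_top_of_lt hγ
  by_cases h : g.length γ 0 1 < A
  · exact ⟨1, by simp, h, by rw [length_self]; exact pos_iff_ne_zero.2 hB⟩
  · push Not at h
    have h1 : g.length γ 0 1 - B < A := by
      rcases le_total B (g.length γ 0 1) with hB' | hB'
      · exact ENNReal.sub_lt_of_lt_add hB' hγ
      · rw [tsub_eq_zero_of_le hB']
        exact pos_iff_ne_zero.2 hA
    obtain ⟨t, ht1, ht2⟩ := exists_between h1
    obtain ⟨s, hs, hst⟩ := intermediate_value_Icc zero_le_one (continuousOn_length hγ')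
      ⟨by rw [length_self]; exact bot_le, ht2.le.trans h⟩
    refine ⟨s, hs, hst ▸ ht2, ?_⟩
    have h2 := length_add (g := g) γ hs.1 hs.2
    have h3 : g.length γ 0 1 < B + t := by
      rw [add_comm]
      exact ENNReal.lt_add_of_sub_lt_right (Or.inl hγ') ht1
    rw [← h2, hst, add_comm] at h3
    exact lt_of_add_lt_add_right h3

/-- The values of a right invariant vector field, as vectors of the model space. -/
noncomputable def _root_.LieGroupoid.rvec (X : Γ.PreSection) (a : G) : EG := Γ.rightInvariant X a

theorem eq_sum_rightInvariant {n : ℕ} {E : Fin n → Γ.PreSection} {a : G} {v : EG}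
    (hv : v ∈ Γ.vertical a) {c : Fin n → ℝ}
    (hc : Γ.toUnit a v = ∑ i, c i • val (E i) (Γ.tgt a)) :
    v = ∑ i, c i • rvec (E i) a := by
  rw [← fromUnit_toUnit hv, hc, map_sum]
  refine Finset.sum_congr rfl fun i _ => ?_
  rw [map_smul]
  exact congrArg (c i • ·) (rightTranslate_eq (Γ := Γ) a (E i (Γ.tgt a))).symm

/-- Compactness of the base lets finitely many fields `E i^r` span all vertical vectors with
coefficients bounded by the norm of the vector. The derivatives of `h` along these fields are
continuous with compact support, hence bounded. -/
theorem exists_lipschitz_of_compactSupport [CompactSpace M] [T2Space G] (g : Γ.Metric) {h : G → ℝ}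
    (hh : ContMDiff 𝓘(ℝ, EG) 𝓘(ℝ, ℝ) ∞ h) (hs : HasCompactSupport h) :
    ∃ L : NNReal, 0 < L ∧ ∀ a (v : EG), ‖dfunG h a v‖ₑ ≤ L * g.fenorm a v := by
  obtain ⟨n, E, C, hC, hE, hgen⟩ := exists_generators g
  have hb : ∀ i, ∃ B : ℝ, ∀ a, ‖dfunG h a (rvec (E i) a)‖ ≤ B := by
    intro i
    have hcont : Continuous fun a => dfunG h a (rvec (E i) a) := by
      have : ContMDiff 𝓘(ℝ, EG) 𝓘(ℝ, ℝ) ∞ fun a => dfunG h a (rvec (E i) a) := fun a =>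
        contMDiffAt_mfderiv_apply (b := id) isOpen_univ hh.contMDiffOn
          (contMDiff_rightInvariant (hE i) a) (mem_univ _)
      exact this.continuous
    refine hcont.bounded_above_of_compact_support (HasCompactSupport.intro hs fun a ha => ?_)
    have h0 : h =ᶠ[𝓝 a] fun _ => 0 := notMem_tsupport_iff_eventuallyEq.1 ha
    have h1 : (dfunG h a : EG →L[ℝ] ℝ) = 0 := by
      refine (h0.mfderiv_eq (I := 𝓘(ℝ, EG)) (I' := 𝓘(ℝ, ℝ))).trans ?_
      exact mfderiv_const
    rw [h1]
    rfl
  choose B hB using hb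
  have hB0 : ∀ i, 0 ≤ |B i| := fun i => abs_nonneg _
  -- The summand one keeps the constant positive, so that its product with the norm `⊤` of a
  -- nonvertical vector is `⊤`.
  refine ⟨Real.toNNReal (C * ∑ i, |B i| + 1), Real.toNNReal_pos.2 (by positivity), fun a v => ?_⟩
  by_cases hv : v ∈ Γ.vertical a
  · obtain ⟨c, hcv, hcb⟩ := hgen (Γ.tgt a) _ (toUnit_mem_vertical hv)
    rw [fenorm_of_mem hv, ← ofReal_norm]
    show _ ≤ ENNReal.ofReal _ * _
    rw [← ENNReal.ofReal_mul (by positivity)]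
    refine ENNReal.ofReal_le_ofReal ?_
    rw [eq_sum_rightInvariant hv hcv, map_sum, ← eq_sum_rightInvariant hv hcv]
    have hfn : g.vnorm (Γ.tgt a) (Γ.toUnit a v) = g.fnorm a v := rfl
    calc ‖∑ i, dfunG h a (c i • rvec (E i) a)‖
        ≤ ∑ i, (C * g.fnorm a v) * |B i| := by
          refine (norm_sum_le _ _).trans (Finset.sum_le_sum fun i _ => ?_)
          rw [map_smul, norm_smul]
          exact mul_le_mul (hcb i) ((hB i a).trans (le_abs_self _)) (norm_nonneg _)
            (mul_nonneg hC (fnorm_nonneg _ _))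
      _ = (C * ∑ i, |B i|) * g.fnorm a v := by
          rw [← Finset.mul_sum]
          ring
      _ ≤ _ := by
          have := fnorm_nonneg (g := g) a v
          nlinarith
  · rw [fenorm_of_notMem hv, ENNReal.mul_top]
    · exact le_top
    · simp only [ne_eq, ENNReal.coe_eq_zero, Real.toNNReal_eq_zero, not_le]
      positivity

/-- A cutoff that is one on the compact set of units is Lipschitz with some constant `L` along the
fibers, so points closer than `δ = 1 / L` to the unit of their fiber lie in its compact support. A
longer path from the unit to `b` is cut at a point `c` with a last part shorter than `δ`. By right
invariance `b c⁻¹` is closer than `δ` to its unit, and `b = (b c⁻¹) c` lies in a product of two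
compact sets. -/
theorem exists_compact_ball [CompactSpace M] [T2Space G] [SecondCountableTopology G]
    (g : Γ.Metric) (R : ℝ) :
    ∃ K : Set G, IsCompact K ∧ ∀ b, g.edist (Γ.unit (Γ.src b)) b < ENNReal.ofReal R → b ∈ K := by
  have : LocallyCompactSpace G := ChartedSpace.locallyCompactSpace EG G
  have hunits : IsCompact (range Γ.unit) := isCompact_range Γ.contMDiff_unit.continuous
  obtain ⟨K₁, hK₁, hsub⟩ := exists_compact_superset hunits
  obtain ⟨h, h1, h0, -⟩ := exists_contMDiffMap_one_nhds_of_subset_interior 𝓘(ℝ, EG) (n := ⊤)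
    hunits.isClosed hsub
  have hcs : HasCompactSupport h := HasCompactSupport.intro hK₁ h0
  obtain ⟨L, hL, hlip⟩ := exists_lipschitz_of_compactSupport g h.contMDiff hcs
  have hL' : (L : ENNReal) ≠ 0 := by simpa using hL.ne'
  set δ : ENNReal := (L : ENNReal)⁻¹ with hδ
  have hδ0 : δ ≠ 0 := by simp [hδ]
  have step0 : ∀ b, g.edist (Γ.unit (Γ.src b)) b < δ → b ∈ tsupport h := by
    intro b hb
    obtain ⟨γ, g0, g1, hγ, hl⟩ := exists_path_of_edist_lt hb
    have h2 := enorm_sub_le_length (g := g) (h.contMDiff.of_le (by simp)) hlip hγ zero_le_one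
      ENNReal.coe_ne_top
    have h3 : (L : ENNReal) * g.length γ 0 1 < 1 := by
      rw [← ENNReal.mul_inv_cancel hL' ENNReal.coe_ne_top]
      exact ENNReal.mul_lt_mul_right hL' ENNReal.coe_ne_top hl
    by_contra hbs
    have h4 : h b = 0 := image_eq_zero_of_notMem_tsupport hbs
    have h5 : h (Γ.unit (Γ.src b)) = 1 := h1.self_of_nhdsSet _ (mem_range_self _)
    rw [g0, g1, h4, h5] at h2
    have := h2.trans_lt h3
    simp at this
  have step : ∀ n : ℕ, ∃ K : Set G, IsCompact K ∧
      ∀ b, g.edist (Γ.unit (Γ.src b)) b < (n + 1) * δ → b ∈ K := by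
    intro n
    induction n with
    | zero => exact ⟨tsupport h, hcs, fun b hb => step0 b (by simpa using hb)⟩
    | succ n ih =>
      obtain ⟨K, hK, hKb⟩ := ih
      -- Composability is a closed condition, so the products of composable pairs from two compact
      -- sets form a compact set.
      have hcl : IsClosed {p : G × G | Γ.src p.1 = Γ.tgt p.2} :=
        isClosed_eq (Γ.contMDiff_src.continuous.comp continuous_fst)
          (Γ.contMDiff_tgt.continuous.comp continuous_snd)
      refine ⟨(fun p : G × G => Γ.mul p.1 p.2) ''
        ((tsupport h ×ˢ K) ∩ {p : G × G | Γ.src p.1 = Γ.tgt p.2}),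
        ((hcs.isCompact.prod hK).inter_right hcl).image_of_continuousOn
          (Γ.contMDiffOn_mul.continuousOn.mono inter_subset_right), fun b hb => ?_⟩
      obtain ⟨γ, g0, g1, hγ, hl⟩ := exists_path_of_edist_lt hb
      have hl' : g.length γ 0 1 < (n + 1) * δ + δ := by
        refine hl.trans_le (le_of_eq ?_)
        push_cast
        ring
      obtain ⟨s, hs, hs1, hs2⟩ := exists_split_length (by simp [hδ0]) hδ0 hl'
      have e1 := (edist_le_length (g := g) hγ.contMDiffOn hs.1).trans_lt hs1
      have e2 := (edist_le_length (g := g) hγ.contMDiffOn hs.2).trans_lt hs2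
      rw [g0] at e1
      rw [g1] at e2
      have hsrc1 := src_eq_of_edist_ne_top (ne_top_of_lt e1)
      have hsrc2 := src_eq_of_edist_ne_top (ne_top_of_lt e2)
      have hcK : γ s ∈ K := hKb _ (by rw [hsrc2]; exact e1)
      have e3 : g.edist (Γ.unit (Γ.tgt (γ s))) (Γ.mul b (Γ.inv (γ s))) < δ := by
        rw [← Γ.mul_inv, edist_mul_right (Γ.tgt_inv _).symm (by rw [Γ.tgt_inv, hsrc2])]
        exact e2
      refine ⟨(Γ.mul b (Γ.inv (γ s)), γ s), ⟨⟨step0 _ ?_, hcK⟩, ?_⟩, ?_⟩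
      · rwa [Γ.src_mul_inv hsrc2.symm]
      · exact Γ.src_mul_inv hsrc2.symm
      · exact Γ.mul_inv_mul hsrc2.symm
  obtain ⟨n, hn⟩ := ENNReal.exists_nat_mul_gt hδ0 (ENNReal.ofReal_ne_top (r := R))
  obtain ⟨K, hK, hKb⟩ := step n
  refine ⟨K, hK, fun b hb => hKb b (hb.trans (hn.trans_le ?_))⟩
  gcongr
  exact le_self_add

end Metric

end DistanceGlobal

end LieGroupoid

/-! ### The fiber volumes: evaluation in charts and right invariance. -/

namespace LieGroupoid

section Volume

variable {EG EM G M : Type*}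
  [NormedAddCommGroup EG] [NormedSpace ℝ EG] [FiniteDimensional ℝ EG]
  [NormedAddCommGroup EM] [NormedSpace ℝ EM] [FiniteDimensional ℝ EM]
  [TopologicalSpace G] [ChartedSpace EG G] [IsManifold 𝓘(ℝ, EG) ∞ G]
  [TopologicalSpace M] [ChartedSpace EM M] [IsManifold 𝓘(ℝ, EM) ∞ M]
  {Γ : LieGroupoid EG EM G M} [T2Space M]

namespace LocalParam

variable {x : M} (φ : Γ.LocalParam x)

/-- The differential of a parametrization. -/
noncomputable def deriv (y : FiberModel EG EM) : FiberModel EG EM →L[ℝ] EG :=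
  mfderiv 𝓘(ℝ, FiberModel EG EM) 𝓘(ℝ, EG) φ.toFun y

theorem hasMFDerivAt {y : FiberModel EG EM} (hy : y ∈ φ.dom) :
    HasMFDerivAt 𝓘(ℝ, FiberModel EG EM) 𝓘(ℝ, EG) φ.toFun y (φ.deriv y) :=
  ((φ.smooth.contMDiffAt (φ.isOpen_dom.mem_nhds hy)).mdifferentiableAt (by simp)).hasMFDerivAt

theorem deriv_mem_vertical {y : FiberModel EG EM} (hy : y ∈ φ.dom) (w : FiberModel EG EM) :
    φ.deriv y w ∈ Γ.vertical (φ.toFun y) := by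
  have h1 := HasMFDerivAt.comp y
    (Γ.contMDiff_src.mdifferentiableAt (x := φ.toFun y) (by simp)).hasMFDerivAt (φ.hasMFDerivAt hy)
  have h2 : HasMFDerivAt 𝓘(ℝ, FiberModel EG EM) 𝓘(ℝ, EM) (Γ.src ∘ φ.toFun) y
      (0 : FiberModel EG EM →L[ℝ] EM) := by
    refine (hasMFDerivAt_const x y).congr_of_eventuallyEq ?_
    filter_upwards [φ.isOpen_dom.mem_nhds hy] with z hz using φ.mapsTo z hz
  exact congrArg (fun A : FiberModel EG EM →L[ℝ] EM => A w) (hasMFDerivAt_unique h1 h2)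

/-- The parametrization of a piece of a fiber by an adapted chart. -/
noncomputable def ofChart (c : Γ.AdaptedChart) {x : M} (hx : x ∈ (chartAt EM c.base).source) :
    Γ.LocalParam x where
  dom := c.dom x
  toFun := c.pt x
  isOpen_dom := c.isOpen_dom x
  smooth := AdaptedChart.contMDiffOn_pt x
  injOn := fun y hy z hz h => by
    rw [← AdaptedChart.kappa_pt hy, ← AdaptedChart.kappa_pt hz, h]
  immersion := fun y hy v w h => by
    have h' : c.dpt x y v = c.dpt x y w := h
    rw [← AdaptedChart.coord_dpt hy v, ← AdaptedChart.coord_dpt hy w, h']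
  mapsTo := fun y hy => AdaptedChart.src_pt hx hy

theorem hasMFDerivAt_mul {b : G} (φ : Γ.LocalParam (Γ.tgt b)) {y : FiberModel EG EM}
    (hy : y ∈ φ.dom) :
    HasMFDerivAt 𝓘(ℝ, FiberModel EG EM) 𝓘(ℝ, EG) (fun y => Γ.mul (φ.toFun y) b) y
      ((Γ.transl b (φ.toFun y)).comp (φ.deriv y)) :=
  (HasMFDerivWithinAt.comp (g := fun d => Γ.mul d b) (f := φ.toFun) y
    (hasMFDerivWithinAt_mul_right (φ.mapsTo y hy)) (φ.hasMFDerivAt hy).hasMFDerivWithinAt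
    (s := φ.dom) (fun z hz => (φ.mapsTo z hz).trans (φ.mapsTo y hy).symm)).hasMFDerivAt
    (φ.isOpen_dom.mem_nhds hy)

/-- Right translation of a parametrization. -/
noncomputable def mulRight {b : G} (φ : Γ.LocalParam (Γ.tgt b)) : Γ.LocalParam (Γ.src b) where
  dom := φ.dom
  toFun := fun y => Γ.mul (φ.toFun y) b
  isOpen_dom := φ.isOpen_dom
  smooth := (Γ.contMDiffOn_mul_right b).comp φ.smooth φ.mapsTo
  injOn := fun y hy z hz h => φ.injOn hy hz
    (Γ.mul_right_cancel (φ.mapsTo y hy) (φ.mapsTo z hz) h)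
  immersion := fun y hy v w h => by
    have h1 := (φ.hasMFDerivAt_mul hy).mfderiv
    have h2 : Γ.transl b (φ.toFun y) (φ.deriv y v) = Γ.transl b (φ.toFun y) (φ.deriv y w) := by
      have e1 := congrArg (fun A : FiberModel EG EM →L[ℝ] EG => A v) h1
      have e2 := congrArg (fun A : FiberModel EG EM →L[ℝ] EG => A w) h1
      exact e1.symm.trans (Eq.trans h e2)
    have h3 := congrArg (Γ.toUnit (Γ.mul (φ.toFun y) b)) h2
    rw [toUnit_transl (φ.mapsTo y hy) (φ.deriv_mem_vertical hy v),
      toUnit_transl (φ.mapsTo y hy) (φ.deriv_mem_vertical hy w)] at h3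
    have h4 := congrArg (Γ.fromUnit (φ.toFun y)) h3
    rw [fromUnit_toUnit (φ.deriv_mem_vertical hy v),
      fromUnit_toUnit (φ.deriv_mem_vertical hy w)] at h4
    exact φ.immersion y hy h4
  mapsTo := fun y hy => Γ.src_mul _ _ (φ.mapsTo y hy)

theorem deriv_mulRight {b : G} (φ : Γ.LocalParam (Γ.tgt b)) {y : FiberModel EG EM}
    (hy : y ∈ φ.dom) (w : FiberModel EG EM) :
    φ.mulRight.deriv y w = Γ.transl b (φ.toFun y) (φ.deriv y w) :=
  congrArg (fun A : FiberModel EG EM →L[ℝ] EG => A w) (φ.hasMFDerivAt_mul hy).mfderiv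

end LocalParam

namespace Metric

variable {g : Γ.Metric}

theorem density_eq {x : M} (φ : Γ.LocalParam x) (y : FiberModel EG EM) :
    g.density φ y = √(Matrix.det (Matrix.of fun i j => g.fip (φ.toFun y)
      (φ.deriv y (EuclideanSpace.single i 1)) (φ.deriv y (EuclideanSpace.single j 1)))) := rfl

/-- The Gram matrix transforms as `Aᵀ B A`, so the root of its determinant scales by `|det A|`. -/
theorem density_comp {x : M} {φ ψ : Γ.LocalParam x} {y z : FiberModel EG EM}
    {T : FiberModel EG EM →L[ℝ] FiberModel EG EM} (h : φ.toFun y = ψ.toFun z)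
    (hT : ∀ w, φ.deriv y w = ψ.deriv z (T w)) :
    g.density φ y = |T.det| * g.density ψ z := by
  set b := (EuclideanSpace.basisFun (Fin (Module.finrank ℝ EG - Module.finrank ℝ EM)) ℝ).toBasis
  set A := LinearMap.toMatrix b b T.toLinearMap with hA
  have hTi : ∀ i, T (EuclideanSpace.single i 1) = ∑ p, A p i • EuclideanSpace.single p (1 : ℝ) := by
    intro i
    ext q
    simp [hA, b, LinearMap.toMatrix_apply, Pi.single_apply]
  have hdet : T.det = A.det := (LinearMap.det_toMatrix b _).symm
  have hmat : (Matrix.of fun i j => g.fip (φ.toFun y)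
      (φ.deriv y (EuclideanSpace.single i 1)) (φ.deriv y (EuclideanSpace.single j 1)))
      = A.transpose * (Matrix.of fun i j => g.fip (ψ.toFun z)
      (ψ.deriv z (EuclideanSpace.single i 1)) (ψ.deriv z (EuclideanSpace.single j 1))) * A := by
    ext i j
    have hL : ∀ i, Γ.toUnit (φ.toFun y) (φ.deriv y (EuclideanSpace.single i 1)) = ∑ p, A p i •
        Γ.toUnit (ψ.toFun z) (ψ.deriv z (EuclideanSpace.single p 1)) := by
      intro i
      rw [hT, hTi, h, map_sum, map_sum]
      exact Finset.sum_congr rfl fun p _ => by rw [map_smul, map_smul]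
    rw [Matrix.of_apply, fip, hL, hL, h]
    refine (bilin_sum_sum (g.ip (Γ.tgt (ψ.toFun z))) (fun p => A p i) (fun p => A p j)
      (fun p => Γ.toUnit _ (ψ.deriv z (EuclideanSpace.single p 1)))
      (fun p => Γ.toUnit _ (ψ.deriv z (EuclideanSpace.single p 1)))).trans ?_
    simp only [Matrix.mul_apply, Matrix.transpose_apply, Matrix.of_apply, Finset.sum_mul, fip]
    rw [Finset.sum_comm]
    exact Finset.sum_congr rfl fun p _ => Finset.sum_congr rfl fun q _ => by ring
  rw [density_eq, density_eq, hmat, Matrix.det_mul, Matrix.det_mul, Matrix.det_transpose, hdet,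
    mul_right_comm, Real.sqrt_mul (mul_self_nonneg _), Real.sqrt_mul_self_eq_abs]

variable [MeasurableSpace G] [BorelSpace G]

/-- The Riemannian volume measure of a parametrized piece of a fiber. -/
noncomputable def paramMeasure (g : Γ.Metric) {x : M} (φ : Γ.LocalParam x) : Measure G :=
  Measure.map φ.toFun
    ((volume.restrict φ.dom).withDensity fun y => ENNReal.ofReal (g.density φ y))

theorem aemeasurable_param {x : M} (φ : Γ.LocalParam x) : AEMeasurable φ.toFun
    ((volume.restrict φ.dom).withDensity fun y => ENNReal.ofReal (g.density φ y)) :=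
  (φ.smooth.continuousOn.aemeasurable φ.isOpen_dom.measurableSet).mono_ac
    (withDensity_absolutelyContinuous _ _)

theorem paramMeasure_apply {x : M} (φ : Γ.LocalParam x) {A : Set G} (hA : MeasurableSet A) :
    g.paramMeasure φ A = ∫⁻ y in φ.toFun ⁻¹' A ∩ φ.dom, ENNReal.ofReal (g.density φ y) := by
  rw [paramMeasure, Measure.map_apply_of_aemeasurable (aemeasurable_param φ) hA,
    withDensity_apply', Measure.restrict_restrict' φ.isOpen_dom.measurableSet]

theorem measurableSet_param {x : M} (φ : Γ.LocalParam x) {A : Set G} (hA : MeasurableSet A) :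
    MeasurableSet (φ.toFun ⁻¹' A ∩ φ.dom) := by
  have h := φ.isOpen_dom.measurableSet.subtype_image
    (φ.smooth.continuousOn.domRestrict.measurable hA)
  convert! h using 1
  ext y
  simp [and_comm]

theorem paramMeasure_le (φ : Γ.LocalParam x) : g.paramMeasure φ ≤ g.fiberVolume x :=
  le_iSup (fun φ : Γ.LocalParam x => g.paramMeasure φ) φ

theorem measurableSet_fiber (x : M) : MeasurableSet (Γ.fiber x) := (isClosed_fiber Γ x).measurableSet

theorem paramMeasure_restrict_of_mapsTo {x : M} (φ : Γ.LocalParam x) {U : Set G}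
    (hU : MeasurableSet U) (h : ∀ y ∈ φ.dom, φ.toFun y ∈ U) :
    (g.paramMeasure φ).restrict U = g.paramMeasure φ := by
  refine Measure.restrict_eq_self_of_ae_mem ?_
  refine (ae_map_iff (p := fun a => a ∈ U) (aemeasurable_param φ) hU).2 ?_
  exact (withDensity_absolutelyContinuous _ _).ae_le
    ((ae_restrict_mem φ.isOpen_dom.measurableSet).mono h)

theorem fiberVolume_restrict_fiber (x : M) :
    (g.fiberVolume x).restrict (Γ.fiber x) = g.fiberVolume x := by
  refine le_antisymm Measure.restrict_le_self (iSup_le fun φ => ?_)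
  show g.paramMeasure φ ≤ _
  rw [← paramMeasure_restrict_of_mapsTo φ (measurableSet_fiber x) φ.mapsTo]
  exact Measure.restrict_mono le_rfl (paramMeasure_le φ)

theorem ae_mem_fiber (x : M) : ∀ᵐ b ∂g.fiberVolume x, Γ.src b = x := by
  rw [← fiberVolume_restrict_fiber]
  exact ae_restrict_mem (measurableSet_fiber x)

/-- Change of variables along `kappa ∘ ψ`; the Jacobian is absorbed by `density_comp`. Only an
inequality results, as `ψ` may cover just a part of the chart domain. -/
theorem paramMeasure_restrict_le {x : M} {c : Γ.AdaptedChart}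
    (hx : x ∈ (chartAt EM c.base).source) (ψ : Γ.LocalParam x) :
    (g.paramMeasure ψ).restrict c.e.source ≤ g.paramMeasure (LocalParam.ofChart c hx) := by
  refine Measure.le_iff.2 fun A hA => ?_
  have hU := c.e.open_source.measurableSet
  rw [Measure.restrict_apply hA, paramMeasure_apply ψ (hA.inter hU), paramMeasure_apply _ hA]
  set s := ψ.toFun ⁻¹' (A ∩ c.e.source) ∩ ψ.dom with hs
  have hsm : MeasurableSet s := measurableSet_param ψ (hA.inter hU)
  have hpt : ∀ y ∈ s, c.pt x (c.kappa (ψ.toFun y)) = ψ.toFun y := by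
    intro y hy
    have := AdaptedChart.pt_kappa hy.1.2
    rwa [ψ.mapsTo y hy.2] at this
  have hdom : ∀ y ∈ s, c.kappa (ψ.toFun y) ∈ c.dom x := by
    intro y hy
    have := AdaptedChart.kappa_mem hy.1.2
    rwa [ψ.mapsTo y hy.2] at this
  set T : FiberModel EG EM → FiberModel EG EM →L[ℝ] FiberModel EG EM := fun y =>
    (c.coord (ψ.toFun y)).comp (ψ.deriv y) with hT
  have hderiv : ∀ y ∈ s, HasFDerivWithinAt (fun y => c.kappa (ψ.toFun y)) (T y) s y := by
    intro y hy
    have h1 := ((AdaptedChart.contMDiffAt_kappa hy.1.2).mdifferentiableAt (by simp)).hasMFDerivAt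
    have h2 := (HasMFDerivAt.comp y h1 (ψ.hasMFDerivAt hy.2)).hasFDerivAt
    refine (h2.congr_fderiv ?_).hasFDerivWithinAt
    ext w : 1
    exact AdaptedChart.mfderiv_kappa hy.1.2 (ψ.deriv y w)
  have hinj : InjOn (fun y => c.kappa (ψ.toFun y)) s := by
    intro y hy z hz h
    apply ψ.injOn hy.2 hz.2
    rw [← hpt y hy, ← hpt z hz]
    exact congrArg (c.pt x) h
  have hdens : ∀ y ∈ s, ENNReal.ofReal (g.density ψ y) = ENNReal.ofReal |(T y).det| *
      ENNReal.ofReal (g.density (LocalParam.ofChart c hx) (c.kappa (ψ.toFun y))) := by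
    intro y hy
    rw [← ENNReal.ofReal_mul (abs_nonneg _)]
    congr 1
    refine density_comp (T := T y) (hpt y hy).symm fun w => ?_
    have hv : ψ.deriv y w ∈ Γ.vertical (c.pt x (c.kappa (ψ.toFun y))) := by
      rw [hpt y hy]; exact ψ.deriv_mem_vertical hy.2 w
    have h3 := AdaptedChart.dpt_coord (hdom y hy) hv
    rw [hpt y hy] at h3
    exact h3.symm
  refine (setLIntegral_congr_fun hsm hdens).trans_le
    ((lintegral_image_eq_lintegral_abs_det_fderiv_mul volume hsm hderiv hinj
      (fun k => ENNReal.ofReal (g.density (LocalParam.ofChart c hx) k))).symm.trans_le ?_)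
  refine lintegral_mono_set ?_
  rintro _ ⟨y, hy, rfl⟩
  refine ⟨?_, hdom y hy⟩
  show c.pt x (c.kappa (ψ.toFun y)) ∈ A
  rw [hpt y hy]
  exact hy.1.1

/-- On a chart domain the supremum defining the volume is attained by the chart. Every parametrized
piece is dominated by the measure of the chart plus the volume outside the chart domain, hence so is
the supremum. -/
theorem fiberVolume_restrict_source {x : M} {c : Γ.AdaptedChart}
    (hx : x ∈ (chartAt EM c.base).source) :
    (g.fiberVolume x).restrict c.e.source = g.paramMeasure (LocalParam.ofChart c hx) := by
  have hU := c.e.open_source.measurableSet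
  apply le_antisymm
  · have h : g.fiberVolume x ≤ g.paramMeasure (LocalParam.ofChart c hx)
        + (g.fiberVolume x).restrict c.e.sourceᶜ := by
      refine iSup_le fun ψ => ?_
      show g.paramMeasure ψ ≤ _
      rw [← Measure.restrict_add_restrict_compl (μ := g.paramMeasure ψ) hU]
      exact add_le_add (paramMeasure_restrict_le hx ψ)
        (Measure.restrict_mono le_rfl (paramMeasure_le ψ))
    refine (Measure.restrict_mono (le_refl c.e.source) h).trans ?_
    rw [Measure.restrict_add, Measure.restrict_restrict hU, inter_compl_self,
      Measure.restrict_empty, add_zero]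
    exact Measure.restrict_le_self
  · rw [← paramMeasure_restrict_of_mapsTo (LocalParam.ofChart c hx) hU
      (fun y hy => AdaptedChart.pt_mem hy)]
    exact Measure.restrict_mono le_rfl (paramMeasure_le _)

theorem aemeasurable_mul_right {b : G} {ν : Measure G} (h : ∀ᵐ a ∂ν, Γ.src a = Γ.tgt b) :
    AEMeasurable (fun a => Γ.mul a b) ν := by
  rw [← Measure.restrict_eq_self_of_ae_mem h]
  exact (Γ.contMDiffOn_mul_right b).continuousOn.aemeasurable (measurableSet_fiber _)

theorem ae_map_mul_right {b : G} {ν : Measure G} (h : ∀ᵐ a ∂ν, Γ.src a = Γ.tgt b) :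
    ∀ᵐ a ∂Measure.map (fun a => Γ.mul a b) ν, Γ.src a = Γ.src b := by
  rw [ae_map_iff (aemeasurable_mul_right h) (measurableSet_fiber _)]
  exact h.mono fun a ha => Γ.src_mul _ _ ha

theorem map_map_mul_right_inv {b : G} {ν : Measure G} (h : ∀ᵐ a ∂ν, Γ.src a = Γ.tgt b) :
    Measure.map (fun a => Γ.mul a (Γ.inv b)) (Measure.map (fun a => Γ.mul a b) ν) = ν := by
  have h' : ∀ᵐ a ∂Measure.map (fun a => Γ.mul a b) ν, Γ.src a = Γ.tgt (Γ.inv b) := by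
    rw [Γ.tgt_inv]
    exact ae_map_mul_right h
  rw [AEMeasurable.map_map_of_aemeasurable (aemeasurable_mul_right h') (aemeasurable_mul_right h)]
  refine (Measure.map_congr ?_).trans Measure.map_id
  exact h.mono fun a ha => Γ.mul_mul_inv ha

theorem ae_paramMeasure {x : M} (φ : Γ.LocalParam x) : ∀ᵐ a ∂g.paramMeasure φ, Γ.src a = x :=
  (MeasureTheory.ae_mono (paramMeasure_le φ)) (ae_mem_fiber x)

/-- A translated parametrization has the same density, by right invariance of the metric. -/
theorem map_paramMeasure_mul_right {b : G} (φ : Γ.LocalParam (Γ.tgt b)) :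
    Measure.map (fun a => Γ.mul a b) (g.paramMeasure φ) = g.paramMeasure φ.mulRight := by
  have h := aemeasurable_mul_right (ae_paramMeasure (g := g) φ)
  rw [paramMeasure] at h ⊢
  rw [AEMeasurable.map_map_of_aemeasurable h (aemeasurable_param φ), paramMeasure]
  refine congrArg (Measure.map _) (withDensity_congr_ae ?_)
  refine (ae_restrict_mem φ.isOpen_dom.measurableSet).mono fun y hy => congrArg _ ?_
  rw [density_eq, density_eq]
  congr 2
  ext i j
  rw [Matrix.of_apply, Matrix.of_apply, φ.deriv_mulRight hy, φ.deriv_mulRight hy]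
  exact (fip_transl (φ.mapsTo y hy) (φ.deriv_mem_vertical hy _) (φ.deriv_mem_vertical hy _)).symm

/-- A piece of the fiber over `t(b)` is the translate by `b⁻¹` of its translate by `b`, which is a
piece of the fiber over `s(b)`. Used for `b` and for its inverse, this inequality gives equality. -/
theorem fiberVolume_le_map_mul_right_inv (g : Γ.Metric) (b : G) :
    g.fiberVolume (Γ.tgt b) ≤
      Measure.map (fun a => Γ.mul a (Γ.inv b)) (g.fiberVolume (Γ.src b)) := by
  refine iSup_le fun φ => ?_
  show g.paramMeasure φ ≤ _
  rw [← map_map_mul_right_inv (ae_paramMeasure φ), map_paramMeasure_mul_right]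
  refine Measure.map_mono_of_aemeasurable (paramMeasure_le _) (aemeasurable_mul_right ?_)
  rw [Γ.tgt_inv]
  exact ae_mem_fiber _

/-- The fiberwise volume measures are right invariant. -/
theorem map_mul_right (g : Γ.Metric) (b : G) :
    Measure.map (fun a => Γ.mul a b) (g.fiberVolume (Γ.tgt b)) = g.fiberVolume (Γ.src b) := by
  have h0 := ae_mem_fiber (g := g) (Γ.src b)
  have hi : ∀ᵐ a ∂g.fiberVolume (Γ.src b), Γ.src a = Γ.tgt (Γ.inv b) := by
    rw [Γ.tgt_inv]
    exact h0
  apply le_antisymm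
  · have h1 := map_map_mul_right_inv hi
    rw [Γ.inv_inv] at h1
    refine (Measure.map_mono_of_aemeasurable (fiberVolume_le_map_mul_right_inv g b)
      (aemeasurable_mul_right ?_)).trans h1.le
    have h2 := ae_map_mul_right hi
    rwa [Γ.src_inv] at h2
  · have h1 := fiberVolume_le_map_mul_right_inv g (Γ.inv b)
    rwa [Γ.inv_inv, Γ.tgt_inv, Γ.src_inv] at h1

end Metric

end Volume

end LieGroupoid

/-! ### Integrability of exponentials and continuity of fiber integrals. -/

namespace LieGroupoid

section Integrals

variable {EG EM G M : Type*}
  [NormedAddCommGroup EG] [NormedSpace ℝ EG] [FiniteDimensional ℝ EG]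
  [NormedAddCommGroup EM] [NormedSpace ℝ EM] [FiniteDimensional ℝ EM]
  [TopologicalSpace G] [ChartedSpace EG G] [IsManifold 𝓘(ℝ, EG) ∞ G]
  [TopologicalSpace M] [ChartedSpace EM M] [IsManifold 𝓘(ℝ, EM) ∞ M]
  {Γ : LieGroupoid EG EM G M} [T2Space M] [MeasurableSpace G] [BorelSpace G]

namespace Metric

variable {g : Γ.Metric}

theorem aestronglyMeasurable_of_continuousOn {E : Type*} [NormedAddCommGroup E]
    [SecondCountableTopology E] {x : M} {f : G → E}
    (hf : ContinuousOn f (Γ.fiber x)) : AEStronglyMeasurable f (g.fiberVolume x) := by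
  rw [← fiberVolume_restrict_fiber]
  exact hf.aestronglyMeasurable (measurableSet_fiber x)

theorem measurableSet_ball (hc : ∀ x, IsPreconnected (Γ.fiber x)) (a : G) (r : ℝ) :
    MeasurableSet {b | Γ.src b = Γ.src a ∧ g.dist a b < r} := by
  obtain ⟨u, hu, h⟩ := (continuousOn_iff'.1 (continuousOn_dist (g := g) hc a)) (Iio r) isOpen_Iio
  have : {b | Γ.src b = Γ.src a ∧ g.dist a b < r} = u ∩ Γ.fiber (Γ.src a) := by
    rw [← h]
    ext b
    exact and_comm
  rw [this]
  exact hu.measurableSet.inter (measurableSet_fiber _)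

/-- Where the distance lies in `[n, n + 1)` the exponential is at most `exp (-m n)`, and the ball of
radius `n + 1` has volume at most `C (n + 1)^N`. The resulting series converges and does not depend
on `a`. -/
theorem exists_lintegral_exp_le (hg : g.PolynomialGrowth) (hc : ∀ x, IsPreconnected (Γ.fiber x))
    {m : ℝ} (hm : 0 < m) : ∃ C : ℝ, 0 ≤ C ∧ ∀ a : G,
      ∫⁻ b, ENNReal.ofReal (Real.exp (-m * g.dist a b)) ∂g.fiberVolume (Γ.src a)
        ≤ ENNReal.ofReal C := by
  obtain ⟨N, C, hC, h⟩ := hg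
  have hs : Summable fun n : ℕ => Real.exp (-m * n) * (C * ((n : ℝ) + 1) ^ N) := by
    have h1 := (summable_nat_add_iff 1).2 (Real.summable_pow_mul_exp_neg_nat_mul N hm)
    refine (h1.mul_left (C * Real.exp m)).congr fun n => ?_
    have h2 : Real.exp (-m * n) = Real.exp m * Real.exp (-m * ((n + 1 : ℕ) : ℝ)) := by
      rw [← Real.exp_add]
      congr 1
      push_cast
      ring
    rw [h2]
    push_cast
    ring
  have hpos : ∀ n : ℕ, 0 ≤ Real.exp (-m * n) * (C * ((n : ℝ) + 1) ^ N) := fun n => by positivity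
  refine ⟨∑' n : ℕ, Real.exp (-m * n) * (C * ((n : ℝ) + 1) ^ N), tsum_nonneg hpos, fun a => ?_⟩
  set B : ℕ → Set G := fun n => {b | Γ.src b = Γ.src a ∧ g.dist a b < (n : ℝ) + 1} with hB
  calc _ ≤ ∫⁻ b, ∑' n : ℕ, (B n).indicator (fun _ => ENNReal.ofReal (Real.exp (-m * n))) b
        ∂g.fiberVolume (Γ.src a) := by
        refine lintegral_mono_ae ((ae_mem_fiber (Γ.src a)).mono fun b hb => ?_)
        -- The single term with index `⌊d(a, b)⌋` suffices. The radii are `n + 1` rather than `n`,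
        -- so they are at least one, as the growth hypothesis requires.
        refine le_trans ?_ (ENNReal.le_tsum ⌊g.dist a b⌋₊)
        have hmem : b ∈ B ⌊g.dist a b⌋₊ := ⟨hb, Nat.lt_floor_add_one _⟩
        rw [indicator_of_mem hmem]
        refine ENNReal.ofReal_le_ofReal (Real.exp_le_exp.2 ?_)
        have := Nat.floor_le (dist_nonneg (g := g) a b)
        nlinarith
    _ = ∑' n : ℕ, ∫⁻ b, (B n).indicator (fun _ => ENNReal.ofReal (Real.exp (-m * n))) b
        ∂g.fiberVolume (Γ.src a) := lintegral_tsum fun n =>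
          (measurable_const.indicator (measurableSet_ball hc a _)).aemeasurable
    _ ≤ ∑' n : ℕ, ENNReal.ofReal (Real.exp (-m * n) * (C * ((n : ℝ) + 1) ^ N)) := by
        refine ENNReal.tsum_le_tsum fun n => ?_
        rw [lintegral_indicator_const (measurableSet_ball hc a _),
          ENNReal.ofReal_mul (Real.exp_pos _).le]
        gcongr
        exact h a _ (by linarith [Nat.cast_nonneg (α := ℝ) n])
    _ = _ := (ENNReal.ofReal_tsum_of_nonneg hpos hs).symm

/-- Exponentials of the distance are integrable over the fibers, with uniformly bounded
integrals. -/
def ExpIntegrable (g : Γ.Metric) : Prop :=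
  ∀ m : ℝ, 0 < m → ∃ C : ℝ, 0 ≤ C ∧ ∀ a : G,
    Integrable (fun b => Real.exp (-m * g.dist a b)) (g.fiberVolume (Γ.src a)) ∧
    ∫ b, Real.exp (-m * g.dist a b) ∂g.fiberVolume (Γ.src a) ≤ C

theorem PolynomialGrowth.expIntegrable (hg : g.PolynomialGrowth)
    (hc : ∀ x, IsPreconnected (Γ.fiber x)) : g.ExpIntegrable := by
  intro m hm
  obtain ⟨C, hC, h⟩ := exists_lintegral_exp_le hg hc hm
  refine ⟨C, hC, fun a => ?_⟩
  have hmeas : AEStronglyMeasurable (fun b => Real.exp (-m * g.dist a b))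
      (g.fiberVolume (Γ.src a)) := aestronglyMeasurable_of_continuousOn
    (Real.continuous_exp.comp_continuousOn (continuousOn_const.mul (continuousOn_dist hc a)))
  constructor
  · refine ⟨hmeas, ?_⟩
    rw [hasFiniteIntegral_iff_ofReal (Eventually.of_forall fun b => (Real.exp_pos _).le)]
    exact (h a).trans_lt ENNReal.ofReal_lt_top
  · rw [integral_eq_lintegral_of_nonneg_ae (Eventually.of_forall fun b => (Real.exp_pos _).le) hmeas]
    exact ENNReal.toReal_le_of_le_ofReal hC (h a)

/-- The Riemannian volume density in an adapted chart, as a function on the groupoid. -/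
noncomputable def chartDensity (g : Γ.Metric) (c : Γ.AdaptedChart) (a : G) : ℝ :=
  √(Matrix.det (Matrix.of fun i j => g.chartForm c a i j))

theorem continuousAt_chartDensity {c : Γ.AdaptedChart} {a : G} (ha : a ∈ c.e.source) :
    ContinuousAt (g.chartDensity c) a := by
  have h : ContinuousAt (fun a => (Matrix.of fun i j => g.chartForm c a i j)) a :=
    continuousAt_pi.2 fun i => continuousAt_pi.2 fun j => (contMDiffAt_chartForm ha i j).continuousAt
  exact Real.continuous_sqrt.continuousAt.comp
    ((Continuous.matrix_det continuous_id).continuousAt.comp h)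

theorem density_ofChart {c : Γ.AdaptedChart} {x : M} (hx : x ∈ (chartAt EM c.base).source)
    {k : FiberModel EG EM} (hk : k ∈ c.dom x) :
    g.density (LocalParam.ofChart c hx) k = g.chartDensity c (c.pt x k) := by
  rw [density_eq, chartDensity]
  congr 2
  ext i j
  rw [Matrix.of_apply, Matrix.of_apply, chartForm, AdaptedChart.src_pt hx hk,
    AdaptedChart.kappa_pt hk]
  rfl

/-- The function vanishes off the chart domain, where the volume is not given by the chart.
Extension by zero off `c.dom x` makes the domain of integration independent of `x`. -/
theorem integral_eq_integral_chart {c : Γ.AdaptedChart} {x : M}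
    (hx : x ∈ (chartAt EM c.base).source) {F : G → ℂ} (hF : ContinuousOn F (Γ.fiber x))
    (h0 : ∀ b ∉ c.e.source, F b = 0) :
    ∫ b, F b ∂g.fiberVolume x
      = ∫ k, (c.dom x).indicator (fun k => g.chartDensity c (c.pt x k) • F (c.pt x k)) k := by
  have hd : MeasurableSet (c.dom x) := (c.isOpen_dom x).measurableSet
  have hcont : ContinuousOn (g.density (LocalParam.ofChart c hx)) (c.dom x) := by
    intro k hk
    refine (ContinuousAt.continuousWithinAt ?_)
    refine ContinuousAt.congr (f := fun k => g.chartDensity c (c.pt x k)) ?_ ?_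
    · exact (continuousAt_chartDensity (AdaptedChart.pt_mem hk)).comp
        (AdaptedChart.contMDiffAt_pt hk).continuousAt
    · filter_upwards [(c.isOpen_dom x).mem_nhds hk] with z hz using (density_ofChart hx hz).symm
  rw [← setIntegral_eq_integral_of_forall_compl_eq_zero h0, fiberVolume_restrict_source hx,
    paramMeasure, integral_map (aemeasurable_param _)
      ((aestronglyMeasurable_of_continuousOn hF).mono_measure (paramMeasure_le _)),
    integral_withDensity_eq_integral_toReal_smul₀, integral_indicator hd]
  · refine setIntegral_congr_fun hd fun k hk => ?_
    show (ENNReal.ofReal (g.density (LocalParam.ofChart c hx) k)).toReal • F (c.pt x k) = _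
    rw [ENNReal.toReal_ofReal
      (show 0 ≤ g.density (LocalParam.ofChart c hx) k from Real.sqrt_nonneg _), density_ofChart hx hk]
  · exact (hcont.aemeasurable hd).ennreal_ofReal
  · exact Eventually.of_forall fun _ => ENNReal.ofReal_lt_top

/-- If `s p₀` lies in the base chart, the integral becomes that of a jointly continuous function
over a fixed compact set of coordinates. Otherwise `s p₀` avoids the compact set of sources of the
support, and the integrals vanish nearby. -/
theorem continuous_integral_of_tsupport_subset {X : Type*} [TopologicalSpace X]
    [FirstCountableTopology X] {s : X → M}
    (hs : Continuous s) {f : X → G → ℂ}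
    (hf : ContinuousOn (fun p : X × G => f p.1 p.2) {p | Γ.src p.2 = s p.1})
    {c : Γ.AdaptedChart} {χ : G → ℝ} (hχ : Continuous χ) (hsub : tsupport χ ⊆ c.e.source)
    (hcpt : HasCompactSupport χ) :
    Continuous fun p => ∫ b, χ b • f p b ∂g.fiberVolume (s p) := by
  have hL : IsCompact (tsupport χ) := hcpt
  have hfib : ∀ p, ContinuousOn (fun b => χ b • f p b) (Γ.fiber (s p)) := fun p =>
    hχ.continuousOn.smul (hf.comp (continuousOn_const.prodMk continuousOn_id) fun b hb => hb)
  have h0 : ∀ p, ∀ b ∉ c.e.source, χ b • f p b = 0 := fun p b hb => by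
    rw [image_eq_zero_of_notMem_tsupport fun h => hb (hsub h), zero_smul]
  rw [continuous_iff_continuousAt]
  intro p₀
  by_cases hp : s p₀ ∈ (chartAt EM c.base).source
  · set V : Set X := s ⁻¹' (chartAt EM c.base).source with hV
    have hVo : IsOpen V := (chartAt EM c.base).open_source.preimage hs
    have key : ContinuousOn (fun p => ∫ k, (c.dom (s p)).indicator
        (fun k => g.chartDensity c (c.pt (s p) k) • (χ (c.pt (s p) k) • f p (c.pt (s p) k))) k) V := by
      have hL' : IsCompact (c.e '' tsupport χ) := hL.image_of_continuousOn (c.e.continuousOn.mono hsub)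
      refine continuousOn_integral_of_compact_support (hL'.image continuous_snd) ?_ ?_
      · rintro ⟨p, k⟩ ⟨hpV, -⟩
        refine ContinuousAt.continuousWithinAt ?_
        have hsA : ContinuousAt (fun q : X × FiberModel EG EM => s q.1) (p, k) :=
          hs.continuousAt.comp continuousAt_fst
        by_cases hk : k ∈ c.dom (s p)
        · have hev := AdaptedChart.eventually_mem_dom (c := c) (k := fun q : X × FiberModel EG EM => q.2)
            hsA continuousAt_snd hpV hk
          have hpt : ContinuousAt (fun q : X × FiberModel EG EM => c.pt (s q.1) q.2) (p, k) :=
            ContinuousAt.comp (f := fun q : X × FiberModel EG EM => (chartAt EM c.base (s q.1), q.2))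
              (g := c.e.symm) (AdaptedChart.contMDiffAt_e_symm hk).continuousAt
              ((ContinuousAt.comp (f := fun q : X × FiberModel EG EM => s q.1)
                ((chartAt EM c.base).continuousAt hpV) hsA).prodMk continuousAt_snd)
          refine ContinuousAt.congr (f := fun q : X × FiberModel EG EM =>
            g.chartDensity c (c.pt (s q.1) q.2) • (χ (c.pt (s q.1) q.2) • f q.1 (c.pt (s q.1) q.2)))
            ?_ ?_
          · have h1 : ContinuousAt (fun q : X × FiberModel EG EM =>
                g.chartDensity c (c.pt (s q.1) q.2)) (p, k) :=
              ContinuousAt.comp (g := g.chartDensity c)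
                (continuousAt_chartDensity (AdaptedChart.pt_mem hk)) hpt
            have h2 : ContinuousAt (fun q : X × FiberModel EG EM => χ (c.pt (s q.1) q.2)) (p, k) :=
              ContinuousAt.comp (g := χ) hχ.continuousAt hpt
            have h3 : ContinuousAt (fun q : X × FiberModel EG EM => f q.1 (c.pt (s q.1) q.2))
                (p, k) := by
              have h4 := (hf (p, c.pt (s p) k) (AdaptedChart.src_pt hpV hk)).tendsto
              have h5 : Tendsto (fun q : X × FiberModel EG EM => (q.1, c.pt (s q.1) q.2)) (𝓝 (p, k))
                  (𝓝[{p | Γ.src p.2 = s p.1}] (p, c.pt (s p) k)) :=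
                tendsto_nhdsWithin_iff.2 ⟨continuousAt_fst.prodMk hpt,
                  hev.mono fun q hq => AdaptedChart.src_pt hq.1 hq.2⟩
              exact h4.comp h5
            exact h1.smul (h2.smul h3)
          · filter_upwards [hev] with q hq
            exact (indicator_of_mem hq.2 (fun k => g.chartDensity c (c.pt (s q.1) k) •
              (χ (c.pt (s q.1) k) • f q.1 (c.pt (s q.1) k)))).symm
        -- Outside the parameter domain the integrand vanishes nearby: the image of the support of
        -- `χ` in the chart is compact, hence closed, and contained in the target.
        · refine ContinuousAt.congr (f := fun _ => (0 : ℂ)) continuousAt_const ?_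
          have hA : ContinuousAt (fun q : X × FiberModel EG EM => (chartAt EM c.base (s q.1), q.2))
              (p, k) := (ContinuousAt.comp (f := fun q : X × FiberModel EG EM => s q.1)
                ((chartAt EM c.base).continuousAt hpV) hsA).prodMk continuousAt_snd
          have hN : (c.e '' tsupport χ)ᶜ ∈ 𝓝 (chartAt EM c.base (s p), k) := by
            refine hL'.isClosed.isOpen_compl.mem_nhds ?_
            rintro ⟨b, hb, hbe⟩
            apply hk
            show (chartAt EM c.base (s p), k) ∈ c.e.target
            rw [← hbe]
            exact c.e.map_source (hsub hb)
          filter_upwards [hA hN] with q hq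
          show 0 = (c.dom (s q.1)).indicator (fun k => g.chartDensity c (c.pt (s q.1) k) •
              (χ (c.pt (s q.1) k) • f q.1 (c.pt (s q.1) k))) q.2
          refine (indicator_apply_eq_zero.2 fun hqd => ?_).symm
          rw [image_eq_zero_of_notMem_tsupport (f := χ) (x := c.pt (s q.1) q.2), zero_smul, smul_zero]
          intro hmem
          exact hq ⟨_, hmem, AdaptedChart.e_pt hqd⟩
      · intro p k hpV hk
        refine indicator_apply_eq_zero.2 fun hkd => ?_
        rw [image_eq_zero_of_notMem_tsupport (f := χ) (x := c.pt (s p) k), zero_smul, smul_zero]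
        intro hmem
        exact hk ⟨_, ⟨_, hmem, AdaptedChart.e_pt hkd⟩, rfl⟩
    refine (key.continuousAt (hVo.mem_nhds hp)).congr ?_
    filter_upwards [hVo.mem_nhds hp] with p hpV
    exact (integral_eq_integral_chart hpV (hfib p) (h0 p)).symm
  · refine ContinuousAt.congr (f := fun _ => (0 : ℂ)) continuousAt_const ?_
    have hcl : IsClosed (Γ.src '' tsupport χ) := (hL.image Γ.contMDiff_src.continuous).isClosed
    have hN : s ⁻¹' (Γ.src '' tsupport χ)ᶜ ∈ 𝓝 p₀ := by
      refine hs.continuousAt.preimage_mem_nhds (hcl.isOpen_compl.mem_nhds ?_)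
      rintro ⟨b, hb, hbs⟩
      exact hp (hbs ▸ c.src_mem b (hsub hb))
    filter_upwards [hN] with p hp'
    refine (integral_eq_zero_of_ae ((ae_mem_fiber (s p)).mono fun b hb => ?_)).symm
    show χ b • f p b = 0
    rw [image_eq_zero_of_notMem_tsupport fun h => hp' ⟨b, h, hb⟩, zero_smul]

/-- A continuous function with compact support is integrable over every fiber. -/
theorem integrable_of_hasCompactSupport (hc : ∀ x, IsPreconnected (Γ.fiber x))
    (hE : g.ExpIntegrable) {x : M} {F : G → ℂ} (hF : ContinuousOn F (Γ.fiber x)) {K : Set G}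
    (hK : IsCompact K) (h0 : ∀ b ∉ K, F b = 0) : Integrable F (g.fiberVolume x) := by
  obtain ⟨C, -, hC⟩ := hE 1 one_pos
  set a := Γ.unit x
  have ha : Γ.src a = x := Γ.src_unit x
  have hKx : IsCompact (K ∩ Γ.fiber x) := hK.inter_right (isClosed_fiber Γ x)
  obtain ⟨B, hB⟩ := hKx.exists_bound_of_continuousOn (hF.mono inter_subset_right)
  have hd : ContinuousOn (g.dist a) (K ∩ Γ.fiber x) := by
    have := continuousOn_dist (g := g) hc a
    rw [ha] at this
    exact this.mono inter_subset_right
  obtain ⟨R, hR⟩ := hKx.exists_bound_of_continuousOn hd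
  -- On the compact set the distance to `a` is at most `R`, so `|B| exp (R - d(a, b))` dominates the
  -- bound `B` of the function.
  have hint := ((hC a).1).const_mul (|B| * Real.exp R)
  rw [ha] at hint
  refine hint.mono' (aestronglyMeasurable_of_continuousOn hF) ((ae_mem_fiber x).mono fun b hb => ?_)
  by_cases hbK : b ∈ K
  · have h1 := hB b ⟨hbK, hb⟩
    have h2 := (le_abs_self _).trans (hR b ⟨hbK, hb⟩)
    rw [_root_.mul_assoc, ← Real.exp_add]
    have h3 : 1 ≤ Real.exp (R + -1 * g.dist a b) := Real.one_le_exp (by linarith)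
    nlinarith [le_abs_self B, abs_nonneg B]
  · rw [h0 b hbK, norm_zero]
    positivity

/-- A partition of unity on `K`, subordinate to finitely many adapted charts, reduces the claim to
integrands supported in one chart. -/
theorem continuous_integral_of_hasCompactSupport [T2Space G] (hc : ∀ x, IsPreconnected (Γ.fiber x))
    (hE : g.ExpIntegrable) {X : Type*} [TopologicalSpace X]
    [FirstCountableTopology X] {s : X → M} (hs : Continuous s) {f : X → G → ℂ}
    (hf : ContinuousOn (fun p : X × G => f p.1 p.2) {p | Γ.src p.2 = s p.1})
    {K : Set G} (hK : IsCompact K) (h0 : ∀ p, ∀ b ∉ K, f p b = 0) :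
    Continuous fun p => ∫ b, f p b ∂g.fiberVolume (s p) := by
  have : LocallyCompactSpace G := ChartedSpace.locallyCompactSpace EG G
  choose c hcb hcs using fun a => Γ.exists_adaptedChart a
  obtain ⟨t, ht⟩ := hK.elim_finite_subcover (fun a => (c a).e.source)
    (fun a => (c a).e.open_source) fun a _ => mem_iUnion.2 ⟨a, hcs a⟩
  set c' : Fin t.card → Γ.AdaptedChart := fun i => c (t.equivFin.symm i) with hc'
  have hcov : K ⊆ ⋃ i, (c' i).e.source := by
    intro b hb
    obtain ⟨a, hat, hba⟩ := mem_iUnion₂.1 (ht hb)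
    refine mem_iUnion.2 ⟨t.equivFin ⟨a, hat⟩, ?_⟩
    simpa [hc'] using hba
  obtain ⟨χ, hχs, hχ1, -, hχc⟩ := exists_continuous_sum_one_of_isOpen_isCompact
    (fun i => (c' i).e.open_source) hK hcov
  have hsum : ∀ p b, f p b = ∑ i, χ i b • f p b := by
    intro p b
    by_cases hb : b ∈ K
    · rw [← Finset.sum_smul]
      have := hχ1 hb
      rw [Finset.sum_apply] at this
      rw [this, Pi.one_apply, one_smul]
    · simp [h0 p b hb]
  have hfib : ∀ p, ContinuousOn (f p) (Γ.fiber (s p)) := fun p =>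
    hf.comp (continuousOn_const.prodMk continuousOn_id) fun b hb => hb
  have hint : ∀ p, ∫ b, f p b ∂g.fiberVolume (s p)
      = ∑ i, ∫ b, χ i b • f p b ∂g.fiberVolume (s p) := by
    intro p
    rw [← integral_finsetSum]
    · exact integral_congr_ae (Eventually.of_forall fun b => hsum p b)
    · intro i _
      exact integrable_of_hasCompactSupport hc hE ((χ i).continuous.continuousOn.smul (hfib p)) hK
        fun b hb => by rw [h0 p b hb, smul_zero]
  simp only [hint]
  exact continuous_finsetSum _ fun i _ => continuous_integral_of_tsupport_subset hs hf
    (χ i).continuous (hχs i) (hχc i)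

end Metric

end Integrals

end LieGroupoid

/-! ### The convolution: integrability and continuity. -/

namespace LieGroupoid

section Convolution

variable {EG EM G M : Type*}
  [NormedAddCommGroup EG] [NormedSpace ℝ EG] [FiniteDimensional ℝ EG]
  [NormedAddCommGroup EM] [NormedSpace ℝ EM] [FiniteDimensional ℝ EM]
  [TopologicalSpace G] [ChartedSpace EG G] [IsManifold 𝓘(ℝ, EG) ∞ G]
  [TopologicalSpace M] [ChartedSpace EM M] [IsManifold 𝓘(ℝ, EM) ∞ M]
  {Γ : LieGroupoid EG EM G M} [T2Space M] [MeasurableSpace G] [BorelSpace G]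

/-- The function `(a, b) ↦ ψ (a b⁻¹)` determined by a function on the groupoid. -/
def kernel (Γ : LieGroupoid EG EM G M) (ψ : G → ℂ) (p : G × G) : ℂ :=
  ψ (Γ.mul p.1 (Γ.inv p.2))

theorem continuousOn_mul_inv (Γ : LieGroupoid EG EM G M) :
    ContinuousOn (fun p : G × G => Γ.mul p.1 (Γ.inv p.2)) {p | Γ.src p.1 = Γ.src p.2} :=
  Γ.contMDiffOn_mul.continuousOn.comp
    (continuousOn_fst.prodMk (Γ.contMDiff_inv.continuous.comp_continuousOn continuousOn_snd))
    fun p hp => hp.trans (Γ.tgt_inv p.2).symm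

namespace Metric

variable {g : Γ.Metric}

theorem continuousOn_convIntegrand {ψ₁ ψ₂ : G → ℂ} (hψ₁ : Continuous ψ₁) (hψ₂ : Continuous ψ₂) :
    ContinuousOn (fun p : G × G => ψ₁ (Γ.mul p.1 (Γ.inv p.2)) * ψ₂ p.2)
      {p | Γ.src p.2 = Γ.src p.1} := by
  refine ContinuousOn.mul (hψ₁.comp_continuousOn (Γ.continuousOn_mul_inv.mono fun p hp => ?_))
    (hψ₂.comp_continuousOn continuousOn_snd)
  exact Eq.symm hp

theorem norm_convIntegrand_le {ψ₁ ψ₂ : G → ℂ} {C₁ C₂ m : ℝ} (h₁ : ∀ a, ‖ψ₁ a‖ ≤ C₁)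
    (h₂ : ∀ b, ‖ψ₂ b‖ ≤ C₂ * Real.exp (-m * g.dist (Γ.unit (Γ.src b)) b)) (a : G) {b : G}
    (hb : Γ.src b = Γ.src a) : ‖ψ₁ (Γ.mul a (Γ.inv b)) * ψ₂ b‖
      ≤ C₁ * C₂ * Real.exp (-m * g.dist (Γ.unit (Γ.src a)) b) := by
  rw [norm_mul, _root_.mul_assoc, ← hb]
  exact mul_le_mul (h₁ _) (h₂ b) (norm_nonneg _) ((norm_nonneg _).trans (h₁ a))

theorem integrable_convIntegrand (hE : g.ExpIntegrable) {ψ₁ ψ₂ : G → ℂ} (hψ₁ : Continuous ψ₁)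
    (hψ₂ : Continuous ψ₂) {C₁ C₂ m : ℝ} (hm : 0 < m) (h₁ : ∀ a, ‖ψ₁ a‖ ≤ C₁)
    (h₂ : ∀ b, ‖ψ₂ b‖ ≤ C₂ * Real.exp (-m * g.dist (Γ.unit (Γ.src b)) b)) (a : G) :
    Integrable (fun b => ψ₁ (Γ.mul a (Γ.inv b)) * ψ₂ b) (g.fiberVolume (Γ.src a)) := by
  obtain ⟨C, -, hC⟩ := hE m hm
  have hint := ((hC (Γ.unit (Γ.src a))).1).const_mul (C₁ * C₂)
  rw [Γ.src_unit] at hint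
  refine hint.mono' (aestronglyMeasurable_of_continuousOn ?_)
    ((ae_mem_fiber _).mono fun b hb => norm_convIntegrand_le h₁ h₂ a hb)
  exact (continuousOn_convIntegrand hψ₁ hψ₂).comp (continuousOn_const.prodMk continuousOn_id)
    fun b hb => hb

/-- By `exists_compact_ball` the points at distance less than `R` from the units lie in a compact
set. A cutoff equal to one there gives continuous integrals, and as `R` grows the error tends to
zero uniformly in `a`. -/
theorem continuous_conv [CompactSpace M] [T2Space G] [SecondCountableTopology G]
    (hc : ∀ x, IsPreconnected (Γ.fiber x)) (hE : g.ExpIntegrable) {ψ₁ ψ₂ : G → ℂ}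
    (hψ₁ : Continuous ψ₁) (hψ₂ : Continuous ψ₂) {C₁ C₂ m : ℝ} (hm : 0 < m)
    (h₁ : ∀ a, ‖ψ₁ a‖ ≤ C₁)
    (h₂ : ∀ b, ‖ψ₂ b‖ ≤ C₂ * Real.exp (-m * g.dist (Γ.unit (Γ.src b)) b)) :
    Continuous (g.conv ψ₁ ψ₂) := by
  have : IsManifold 𝓘(ℝ, EG) 1 G := IsManifold.of_le (n := ∞) (by simp)
  have : LocallyCompactSpace G := ChartedSpace.locallyCompactSpace EG G
  -- Half of the decay rate pays for integrability, the other half for the factor `exp (-(m / 2) R)`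
  -- in the truncation error.
  obtain ⟨C, hC0, hC⟩ := hE (m / 2) (by positivity)
  have hcont := continuousOn_convIntegrand (Γ := Γ) hψ₁ hψ₂
  refine continuous_of_uniform_approx_of_continuous fun u hu => ?_
  obtain ⟨δ, hδ, hδu⟩ := _root_.Metric.mem_uniformity_dist.1 hu
  obtain ⟨R, hR0, hR⟩ : ∃ R : ℝ, 0 < R ∧ |C₁ * C₂| * C * Real.exp (-(m / 2) * R) < δ := by
    have h1 : Tendsto (fun R : ℝ => |C₁ * C₂| * C * Real.exp (-(m / 2) * R)) atTop
        (𝓝 (|C₁ * C₂| * C * 0)) := by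
      refine Tendsto.const_mul _ (Real.tendsto_exp_atBot.comp ?_)
      exact tendsto_id.const_mul_atTop_of_neg (by linarith)
    rw [mul_zero] at h1
    obtain ⟨R, hR⟩ := ((h1.eventually (gt_mem_nhds hδ)).and (eventually_gt_atTop 0)).exists
    exact ⟨R, hR.2, hR.1⟩
  obtain ⟨K, hK, hball⟩ := exists_compact_ball g R
  obtain ⟨χ, hχ1, -, hχc, hχ01⟩ := exists_continuous_one_zero_of_isCompact hK isClosed_empty
    (disjoint_empty K)
  refine ⟨fun a => ∫ b, χ b • (ψ₁ (Γ.mul a (Γ.inv b)) * ψ₂ b) ∂g.fiberVolume (Γ.src a), ?_, ?_⟩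
  · refine continuous_integral_of_hasCompactSupport hc hE Γ.contMDiff_src.continuous
      (f := fun a b => χ b • (ψ₁ (Γ.mul a (Γ.inv b)) * ψ₂ b)) ?_ hχc ?_
    · exact (χ.continuous.comp_continuousOn continuousOn_snd).smul hcont
    · intro a b hb
      rw [image_eq_zero_of_notMem_tsupport hb, zero_smul]
  · intro a
    apply hδu
    have hfib : ContinuousOn (fun b => χ b • (ψ₁ (Γ.mul a (Γ.inv b)) * ψ₂ b))
        (Γ.fiber (Γ.src a)) := χ.continuous.continuousOn.smul
      (hcont.comp (continuousOn_const.prodMk continuousOn_id) fun b hb => hb)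
    have hi1 := integrable_convIntegrand hE hψ₁ hψ₂ hm h₁ h₂ a
    have hi2 := integrable_of_hasCompactSupport hc hE hfib hχc fun b hb => by
      rw [image_eq_zero_of_notMem_tsupport hb, zero_smul]
    rw [_root_.dist_eq_norm, conv, ← integral_sub hi1 hi2]
    have hint := ((hC (Γ.unit (Γ.src a))).1).const_mul (|C₁ * C₂| * Real.exp (-(m / 2) * R))
    have hle := (hC (Γ.unit (Γ.src a))).2
    rw [Γ.src_unit] at hint hle
    refine (norm_integral_le_of_norm_le hint ((ae_mem_fiber _).mono fun b hb => ?_)).trans_lt ?_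
    · have hsub : ψ₁ (Γ.mul a (Γ.inv b)) * ψ₂ b - χ b • (ψ₁ (Γ.mul a (Γ.inv b)) * ψ₂ b)
          = (1 - χ b) • (ψ₁ (Γ.mul a (Γ.inv b)) * ψ₂ b) := by rw [sub_smul, one_smul]
      rw [hsub, norm_smul, Real.norm_eq_abs]
      by_cases hbK : b ∈ K
      · rw [hχ1 hbK, Pi.one_apply, sub_self, abs_zero, zero_mul]
        positivity
      · have hd : R ≤ g.dist (Γ.unit (Γ.src a)) b := by
          have h3 : ENNReal.ofReal R ≤ g.edist (Γ.unit (Γ.src a)) b := by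
            rw [← hb]
            exact not_lt.1 fun h => hbK (hball b h)
          have h4 : g.edist (Γ.unit (Γ.src a)) b ≠ ⊤ :=
            edist_ne_top ((Γ.src_unit _).trans hb.symm) (hc _)
          rw [dist_eq_toReal_edist]
          exact (ENNReal.ofReal_le_iff_le_toReal h4).1 h3
        have h5 := norm_convIntegrand_le h₁ h₂ a hb
        have h6 : |1 - χ b| ≤ 1 := by
          rw [abs_le]
          constructor <;> linarith [(hχ01 b).1, (hχ01 b).2]
        calc |1 - χ b| * ‖ψ₁ (Γ.mul a (Γ.inv b)) * ψ₂ b‖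
            ≤ 1 * (|C₁ * C₂| * Real.exp (-m * g.dist (Γ.unit (Γ.src a)) b)) :=
              mul_le_mul h6 (h5.trans (mul_le_mul_of_nonneg_right (le_abs_self _)
                (Real.exp_pos _).le)) (norm_nonneg _) zero_le_one
          _ ≤ |C₁ * C₂| * Real.exp (-(m / 2) * R)
              * Real.exp (-(m / 2) * g.dist (Γ.unit (Γ.src a)) b) := by
            rw [one_mul, _root_.mul_assoc, ← Real.exp_add]
            refine mul_le_mul_of_nonneg_left (Real.exp_le_exp.2 ?_) (abs_nonneg _)
            nlinarith
    · rw [integral_const_mul]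
      calc _ ≤ |C₁ * C₂| * Real.exp (-(m / 2) * R) * C :=
            mul_le_mul_of_nonneg_left hle (by positivity)
        _ = |C₁ * C₂| * C * Real.exp (-(m / 2) * R) := by ring
        _ < δ := hR

end Metric

end Convolution

end LieGroupoid

/-! ### Calculus on the products of fibers. -/

namespace LieGroupoid

section FiberCalculus

variable {EG EM G M : Type*}
  [NormedAddCommGroup EG] [NormedSpace ℝ EG] [FiniteDimensional ℝ EG]
  [NormedAddCommGroup EM] [NormedSpace ℝ EM] [FiniteDimensional ℝ EM]
  [TopologicalSpace G] [ChartedSpace EG G] [IsManifold 𝓘(ℝ, EG) ∞ G]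
  [TopologicalSpace M] [ChartedSpace EM M] [IsManifold 𝓘(ℝ, EM) ∞ M]
  {Γ : LieGroupoid EG EM G M} [T2Space M]

/-- Smoothness on all products `G_x × G_x`. -/
def FiberSmooth (Γ : LieGroupoid EG EM G M) (h : G × G → ℂ) : Prop :=
  ∀ x, ContMDiffOn (𝓘(ℝ, EG).prod 𝓘(ℝ, EG)) 𝓘(ℝ, ℂ) ∞ h (Γ.fiber x ×ˢ Γ.fiber x)

/-- The representation of a function on `G_x × G_x` in adapted charts. -/
noncomputable def chartRep (c c' : Γ.AdaptedChart) (x : M) (h : G × G → ℂ)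
    (q : FiberModel EG EM × FiberModel EG EM) : ℂ := h (c.pt x q.1, c'.pt x q.2)

variable {c c' : Γ.AdaptedChart} {x : M} {k k' : FiberModel EG EM} {h h₁ h₂ : G × G → ℂ}

theorem FiberSmooth.contDiffAt (hh : Γ.FiberSmooth h) (hx : x ∈ (chartAt EM c.base).source)
    (hk : k ∈ c.dom x) (hx' : x ∈ (chartAt EM c'.base).source) (hk' : k' ∈ c'.dom x) :
    ContDiffAt ℝ ∞ (chartRep c c' x h) (k, k') :=
  contMDiffAt_iff_contDiffAt.1 ((AdaptedChart.contMDiffWithinAt_fiber_prod_iff hx hk hx' hk').1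
    (hh x _ ⟨AdaptedChart.src_pt hx hk, AdaptedChart.src_pt hx' hk'⟩))

theorem FiberSmooth.differentiableAt (hh : Γ.FiberSmooth h) (hx : x ∈ (chartAt EM c.base).source)
    (hk : k ∈ c.dom x) (hx' : x ∈ (chartAt EM c'.base).source) (hk' : k' ∈ c'.dom x) :
    DifferentiableAt ℝ (chartRep c c' x h) (k, k') :=
  (hh.contDiffAt hx hk hx' hk').differentiableAt (by simp)

theorem fiberSmooth_of_contDiffAt (H : ∀ (c c' : Γ.AdaptedChart) (x : M) (k k' : FiberModel EG EM),
    x ∈ (chartAt EM c.base).source → k ∈ c.dom x → x ∈ (chartAt EM c'.base).source →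
    k' ∈ c'.dom x → ContDiffAt ℝ ∞ (chartRep c c' x h) (k, k')) : Γ.FiberSmooth h := by
  rintro x ⟨a, b⟩ ⟨ha, hb⟩
  obtain ⟨c, k, -, hx, hk, hak⟩ := exists_adaptedChart_pt (Γ := Γ) a
  obtain ⟨c', k', -, hx', hk', hbk⟩ := exists_adaptedChart_pt (Γ := Γ) b
  rw [show Γ.src a = x from ha] at hx hk hak
  rw [show Γ.src b = x from hb] at hx' hk' hbk
  rw [← hak, ← hbk]
  exact (AdaptedChart.contMDiffWithinAt_fiber_prod_iff hx hk hx' hk').2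
    (contMDiffAt_iff_contDiffAt.2 (H c c' x k k' hx hk hx' hk'))

theorem FiberSmooth.continuousOn (hh : Γ.FiberSmooth h) (x : M) :
    ContinuousOn h (Γ.fiber x ×ˢ Γ.fiber x) := (hh x).continuousOn

/-- The derivative along right invariant vector fields, in adapted charts. -/
theorem lieDeriv_eq_fderiv (hh : Γ.FiberSmooth h) (hx : x ∈ (chartAt EM c.base).source)
    (hk : k ∈ c.dom x) (hx' : x ∈ (chartAt EM c'.base).source) (hk' : k' ∈ c'.dom x)
    {Z : Γ.PreSection × Γ.PreSection} (hZ : Γ.IsSection Z.1 ∧ Γ.IsSection Z.2) :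
    Γ.lieDeriv Z h (c.pt x k, c'.pt x k') = fderiv ℝ (chartRep c c' x h) (k, k')
      (c.coord (c.pt x k) (rvec Z.1 (c.pt x k)),
        c'.coord (c'.pt x k') (rvec Z.2 (c'.pt x k'))) := by
  have hs := AdaptedChart.src_pt hx hk
  have hs' := AdaptedChart.src_pt hx' hk'
  have h1 : HasMFDerivWithinAt (𝓘(ℝ, EG).prod 𝓘(ℝ, EG)) 𝓘(ℝ, ℂ) h (Γ.fiber x ×ˢ Γ.fiber x)
      (c.pt x k, c'.pt x k') _ := ((hh x (c.pt x k, c'.pt x k') ⟨hs, hs'⟩).mdifferentiableWithinAt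
        (by simp)).hasMFDerivWithinAt
  have h2 : HasMFDerivAt 𝓘(ℝ, FiberModel EG EM × FiberModel EG EM) 𝓘(ℝ, EG)
      (fun q : FiberModel EG EM × FiberModel EG EM => c.pt x q.1) (k, k')
      ((c.dpt x k).comp (ContinuousLinearMap.fst ℝ _ _)) :=
    HasMFDerivAt.comp (f := Prod.fst) (k, k') (AdaptedChart.hasMFDerivAt_pt hk)
      hasFDerivAt_fst.hasMFDerivAt
  have h3 : HasMFDerivAt 𝓘(ℝ, FiberModel EG EM × FiberModel EG EM) 𝓘(ℝ, EG)
      (fun q : FiberModel EG EM × FiberModel EG EM => c'.pt x q.2) (k, k')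
      ((c'.dpt x k').comp (ContinuousLinearMap.snd ℝ _ _)) :=
    HasMFDerivAt.comp (f := Prod.snd) (k, k') (AdaptedChart.hasMFDerivAt_pt hk')
      hasFDerivAt_snd.hasMFDerivAt
  have hnhds : (c.dom x) ×ˢ (c'.dom x) ∈ 𝓝 (k, k') :=
    prod_mem_nhds ((c.isOpen_dom x).mem_nhds hk) ((c'.isOpen_dom x).mem_nhds hk')
  have h23 : HasMFDerivWithinAt 𝓘(ℝ, FiberModel EG EM × FiberModel EG EM)
      (𝓘(ℝ, EG).prod 𝓘(ℝ, EG))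
      (fun q : FiberModel EG EM × FiberModel EG EM => (c.pt x q.1, c'.pt x q.2))
      ((c.dom x) ×ˢ (c'.dom x)) (k, k') _ := (h2.prodMk h3).hasMFDerivWithinAt
  have h4 := (HasMFDerivWithinAt.comp (k, k') h1 h23 (fun q hq => mk_mem_prod
    (AdaptedChart.src_pt hx hq.1) (AdaptedChart.src_pt hx' hq.2))).hasMFDerivAt hnhds
  set L : EG × EG →L[ℝ] ℂ := mfderivWithin (𝓘(ℝ, EG).prod 𝓘(ℝ, EG)) 𝓘(ℝ, ℂ) h
    (Γ.fiber x ×ˢ Γ.fiber x) (c.pt x k, c'.pt x k')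
  have h6 : HasFDerivAt (chartRep c c' x h) (L.comp
      (((c.dpt x k).comp (ContinuousLinearMap.fst ℝ (FiberModel EG EM) (FiberModel EG EM))).prod
        ((c'.dpt x k').comp (ContinuousLinearMap.snd ℝ (FiberModel EG EM) (FiberModel EG EM)))))
      (k, k') := hasMFDerivAt_iff_hasFDerivAt.1 h4
  rw [h6.fderiv, LieGroupoid.lieDeriv]
  have e1 := AdaptedChart.dpt_coord hk (rightInvariant_mem_vertical hZ.1 (c.pt x k))
  have e2 := AdaptedChart.dpt_coord hk' (rightInvariant_mem_vertical hZ.2 (c'.pt x k'))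
  have e3 : Γ.src ((c.pt x k, c'.pt x k') : G × G).1 = x := hs
  rw [e3]
  exact (congrArg L (Prod.ext e1 e2)).symm

/-- The derivative is taken within a product of fibers, so values at pairs with different sources
are irrelevant. The identities between kernels hold only where the sources agree. -/
theorem lieDeriv_congr {Z : Γ.PreSection × Γ.PreSection}
    (H : ∀ p : G × G, Γ.src p.1 = Γ.src p.2 → h₁ p = h₂ p) {p : G × G}
    (hp : Γ.src p.1 = Γ.src p.2) : Γ.lieDeriv Z h₁ p = Γ.lieDeriv Z h₂ p := by
  have e : mfderivWithin (𝓘(ℝ, EG).prod 𝓘(ℝ, EG)) 𝓘(ℝ, ℂ) h₁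
      (Γ.fiber (Γ.src p.1) ×ˢ Γ.fiber (Γ.src p.1)) p = mfderivWithin (𝓘(ℝ, EG).prod 𝓘(ℝ, EG))
      𝓘(ℝ, ℂ) h₂ (Γ.fiber (Γ.src p.1) ×ˢ Γ.fiber (Γ.src p.1)) p :=
    mfderivWithin_congr (fun q hq => H q (Eq.trans hq.1 (Eq.symm hq.2))) (H p hp)
  exact congrArg (fun L : EG × EG →L[ℝ] ℂ => L (_, _)) e

theorem FiberSmooth.congr (hh : Γ.FiberSmooth h₁)
    (H : ∀ p : G × G, Γ.src p.1 = Γ.src p.2 → h₁ p = h₂ p) : Γ.FiberSmooth h₂ := fun x =>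
  (hh x).congr fun q hq => (H q (Eq.trans hq.1 (Eq.symm hq.2))).symm

theorem fiberSmooth_zero : Γ.FiberSmooth (fun _ => 0) := fun _ => contMDiffOn_const

theorem FiberSmooth.add (hh₁ : Γ.FiberSmooth h₁) (hh₂ : Γ.FiberSmooth h₂) :
    Γ.FiberSmooth (fun p => h₁ p + h₂ p) := fun x => (hh₁ x).add (hh₂ x)

theorem FiberSmooth.sub (hh₁ : Γ.FiberSmooth h₁) (hh₂ : Γ.FiberSmooth h₂) :
    Γ.FiberSmooth (fun p => h₁ p - h₂ p) := fun x => (hh₁ x).sub (hh₂ x)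

theorem fiberSmooth_sum {ι : Type*} (s : Finset ι) {f : ι → G × G → ℂ}
    (hf : ∀ i ∈ s, Γ.FiberSmooth (f i)) : Γ.FiberSmooth (fun p => ∑ i ∈ s, f i p) := by
  classical
  induction s using Finset.induction_on with
  | empty => simpa using fiberSmooth_zero
  | insert i s hi ih =>
    simp only [Finset.sum_insert hi]
    exact (hf i (Finset.mem_insert_self i s)).add
      (ih fun j hj => hf j (Finset.mem_insert_of_mem hj))

theorem exists_charts {p : G × G} (hp : Γ.src p.1 = Γ.src p.2) :
    ∃ (c c' : Γ.AdaptedChart) (x : M) (k k' : FiberModel EG EM),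
      x ∈ (chartAt EM c.base).source ∧ k ∈ c.dom x ∧ x ∈ (chartAt EM c'.base).source ∧
      k' ∈ c'.dom x ∧ p = (c.pt x k, c'.pt x k') := by
  obtain ⟨c, k, -, hx, hk, hak⟩ := exists_adaptedChart_pt (Γ := Γ) p.1
  obtain ⟨c', k', -, hx', hk', hbk⟩ := exists_adaptedChart_pt (Γ := Γ) p.2
  rw [← hp] at hx' hk' hbk
  exact ⟨c, c', _, k, k', hx, hk, hx', hk', Prod.ext hak.symm hbk.symm⟩

theorem lieDeriv_add (hh₁ : Γ.FiberSmooth h₁) (hh₂ : Γ.FiberSmooth h₂)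
    {Z : Γ.PreSection × Γ.PreSection} (hZ : Γ.IsSection Z.1 ∧ Γ.IsSection Z.2) {p : G × G}
    (hp : Γ.src p.1 = Γ.src p.2) :
    Γ.lieDeriv Z (fun p => h₁ p + h₂ p) p = Γ.lieDeriv Z h₁ p + Γ.lieDeriv Z h₂ p := by
  obtain ⟨c, c', x, k, k', hx, hk, hx', hk', rfl⟩ := exists_charts hp
  rw [lieDeriv_eq_fderiv (hh₁.add hh₂) hx hk hx' hk' hZ, lieDeriv_eq_fderiv hh₁ hx hk hx' hk' hZ,
    lieDeriv_eq_fderiv hh₂ hx hk hx' hk' hZ]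
  have e : fderiv ℝ (chartRep c c' x fun p => h₁ p + h₂ p) (k, k')
      = fderiv ℝ (chartRep c c' x h₁) (k, k') + fderiv ℝ (chartRep c c' x h₂) (k, k') :=
    fderiv_add (hh₁.differentiableAt hx hk hx' hk') (hh₂.differentiableAt hx hk hx' hk')
  rw [e]
  rfl

theorem lieDeriv_zero {Z : Γ.PreSection × Γ.PreSection}
    (hZ : Γ.IsSection Z.1 ∧ Γ.IsSection Z.2) {p : G × G}
    (hp : Γ.src p.1 = Γ.src p.2) : Γ.lieDeriv Z (fun _ => 0) p = 0 := by
  obtain ⟨c, c', x, k, k', hx, hk, hx', hk', rfl⟩ := exists_charts hp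
  rw [lieDeriv_eq_fderiv fiberSmooth_zero hx hk hx' hk' hZ]
  have e : fderiv ℝ (chartRep c c' x fun _ => 0) (k, k') = 0 := fderiv_const_apply 0
  rw [e]
  rfl

theorem lieDeriv_sum {ι : Type*} (s : Finset ι) {f : ι → G × G → ℂ}
    (hf : ∀ i ∈ s, Γ.FiberSmooth (f i)) {Z : Γ.PreSection × Γ.PreSection}
    (hZ : Γ.IsSection Z.1 ∧ Γ.IsSection Z.2) {p : G × G} (hp : Γ.src p.1 = Γ.src p.2) :
    Γ.lieDeriv Z (fun p => ∑ i ∈ s, f i p) p = ∑ i ∈ s, Γ.lieDeriv Z (f i) p := by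
  classical
  induction s using Finset.induction_on with
  | empty => simpa using lieDeriv_zero hZ hp
  | insert i s hi ih =>
    simp only [Finset.sum_insert hi]
    rw [lieDeriv_add (hf i (Finset.mem_insert_self i s))
      (fiberSmooth_sum s fun j hj => hf j (Finset.mem_insert_of_mem hj)) hZ hp,
      ih fun j hj => hf j (Finset.mem_insert_of_mem hj)]

theorem FiberSmooth.lieDeriv (hh : Γ.FiberSmooth h) {Z : Γ.PreSection × Γ.PreSection}
    (hZ : Γ.IsSection Z.1 ∧ Γ.IsSection Z.2) : Γ.FiberSmooth (Γ.lieDeriv Z h) := by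
  refine fiberSmooth_of_contDiffAt fun c c' x k k' hx hk hx' hk' => ?_
  have hX : ∀ (c : Γ.AdaptedChart) (k : FiberModel EG EM) (X : Γ.PreSection), Γ.IsSection X →
      k ∈ c.dom x →
      ContDiffAt ℝ ∞ (fun k => c.coord (c.pt x k) (rvec X (c.pt x k))) k := by
    intro c k X hX hk
    exact contMDiffAt_iff_contDiffAt.1 (ContMDiffAt.comp k (contMDiffAt_coord_rightInvariant hX
      (AdaptedChart.pt_mem hk)) (AdaptedChart.contMDiffAt_pt hk))
  have h1 : ContDiffAt ℝ ∞ (fderiv ℝ (chartRep c c' x h)) (k, k') :=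
    (hh.contDiffAt hx hk hx' hk').fderiv_right (by simp)
  have h2 := h1.clm_apply ((ContDiffAt.comp (f := Prod.fst) (k, k') (hX c k Z.1 hZ.1 hk)
    contDiffAt_fst).prodMk (ContDiffAt.comp (f := Prod.snd) (k, k') (hX c' k' Z.2 hZ.2 hk')
    contDiffAt_snd))
  refine h2.congr_of_eventuallyEq ?_
  filter_upwards [prod_mem_nhds ((c.isOpen_dom x).mem_nhds hk) ((c'.isOpen_dom x).mem_nhds hk')]
    with q hq
  exact lieDeriv_eq_fderiv hh hx hq.1 hx' hq.2 hZ

/-- Right invariant vector fields span the tangent spaces of the fibers, with smooth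
coefficients. -/
theorem exists_coordFrame (hx : x ∈ (chartAt EM c.base).source) (hk : k ∈ c.dom x) :
    ∃ (E : Fin (Module.finrank ℝ EG - Module.finrank ℝ EM) → Γ.PreSection)
      (m : FiberModel EG EM → Fin (Module.finrank ℝ EG - Module.finrank ℝ EM) →
        FiberModel EG EM →L[ℝ] ℝ),
      (∀ j, Γ.IsSection (E j)) ∧ (∀ j, ContDiffAt ℝ ∞ (fun l => m l j) k) ∧
      ∀ᶠ l in 𝓝 k, l ∈ c.dom x ∧ ∀ w, w = ∑ j, m l j w •
        c.coord (c.pt x l) (rvec (E j) (c.pt x l)) := by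
  obtain ⟨𝓕, h𝓕⟩ := exists_localFrame (Γ := Γ) (Γ.tgt (c.pt x k))
  refine ⟨𝓕.field, fun l j => (EuclideanSpace.proj j).comp (toUnitCoord 𝓕.chart c (c.pt x l)),
    𝓕.isSection, fun j => ?_, ?_⟩
  · refine contDiffAt_const.clm_comp (contMDiffAt_iff_contDiffAt.1 ?_)
    exact ContMDiffAt.comp k (contMDiffAt_toUnitCoord (𝓕.unit_mem _ h𝓕) (AdaptedChart.pt_mem hk))
      (AdaptedChart.contMDiffAt_pt hk)
  · have h1 : ∀ᶠ l in 𝓝 k, Γ.tgt (c.pt x l) ∈ 𝓕.dom :=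
      (AdaptedChart.contMDiffAt_pt hk).continuousAt.eventually
        (Γ.contMDiff_tgt.continuous.continuousAt.eventually (𝓕.isOpen_dom.mem_nhds h𝓕))
    filter_upwards [h1, (c.isOpen_dom x).mem_nhds hk] with l hl hld
    refine ⟨hld, fun w => ?_⟩
    have hv := AdaptedChart.dpt_mem_vertical hx hld w
    have h2 := LocalFrame.sum_coeff hl (toUnit_mem_vertical hv)
    have h3 := Metric.eq_sum_rightInvariant hv h2
    have h4 : 𝓕.coeff (Γ.tgt (c.pt x l)) (Γ.toUnit (c.pt x l) (c.dpt x l w))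
        = toUnitCoord 𝓕.chart c (c.pt x l) w := by
      have := coord_toUnit (𝓕.unit_mem _ hl) (AdaptedChart.pt_mem hld) hv
      rw [AdaptedChart.coord_dpt hld] at this
      exact this
    rw [h4] at h3
    have h5 := congrArg (c.coord (c.pt x l)) h3
    rw [AdaptedChart.coord_dpt hld, map_sum] at h5
    refine h5.trans (Finset.sum_congr rfl fun j _ => ?_)
    rw [map_smul]
    rfl

theorem rvec_zero (a : G) : rvec (Γ := Γ) (fun _ => 0) a = 0 :=
  congrFun (Metric.rightInvariant_zero (Γ := Γ)) a

variable {E : Fin (Module.finrank ℝ EG - Module.finrank ℝ EM) → Γ.PreSection}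
  {m : Fin (Module.finrank ℝ EG - Module.finrank ℝ EM) → FiberModel EG EM →L[ℝ] ℝ}

/-- The coordinate derivative is expressed by derivatives along the fields `E j^r`, because
exponential bounds, uniform in `b`, are known for those. -/
theorem hasFDerivAt_left (hh : Γ.FiberSmooth h) (hx : x ∈ (chartAt EM c.base).source)
    (hk : k ∈ c.dom x) (hE : ∀ j, Γ.IsSection (E j))
    (hm : ∀ w, w = ∑ j, m j w • c.coord (c.pt x k) (rvec (E j) (c.pt x k))) {b : G}
    (hb : Γ.src b = x) :
    HasFDerivAt (fun l => h (c.pt x l, b))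
      (∑ j, (m j).smulRight (Γ.lieDeriv (E j, fun _ => 0) h (c.pt x k, b))) k := by
  subst hb
  obtain ⟨c', k', -, hx', hk', hbk⟩ := exists_adaptedChart_pt (Γ := Γ) b
  have h1 := (hh.differentiableAt hx hk hx' hk').hasFDerivAt
  have h2 : HasFDerivAt (fun l => chartRep c c' (Γ.src b) h (l, k')) _ k :=
    HasFDerivAt.comp (g := chartRep c c' (Γ.src b) h) (f := fun l => (l, k')) k h1
      ((hasFDerivAt_id k).prodMk (hasFDerivAt_const k' k))
  have h3 : (fun l => chartRep c c' (Γ.src b) h (l, k')) = fun l => h (c.pt (Γ.src b) l, b) := by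
    funext l
    rw [chartRep, hbk]
  rw [h3] at h2
  refine h2.congr_fderiv (ContinuousLinearMap.ext fun w => ?_)
  have h4 : ∀ j, Γ.lieDeriv (E j, fun _ => 0) h (c.pt (Γ.src b) k, b)
      = fderiv ℝ (chartRep c c' (Γ.src b) h) (k, k')
        (c.coord (c.pt (Γ.src b) k) (rvec (E j) (c.pt (Γ.src b) k)), 0) := by
    intro j
    have := lieDeriv_eq_fderiv (Z := (E j, fun _ => 0)) hh hx hk hx' hk' ⟨hE j, isSection_zero⟩
    rw [rvec_zero, map_zero, hbk] at this
    exact this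
  simp only [h4]
  show fderiv ℝ (chartRep c c' (Γ.src b) h) (k, k') (w, 0) = _
  have h5 : ((w, 0) : FiberModel EG EM × FiberModel EG EM) = ∑ j, m j w •
      (c.coord (c.pt (Γ.src b) k) (rvec (E j) (c.pt (Γ.src b) k)), 0) := by
    refine Prod.ext ?_ ?_
    · rw [Prod.fst_sum]
      exact hm w
    · rw [Prod.snd_sum]
      simp
  rw [h5, map_sum, _root_.sum_apply]
  refine Finset.sum_congr rfl fun j _ => ?_
  rw [map_smul]
  rfl

theorem hasFDerivAt_right (hh : Γ.FiberSmooth h) (hx : x ∈ (chartAt EM c.base).source)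
    (hk : k ∈ c.dom x) (hE : ∀ j, Γ.IsSection (E j))
    (hm : ∀ w, w = ∑ j, m j w • c.coord (c.pt x k) (rvec (E j) (c.pt x k))) {a : G}
    (ha : Γ.src a = x) :
    HasFDerivAt (fun l => h (a, c.pt x l))
      (∑ j, (m j).smulRight (Γ.lieDeriv (fun _ => 0, E j) h (a, c.pt x k))) k := by
  subst ha
  obtain ⟨c', k', -, hx', hk', hak⟩ := exists_adaptedChart_pt (Γ := Γ) a
  have h1 := (hh.differentiableAt hx' hk' hx hk).hasFDerivAt
  have h2 : HasFDerivAt (fun l => chartRep c' c (Γ.src a) h (k', l)) _ k :=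
    HasFDerivAt.comp (g := chartRep c' c (Γ.src a) h) (f := fun l => (k', l)) k h1
      ((hasFDerivAt_const k' k).prodMk (hasFDerivAt_id k))
  have h3 : (fun l => chartRep c' c (Γ.src a) h (k', l)) = fun l => h (a, c.pt (Γ.src a) l) := by
    funext l
    rw [chartRep, hak]
  rw [h3] at h2
  refine h2.congr_fderiv (ContinuousLinearMap.ext fun w => ?_)
  have h4 : ∀ j, Γ.lieDeriv (fun _ => 0, E j) h (a, c.pt (Γ.src a) k)
      = fderiv ℝ (chartRep c' c (Γ.src a) h) (k', k)
        (0, c.coord (c.pt (Γ.src a) k) (rvec (E j) (c.pt (Γ.src a) k))) := by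
    intro j
    have := lieDeriv_eq_fderiv (Z := (fun _ => 0, E j)) hh hx' hk' hx hk ⟨isSection_zero, hE j⟩
    rw [rvec_zero, map_zero, hak] at this
    exact this
  simp only [h4]
  show fderiv ℝ (chartRep c' c (Γ.src a) h) (k', k) (0, w) = _
  have h5 : ((0, w) : FiberModel EG EM × FiberModel EG EM) = ∑ j, m j w •
      (0, c.coord (c.pt (Γ.src a) k) (rvec (E j) (c.pt (Γ.src a) k))) := by
    refine Prod.ext ?_ ?_
    · rw [Prod.fst_sum]
      simp
    · rw [Prod.snd_sum]
      exact hm w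
  rw [h5, map_sum, _root_.sum_apply]
  refine Finset.sum_congr rfl fun j _ => ?_
  rw [map_smul]
  rfl

end FiberCalculus

end LieGroupoid

/-! ### Differentiation under the integral sign. -/

namespace LieGroupoid

theorem norm_comp_fst_le {V V' : Type*} [NormedAddCommGroup V] [NormedSpace ℝ V]
    [NormedAddCommGroup V'] [NormedSpace ℝ V'] (u : V →L[ℝ] ℝ) :
    ‖u.comp (ContinuousLinearMap.fst ℝ V V')‖ ≤ ‖u‖ :=
  (ContinuousLinearMap.opNorm_comp_le _ _).trans
    (mul_le_of_le_one_right (norm_nonneg _) (ContinuousLinearMap.norm_fst_le _ _ _))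

theorem norm_comp_snd_le {V V' : Type*} [NormedAddCommGroup V] [NormedSpace ℝ V]
    [NormedAddCommGroup V'] [NormedSpace ℝ V'] (u : V' →L[ℝ] ℝ) :
    ‖u.comp (ContinuousLinearMap.snd ℝ V V')‖ ≤ ‖u‖ :=
  (ContinuousLinearMap.opNorm_comp_le _ _).trans
    (mul_le_of_le_one_right (norm_nonneg _) (ContinuousLinearMap.norm_snd_le _ _ _))

theorem integral_sum_clm_add {W ι α : Type*} [NormedAddCommGroup W] [NormedSpace ℝ W]
    [CompleteSpace W] [Fintype ι] [MeasurableSpace α] {μ : Measure α} (L₁ L₂ : ι → ℂ →L[ℝ] W) {p r : ι → α → ℂ}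
    (hp : ∀ j, Integrable (p j) μ) (hr : ∀ j, Integrable (r j) μ) :
    Integrable (fun b => ∑ j, L₁ j (p j b) + ∑ j, L₂ j (r j b)) μ ∧
    ∫ b, (∑ j, L₁ j (p j b) + ∑ j, L₂ j (r j b)) ∂μ
      = ∑ j, L₁ j (∫ b, p j b ∂μ) + ∑ j, L₂ j (∫ b, r j b ∂μ) := by
  have h1 : ∀ j, Integrable (fun b => L₁ j (p j b)) μ := fun j => (L₁ j).integrable_comp (hp j)
  have h2 : ∀ j, Integrable (fun b => L₂ j (r j b)) μ := fun j => (L₂ j).integrable_comp (hr j)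
  have h3 : Integrable (fun b => ∑ j, L₁ j (p j b)) μ := integrable_finsetSum _ fun j _ => h1 j
  have h4 : Integrable (fun b => ∑ j, L₂ j (r j b)) μ := integrable_finsetSum _ fun j _ => h2 j
  refine ⟨h3.add h4, ?_⟩
  rw [integral_add h3 h4, integral_finsetSum _ fun j _ => h1 j,
    integral_finsetSum _ fun j _ => h2 j]
  exact congrArg₂ (· + ·)
    (Finset.sum_congr rfl fun j _ => (L₁ j).integral_comp_comm (hp j))
    (Finset.sum_congr rfl fun j _ => (L₂ j).integral_comp_comm (hr j))

/-- Differentiation of `∫ P q.1 b * Q q.2 b` under the integral sign. -/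
theorem hasFDerivAt_integral_mul {V V' ι α : Type*} [NormedAddCommGroup V] [NormedSpace ℝ V]
    [NormedAddCommGroup V'] [NormedSpace ℝ V'] [Fintype ι] [MeasurableSpace α] {μ : Measure α}
    {P : V → α → ℂ} {Q : V' → α → ℂ} {P' : ι → V → α → ℂ} {Q' : ι → V' → α → ℂ}
    {u : V → ι → V →L[ℝ] ℝ} {u' : V' → ι → V' →L[ℝ] ℝ} {k : V} {k' : V'} {S : Set α}
    {φ : α → ℝ} {C : ℝ} (hS : ∀ᵐ b ∂μ, b ∈ S) (hC : 0 ≤ C) (hφ0 : ∀ b, 0 ≤ φ b)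
    (hφ : Integrable φ μ)
    (hu : ∀ j, ContinuousAt (fun l => u l j) k) (hu' : ∀ j, ContinuousAt (fun l => u' l j) k')
    (hPm : ∀ᶠ l in 𝓝 k, AEStronglyMeasurable (P l) μ)
    (hQm : ∀ᶠ l in 𝓝 k', AEStronglyMeasurable (Q l) μ)
    (hPm' : ∀ j, AEStronglyMeasurable (P' j k) μ) (hQm' : ∀ j, AEStronglyMeasurable (Q' j k') μ)
    (hP : ∀ᶠ l in 𝓝 k, ∀ b ∈ S, HasFDerivAt (fun l => P l b) (∑ j, (u l j).smulRight (P' j l b)) l)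
    (hQ : ∀ᶠ l in 𝓝 k', ∀ b ∈ S,
      HasFDerivAt (fun l => Q l b) (∑ j, (u' l j).smulRight (Q' j l b)) l)
    (hPb : ∀ᶠ l in 𝓝 k, ∀ b ∈ S, ‖P l b‖ ≤ C * φ b ∧ ∀ j, ‖P' j l b‖ ≤ C * φ b)
    (hQb : ∀ᶠ l in 𝓝 k', ∀ b ∈ S, ‖Q l b‖ ≤ C ∧ ∀ j, ‖Q' j l b‖ ≤ C) :
    (∀ j, Integrable (fun b => P' j k b * Q k' b) μ) ∧
    (∀ j, Integrable (fun b => P k b * Q' j k' b) μ) ∧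
    HasFDerivAt (fun q : V × V' => ∫ b, P q.1 b * Q q.2 b ∂μ)
      (∑ j, ((u k j).comp (ContinuousLinearMap.fst ℝ V V')).smulRight (∫ b, P' j k b * Q k' b ∂μ)
        + ∑ j, ((u' k' j).comp (ContinuousLinearMap.snd ℝ V V')).smulRight
          (∫ b, P k b * Q' j k' b ∂μ)) (k, k') := by
  have hprod : ∀ {f₁ f₂ : α → ℂ}, AEStronglyMeasurable f₁ μ → AEStronglyMeasurable f₂ μ →
      (∀ b ∈ S, ‖f₁ b‖ ≤ C * φ b) → (∀ b ∈ S, ‖f₂ b‖ ≤ C) →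
      Integrable (fun b => f₁ b * f₂ b) μ := by
    intro f₁ f₂ h1 h2 h3 h4
    refine (hφ.const_mul (C * C)).mono' (h1.mul h2) (hS.mono fun b hb => ?_)
    rw [norm_mul]
    calc _ ≤ C * φ b * C := mul_le_mul (h3 b hb) (h4 b hb) (norm_nonneg _)
          (mul_nonneg hC (hφ0 b))
      _ = _ := by ring
  have hPk := hPb.self_of_nhds
  have hQk := hQb.self_of_nhds
  have hi1 : ∀ j, Integrable (fun b => P' j k b * Q k' b) μ := fun j =>
    hprod (hPm' j) hQm.self_of_nhds (fun b hb => (hPk b hb).2 j) fun b hb => (hQk b hb).1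
  have hi2 : ∀ j, Integrable (fun b => P k b * Q' j k' b) μ := fun j =>
    hprod hPm.self_of_nhds (hQm' j) (fun b hb => (hPk b hb).1) fun b hb => (hQk b hb).2 j
  refine ⟨hi1, hi2, ?_⟩
  -- The derivative of the integrand is a finite sum of continuous linear maps, independent of `b`,
  -- applied to scalar functions of `b`; the integral can be moved inside them.
  set L₁ : ι → V × V' → ℂ →L[ℝ] V × V' →L[ℝ] ℂ := fun j q =>
    ContinuousLinearMap.smulRightL ℝ (V × V') ℂ ((u q.1 j).comp (ContinuousLinearMap.fst ℝ V V'))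
    with hL₁
  set L₂ : ι → V × V' → ℂ →L[ℝ] V × V' →L[ℝ] ℂ := fun j q =>
    ContinuousLinearMap.smulRightL ℝ (V × V') ℂ ((u' q.2 j).comp (ContinuousLinearMap.snd ℝ V V'))
    with hL₂
  set f' : V × V' → α → V × V' →L[ℝ] ℂ := fun q b =>
    ∑ j, L₁ j q (P' j q.1 b * Q q.2 b) + ∑ j, L₂ j q (P q.1 b * Q' j q.2 b) with hf'
  obtain ⟨hif, hint⟩ := integral_sum_clm_add (fun j => L₁ j (k, k')) (fun j => L₂ j (k, k'))
    hi1 hi2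
  suffices HasFDerivAt (fun q : V × V' => ∫ b, P q.1 b * Q q.2 b ∂μ) (∫ b, f' (k, k') b ∂μ)
      (k, k') by
    exact this.congr_fderiv hint
  -- Only finitely many coefficients occur, so continuity at `k` bounds all of them on one
  -- neighbourhood.
  have hubd : ∀ᶠ l in 𝓝 k, ∀ j, ‖u l j‖ < ‖u k j‖ + 1 :=
    eventually_all.2 fun j => (hu j).norm.eventually (gt_mem_nhds (lt_add_one _))
  have hubd' : ∀ᶠ l in 𝓝 k', ∀ j, ‖u' l j‖ < ‖u' k' j‖ + 1 :=
    eventually_all.2 fun j => (hu' j).norm.eventually (gt_mem_nhds (lt_add_one _))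
  refine hasFDerivAt_integral_of_dominated_of_fderiv_le
    (bound := fun b => (∑ j, (‖u k j‖ + 1) * (C * C) + ∑ j, (‖u' k' j‖ + 1) * (C * C)) * φ b)
    (prod_mem_nhds ((hP.and hPb).and hubd) ((hQ.and hQb).and hubd')) ?_ ?_ ?_ ?_
    (hφ.const_mul _) ?_
  · filter_upwards [prod_mem_nhds hPm hQm] with q hq using hq.1.mul hq.2
  · exact hprod hPm.self_of_nhds hQm.self_of_nhds (fun b hb => (hPk b hb).1)
      fun b hb => (hQk b hb).1
  · exact hif.aestronglyMeasurable
  · refine hS.mono fun b hb q hq => ?_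
    obtain ⟨⟨⟨-, h1⟩, h2⟩, ⟨-, h3⟩, h4⟩ := hq
    refine (norm_add_le _ _).trans ?_
    rw [add_mul, Finset.sum_mul, Finset.sum_mul]
    have hpr : ∀ {z w : ℂ}, ‖z‖ ≤ C * φ b → ‖w‖ ≤ C → ‖z * w‖ ≤ C * C * φ b := by
      intro z w hz hw
      rw [norm_mul]
      calc _ ≤ C * φ b * C := mul_le_mul hz hw (norm_nonneg _) (mul_nonneg hC (hφ0 b))
        _ = _ := by ring
    refine add_le_add ((norm_sum_le _ _).trans (Finset.sum_le_sum fun j _ => ?_))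
      ((norm_sum_le _ _).trans (Finset.sum_le_sum fun j _ => ?_))
    · rw [hL₁]
      show ‖ContinuousLinearMap.smulRight _ _‖ ≤ _
      rw [ContinuousLinearMap.norm_smulRight_apply, _root_.mul_assoc]
      exact mul_le_mul ((norm_comp_fst_le _).trans (h2 j).le)
        (hpr ((h1 b hb).2 j) (h3 b hb).1) (norm_nonneg _) (by positivity)
    · rw [hL₂]
      show ‖ContinuousLinearMap.smulRight _ _‖ ≤ _
      rw [ContinuousLinearMap.norm_smulRight_apply, _root_.mul_assoc]
      exact mul_le_mul ((norm_comp_snd_le _).trans (h4 j).le)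
        (hpr (h1 b hb).1 ((h3 b hb).2 j)) (norm_nonneg _) (by positivity)
  · refine hS.mono fun b hb q hq => ?_
    obtain ⟨⟨⟨h1, -⟩, -⟩, ⟨h3, -⟩, -⟩ := hq
    have d3 := HasFDerivAt.mul (HasFDerivAt.comp (f := Prod.fst) q (h1 b hb) hasFDerivAt_fst)
      (HasFDerivAt.comp (f := Prod.snd) q (h3 b hb) hasFDerivAt_snd)
    refine HasFDerivAt.congr_fderiv d3 (ContinuousLinearMap.ext fun w => ?_)
    simp only [hf', hL₁, hL₂, Function.comp_apply, _root_.add_apply, _root_.sum_apply,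
      ContinuousLinearMap.smulRight_apply, ContinuousLinearMap.comp_apply,
      ContinuousLinearMap.coe_fst', ContinuousLinearMap.coe_snd', _root_.smul_apply,
      smul_eq_mul, Finset.mul_sum, Complex.real_smul, ContinuousLinearMap.smulRightL_apply_apply]
    rw [add_comm]
    refine congrArg₂ (· + ·) (Finset.sum_congr rfl fun j _ => ?_)
      (Finset.sum_congr rfl fun j _ => ?_) <;> ring

/-! ### Composition of decaying kernels: bounds, smoothness, Leibniz rule. -/

section Star

variable {EG EM G M : Type*}
  [NormedAddCommGroup EG] [NormedSpace ℝ EG] [FiniteDimensional ℝ EG]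
  [NormedAddCommGroup EM] [NormedSpace ℝ EM] [FiniteDimensional ℝ EM]
  [TopologicalSpace G] [ChartedSpace EG G] [IsManifold 𝓘(ℝ, EG) ∞ G]
  [TopologicalSpace M] [ChartedSpace EM M] [IsManifold 𝓘(ℝ, EM) ∞ M]
  {Γ : LieGroupoid EG EM G M} [T2Space M]

namespace Metric

/-- Smooth functions on the products `G_x × G_x` that decay exponentially together with all their
iterated derivatives along right invariant vector fields. -/
def Decays (g : Γ.Metric) (m : ℝ) (h : G × G → ℂ) : Prop :=
  ∃ 𝓢 : (G × G → ℂ) → Prop, 𝓢 h ∧ (∀ f, 𝓢 f → Γ.FiberSmooth f) ∧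
    (∀ f, 𝓢 f → ∃ C : ℝ, 0 ≤ C ∧ ∀ a b, Γ.src a = Γ.src b →
      ‖f (a, b)‖ ≤ C * Real.exp (-m * g.dist a b)) ∧
    ∀ f, 𝓢 f → ∀ Z : Γ.PreSection × Γ.PreSection, Γ.IsSection Z.1 ∧ Γ.IsSection Z.2 →
      𝓢 (Γ.lieDeriv Z f)

variable {g : Γ.Metric} {m : ℝ} {h h₁ h₂ : G × G → ℂ}

theorem Decays.fiberSmooth (hh : g.Decays m h) : Γ.FiberSmooth h := by
  obtain ⟨𝓢, h1, h2, -, -⟩ := hh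
  exact h2 h h1

theorem Decays.bound (hh : g.Decays m h) : ∃ C : ℝ, 0 ≤ C ∧ ∀ a b, Γ.src a = Γ.src b →
    ‖h (a, b)‖ ≤ C * Real.exp (-m * g.dist a b) := by
  obtain ⟨𝓢, h1, -, h3, -⟩ := hh
  exact h3 h h1

/-- The class required in `Decays` is itself closed under Lie derivatives, so the same class serves
for the derivative and no count of orders is needed. -/
theorem Decays.lieDeriv (hh : g.Decays m h) {Z : Γ.PreSection × Γ.PreSection}
    (hZ : Γ.IsSection Z.1 ∧ Γ.IsSection Z.2) : g.Decays m (Γ.lieDeriv Z h) := by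
  obtain ⟨𝓢, h1, h2, h3, h4⟩ := hh
  exact ⟨𝓢, h4 h h1 Z hZ, h2, h3, h4⟩

variable [MeasurableSpace G] [BorelSpace G]

/-- The composition of kernels on the fibers. -/
noncomputable def star (g : Γ.Metric) (h₁ h₂ : G × G → ℂ) (p : G × G) : ℂ :=
  ∫ b, h₁ (p.1, b) * h₂ (b, p.2) ∂g.fiberVolume (Γ.src p.1)

theorem star_eq {x : M} {a b : G} (ha : Γ.src a = x) :
    g.star h₁ h₂ (a, b) = ∫ d, h₁ (a, d) * h₂ (d, b) ∂g.fiberVolume x := by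
  subst ha
  rfl

/-- With `d(a, b) ≤ d(a, d) + d(d, b)`, the part `ε'` of the rate yields `exp (-ε' d(a, b))` and the
rest `m - ε'` makes the integral over `d` converge. The constant depends on `m - ε'` only, not on
the kernels or the points. -/
theorem norm_star_le (hc : ∀ x, IsPreconnected (Γ.fiber x)) (hE : g.ExpIntegrable) {ε' : ℝ}
    (hε' : 0 ≤ ε') (hm : ε' < m) : ∃ C : ℝ, 0 ≤ C ∧ ∀ (h₁ h₂ : G × G → ℂ) (B₁ B₂ : ℝ) (a b : G),
      0 ≤ B₁ → 0 ≤ B₂ → Γ.src a = Γ.src b →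
      (∀ d, Γ.src a = Γ.src d → ‖h₁ (a, d)‖ ≤ B₁ * Real.exp (-m * g.dist a d)) →
      (∀ d, Γ.src d = Γ.src b → ‖h₂ (d, b)‖ ≤ B₂ * Real.exp (-m * g.dist d b)) →
      ‖g.star h₁ h₂ (a, b)‖ ≤ C * (B₁ * B₂) * Real.exp (-ε' * g.dist a b) := by
  obtain ⟨C, hC0, hC⟩ := hE (m - ε') (by linarith)
  refine ⟨C, hC0, fun h₁ h₂ B₁ B₂ a b hB₁ hB₂ hab H₁ H₂ => ?_⟩
  have hint := ((hC a).1).const_mul (B₁ * B₂ * Real.exp (-ε' * g.dist a b))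
  refine (norm_integral_le_of_norm_le hint ((ae_mem_fiber _).mono fun d hd => ?_)).trans ?_
  · have had : Γ.src a = Γ.src d := hd.symm
    have hdb : Γ.src d = Γ.src b := had.symm.trans hab
    have htri := dist_triangle (g := g) hc had hdb
    have h0 := dist_nonneg (g := g) d b
    rw [norm_mul]
    refine (mul_le_mul (H₁ d had) (H₂ d hdb) (norm_nonneg _) (by positivity)).trans ?_
    have e1 : B₁ * Real.exp (-m * g.dist a d) * (B₂ * Real.exp (-m * g.dist d b))
        = B₁ * B₂ * Real.exp (-m * g.dist a d + -m * g.dist d b) := by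
      rw [Real.exp_add]
      ring
    have e2 : B₁ * B₂ * Real.exp (-ε' * g.dist a b) * Real.exp (-(m - ε') * g.dist a d)
        = B₁ * B₂ * Real.exp (-ε' * g.dist a b + -(m - ε') * g.dist a d) := by
      rw [Real.exp_add]
      ring
    rw [e1, e2]
    refine mul_le_mul_of_nonneg_left (Real.exp_le_exp.2 ?_) (by positivity)
    nlinarith
  · rw [integral_const_mul]
    calc _ ≤ B₁ * B₂ * Real.exp (-ε' * g.dist a b) * C :=
          mul_le_mul_of_nonneg_left (hC a).2 (by positivity)
      _ = _ := by ring

/-- Decay of the first kernel gives integrability; of the second only boundedness is used. -/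
theorem integrable_star (hE : g.ExpIntegrable) (hm : 0 < m)
    (hh₁ : g.Decays m h₁) (hh₂ : g.Decays m h₂) {a b : G} {x : M} (ha : Γ.src a = x)
    (hb : Γ.src b = x) :
    Integrable (fun d => h₁ (a, d) * h₂ (d, b)) (g.fiberVolume x) := by
  subst ha
  obtain ⟨C, -, hC⟩ := hE m hm
  obtain ⟨C₁, hC₁, H₁⟩ := hh₁.bound
  obtain ⟨C₂, hC₂, H₂⟩ := hh₂.bound
  refine (((hC a).1).const_mul (C₁ * C₂)).mono' (aestronglyMeasurable_of_continuousOn ?_)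
    ((ae_mem_fiber _).mono fun d hd => ?_)
  · refine ContinuousOn.mul ?_ ?_
    · exact (hh₁.fiberSmooth.continuousOn (Γ.src a)).comp
        (continuousOn_const.prodMk continuousOn_id) fun d hd => mk_mem_prod rfl hd
    · exact (hh₂.fiberSmooth.continuousOn (Γ.src a)).comp
        (continuousOn_id.prodMk continuousOn_const) fun d hd => mk_mem_prod hd hb
  · rw [norm_mul]
    have h1 := H₁ a d hd.symm
    have h2 : ‖h₂ (d, b)‖ ≤ C₂ := (H₂ d b (hd.trans hb.symm)).trans
      (mul_le_of_le_one_right hC₂ (Real.exp_le_one_iff.2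
        (by nlinarith [dist_nonneg (g := g) d b])))
    calc _ ≤ C₁ * Real.exp (-m * g.dist a d) * C₂ :=
          mul_le_mul h1 h2 (norm_nonneg _) (by positivity)
      _ = _ := by ring

theorem star_sub_left (hE : g.ExpIntegrable) (hm : 0 < m)
    {h₁' : G × G → ℂ} (hh₁ : g.Decays m h₁) (hh₁' : g.Decays m h₁') (hh₂ : g.Decays m h₂)
    {p : G × G} (hp : Γ.src p.1 = Γ.src p.2) :
    g.star (fun p => h₁ p - h₁' p) h₂ p = g.star h₁ h₂ p - g.star h₁' h₂ p := by
  unfold star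
  rw [← integral_sub (integrable_star hE hm hh₁ hh₂ rfl hp.symm)
    (integrable_star hE hm hh₁' hh₂ rfl hp.symm)]
  simp only [sub_mul]

theorem star_sub_right (hE : g.ExpIntegrable) (hm : 0 < m)
    {h₂' : G × G → ℂ} (hh₁ : g.Decays m h₁) (hh₂ : g.Decays m h₂) (hh₂' : g.Decays m h₂')
    {p : G × G} (hp : Γ.src p.1 = Γ.src p.2) :
    g.star h₁ (fun p => h₂ p - h₂' p) p = g.star h₁ h₂ p - g.star h₁ h₂' p := by
  unfold star
  rw [← integral_sub (integrable_star hE hm hh₁ hh₂ rfl hp.symm)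
    (integrable_star hE hm hh₁ hh₂' rfl hp.symm)]
  simp only [mul_sub]

theorem star_sum_left (hE : g.ExpIntegrable) (hm : 0 < m)
    {ι : Type*} (s : Finset ι) {f : ι → G × G → ℂ} (hf : ∀ i ∈ s, g.Decays m (f i))
    (hh₂ : g.Decays m h₂) {p : G × G} (hp : Γ.src p.1 = Γ.src p.2) :
    g.star (fun p => ∑ i ∈ s, f i p) h₂ p = ∑ i ∈ s, g.star (f i) h₂ p := by
  unfold star
  rw [← integral_finsetSum _ fun i hi => integrable_star hE hm (hf i hi) hh₂ rfl hp.symm]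
  simp only [Finset.sum_mul]

theorem star_sum_right (hE : g.ExpIntegrable) (hm : 0 < m)
    {ι : Type*} (s : Finset ι) {f : ι → G × G → ℂ} (hf : ∀ i ∈ s, g.Decays m (f i))
    (hh₁ : g.Decays m h₁) {p : G × G} (hp : Γ.src p.1 = Γ.src p.2) :
    g.star h₁ (fun p => ∑ i ∈ s, f i p) p = ∑ i ∈ s, g.star h₁ (f i) p := by
  unfold star
  rw [← integral_finsetSum _ fun i hi => integrable_star hE hm hh₁ (hf i hi) rfl hp.symm]
  simp only [Finset.mul_sum]

theorem eventually_dist_pt_lt (hc : ∀ x, IsPreconnected (Γ.fiber x)) {c : Γ.AdaptedChart} {x : M}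
    {k : FiberModel EG EM} (hx : x ∈ (chartAt EM c.base).source) (hk : k ∈ c.dom x) :
    ∀ᶠ l in 𝓝 k, g.dist (c.pt x k) (c.pt x l) < 1 := by
  have hs := AdaptedChart.src_pt hx hk
  have h1 := continuousOn_dist (g := g) hc (c.pt x k) (c.pt x k) rfl
  have h2 : Tendsto (c.pt x) (𝓝 k) (𝓝[Γ.fiber (Γ.src (c.pt x k))] (c.pt x k)) := by
    refine tendsto_nhdsWithin_iff.2 ⟨(AdaptedChart.contMDiffAt_pt hk).continuousAt, ?_⟩
    filter_upwards [(c.isOpen_dom x).mem_nhds hk] with l hl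
    exact (AdaptedChart.src_pt hx hl).trans hs.symm
  refine (h1.tendsto.comp h2).eventually (gt_mem_nhds ?_)
  rw [dist_self]
  exact one_pos

/-- The first kernel and its derivatives are dominated by one integrable exponential as the first
point varies near `c.pt x k`, and the second kernel with its derivatives stays bounded, so
`hasFDerivAt_integral_mul` applies. -/
theorem hasFDerivAt_star (hE : g.ExpIntegrable) (hc : ∀ x, IsPreconnected (Γ.fiber x)) (hm : 0 < m)
    (hh₁ : g.Decays m h₁) (hh₂ : g.Decays m h₂) {c c' : Γ.AdaptedChart} {x : M}
    {k k' : FiberModel EG EM} (hx : x ∈ (chartAt EM c.base).source) (hk : k ∈ c.dom x)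
    (hx' : x ∈ (chartAt EM c'.base).source) (hk' : k' ∈ c'.dom x)
    {E E' : Fin (Module.finrank ℝ EG - Module.finrank ℝ EM) → Γ.PreSection}
    {u u' : FiberModel EG EM → Fin (Module.finrank ℝ EG - Module.finrank ℝ EM) →
      FiberModel EG EM →L[ℝ] ℝ}
    (hEs : ∀ j, Γ.IsSection (E j)) (hEs' : ∀ j, Γ.IsSection (E' j))
    (hu : ∀ j, ContinuousAt (fun l => u l j) k) (hu' : ∀ j, ContinuousAt (fun l => u' l j) k')
    (hev : ∀ᶠ l in 𝓝 k, l ∈ c.dom x ∧ ∀ w, w = ∑ j, u l j w •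
        c.coord (c.pt x l) (rvec (E j) (c.pt x l)))
    (hev' : ∀ᶠ l in 𝓝 k', l ∈ c'.dom x ∧ ∀ w, w = ∑ j, u' l j w •
        c'.coord (c'.pt x l) (rvec (E' j) (c'.pt x l))) :
    HasFDerivAt (chartRep c c' x (g.star h₁ h₂))
      (∑ j, ((u k j).comp (ContinuousLinearMap.fst ℝ (FiberModel EG EM)
            (FiberModel EG EM))).smulRight
          (g.star (Γ.lieDeriv (E j, fun _ => 0) h₁) h₂ (c.pt x k, c'.pt x k'))
        + ∑ j, ((u' k' j).comp (ContinuousLinearMap.snd ℝ (FiberModel EG EM)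
            (FiberModel EG EM))).smulRight
          (g.star h₁ (Γ.lieDeriv (fun _ => 0, E' j) h₂) (c.pt x k, c'.pt x k'))) (k, k') := by
  have hAd : ∀ j, g.Decays m (Γ.lieDeriv (E j, fun _ => 0) h₁) :=
    fun j => hh₁.lieDeriv ⟨hEs j, isSection_zero⟩
  have hBd : ∀ j, g.Decays m (Γ.lieDeriv (fun _ => 0, E' j) h₂) :=
    fun j => hh₂.lieDeriv ⟨isSection_zero, hEs' j⟩
  have hs := AdaptedChart.src_pt hx hk
  have hrep : chartRep c c' x (g.star h₁ h₂) =ᶠ[𝓝 (k, k')]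
      fun q => ∫ b, h₁ (c.pt x q.1, b) * h₂ (b, c'.pt x q.2) ∂g.fiberVolume x := by
    filter_upwards [(continuousAt_fst (p := (k, k'))).eventually
      ((c.isOpen_dom x).mem_nhds hk)] with q hq
    exact star_eq (AdaptedChart.src_pt hx hq)
  refine HasFDerivAt.congr_of_eventuallyEq ?_ hrep
  simp only [star_eq hs]
  obtain ⟨D, -, hD⟩ := hE m hm
  obtain ⟨C₁, hC₁, H₁⟩ := hh₁.bound
  obtain ⟨C₂, hC₂, H₂⟩ := hh₂.bound
  choose CA hCA HA using fun j => (hAd j).bound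
  choose CB hCB HB using fun j => (hBd j).bound
  have hSA : 0 ≤ ∑ j, CA j := Finset.sum_nonneg fun j _ => hCA j
  have hSB : 0 ≤ ∑ j, CB j := Finset.sum_nonneg fun j _ => hCB j
  have hjA : ∀ j, CA j ≤ ∑ j, CA j := fun j =>
    Finset.single_le_sum (fun j _ => hCA j) (Finset.mem_univ j)
  have hjB : ∀ j, CB j ≤ ∑ j, CB j := fun j =>
    Finset.single_le_sum (fun j _ => hCB j) (Finset.mem_univ j)
  have hem : 0 < Real.exp m := Real.exp_pos m
  -- Moving the first point by a distance less than one costs at most the factor `exp m`; this gives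
  -- a majorant centred at the fixed point.
  have hexp : ∀ᶠ l in 𝓝 k, ∀ b ∈ Γ.fiber x, Γ.src (c.pt x l) = x ∧
      Real.exp (-m * g.dist (c.pt x l) b) ≤ Real.exp m * Real.exp (-m * g.dist (c.pt x k) b) := by
    filter_upwards [(c.isOpen_dom x).mem_nhds hk, eventually_dist_pt_lt (g := g) hc hx hk]
      with l hl hd b hb
    have htri := dist_triangle (g := g) hc (a := c.pt x k) (b := c.pt x l) (c := b)
      (hs.trans (AdaptedChart.src_pt hx hl).symm) ((AdaptedChart.src_pt hx hl).trans (Eq.symm hb))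
    refine ⟨AdaptedChart.src_pt hx hl, ?_⟩
    rw [← Real.exp_add]
    refine Real.exp_le_exp.2 ?_
    nlinarith
  have hleft : ∀ {f : G × G → ℂ} {a : G}, g.Decays m f → Γ.src a = x →
      AEStronglyMeasurable (fun b => f (a, b)) (g.fiberVolume x) := fun hf ha =>
    aestronglyMeasurable_of_continuousOn ((hf.fiberSmooth.continuousOn x).comp
      (continuousOn_const.prodMk continuousOn_id) fun d hd => mk_mem_prod ha hd)
  have hright : ∀ {f : G × G → ℂ} {a : G}, g.Decays m f → Γ.src a = x →
      AEStronglyMeasurable (fun b => f (b, a)) (g.fiberVolume x) := fun hf ha =>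
    aestronglyMeasurable_of_continuousOn ((hf.fiberSmooth.continuousOn x).comp
      (continuousOn_id.prodMk continuousOn_const) fun d hd => mk_mem_prod hd ha)
  have hDint := (hD (c.pt x k)).1
  rw [hs] at hDint
  have hdom := (c.isOpen_dom x).mem_nhds hk
  have hdom' := (c'.isOpen_dom x).mem_nhds hk'
  have hs' := AdaptedChart.src_pt hx' hk'
  refine (hasFDerivAt_integral_mul (μ := g.fiberVolume x) (S := Γ.fiber x)
    (P := fun l b => h₁ (c.pt x l, b)) (Q := fun l b => h₂ (b, c'.pt x l))
    (P' := fun j l b => Γ.lieDeriv (E j, fun _ => 0) h₁ (c.pt x l, b))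
    (Q' := fun j l b => Γ.lieDeriv (fun _ => 0, E' j) h₂ (b, c'.pt x l))
    (C := (C₁ + ∑ j, CA j) * Real.exp m + C₂ + ∑ j, CB j)
    (φ := fun b => Real.exp (-m * g.dist (c.pt x k) b)) (ae_mem_fiber x) (by positivity)
    (fun b => (Real.exp_pos _).le) hDint hu hu' ?_ ?_ (fun j => hleft (hAd j) hs)
    (fun j => hright (hBd j) hs') ?_ ?_ ?_ ?_).2.2
  · filter_upwards [hdom] with l hl using hleft hh₁ (AdaptedChart.src_pt hx hl)
  · filter_upwards [hdom'] with l hl using hright hh₂ (AdaptedChart.src_pt hx' hl)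
  · filter_upwards [hev] with l hl b hb
    exact hasFDerivAt_left hh₁.fiberSmooth hx hl.1 hEs hl.2 hb
  · filter_upwards [hev'] with l hl b hb
    exact hasFDerivAt_right hh₂.fiberSmooth hx' hl.1 hEs' hl.2 hb
  · filter_upwards [hexp] with l hl b hb
    obtain ⟨h1, h2⟩ := hl b hb
    have key : ∀ {C' : ℝ} {z : ℂ}, 0 ≤ C' → C' ≤ C₁ + ∑ j, CA j →
        ‖z‖ ≤ C' * Real.exp (-m * g.dist (c.pt x l) b) →
        ‖z‖ ≤ ((C₁ + ∑ j, CA j) * Real.exp m + C₂ + ∑ j, CB j)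
          * Real.exp (-m * g.dist (c.pt x k) b) := by
      intro C' z h3 h4 h5
      calc ‖z‖ ≤ C' * Real.exp (-m * g.dist (c.pt x l) b) := h5
        _ ≤ C' * (Real.exp m * Real.exp (-m * g.dist (c.pt x k) b)) :=
          mul_le_mul_of_nonneg_left h2 h3
        _ = C' * Real.exp m * Real.exp (-m * g.dist (c.pt x k) b) := by ring
        _ ≤ _ := by
          refine mul_le_mul_of_nonneg_right ?_ (Real.exp_pos _).le
          nlinarith
    exact ⟨key hC₁ (by linarith) (H₁ _ _ (h1.trans (Eq.symm hb))),
      fun j => key (hCA j) (by linarith [hjA j]) (HA j _ _ (h1.trans (Eq.symm hb)))⟩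
  · filter_upwards [hdom'] with l hl b hb
    have h1 := AdaptedChart.src_pt hx' hl
    have key : ∀ {C' : ℝ} {z : ℂ}, 0 ≤ C' → C' ≤ C₂ + ∑ j, CB j →
        ‖z‖ ≤ C' * Real.exp (-m * g.dist b (c'.pt x l)) →
        ‖z‖ ≤ (C₁ + ∑ j, CA j) * Real.exp m + C₂ + ∑ j, CB j := by
      intro C' z h3 h4 h5
      have h6 : C' * Real.exp (-m * g.dist b (c'.pt x l)) ≤ C' :=
        mul_le_of_le_one_right h3 (Real.exp_le_one_iff.2
          (by nlinarith [dist_nonneg (g := g) b (c'.pt x l)]))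
      nlinarith
    exact ⟨key hC₂ (by linarith) (H₂ _ _ (Eq.trans hb h1.symm)),
      fun j => key (hCB j) (by linarith [hjB j]) (HB j _ _ (Eq.trans hb h1.symm))⟩

/-- Induction on the order, for all pairs of kernels at once: the derivative of a composition is a
combination, with smooth coefficients, of compositions of decaying kernels. -/
theorem contDiffAt_star (hE : g.ExpIntegrable) (hc : ∀ x, IsPreconnected (Γ.fiber x)) (hm : 0 < m)
    (n : ℕ) {c c' : Γ.AdaptedChart} {x : M} {k k' : FiberModel EG EM}
    (hx : x ∈ (chartAt EM c.base).source) (hk : k ∈ c.dom x)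
    (hx' : x ∈ (chartAt EM c'.base).source) (hk' : k' ∈ c'.dom x) :
    ∀ {h₁ h₂ : G × G → ℂ}, g.Decays m h₁ → g.Decays m h₂ →
      ContDiffAt ℝ n (chartRep c c' x (g.star h₁ h₂)) (k, k') := by
  obtain ⟨E, u, hEs, hu, hev⟩ := exists_coordFrame (Γ := Γ) hx hk
  obtain ⟨E', u', hEs', hu', hev'⟩ := exists_coordFrame (Γ := Γ) hx' hk'
  -- Smoothness of finite order persists near `k`; continuity at the nearby points is needed to
  -- apply `hasFDerivAt_star` there.
  have hcont : ∀ {k : FiberModel EG EM} {v : FiberModel EG EM →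
      Fin (Module.finrank ℝ EG - Module.finrank ℝ EM) → FiberModel EG EM →L[ℝ] ℝ},
      (∀ j, ContDiffAt ℝ ∞ (fun l => v l j) k) → ∀ᶠ l in 𝓝 k, ∀ j,
        ContinuousAt (fun l => v l j) l := fun hv => eventually_all.2 fun j =>
    (((hv j).of_le (show (1 : ℕ∞ω) ≤ ∞ by simp)).eventually (by simp)).mono
      fun l hl => hl.continuousAt
  have hder : ∀ {h₁ h₂ : G × G → ℂ}, g.Decays m h₁ → g.Decays m h₂ →
      ∀ᶠ q in 𝓝 (k, k'), HasFDerivAt (chartRep c c' x (g.star h₁ h₂))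
      (∑ j, ((u q.1 j).comp (ContinuousLinearMap.fst ℝ (FiberModel EG EM)
            (FiberModel EG EM))).smulRight
          (chartRep c c' x (g.star (Γ.lieDeriv (E j, fun _ => 0) h₁) h₂) q)
        + ∑ j, ((u' q.2 j).comp (ContinuousLinearMap.snd ℝ (FiberModel EG EM)
            (FiberModel EG EM))).smulRight
          (chartRep c c' x (g.star h₁ (Γ.lieDeriv (fun _ => 0, E' j) h₂)) q)) q := by
    intro h₁ h₂ hh₁ hh₂
    filter_upwards [prod_mem_nhds (hev.eventually_nhds.and (hcont hu))
      (hev'.eventually_nhds.and (hcont hu'))] with q hq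
    exact hasFDerivAt_star hE hc hm hh₁ hh₂ hx hq.1.1.self_of_nhds.1 hx' hq.2.1.self_of_nhds.1
      hEs hEs' hq.1.2 hq.2.2 hq.1.1 hq.2.1
  induction n with
  | zero =>
    intro h₁ h₂ hh₁ hh₂
    obtain ⟨s, hs, H⟩ := (hder hh₁ hh₂).exists_mem
    exact contDiffAt_zero.2 ⟨s, hs, fun q hq => (H q hq).continuousAt.continuousWithinAt⟩
  | succ n ih =>
    intro h₁ h₂ hh₁ hh₂
    obtain ⟨s, hs, H⟩ := (hder hh₁ hh₂).exists_mem
    have hn : ((n : ℕ) : ℕ∞ω) ≤ ∞ := by exact_mod_cast le_top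
    push_cast
    refine contDiffAt_succ_iff_hasFDerivAt.2 ⟨_, ⟨s, hs, H⟩, ?_⟩
    refine (ContDiffAt.sum fun j _ => ?_).add (ContDiffAt.sum fun j _ => ?_)
    · refine ContDiffAt.smulRight (ContDiffAt.clm_comp ?_ contDiffAt_const)
        (ih (hh₁.lieDeriv ⟨hEs j, isSection_zero⟩) hh₂)
      exact ContDiffAt.comp (f := Prod.fst) (k, k') ((hu j).of_le hn) contDiffAt_fst
    · refine ContDiffAt.smulRight (ContDiffAt.clm_comp ?_ contDiffAt_const)
        (ih hh₁ (hh₂.lieDeriv ⟨isSection_zero, hEs' j⟩))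
      exact ContDiffAt.comp (f := Prod.snd) (k, k') ((hu' j).of_le hn) contDiffAt_snd

theorem fiberSmooth_star (hE : g.ExpIntegrable) (hc : ∀ x, IsPreconnected (Γ.fiber x)) (hm : 0 < m)
    (hh₁ : g.Decays m h₁) (hh₂ : g.Decays m h₂) : Γ.FiberSmooth (g.star h₁ h₂) :=
  fiberSmooth_of_contDiffAt fun _ _ _ _ _ hx hk hx' hk' =>
    contDiffAt_infty.2 fun n => contDiffAt_star hE hc hm n hx hk hx' hk' hh₁ hh₂

/-- The derivative is linear in the coordinate vector. The coefficients depend on the first point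
alone, so they are constants for the integration over `b` in `lieDeriv_star`. -/
theorem lieDeriv_left_eq_sum (hh : Γ.FiberSmooth h) {c : Γ.AdaptedChart} {x : M}
    {k : FiberModel EG EM} (hx : x ∈ (chartAt EM c.base).source) (hk : k ∈ c.dom x)
    {E : Fin (Module.finrank ℝ EG - Module.finrank ℝ EM) → Γ.PreSection}
    {u : Fin (Module.finrank ℝ EG - Module.finrank ℝ EM) → FiberModel EG EM →L[ℝ] ℝ}
    (hE : ∀ j, Γ.IsSection (E j))
    (hu : ∀ w, w = ∑ j, u j w • c.coord (c.pt x k) (rvec (E j) (c.pt x k)))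
    {X : Γ.PreSection} (hX : Γ.IsSection X) {b : G} (hb : Γ.src b = x) :
    Γ.lieDeriv (X, fun _ => 0) h (c.pt x k, b)
      = ∑ j, u j (c.coord (c.pt x k) (rvec X (c.pt x k))) •
        Γ.lieDeriv (E j, fun _ => 0) h (c.pt x k, b) := by
  subst hb
  obtain ⟨c', k', -, hx', hk', hbk⟩ := exists_adaptedChart_pt (Γ := Γ) b
  have h4 : ∀ Y, Γ.IsSection Y → Γ.lieDeriv (Y, fun _ => 0) h (c.pt (Γ.src b) k, b)
      = fderiv ℝ (chartRep c c' (Γ.src b) h) (k, k')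
        (c.coord (c.pt (Γ.src b) k) (rvec Y (c.pt (Γ.src b) k)), 0) := by
    intro Y hY
    have := lieDeriv_eq_fderiv (Z := (Y, fun _ => 0)) hh hx hk hx' hk' ⟨hY, isSection_zero⟩
    rw [rvec_zero, map_zero, hbk] at this
    exact this
  rw [h4 X hX]
  simp only [h4 _ (hE _)]
  set w := c.coord (c.pt (Γ.src b) k) (rvec X (c.pt (Γ.src b) k))
  have h5 : ((w, 0) : FiberModel EG EM × FiberModel EG EM) = ∑ j, u j w •
      (c.coord (c.pt (Γ.src b) k) (rvec (E j) (c.pt (Γ.src b) k)), 0) := by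
    refine Prod.ext ?_ ?_
    · rw [Prod.fst_sum]
      exact hu w
    · rw [Prod.snd_sum]
      simp
  rw [h5, map_sum]
  exact Finset.sum_congr rfl fun j _ => map_smul _ _ _

theorem lieDeriv_right_eq_sum (hh : Γ.FiberSmooth h) {c : Γ.AdaptedChart} {x : M}
    {k : FiberModel EG EM} (hx : x ∈ (chartAt EM c.base).source) (hk : k ∈ c.dom x)
    {E : Fin (Module.finrank ℝ EG - Module.finrank ℝ EM) → Γ.PreSection}
    {u : Fin (Module.finrank ℝ EG - Module.finrank ℝ EM) → FiberModel EG EM →L[ℝ] ℝ}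
    (hE : ∀ j, Γ.IsSection (E j))
    (hu : ∀ w, w = ∑ j, u j w • c.coord (c.pt x k) (rvec (E j) (c.pt x k)))
    {X : Γ.PreSection} (hX : Γ.IsSection X) {b : G} (hb : Γ.src b = x) :
    Γ.lieDeriv (fun _ => 0, X) h (b, c.pt x k)
      = ∑ j, u j (c.coord (c.pt x k) (rvec X (c.pt x k))) •
        Γ.lieDeriv (fun _ => 0, E j) h (b, c.pt x k) := by
  subst hb
  obtain ⟨c', k', -, hx', hk', hbk⟩ := exists_adaptedChart_pt (Γ := Γ) b
  have h4 : ∀ Y, Γ.IsSection Y → Γ.lieDeriv (fun _ => 0, Y) h (b, c.pt (Γ.src b) k)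
      = fderiv ℝ (chartRep c' c (Γ.src b) h) (k', k)
        (0, c.coord (c.pt (Γ.src b) k) (rvec Y (c.pt (Γ.src b) k))) := by
    intro Y hY
    have := lieDeriv_eq_fderiv (Z := (fun _ => 0, Y)) hh hx' hk' hx hk ⟨isSection_zero, hY⟩
    rw [rvec_zero, map_zero, hbk] at this
    exact this
  rw [h4 X hX]
  simp only [h4 _ (hE _)]
  set w := c.coord (c.pt (Γ.src b) k) (rvec X (c.pt (Γ.src b) k))
  have h5 : ((0, w) : FiberModel EG EM × FiberModel EG EM) = ∑ j, u j w •
      (0, c.coord (c.pt (Γ.src b) k) (rvec (E j) (c.pt (Γ.src b) k))) := by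
    refine Prod.ext ?_ ?_
    · rw [Prod.fst_sum]
      simp
    · rw [Prod.snd_sum]
      exact hu w
  rw [h5, map_sum]
  exact Finset.sum_congr rfl fun j _ => map_smul _ _ _

/-- The Leibniz rule for the composition of kernels. -/
theorem lieDeriv_star (hE : g.ExpIntegrable) (hc : ∀ x, IsPreconnected (Γ.fiber x)) (hm : 0 < m)
    (hh₁ : g.Decays m h₁) (hh₂ : g.Decays m h₂) {Z : Γ.PreSection × Γ.PreSection}
    (hZ : Γ.IsSection Z.1 ∧ Γ.IsSection Z.2) {p : G × G} (hp : Γ.src p.1 = Γ.src p.2) :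
    Γ.lieDeriv Z (g.star h₁ h₂) p = g.star (Γ.lieDeriv (Z.1, fun _ => 0) h₁) h₂ p
      + g.star h₁ (Γ.lieDeriv (fun _ => 0, Z.2) h₂) p := by
  obtain ⟨c, c', x, k, k', hx, hk, hx', hk', rfl⟩ := exists_charts hp
  obtain ⟨E, u, hEs, hu, hev⟩ := exists_coordFrame (Γ := Γ) hx hk
  obtain ⟨E', u', hEs', hu', hev'⟩ := exists_coordFrame (Γ := Γ) hx' hk'
  have hs := AdaptedChart.src_pt hx hk
  have hs' := AdaptedChart.src_pt hx' hk'
  rw [lieDeriv_eq_fderiv (fiberSmooth_star hE hc hm hh₁ hh₂) hx hk hx' hk' hZ,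
    (hasFDerivAt_star hE hc hm hh₁ hh₂ hx hk hx' hk' hEs hEs' (fun j => (hu j).continuousAt)
      (fun j => (hu' j).continuousAt) hev hev').fderiv]
  rw [_root_.add_apply, _root_.sum_apply, _root_.sum_apply]
  have hAd : ∀ j, g.Decays m (Γ.lieDeriv (E j, fun _ => 0) h₁) :=
    fun j => hh₁.lieDeriv ⟨hEs j, isSection_zero⟩
  have hBd : ∀ j, g.Decays m (Γ.lieDeriv (fun _ => 0, E' j) h₂) :=
    fun j => hh₂.lieDeriv ⟨isSection_zero, hEs' j⟩
  simp only [ContinuousLinearMap.smulRight_apply, ContinuousLinearMap.comp_apply,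
    ContinuousLinearMap.coe_fst', ContinuousLinearMap.coe_snd', star_eq hs]
  refine congrArg₂ (· + ·) ?_ ?_
  · simp only [← integral_smul]
    have hi : ∀ j, Integrable (fun b => u k j (c.coord (c.pt x k) (rvec Z.1 (c.pt x k))) •
        (Γ.lieDeriv (E j, fun _ => 0) h₁ (c.pt x k, b) * h₂ (b, c'.pt x k')))
        (g.fiberVolume x) := fun j => (integrable_star hE hm (hAd j) hh₂ hs hs').smul
      (u k j (c.coord (c.pt x k) (rvec Z.1 (c.pt x k))))
    rw [← integral_finsetSum Finset.univ fun j _ => hi j]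
    refine integral_congr_ae ((ae_mem_fiber x).mono fun b hb => ?_)
    show _ = Γ.lieDeriv (Z.1, fun _ => 0) h₁ (c.pt x k, b) * h₂ (b, c'.pt x k')
    rw [lieDeriv_left_eq_sum hh₁.fiberSmooth hx hk hEs hev.self_of_nhds.2 hZ.1 hb, Finset.sum_mul]
    exact Finset.sum_congr rfl fun j _ => (smul_mul_assoc _ _ _).symm
  · simp only [← integral_smul]
    have hi : ∀ j, Integrable (fun b => u' k' j (c'.coord (c'.pt x k') (rvec Z.2 (c'.pt x k'))) •
        (h₁ (c.pt x k, b) * Γ.lieDeriv (fun _ => 0, E' j) h₂ (b, c'.pt x k')))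
        (g.fiberVolume x) := fun j => (integrable_star hE hm hh₁ (hBd j) hs hs').smul
      (u' k' j (c'.coord (c'.pt x k') (rvec Z.2 (c'.pt x k'))))
    rw [← integral_finsetSum Finset.univ fun j _ => hi j]
    refine integral_congr_ae ((ae_mem_fiber x).mono fun b hb => ?_)
    show _ = h₁ (c.pt x k, b) * Γ.lieDeriv (fun _ => 0, Z.2) h₂ (b, c'.pt x k')
    rw [lieDeriv_right_eq_sum hh₂.fiberSmooth hx' hk' hEs' hev'.self_of_nhds.2 hZ.2 hb,
      Finset.mul_sum]
    exact Finset.sum_congr rfl fun j _ => (mul_smul_comm _ _ _).symm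

end Metric

end Star

end LieGroupoid

/-! ### Covariant derivatives of a composition. -/

namespace LieGroupoid

section Covariant

variable {EG EM G M : Type*}
  [NormedAddCommGroup EG] [NormedSpace ℝ EG] [FiniteDimensional ℝ EG]
  [NormedAddCommGroup EM] [NormedSpace ℝ EM] [FiniteDimensional ℝ EM]
  [TopologicalSpace G] [ChartedSpace EG G] [IsManifold 𝓘(ℝ, EG) ∞ G]
  [TopologicalSpace M] [ChartedSpace EM M] [IsManifold 𝓘(ℝ, EM) ∞ M]
  {Γ : LieGroupoid EG EM G M} [T2Space M]

namespace Metric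

variable {g : Γ.Metric} {m : ℝ} {F F₁ F₂ h₁ h₂ : G × G → ℂ}

theorem isSection_update {l : ℕ} {W : Fin l → Γ.PreSection × Γ.PreSection}
    (hW : ∀ i, Γ.IsSection (W i).1 ∧ Γ.IsSection (W i).2) (k : Fin l)
    {Z : Γ.PreSection × Γ.PreSection} (hZ : Γ.IsSection Z.1 ∧ Γ.IsSection Z.2) (i : Fin l) :
    Γ.IsSection (Function.update W k (g.nabla Z.1 (W k).1, g.nabla Z.2 (W k).2) i).1 ∧
      Γ.IsSection (Function.update W k (g.nabla Z.1 (W k).1, g.nabla Z.2 (W k).2) i).2 := by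
  by_cases h : i = k
  · subst h
    rw [Function.update_self]
    exact ⟨isSection_nabla hZ.1 (hW i).1, isSection_nabla hZ.2 (hW i).2⟩
  · rw [Function.update_of_ne h]
    exact hW i

theorem fiberSmooth_covDeriv (hF : Γ.FiberSmooth F) (l : ℕ) :
    ∀ {Z : Fin l → Γ.PreSection × Γ.PreSection},
      (∀ i, Γ.IsSection (Z i).1 ∧ Γ.IsSection (Z i).2) → Γ.FiberSmooth (g.covDeriv F l Z) := by
  induction l with
  | zero => exact fun _ => hF
  | succ l ih =>
    intro Z hZ
    have ht : ∀ i, Γ.IsSection (Fin.tail Z i).1 ∧ Γ.IsSection (Fin.tail Z i).2 := fun i => hZ i.succ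
    exact ((ih ht).lieDeriv (hZ 0)).sub
      (fiberSmooth_sum Finset.univ fun k _ => ih (isSection_update ht k (hZ 0)))

theorem covDeriv_congr (H : ∀ p : G × G, Γ.src p.1 = Γ.src p.2 → F₁ p = F₂ p) (l : ℕ) :
    ∀ (Z : Fin l → Γ.PreSection × Γ.PreSection) (p : G × G), Γ.src p.1 = Γ.src p.2 →
      g.covDeriv F₁ l Z p = g.covDeriv F₂ l Z p := by
  induction l with
  | zero => exact fun _ p hp => H p hp
  | succ l ih =>
    intro Z p hp
    exact congrArg₂ (· - ·) (lieDeriv_congr (ih _) hp) (Finset.sum_congr rfl fun k _ => ih _ p hp)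

/-- Sums of iterated covariant derivatives. -/
inductive CovSpan (g : Γ.Metric) (F : G × G → ℂ) : (G × G → ℂ) → Prop
  | base (l : ℕ) (Z : Fin l → Γ.PreSection × Γ.PreSection)
      (hZ : ∀ i, Γ.IsSection (Z i).1 ∧ Γ.IsSection (Z i).2) : CovSpan g F (g.covDeriv F l Z)
  | zero : CovSpan g F (fun _ => 0)
  | add {h₁ h₂ : G × G → ℂ} (hh₁ : CovSpan g F h₁) (hh₂ : CovSpan g F h₂) :
      CovSpan g F (fun p => h₁ p + h₂ p)
  | congr {h₁ h₂ : G × G → ℂ} (hh₁ : CovSpan g F h₁)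
      (H : ∀ p : G × G, Γ.src p.1 = Γ.src p.2 → h₁ p = h₂ p) : CovSpan g F h₂

theorem CovSpan.sum {ι : Type*} (s : Finset ι) {f : ι → G × G → ℂ}
    (hf : ∀ i ∈ s, g.CovSpan F (f i)) : g.CovSpan F (fun p => ∑ i ∈ s, f i p) := by
  classical
  induction s using Finset.induction_on with
  | empty => simpa using CovSpan.zero
  | insert i s hi ih =>
    simp only [Finset.sum_insert hi]
    exact (hf i (Finset.mem_insert_self i s)).add
      (ih fun j hj => hf j (Finset.mem_insert_of_mem hj))

theorem CovSpan.fiberSmooth (hF : Γ.FiberSmooth F) {h : G × G → ℂ} (hh : g.CovSpan F h) :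
    Γ.FiberSmooth h := by
  induction hh with
  | base l Z hZ => exact fiberSmooth_covDeriv hF l hZ
  | zero => exact fiberSmooth_zero
  | add _ _ ih₁ ih₂ => exact ih₁.add ih₂
  | congr _ H ih => exact ih.congr H

/-- In the recursion for `covDeriv` the Lie derivative of `∇̃^l F` is `∇̃^(l+1) F` plus the
corrections, and both belong to the span. -/
theorem CovSpan.lieDeriv (hF : Γ.FiberSmooth F) {Z : Γ.PreSection × Γ.PreSection}
    (hZ : Γ.IsSection Z.1 ∧ Γ.IsSection Z.2) {h : G × G → ℂ} (hh : g.CovSpan F h) :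
    g.CovSpan F (Γ.lieDeriv Z h) := by
  induction hh with
  | base l W hW =>
    have h1 : g.CovSpan F (g.covDeriv F (l + 1) (Fin.cons Z W)) :=
      CovSpan.base _ _ fun i => by
        refine Fin.cases ?_ (fun j => ?_) i
        · simpa using hZ
        · simpa using hW j
    have h2 : g.CovSpan F (fun p => ∑ k : Fin l, g.covDeriv F l
        (Function.update W k (g.nabla Z.1 (W k).1, g.nabla Z.2 (W k).2)) p) :=
      CovSpan.sum Finset.univ fun k _ => CovSpan.base l _ (isSection_update (g := g) hW k hZ)
    refine (h1.add h2).congr fun p _ => ?_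
    exact sub_add_cancel _ _
  | zero => exact CovSpan.zero.congr fun p hp => (lieDeriv_zero hZ hp).symm
  | add hh₁ hh₂ ih₁ ih₂ =>
    exact (ih₁.add ih₂).congr fun p hp =>
      (lieDeriv_add (hh₁.fiberSmooth hF) (hh₂.fiberSmooth hF) hZ hp).symm
  | congr _ H ih => exact ih.congr fun p hp => lieDeriv_congr H hp

/-- The span is closed under Lie derivatives and inherits smoothness and bounds from its generators,
so it is an admissible class in `Decays`. -/
theorem CovSpan.decays (hF : Γ.FiberSmooth F)
    (H : ∀ (l : ℕ) (Z : Fin l → Γ.PreSection × Γ.PreSection),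
      (∀ i, Γ.IsSection (Z i).1 ∧ Γ.IsSection (Z i).2) → ∃ C : ℝ, 0 ≤ C ∧ ∀ a b,
        Γ.src a = Γ.src b → ‖g.covDeriv F l Z (a, b)‖ ≤ C * Real.exp (-m * g.dist a b))
    {h : G × G → ℂ} (hh : g.CovSpan F h) : g.Decays m h := by
  refine ⟨g.CovSpan F, hh, fun f hf => hf.fiberSmooth hF, fun f hf => ?_,
    fun f hf Z hZ => hf.lieDeriv hF hZ⟩
  induction hf with
  | base l Z hZ => exact H l Z hZ
  | zero => exact ⟨0, le_rfl, fun a b _ => by simp⟩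
  | add _ _ ih₁ ih₂ =>
    obtain ⟨C₁, h1, H1⟩ := ih₁
    obtain ⟨C₂, h2, H2⟩ := ih₂
    refine ⟨C₁ + C₂, add_nonneg h1 h2, fun a b hab => (norm_add_le _ _).trans ?_⟩
    rw [add_mul]
    exact add_le_add (H1 a b hab) (H2 a b hab)
  | congr _ H' ih =>
    obtain ⟨C, h1, H1⟩ := ih
    exact ⟨C, h1, fun a b hab => by rw [← H' (a, b) hab]; exact H1 a b hab⟩

theorem Decays.zero : g.Decays m (fun _ => 0) := by
  refine ⟨fun f => ∀ p : G × G, Γ.src p.1 = Γ.src p.2 → (fun _ => 0 : G × G → ℂ) p = f p,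
    fun _ _ => rfl, fun f hf => fiberSmooth_zero.congr hf, fun f hf => ⟨0, le_rfl, fun a b hab => ?_⟩,
    fun f hf Z hZ p hp => ?_⟩
  · rw [← hf (a, b) hab]
    simp
  · rw [← lieDeriv_congr hf hp, lieDeriv_zero hZ hp]

/-- The new class consists of the functions that agree with a sum of members of the two given
classes on pairs with equal sources, as the derivative of a sum is computed only there. -/
theorem Decays.add (hh₁ : g.Decays m h₁) (hh₂ : g.Decays m h₂) :
    g.Decays m (fun p => h₁ p + h₂ p) := by
  obtain ⟨𝓢, a1, a2, a3, a4⟩ := hh₁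
  obtain ⟨𝓣, b1, b2, b3, b4⟩ := hh₂
  refine ⟨fun f => ∃ f₁ f₂, 𝓢 f₁ ∧ 𝓣 f₂ ∧ ∀ p : G × G, Γ.src p.1 = Γ.src p.2 →
    f₁ p + f₂ p = f p, ⟨h₁, h₂, a1, b1, fun _ _ => rfl⟩, ?_, ?_, ?_⟩
  · rintro f ⟨f₁, f₂, c1, c2, H⟩
    exact ((a2 _ c1).add (b2 _ c2)).congr H
  · rintro f ⟨f₁, f₂, c1, c2, H⟩
    obtain ⟨C₁, hC₁, H₁⟩ := a3 _ c1
    obtain ⟨C₂, hC₂, H₂⟩ := b3 _ c2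
    refine ⟨C₁ + C₂, add_nonneg hC₁ hC₂, fun a b hab => ?_⟩
    rw [← H (a, b) hab, add_mul]
    exact (norm_add_le _ _).trans (add_le_add (H₁ a b hab) (H₂ a b hab))
  · rintro f ⟨f₁, f₂, c1, c2, H⟩ Z hZ
    exact ⟨_, _, a4 _ c1 Z hZ, b4 _ c2 Z hZ, fun p hp =>
      (lieDeriv_add (a2 _ c1) (b2 _ c2) hZ hp).symm.trans (lieDeriv_congr H hp)⟩

theorem Decays.sum {ι : Type*} (s : Finset ι) {f : ι → G × G → ℂ}
    (hf : ∀ i ∈ s, g.Decays m (f i)) : g.Decays m (fun p => ∑ i ∈ s, f i p) := by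
  classical
  induction s using Finset.induction_on with
  | empty => simpa using Decays.zero
  | insert i s hi ih =>
    simp only [Finset.sum_insert hi]
    exact (hf i (Finset.mem_insert_self i s)).add
      (ih fun j hj => hf j (Finset.mem_insert_of_mem hj))

/-- The iterated covariant derivative along the fields selected by `s`. -/
noncomputable def covSel (g : Γ.Metric) (F : G × G → ℂ) :
    (l : ℕ) → (Fin l → Bool) → (Fin l → Γ.PreSection × Γ.PreSection) → G × G → ℂ
  | 0, _, _ => F
  | l + 1, s, Z => if s 0 then fun p =>
      Γ.lieDeriv (Z 0) (covSel g F l (Fin.tail s) (Fin.tail Z)) p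
        - ∑ k : Fin l with Fin.tail s k = true, covSel g F l (Fin.tail s)
            (Function.update (Fin.tail Z) k
              (g.nabla (Z 0).1 (Fin.tail Z k).1, g.nabla (Z 0).2 (Fin.tail Z k).2)) p
    else covSel g F l (Fin.tail s) (Fin.tail Z)

/-- Derivatives and corrections run over selected indices only, so the other fields never enter. -/
theorem covSel_congr (l : ℕ) : ∀ (s : Fin l → Bool) (Z Z' : Fin l → Γ.PreSection × Γ.PreSection),
    (∀ i, s i = true → Z i = Z' i) → g.covSel F l s Z = g.covSel F l s Z' := by
  induction l with
  | zero => exact fun _ _ _ _ => rfl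
  | succ l ih =>
    intro s Z Z' h
    have ht : ∀ i, Fin.tail s i = true → Fin.tail Z i = Fin.tail Z' i := fun i hi => h i.succ hi
    have h0 := ih (Fin.tail s) _ _ ht
    by_cases hs : s 0 = true
    · simp only [covSel, hs, if_true]
      funext p
      rw [h0, h 0 hs]
      refine congrArg₂ (· - ·) rfl (Finset.sum_congr rfl fun k hk => ?_)
      have hk' := (Finset.mem_filter.1 hk).2
      rw [ht k hk']
      refine congrFun (ih _ _ _ fun i hi => ?_) p
      by_cases hik : i = k
      · subst hik
        rw [Function.update_self, Function.update_self]
      · rw [Function.update_of_ne hik, Function.update_of_ne hik, ht i hi]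
    · simp only [covSel, hs]
      exact h0

/-- Dropping the fields that are not selected turns `covSel` into an ordinary covariant derivative
of lower or equal order, since the corrections match under the enumeration `ι` of the selected
indices. Decay and bounds of `covDeriv` carry over in this way. -/
theorem exists_covSel_eq (g : Γ.Metric) (F : G × G → ℂ) (l : ℕ) : ∀ s : Fin l → Bool,
    ∃ (n : ℕ) (ι : Fin n → Fin l), Function.Injective ι ∧ (∀ i, s i = true ↔ ∃ j, ι j = i) ∧
      ∀ Z, g.covSel F l s Z = g.covDeriv F n (Z ∘ ι) := by
  induction l with
  | zero => exact fun s => ⟨0, id, Function.injective_id, fun i => i.elim0, fun Z => rfl⟩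
  | succ l ih =>
    intro s
    obtain ⟨n, ι, hι, hs, H⟩ := ih (Fin.tail s)
    by_cases h0 : s 0 = true
    · refine ⟨n + 1, Fin.cons 0 (Fin.succ ∘ ι), ?_, fun i => ?_, fun Z => ?_⟩
      · rw [Fin.cons_injective_iff]
        refine ⟨?_, (Fin.succ_injective l).comp hι⟩
        rintro ⟨j, hj⟩
        exact Fin.succ_ne_zero _ hj
      · refine Fin.cases ?_ (fun i => ?_) i
        · exact ⟨fun _ => ⟨0, rfl⟩, fun _ => h0⟩
        · refine (hs i).trans ⟨fun ⟨j, hj⟩ => ⟨j.succ, ?_⟩, fun ⟨j, hj⟩ => ?_⟩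
          · rw [Fin.cons_succ, Function.comp_apply, hj]
          · revert hj
            refine Fin.cases (fun hj => ?_) (fun j hj => ⟨j, ?_⟩) j
            · exact absurd hj.symm (Fin.succ_ne_zero i)
            · rw [Fin.cons_succ] at hj
              exact Fin.succ_injective _ hj
      · simp only [covSel, h0, if_true]
        funext p
        have hcomp : Fin.tail (Z ∘ (Fin.cons 0 (Fin.succ ∘ ι) : Fin (n + 1) → Fin (l + 1)))
            = Fin.tail Z ∘ ι := rfl
        have hz : (Z ∘ (Fin.cons 0 (Fin.succ ∘ ι) : Fin (n + 1) → Fin (l + 1))) 0 = Z 0 := rfl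
        rw [covDeriv, hcomp, hz, H]
        refine congrArg₂ (· - ·) rfl ?_
        have hfil : (Finset.univ.filter fun k => Fin.tail s k = true) = Finset.univ.image ι := by
          ext i
          simp [hs]
        rw [hfil, Finset.sum_image fun i _ j _ hij => hι hij]
        refine Finset.sum_congr rfl fun k _ => ?_
        rw [H]
        congr 1
        exact (Function.update_comp_eq_of_injective _ hι _ _)
    · refine ⟨n, Fin.succ ∘ ι, (Fin.succ_injective l).comp hι, fun i => ?_, fun Z => ?_⟩
      · refine Fin.cases ?_ (fun i => ?_) i
        · refine ⟨fun h => absurd h h0, ?_⟩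
          rintro ⟨j, hj⟩
          exact absurd hj (Fin.succ_ne_zero _)
        · refine (hs i).trans ⟨fun ⟨j, hj⟩ => ⟨j, congrArg Fin.succ hj⟩,
            fun ⟨j, hj⟩ => ⟨j, Fin.succ_injective _ hj⟩⟩
      · simp only [covSel, h0]
        exact H (Fin.tail Z)

theorem update_pair {l : ℕ} (X Y : Fin l → Γ.PreSection) (k : Fin l) (U V : Γ.PreSection) :
    Function.update (fun i => (X i, Y i)) k (U, V)
      = fun i => (Function.update X k U i, Function.update Y k V i) := by
  funext i
  by_cases h : i = k
  · subst h
    simp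
  · simp [h]

theorem isSection_update_nabla {l : ℕ} {X : Fin l → Γ.PreSection} (hX : ∀ i, Γ.IsSection (X i))
    {U : Γ.PreSection} (hU : Γ.IsSection U) (k i : Fin l) :
    Γ.IsSection (Function.update X k (g.nabla U (X k)) i) := by
  by_cases h : i = k
  · subst h
    rw [Function.update_self]
    exact isSection_nabla hU (hX i)
  · rw [Function.update_of_ne h]
    exact hX i

variable [MeasurableSpace G] [BorelSpace G]

/-- The covariant derivatives of a composition of kernels. -/
theorem covDeriv_star (hE : g.ExpIntegrable) (hc : ∀ x, IsPreconnected (Γ.fiber x)) (hm : 0 < m)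
    (hF₁ : ∀ (l : ℕ) (Z : Fin l → Γ.PreSection × Γ.PreSection),
      (∀ i, Γ.IsSection (Z i).1 ∧ Γ.IsSection (Z i).2) → g.Decays m (g.covDeriv F₁ l Z))
    (hF₂ : ∀ (l : ℕ) (Z : Fin l → Γ.PreSection × Γ.PreSection),
      (∀ i, Γ.IsSection (Z i).1 ∧ Γ.IsSection (Z i).2) → g.Decays m (g.covDeriv F₂ l Z)) (l : ℕ) :
    ∀ X Y : Fin l → Γ.PreSection, (∀ i, Γ.IsSection (X i)) → (∀ i, Γ.IsSection (Y i)) →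
      ∀ p : G × G, Γ.src p.1 = Γ.src p.2 →
      g.covDeriv (g.star F₁ F₂) l (fun i => (X i, Y i)) p
        = ∑ s : Fin l → Bool, g.star (g.covSel F₁ l s fun i => (X i, fun _ => 0))
          (g.covSel F₂ l (fun i => !s i) fun i => (fun _ => 0, Y i)) p := by
  have hd₁ : ∀ (l : ℕ) (s : Fin l → Bool) (X : Fin l → Γ.PreSection), (∀ i, Γ.IsSection (X i)) →
      g.Decays m (g.covSel F₁ l s fun i => (X i, fun _ => 0)) := by
    intro l s X hX
    obtain ⟨n, ι, -, -, H⟩ := exists_covSel_eq g F₁ l s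
    rw [H]
    exact hF₁ n _ fun i => ⟨hX _, isSection_zero⟩
  have hd₂ : ∀ (l : ℕ) (s : Fin l → Bool) (X : Fin l → Γ.PreSection), (∀ i, Γ.IsSection (X i)) →
      g.Decays m (g.covSel F₂ l s fun i => (fun _ => 0, X i)) := by
    intro l s X hX
    obtain ⟨n, ι, -, -, H⟩ := exists_covSel_eq g F₂ l s
    rw [H]
    exact hF₂ n _ fun i => ⟨isSection_zero, hX _⟩
  induction l with
  | zero =>
    intro X Y _ _ p _
    rw [Fintype.sum_unique]
    rfl
  | succ l ih =>
    intro X Y hX hY p hp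
    have hX' : ∀ i, Γ.IsSection (Fin.tail X i) := fun i => hX i.succ
    have hY' : ∀ i, Γ.IsSection (Fin.tail Y i) := fun i => hY i.succ
    set A : (Fin l → Bool) → (Fin l → Γ.PreSection) → G × G → ℂ := fun s X =>
      g.covSel F₁ l s fun i => (X i, fun _ => 0) with hA
    set B : (Fin l → Bool) → (Fin l → Γ.PreSection) → G × G → ℂ := fun s Y =>
      g.covSel F₂ l (fun i => !s i) fun i => (fun _ => 0, Y i) with hB
    set UX : Fin l → Fin l → Γ.PreSection := fun k =>
      Function.update (Fin.tail X) k (g.nabla (X 0) (Fin.tail X k)) with hUX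
    set UY : Fin l → Fin l → Γ.PreSection := fun k =>
      Function.update (Fin.tail Y) k (g.nabla (Y 0) (Fin.tail Y k)) with hUY
    have hUXs : ∀ k i, Γ.IsSection (UX k i) := fun k i => isSection_update_nabla hX' (hX 0) k i
    have hUYs : ∀ k i, Γ.IsSection (UY k i) := fun k i => isSection_update_nabla hY' (hY 0) k i
    -- A correction in an index assigned to one kernel leaves the derivative of the other kernel
    -- unchanged.
    have hAX : ∀ s k, s k = false → A s (UX k) = A s (Fin.tail X) := by
      intro s k hk
      refine covSel_congr l s _ _ fun i hi => ?_
      have hik : i ≠ k := by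
        rintro rfl
        simp [hk] at hi
      simp only [hUX, Function.update_of_ne hik]
    have hBY : ∀ s k, s k = true → B s (UY k) = B s (Fin.tail Y) := by
      intro s k hk
      refine covSel_congr l _ _ _ fun i hi => ?_
      have hik : i ≠ k := by
        rintro rfl
        simp [hk] at hi
      simp only [hUY, Function.update_of_ne hik]
    have hfirst : Γ.lieDeriv (X 0, Y 0) (g.covDeriv (g.star F₁ F₂) l
          (fun i => (Fin.tail X i, Fin.tail Y i))) p
        = ∑ s, (g.star (Γ.lieDeriv (X 0, fun _ => 0) (A s (Fin.tail X))) (B s (Fin.tail Y)) p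
          + g.star (A s (Fin.tail X)) (Γ.lieDeriv (fun _ => 0, Y 0) (B s (Fin.tail Y))) p) := by
      rw [lieDeriv_congr (ih _ _ hX' hY') hp, lieDeriv_sum Finset.univ (fun s _ =>
        fiberSmooth_star hE hc hm (hd₁ l s _ hX') (hd₂ l _ _ hY')) ⟨hX 0, hY 0⟩ hp]
      exact Finset.sum_congr rfl fun s _ =>
        lieDeriv_star hE hc hm (hd₁ l s _ hX') (hd₂ l _ _ hY') ⟨hX 0, hY 0⟩ hp
    have hsecond : ∀ k, g.covDeriv (g.star F₁ F₂) l (Function.update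
          (fun i => (Fin.tail X i, Fin.tail Y i)) k
          (g.nabla (X 0) (Fin.tail X k), g.nabla (Y 0) (Fin.tail Y k))) p
        = ∑ s, g.star (A s (UX k)) (B s (UY k)) p := by
      intro k
      rw [update_pair]
      exact ih _ _ (hUXs k) (hUYs k) p hp
    -- The new index is assigned to the first kernel: its derivative along `X 0` appears, with
    -- corrections for the indices assigned to this kernel before.
    have htrue : ∀ s : Fin l → Bool, g.star
        (g.covSel F₁ (l + 1) (Fin.cons true s) fun i => (X i, fun _ => 0))
        (g.covSel F₂ (l + 1) (fun i => !(Fin.cons true s : Fin (l + 1) → Bool) i)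
          fun i => (fun _ => 0, Y i)) p
        = g.star (Γ.lieDeriv (X 0, fun _ => 0) (A s (Fin.tail X))) (B s (Fin.tail Y)) p
          - ∑ k with s k = true, g.star (A s (UX k)) (B s (Fin.tail Y)) p := by
      intro s
      have e1 : g.covSel F₁ (l + 1) (Fin.cons true s) (fun i => (X i, fun _ => 0))
          = fun p => Γ.lieDeriv (X 0, fun _ => 0) (A s (Fin.tail X)) p
            - ∑ k with s k = true, A s (UX k) p := by
        simp only [covSel, Fin.cons_zero, if_true, Fin.tail_cons]
        funext p
        refine congrArg₂ (· - ·) rfl (Finset.sum_congr rfl fun k _ => ?_)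
        refine congrFun (congrArg (g.covSel F₁ l s) ?_) p
        refine (update_pair (Fin.tail X) (fun _ _ => 0) k _ _).trans ?_
        rw [nabla_zero_left]
        funext i
        exact Prod.ext rfl (congrFun (Function.update_eq_self (β := fun _ => Γ.PreSection) k
          (fun _ _ => 0)) i)
      have e2 : g.covSel F₂ (l + 1) (fun i => !(Fin.cons true s : Fin (l + 1) → Bool) i)
          (fun i => (fun _ => 0, Y i)) = B s (Fin.tail Y) := by
        simp only [covSel, Fin.cons_zero, Bool.not_true, Bool.false_eq_true, if_false]
        rfl
      rw [e1, e2, ← star_sum_left hE hm _ (fun k _ => hd₁ l s _ (hUXs k)) (hd₂ l _ _ hY') hp]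
      exact star_sub_left hE hm ((hd₁ l s _ hX').lieDeriv ⟨hX 0, isSection_zero⟩)
        (Decays.sum _ fun k _ => hd₁ l s _ (hUXs k)) (hd₂ l _ _ hY') hp
    have hfalse : ∀ s : Fin l → Bool, g.star
        (g.covSel F₁ (l + 1) (Fin.cons false s) fun i => (X i, fun _ => 0))
        (g.covSel F₂ (l + 1) (fun i => !(Fin.cons false s : Fin (l + 1) → Bool) i)
          fun i => (fun _ => 0, Y i)) p
        = g.star (A s (Fin.tail X)) (Γ.lieDeriv (fun _ => 0, Y 0) (B s (Fin.tail Y))) p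
          - ∑ k with ¬ s k = true, g.star (A s (Fin.tail X)) (B s (UY k)) p := by
      intro s
      have e1 : g.covSel F₁ (l + 1) (Fin.cons false s) (fun i => (X i, fun _ => 0))
          = A s (Fin.tail X) := by
        simp only [covSel, Fin.cons_zero, Bool.false_eq_true, if_false]
        rfl
      have e2 : g.covSel F₂ (l + 1) (fun i => !(Fin.cons false s : Fin (l + 1) → Bool) i)
          (fun i => (fun _ => 0, Y i))
          = fun p => Γ.lieDeriv (fun _ => 0, Y 0) (B s (Fin.tail Y)) p
            - ∑ k with ¬ s k = true, B s (UY k) p := by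
        have hfil : (Finset.univ.filter fun k => ¬ s k = true)
            = Finset.univ.filter fun k => (!s k) = true := by
          ext k
          simp
        have ht : Fin.tail (fun i => !(Fin.cons false s : Fin (l + 1) → Bool) i)
            = fun i => !s i := rfl
        simp only [covSel, Fin.cons_zero, Bool.not_false, if_true, hfil, ht]
        funext p
        refine congrArg₂ (· - ·) rfl (Finset.sum_congr rfl fun k _ => ?_)
        refine congrFun (congrArg (g.covSel F₂ l fun i => !s i) ?_) p
        refine (update_pair (fun _ _ => 0) (Fin.tail Y) k _ _).trans ?_
        rw [nabla_zero_left]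
        funext i
        exact Prod.ext (congrFun (Function.update_eq_self (β := fun _ => Γ.PreSection) k
          (fun _ _ => 0)) i) rfl
      rw [e1, e2, ← star_sum_right hE hm _ (fun k _ => hd₂ l _ _ (hUYs k)) (hd₁ l s _ hX') hp]
      exact star_sub_right hE hm (hd₁ l s _ hX') ((hd₂ l _ _ hY').lieDeriv ⟨isSection_zero, hY 0⟩)
        (Decays.sum _ fun k _ => hd₂ l _ _ (hUYs k)) hp
    -- Each index is assigned to exactly one kernel, so the corrections of the composition are
    -- distributed over the two factors without overlap.
    have hsplit : ∀ s : Fin l → Bool, ∑ k, g.star (A s (UX k)) (B s (UY k)) p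
        = ∑ k with s k = true, g.star (A s (UX k)) (B s (Fin.tail Y)) p
          + ∑ k with ¬ s k = true, g.star (A s (Fin.tail X)) (B s (UY k)) p := by
      intro s
      rw [← Finset.sum_filter_add_sum_filter_not Finset.univ (fun k => s k = true)]
      refine congrArg₂ (· + ·) (Finset.sum_congr rfl fun k hk => ?_)
        (Finset.sum_congr rfl fun k hk => ?_)
      · rw [hBY s k (Finset.mem_filter.1 hk).2]
      · rw [hAX s k (Bool.eq_false_iff.2 (Finset.mem_filter.1 hk).2)]
    have hleft : g.covDeriv (g.star F₁ F₂) (l + 1) (fun i => (X i, Y i)) p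
        = Γ.lieDeriv (X 0, Y 0) (g.covDeriv (g.star F₁ F₂) l
          (fun i => (Fin.tail X i, Fin.tail Y i))) p
        - ∑ k, g.covDeriv (g.star F₁ F₂) l (Function.update
          (fun i => (Fin.tail X i, Fin.tail Y i)) k
          (g.nabla (X 0) (Fin.tail X k), g.nabla (Y 0) (Fin.tail Y k))) p := rfl
    -- A selection on `l + 1` indices is a selection on `l` indices together with the choice for the
    -- new one; the two choices give the two terms of the Leibniz rule.
    rw [hleft, hfirst, Finset.sum_congr rfl fun k _ => hsecond k, Finset.sum_comm,
      ← Finset.sum_sub_distrib, ← (Fin.consEquiv fun _ => Bool).sum_comp, Fintype.sum_prod_type,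
      Fintype.sum_bool]
    rw [← Finset.sum_add_distrib]
    refine Finset.sum_congr rfl fun s _ => ?_
    rw [hsplit s]
    refine Eq.trans ?_ (congrArg₂ (· + ·) (htrue s) (hfalse s)).symm
    ring

end Metric

end Covariant

end LieGroupoid

/-! ### Uniform bounds and smoothness over the leaves. -/

namespace LieGroupoid

section Bounds

variable {EG EM G M : Type*}
  [NormedAddCommGroup EG] [NormedSpace ℝ EG] [FiniteDimensional ℝ EG]
  [NormedAddCommGroup EM] [NormedSpace ℝ EM] [FiniteDimensional ℝ EM]
  [TopologicalSpace G] [ChartedSpace EG G] [IsManifold 𝓘(ℝ, EG) ∞ G]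
  [TopologicalSpace M] [ChartedSpace EM M] [IsManifold 𝓘(ℝ, EM) ∞ M]
  {Γ : LieGroupoid EG EM G M} [T2Space M]

namespace Metric

variable {g : Γ.Metric} {m : ℝ} {F F₁ F₂ : G × G → ℂ}

/-- Exponential bounds of rate `m` for all covariant derivatives of `F`. -/
def CovBounded (g : Γ.Metric) (m : ℝ) (F : G × G → ℂ) : Prop :=
  ∀ l : ℕ, ∃ C > 0, ∀ X Y : Fin l → Γ.PreSection,
    (∀ i, Γ.IsSection (X i)) → (∀ i, Γ.IsSection (Y i)) →
    ∀ a b, Γ.src a = Γ.src b →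
      ‖g.covDeriv F l (fun i => (X i, Y i)) (a, b)‖ ≤ C * Real.exp (-m * g.dist a b)
        * ∏ i, (g.norm (Γ.tgt a) (X i (Γ.tgt a)) + g.norm (Γ.tgt b) (Y i (Γ.tgt b)))

theorem norm_nonneg' (g : Γ.Metric) (x : M) (v : TangentSpace 𝓘(ℝ, EG) (Γ.unit x)) :
    0 ≤ g.norm x v := Real.sqrt_nonneg _

theorem norm_zero' (g : Γ.Metric) (x : M) :
    g.norm x (0 : TangentSpace 𝓘(ℝ, EG) (Γ.unit x)) = 0 := by
  unfold norm
  rw [map_zero, Real.sqrt_zero]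

theorem exists_norm_le [CompactSpace M] (g : Γ.Metric) {X : Γ.PreSection} (hX : Γ.IsSection X) :
    ∃ B : ℝ, 0 ≤ B ∧ ∀ x, g.norm x (X x) ≤ B := by
  have hcont : Continuous fun x => g.norm x (X x) :=
    Real.continuous_sqrt.comp (g.smooth X X hX hX).continuous
  obtain ⟨B, hB⟩ := isCompact_univ.exists_bound_of_continuousOn hcont.continuousOn
  exact ⟨max B 0, le_max_right _ _, fun x =>
    ((le_abs_self _).trans (hB x (mem_univ x))).trans (le_max_left _ _)⟩

theorem CovBounded.congr (hF : g.CovBounded m F₁)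
    (H : ∀ p : G × G, Γ.src p.1 = Γ.src p.2 → F₁ p = F₂ p) : g.CovBounded m F₂ := fun l => by
  obtain ⟨C, hC, h⟩ := hF l
  refine ⟨C, hC, fun X Y hX hY a b hab => ?_⟩
  rw [← covDeriv_congr H l _ (a, b) hab]
  exact h X Y hX hY a b hab

theorem CovBounded.mono {m' : ℝ} (hF : g.CovBounded m F) (hm : m' ≤ m) : g.CovBounded m' F :=
  fun l => by
    obtain ⟨C, hC, h⟩ := hF l
    refine ⟨C, hC, fun X Y hX hY a b hab => (h X Y hX hY a b hab).trans ?_⟩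
    refine mul_le_mul_of_nonneg_right (mul_le_mul_of_nonneg_left (Real.exp_le_exp.2 ?_) hC.le)
      (Finset.prod_nonneg fun i _ => add_nonneg (norm_nonneg' g _ _) (norm_nonneg' g _ _))
    nlinarith [dist_nonneg (g := g) a b]

/-- Sections over the compact base have bounded norm, so for fixed fields the product of norms is
absorbed into the constant. -/
theorem CovBounded.decays [CompactSpace M] (hF : g.CovBounded m F) (hs : Γ.FiberSmooth F) (l : ℕ)
    (Z : Fin l → Γ.PreSection × Γ.PreSection)
    (hZ : ∀ i, Γ.IsSection (Z i).1 ∧ Γ.IsSection (Z i).2) : g.Decays m (g.covDeriv F l Z) := by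
  refine CovSpan.decays hs (fun n W hW => ?_) (CovSpan.base l Z hZ)
  obtain ⟨C, hC, h⟩ := hF n
  choose B₁ hB₁ H₁ using fun i => exists_norm_le g (hW i).1
  choose B₂ hB₂ H₂ using fun i => exists_norm_le g (hW i).2
  refine ⟨C * ∏ i, (B₁ i + B₂ i), mul_nonneg hC.le (Finset.prod_nonneg fun i _ =>
    add_nonneg (hB₁ i) (hB₂ i)), fun a b hab => ?_⟩
  refine (h (fun i => (W i).1) (fun i => (W i).2) (fun i => (hW i).1) (fun i => (hW i).2)
    a b hab).trans ?_
  rw [mul_right_comm]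
  refine mul_le_mul_of_nonneg_right (mul_le_mul_of_nonneg_left (Finset.prod_le_prod
    (fun i _ => add_nonneg (norm_nonneg' g _ _) (norm_nonneg' g _ _)) fun i _ =>
    add_le_add (H₁ i _) (H₂ i _)) hC.le) (Real.exp_pos _).le

theorem CovBounded.norm_covSel_le (hF : g.CovBounded m F) {l : ℕ} (s : Fin l → Bool) :
    ∃ C : ℝ, 0 ≤ C ∧ ∀ X Y : Fin l → Γ.PreSection,
      (∀ i, Γ.IsSection (X i)) → (∀ i, Γ.IsSection (Y i)) → ∀ a b, Γ.src a = Γ.src b →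
      ‖g.covSel F l s (fun i => (X i, Y i)) (a, b)‖
        ≤ C * Real.exp (-m * g.dist a b) * ∏ i, if s i = true then
          (g.norm (Γ.tgt a) (X i (Γ.tgt a)) + g.norm (Γ.tgt b) (Y i (Γ.tgt b))) else 1 := by
  obtain ⟨n, ι, hι, hs, H⟩ := exists_covSel_eq g F l s
  obtain ⟨C, hC, h⟩ := hF n
  refine ⟨C, hC.le, fun X Y hX hY a b hab => ?_⟩
  rw [H]
  refine (h (X ∘ ι) (Y ∘ ι) (fun i => hX _) (fun i => hY _) a b hab).trans (le_of_eq ?_)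
  have hfil : (Finset.univ.filter fun k => s k = true) = Finset.univ.image ι := by
    ext i
    simp [hs]
  rw [← Finset.prod_filter, hfil, Finset.prod_image fun i _ j _ hij => hι hij]
  rfl

variable [MeasurableSpace G] [BorelSpace G]

/-- In the summand of a selection the first kernel contributes the norms of the selected `X i` at
`t(a)` and the second those of the remaining `Y i` at `t(b)`. The fields at the integration variable
are zero, so these norms are constants in the integral. The product of the two groups is bounded
factor by factor by the product of the sums `|X i| + |Y i|`. -/
theorem CovBounded.star [CompactSpace M] (hE : g.ExpIntegrable)
    (hc : ∀ x, IsPreconnected (Γ.fiber x)) {ε' : ℝ} (hε' : 0 ≤ ε') (hm : ε' < m)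
    (hF₁ : g.CovBounded m F₁) (hs₁ : Γ.FiberSmooth F₁) (hF₂ : g.CovBounded m F₂)
    (hs₂ : Γ.FiberSmooth F₂) : g.CovBounded ε' (g.star F₁ F₂) := by
  intro l
  obtain ⟨D, hD, hstar⟩ := norm_star_le (g := g) hc hE hε' hm
  choose C₁ hC₁ H₁ using fun s : Fin l → Bool => hF₁.norm_covSel_le s
  choose C₂ hC₂ H₂ using fun s : Fin l → Bool => hF₂.norm_covSel_le s
  have hS : 0 ≤ ∑ s : Fin l → Bool, D * (C₁ s * C₂ fun i => !s i) := Finset.sum_nonneg fun s _ =>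
    mul_nonneg hD (mul_nonneg (hC₁ _) (hC₂ _))
  -- The summand one is there because a positive constant is required.
  refine ⟨∑ s : Fin l → Bool, D * (C₁ s * C₂ fun i => !s i) + 1, by linarith,
    fun X Y hX hY a b hab => ?_⟩
  rw [covDeriv_star hE hc (hε'.trans_lt hm) (hF₁.decays hs₁) (hF₂.decays hs₂) l X Y hX hY (a, b) hab]
  set P := ∏ i, (g.norm (Γ.tgt a) (X i (Γ.tgt a)) + g.norm (Γ.tgt b) (Y i (Γ.tgt b))) with hP
  have hP0 : 0 ≤ P := Finset.prod_nonneg fun i _ =>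
    add_nonneg (norm_nonneg' g _ _) (norm_nonneg' g _ _)
  have hterm : ∀ s : Fin l → Bool, ‖g.star (g.covSel F₁ l s fun i => (X i, fun _ => 0))
      (g.covSel F₂ l (fun i => !s i) fun i => (fun _ => 0, Y i)) (a, b)‖
      ≤ D * (C₁ s * C₂ fun i => !s i) * Real.exp (-ε' * g.dist a b) * P := by
    intro s
    set P₁ := ∏ i, if s i = true then g.norm (Γ.tgt a) (X i (Γ.tgt a)) else 1 with hP₁
    set P₂ := ∏ i, if (!s i) = true then g.norm (Γ.tgt b) (Y i (Γ.tgt b)) else 1 with hP₂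
    have hP₁0 : 0 ≤ P₁ := Finset.prod_nonneg fun i _ => by
      split_ifs
      exacts [norm_nonneg' g _ _, zero_le_one]
    have hP₂0 : 0 ≤ P₂ := Finset.prod_nonneg fun i _ => by
      split_ifs
      exacts [norm_nonneg' g _ _, zero_le_one]
    have hPP : P₁ * P₂ ≤ P := by
      rw [hP₁, hP₂, ← Finset.prod_mul_distrib]
      refine Finset.prod_le_prod (fun i _ => ?_) fun i _ => ?_
      · cases s i <;> simp [norm_nonneg']
      · cases s i <;> simp [norm_nonneg']
    have h1 := hstar (g.covSel F₁ l s fun i => (X i, fun _ => 0))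
      (g.covSel F₂ l (fun i => !s i) fun i => (fun _ => 0, Y i)) (C₁ s * P₁) (C₂ (fun i => !s i) * P₂) a b (mul_nonneg (hC₁ _) hP₁0)
      (mul_nonneg (hC₂ _) hP₂0) hab
      (fun d hd => ?_) (fun d hd => ?_)
    · refine h1.trans ?_
      have h2 : 0 ≤ D * (C₁ s * C₂ fun i => !s i) * Real.exp (-ε' * g.dist a b) :=
        mul_nonneg (mul_nonneg hD (mul_nonneg (hC₁ _) (hC₂ _))) (Real.exp_pos _).le
      calc _ = D * (C₁ s * C₂ fun i => !s i) * Real.exp (-ε' * g.dist a b) * (P₁ * P₂) := by ring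
        _ ≤ _ := mul_le_mul_of_nonneg_left hPP h2
    · refine (H₁ s X (fun _ _ => 0) hX (fun _ => isSection_zero) a d hd).trans (le_of_eq ?_)
      simp only [norm_zero', add_zero]
      ring
    · refine (H₂ _ (fun _ _ => 0) Y (fun _ => isSection_zero) hY d b hd).trans (le_of_eq ?_)
      simp only [norm_zero', zero_add]
      ring
  refine (norm_sum_le _ _).trans ((Finset.sum_le_sum fun s _ => hterm s).trans ?_)
  rw [← Finset.sum_mul, ← Finset.sum_mul]
  refine mul_le_mul_of_nonneg_right (mul_le_mul_of_nonneg_right ?_ (Real.exp_pos _).le) hP0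
  linarith

/-- Substitution `d ↦ d b⁻¹`, which carries the volume of the fiber containing `a` and `b` to that
of the fiber over `t(b)`; in the first factor the two inverses of `b` cancel. -/
theorem conv_mul_inv (g : Γ.Metric) {ψ₁ ψ₂ : G → ℂ} (hψ₁ : Continuous ψ₁) (hψ₂ : Continuous ψ₂)
    {a b : G} (hab : Γ.src a = Γ.src b) :
    g.conv ψ₁ ψ₂ (Γ.mul a (Γ.inv b)) = g.star (Γ.kernel ψ₁) (Γ.kernel ψ₂) (a, b) := by
  have hab' : Γ.src a = Γ.tgt (Γ.inv b) := hab.trans (Γ.tgt_inv b).symm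
  have hs : Γ.src (Γ.mul a (Γ.inv b)) = Γ.src (Γ.inv b) := Γ.src_mul _ _ hab'
  have hae : ∀ᵐ d ∂g.fiberVolume (Γ.tgt (Γ.inv b)), Γ.src d = Γ.tgt (Γ.inv b) := ae_mem_fiber _
  rw [star_eq hab', conv, hs, ← map_mul_right g (Γ.inv b), integral_map (aemeasurable_mul_right hae)]
  · refine integral_congr_ae (hae.mono fun d hd => ?_)
    show ψ₁ (Γ.mul (Γ.mul a (Γ.inv b)) (Γ.inv (Γ.mul d (Γ.inv b)))) * ψ₂ (Γ.mul d (Γ.inv b))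
      = ψ₁ (Γ.mul a (Γ.inv d)) * ψ₂ (Γ.mul d (Γ.inv b))
    rw [Γ.mul_mul_inv_mul hab' hd]
  · rw [map_mul_right g (Γ.inv b), ← hs]
    exact aestronglyMeasurable_of_continuousOn ((continuousOn_convIntegrand hψ₁ hψ₂).comp
      (continuousOn_const.prodMk continuousOn_id) fun b hb => hb)

end Metric

theorem contMDiffOn_mul_inv (Γ : LieGroupoid EG EM G M) :
    ContMDiffOn (𝓘(ℝ, EG).prod 𝓘(ℝ, EG)) 𝓘(ℝ, EG) ∞ (fun p : G × G => Γ.mul p.1 (Γ.inv p.2))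
      {p | Γ.src p.1 = Γ.src p.2} :=
  Γ.contMDiffOn_mul.comp
    (contMDiff_fst.contMDiffOn.prodMk (Γ.contMDiff_inv.comp contMDiff_snd).contMDiffOn)
    fun p hp => Eq.trans hp (Γ.tgt_inv p.2).symm

/-- For `a`, `b` in the fiber over `x`, the element `a b⁻¹` has source `t(b)`, which lies in the
leaf of `x` by invariance. So `G_x × G_x` is mapped smoothly into the part of `G` over a single
leaf. -/
theorem fiberSmooth_kernel (hΓ : Γ.IsBoundaryGroupoid) {ψ : G → ℂ}
    (hψ : ∀ x, ContMDiffOn 𝓘(ℝ, EG) 𝓘(ℝ, ℂ) ∞ ψ (Γ.src ⁻¹' Γ.leaf x)) :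
    Γ.FiberSmooth (Γ.kernel ψ) := by
  intro x p hp
  obtain ⟨r, S, d, h⟩ := hΓ
  obtain ⟨k, hk⟩ := h.cover (Γ.tgt p.2)
  have hpS : p.2 ∈ Γ.src ⁻¹' S k := by
    rw [h.invariant k]
    exact hk
  have hx : x ∈ S k := by
    rw [← show Γ.src p.2 = x from hp.2]
    exact hpS
  obtain ⟨y, hy⟩ := h.isLeaf k
  refine (((hψ y).comp (Γ.contMDiffOn_mul_inv.mono fun q hq => ?_) fun q hq => ?_) :
    ContMDiffOn _ _ _ _ (Γ.fiber x ×ˢ Γ.fiber x)) p hp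
  · exact Eq.trans hq.1 (Eq.symm hq.2)
  · have h1 : Γ.src q.1 = Γ.src q.2 := Eq.trans hq.1 (Eq.symm hq.2)
    show Γ.src (Γ.mul q.1 (Γ.inv q.2)) ∈ Γ.leaf y
    rw [← hy, Γ.src_mul _ _ (h1.trans (Γ.tgt_inv _).symm), Γ.src_inv]
    have h2 : q.2 ∈ Γ.src ⁻¹' S k := by
      show Γ.src q.2 ∈ S k
      rw [show Γ.src q.2 = x from hq.2]
      exact hx
    rw [h.invariant k] at h2
    exact h2

/-- A function on a boundary groupoid is smooth over the leaves if the associated kernel is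
smooth along the fibers. -/
theorem contMDiffOn_of_fiberSmooth (hΓ : Γ.IsBoundaryGroupoid) {ψ : G → ℂ} {F : G × G → ℂ}
    (hF : Γ.FiberSmooth F)
    (H : ∀ a b, Γ.src a = Γ.src b → ψ (Γ.mul a (Γ.inv b)) = F (a, b)) (x : M) :
    ContMDiffOn 𝓘(ℝ, EG) 𝓘(ℝ, ℂ) ∞ ψ (Γ.src ⁻¹' Γ.leaf x) := by
  obtain ⟨r, S, d, h⟩ := hΓ
  obtain ⟨k, hk⟩ := h.cover x
  obtain ⟨n, K, _, _, _, _, _, _, _, -, θ, σ, hθ, hσ, hmul, h4, h5⟩ := h.trivial k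
  obtain ⟨y, hy⟩ := h.isLeaf k
  have hsub : Γ.leaf x ⊆ S k := by
    intro z hz
    rw [hy] at hk ⊢
    exact Relation.ReflTransGen.trans hk hz
  refine ContMDiffOn.mono ?_ (preimage_mono hsub)
  have htgt : ∀ a, Γ.src a ∈ S k → Γ.tgt a ∈ S k := fun a ha => by
    have h1 : a ∈ Γ.src ⁻¹' S k := ha
    rw [h.invariant k] at h1
    exact h1
  -- Over the leaf `a = p q⁻¹` with `p = σ (θ a, t(a), x)` and `q = σ (1, s(a), x)`; both are smooth
  -- in `a` and lie in the fiber over `x`.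
  have hP : ContMDiffOn 𝓘(ℝ, EG) 𝓘(ℝ, EG) ∞ (fun a => σ (θ a, Γ.tgt a, x)) (Γ.src ⁻¹' S k) :=
    hσ.comp (hθ.prodMk (Γ.contMDiff_tgt.contMDiffOn.prodMk contMDiffOn_const))
      fun a ha => ⟨mem_univ _, htgt a ha, hk⟩
  have hQ : ContMDiffOn 𝓘(ℝ, EG) 𝓘(ℝ, EG) ∞ (fun a => σ (1, Γ.src a, x)) (Γ.src ⁻¹' S k) :=
    hσ.comp (contMDiffOn_const.prodMk (Γ.contMDiff_src.contMDiffOn.prodMk contMDiffOn_const))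
      fun a ha => ⟨mem_univ _, ha, hk⟩
  refine ((hF x).comp (hP.prodMk hQ) fun a ha => ?_).congr fun a ha => ?_
  · exact ⟨(h4 _ _ (htgt a ha) _ hk).2.2, (h4 _ _ ha _ hk).2.2⟩
  · obtain ⟨p1, p2, p3⟩ := h4 (θ a) _ (htgt a ha) x hk
    obtain ⟨q1, q2, q3⟩ := h4 1 _ ha x hk
    have haq : Γ.src a = Γ.tgt (σ (1, Γ.src a, x)) := q2.symm
    have hsx : Γ.src (σ (1, Γ.src a, x)) ∈ S k := by rwa [q3]
    have e1 : Γ.mul a (σ (1, Γ.src a, x)) = σ (θ a, Γ.tgt a, x) := by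
      rw [← h5 (Γ.mul a (σ (1, Γ.src a, x))) (by rwa [Γ.src_mul _ _ haq]),
        hmul _ _ ha hsx haq, Γ.src_mul _ _ haq, Γ.tgt_mul _ _ haq, q1, q3, mul_one]
    have e2 := Γ.mul_mul_inv haq
    rw [e1] at e2
    show ψ a = F (σ (θ a, Γ.tgt a, x), σ (1, Γ.src a, x))
    rw [← H _ _ (p3.trans q3.symm), e2]

end Bounds

end LieGroupoid

namespace LieGroupoid

/-! ### Pointwise decay and the theorem. -/

namespace Metric

variable {EG EM G M : Type*}
  [NormedAddCommGroup EG] [NormedSpace ℝ EG] [FiniteDimensional ℝ EG]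
  [NormedAddCommGroup EM] [NormedSpace ℝ EM] [FiniteDimensional ℝ EM]
  [TopologicalSpace G] [ChartedSpace EG G] [IsManifold 𝓘(ℝ, EG) ∞ G]
  [TopologicalSpace M] [ChartedSpace EM M] [IsManifold 𝓘(ℝ, EM) ∞ M]
  {Γ : LieGroupoid EG EM G M} [T2Space M] {g : Γ.Metric} {m : ℝ}

/-- The estimate of order zero at the pair of `b` and the unit of its fiber. -/
theorem CovBounded.norm_le {ψ : G → ℂ} (hψ : g.CovBounded m (Γ.kernel ψ)) :
    ∃ C : ℝ, 0 ≤ C ∧ ∀ b, ‖ψ b‖ ≤ C * Real.exp (-m * g.dist (Γ.unit (Γ.src b)) b) := by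
  obtain ⟨C, hC, h⟩ := hψ 0
  refine ⟨C, hC.le, fun b => ?_⟩
  have hs : Γ.src b = Γ.src (Γ.unit (Γ.src b)) := (Γ.src_unit _).symm
  have h1 := h (fun i => i.elim0) (fun i => i.elim0) (fun i => i.elim0) (fun i => i.elim0)
    b (Γ.unit (Γ.src b)) hs
  rw [Finset.univ_eq_empty, Finset.prod_empty, mul_one, dist_comm] at h1
  have h2 : Γ.mul b (Γ.inv (Γ.unit (Γ.src b))) = b := by rw [Γ.inv_unit, Γ.mul_unit]
  have h3 : ‖ψ (Γ.mul b (Γ.inv (Γ.unit (Γ.src b))))‖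
      ≤ C * Real.exp (-m * g.dist (Γ.unit (Γ.src b)) b) := h1
  rwa [h2] at h3

end Metric

end LieGroupoid

theorem mainTheorem9 {EG EM G M : Type*}
    [NormedAddCommGroup EG] [NormedSpace ℝ EG] [FiniteDimensional ℝ EG]
    [NormedAddCommGroup EM] [NormedSpace ℝ EM] [FiniteDimensional ℝ EM]
    [TopologicalSpace G] [T2Space G] [SecondCountableTopology G]
    [ChartedSpace EG G] [IsManifold 𝓘(ℝ, EG) ∞ G] [MeasurableSpace G] [BorelSpace G]
    [TopologicalSpace M] [T2Space M] [CompactSpace M]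
    [ChartedSpace EM M] [IsManifold 𝓘(ℝ, EM) ∞ M]
    (Γ : LieGroupoid EG EM G M) (hΓ : Γ.IsBoundaryGroupoid)
    (g : Γ.Metric) (hg : g.PolynomialGrowth)
    (ε₁ ε₂ : ℝ) (hε₁ : 0 ≤ ε₁) (hε₂ : 0 ≤ ε₂) (ψ₁ ψ₂ : G → ℂ)
    (hψ₁ : ψ₁ ∈ g.expCalculus ε₁) (hψ₂ : ψ₂ ∈ g.expCalculus ε₂) :
    (∀ a : G, MeasureTheory.Integrable (fun b => ψ₁ (Γ.mul a (Γ.inv b)) * ψ₂ b)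
      (g.fiberVolume (Γ.src a))) ∧
    g.conv ψ₁ ψ₂ ∈ g.expCalculus (min ε₁ ε₂) := by
  obtain ⟨hc₁, hl₁, δ₁, hδ₁, hb₁⟩ := hψ₁
  obtain ⟨hc₂, hl₂, δ₂, hδ₂, hb₂⟩ := hψ₂
  have hc := Γ.isPreconnected_fiber hΓ
  have hE := hg.expIntegrable hc
  have hmin : min ε₁ ε₂ < min δ₁ δ₂ :=
    lt_min ((min_le_left _ _).trans_lt hδ₁) ((min_le_right _ _).trans_lt hδ₂)
  -- The new rate must exceed `min ε₁ ε₂` for membership in the calculus and stay below the common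
  -- rate of the two kernels, so that some decay is left for the integral.
  obtain ⟨ε', hε', hεm⟩ := exists_between hmin
  have h0 : 0 ≤ ε' := (le_min hε₁ hε₂).trans hε'.le
  have hm : 0 < min δ₁ δ₂ := h0.trans_lt hεm
  have hb₁ : g.CovBounded (min δ₁ δ₂) (Γ.kernel ψ₁) :=
    LieGroupoid.Metric.CovBounded.mono (m := δ₁) hb₁ (min_le_left _ _)
  have hb₂ : g.CovBounded (min δ₁ δ₂) (Γ.kernel ψ₂) :=
    LieGroupoid.Metric.CovBounded.mono (m := δ₂) hb₂ (min_le_right _ _)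
  have hs₁ := LieGroupoid.fiberSmooth_kernel hΓ hl₁
  have hs₂ := LieGroupoid.fiberSmooth_kernel hΓ hl₂
  obtain ⟨C₁, hC₁, h₁⟩ := hb₁.norm_le
  obtain ⟨C₂, -, h₂⟩ := hb₂.norm_le
  have h₁' : ∀ a, ‖ψ₁ a‖ ≤ C₁ := fun a => by
    have hd := g.dist_nonneg (Γ.unit (Γ.src a)) a
    exact (h₁ a).trans (mul_le_of_le_one_right hC₁ (Real.exp_le_one_iff.2 (by nlinarith)))
  have hconv : ∀ a b, Γ.src a = Γ.src b → g.conv ψ₁ ψ₂ (Γ.mul a (Γ.inv b))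
      = g.star (Γ.kernel ψ₁) (Γ.kernel ψ₂) (a, b) := fun a b hab => g.conv_mul_inv hc₁ hc₂ hab
  refine ⟨LieGroupoid.Metric.integrable_convIntegrand hE hc₁ hc₂ hm h₁' h₂,
    LieGroupoid.Metric.continuous_conv hc hE hc₁ hc₂ hm h₁' h₂, ?_, ε', hε', ?_⟩
  · exact LieGroupoid.contMDiffOn_of_fiberSmooth hΓ
      (LieGroupoid.Metric.fiberSmooth_star hE hc hm
        (hb₁.decays hs₁ 0 (fun i => i.elim0) fun i => i.elim0)
        (hb₂.decays hs₂ 0 (fun i => i.elim0) fun i => i.elim0)) hconv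
  · exact (hb₁.star hE hc h0 hεm hs₁ hb₂ hs₂).congr fun p hp => (hconv p.1 p.2 hp).symm
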